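/- **Conventions.** A directed weighted graph here is a finite, strongly connected directed graph (loops and parallel edges permitted) with $m\ge 1$ edges and positive rational edge weights; $W_{\max}$ and $W_{\min}>0$ are its largest and smallest edge weights. Its diameter is $\max_{u,v} d(u,v)$, where $d(u,v)$ is the least total weight of a directed path from $u$ to $v$. Graphs are given to machines as binary strings: the number of vertices followed by the list of edges, each as (source, target, numerator, denominator of the weight in lowest terms), all numbers in self-delimiting binary. For reals $D'>D>0$, the *$D'/D$-Diameter* problem is the promise problem on such graphs whose YES instances are the graphs of diameter at least $D'$ and whose NO instances are the graphs of diameter at most $D$. For a time bound $T$ (a function of the input), a promise problem $(\Pi_{YES},\Pi_{NO})$ is in $\mathsf{N}\cap\mathsf{coN}^+[T]$ if there are nondeterministic (multitape) Turing machines $\mathcal A_N$, $\mathcal A_{coN}$ all of whose computations on every input $x$ halt with output YES or NO within $T(x)$ steps, such that 1. for $x\in\Pi_{YES}$ some nondeterministic choices make $\mathcal A_N$ output YES, and for $x\in\Pi_{NO}$ all choices make $\mathcal A_N$ output NO; 2. for $x\in\Pi_{NO}$ some nondeterministic choices make $\mathcal A_{coN}$ output NO, and for $x\in\Pi_{YES}$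 all choices make $\mathcal A_{coN}$ output YES; 3. for every input $x\notin\Pi_{YES}\cup\Pi_{NO}$, some choices make $\mathcal A_N$ output YES or some choices make $\mathcal A_{coN}$ output NO. $\tilde O(f)$ stands for a bound $C\cdot f\cdot(\log M)^{c}$ with constants $C,c$ (which may depend on $k,\varepsilon,D$), where $M$ is $m$ plus the largest value of $p+q$ over the edge weights $p/q$ in lowest terms. (So $\log M=\Theta(\log m+b)$, with $b$ the largest bit length of an edge weight; for weights of $\mathrm{polylog}(m)$ bits the extra factor is $\mathrm{polylog}(m)$.) **Theorem.** Let $k\ge 1$ be an integer, $\varepsilon>0$ and $D>0$ real numbers, and $D'=(2-\frac1k+\varepsilon)D$. Then $D'/D$-Diameter on directed weighted graphs with $W_{\min}>0$ is in $$\mathsf{N}\cap\mathsf{coN}^+\Big[\tilde O\Big(m^{1+1/k}\cdot\frac{W_{\max}}{W_{\min}}\Big)\Big].$$ -/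

import Mathlib

/-! ### Nondeterministic multitape Turing machines -/

/-- A nondeterministic Turing machine with `aux + 1` two-way infinite tapes (tape `0` carries the
input), a finite set `Q` of states and a finite tape alphabet `Γ`, whose blank symbol is `default`.
A state `q` is halting iff `output q ≠ none`; `output q = some true` means the answer YES and
`output q = some false` means the answer NO. In a non-halting state `q`, when the heads read `s`,
the machine may take any of the actions in `δ q s` (and there is at least one): pass to a new state
and, on each tape, write a symbol and then move the head one cell or leave it where it is. -/
structure NTM where
  aux : ℕ
  Q : Type
  Γ : Type
  [finQ : Finite Q]
  [finΓ : Finite Γ]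
  [blank : Inhabited Γ]
  bit : Bool → Γ
  bit_injective : Function.Injective bit
  bit_ne_blank : ∀ b, bit b ≠ default
  start : Q
  output : Q → Option Bool
  δ : Q → (Fin (aux + 1) → Γ) → Set (Q × (Fin (aux + 1) → Γ × Option Turing.Dir))
  δ_nonempty : ∀ q s, output q = none → (δ q s).Nonempty

namespace NTM

attribute [instance] NTM.finQ NTM.finΓ NTM.blank

/-- A configuration: the state, and the contents and head position of every tape. -/
structure Cfg (M : NTM) where
  state : M.Q
  tape : Fin (M.aux + 1) → Turing.Tape M.Γ

/-- The initial configuration: the input is written on tape `0`, with the head on its first symbol,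
and all other tapes are blank. -/
def init (M : NTM) (x : List Bool) : M.Cfg where
  state := M.start
  tape := fun i => if i = 0 then Turing.Tape.mk₁ (x.map M.bit) else Turing.Tape.mk₁ []

/-- Effect on one tape of writing a symbol and then possibly moving the head. -/
def act {Γ : Type} [Inhabited Γ] (a : Γ × Option Turing.Dir) (t : Turing.Tape Γ) :
    Turing.Tape Γ :=
  match a.2 with
  | none => t.write a.1
  | some d => (t.write a.1).move d

/-- `M.Step c c₂`: from `c` the machine may pass to `c₂` in one step. There is no step from a
halting configuration. -/
def Step (M : NTM) (c c₂ : M.Cfg) : Prop :=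
  M.output c.state = none ∧
    ∃ a ∈ M.δ c.state (fun i => (c.tape i).head),
      c₂ = { state := a.1, tape := fun i => act (a.2 i) (c.tape i) }

/-- `M.ReachIn t c c₂`: some sequence of nondeterministic choices leads from `c` to `c₂` in exactly
`t` steps. -/
def ReachIn (M : NTM) : ℕ → M.Cfg → M.Cfg → Prop
  | 0, c, c₂ => c = c₂
  | t + 1, c, c₂ => ∃ c₁, M.Step c c₁ ∧ M.ReachIn t c₁ c₂

/-- On input `x`, every computation (whatever the nondeterministic choices) makes at most `T` steps.
As a non-halting configuration always has a successor, every computation then reaches a halting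
configuration, and so gives an output, within `T` steps. -/
def RunsInTime (M : NTM) (x : List Bool) (T : ℝ) : Prop :=
  ∀ t c, M.ReachIn t (M.init x) c → (t : ℝ) ≤ T

/-- On input `x`, some nondeterministic choices cause the output `b`. -/
def CanOutput (M : NTM) (x : List Bool) (b : Bool) : Prop :=
  ∃ t c, M.ReachIn t (M.init x) c ∧ M.output c.state = some b

/-- On input `x`, all nondeterministic choices (that lead to an output) cause the output `b`. -/
def AlwaysOutputs (M : NTM) (x : List Bool) (b : Bool) : Prop :=
  ∀ t c, M.ReachIn t (M.init x) c → ∀ a, M.output c.state = some a → a = b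

end NTM

/-! ### Promise problems and the class `N ∩ coN⁺` -/

/-- A promise problem on a type `α` of inputs: disjoint sets of YES and NO instances. -/
structure PromiseProblem (α : Type) where
  yes : Set α
  no : Set α
  disjoint : Disjoint yes no

/-- Membership of a promise problem in the class `N ∩ coN⁺[T]`, where `enc` is the encoding of the
inputs as binary strings and the time bound `T` may depend on the input. -/
def InNcoNPlus {α : Type} (enc : α → List Bool) (P : PromiseProblem α) (T : α → ℝ) : Prop :=
  ∃ AN AcoN : NTM,
    (∀ x, AN.RunsInTime (enc x) (T x)) ∧
    (∀ x, AcoN.RunsInTime (enc x) (T x)) ∧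
    ((∀ x ∈ P.yes, AN.CanOutput (enc x) true) ∧
      (∀ x ∈ P.no, AN.AlwaysOutputs (enc x) false)) ∧
    ((∀ x ∈ P.no, AcoN.CanOutput (enc x) false) ∧
      (∀ x ∈ P.yes, AcoN.AlwaysOutputs (enc x) true)) ∧
    (∀ x, x ∉ P.yes ∪ P.no → AN.CanOutput (enc x) true ∨ AcoN.CanOutput (enc x) false)

/-- Membership in `N ∩ coN⁺[Õ(T)]`: a constant factor and a power of `log (size x)` are allowed on
top of `T x`. -/
def InNcoNPlusTilde {α : Type} (enc : α → List Bool) (size : α → ℕ) (P : PromiseProblem α)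
    (T : α → ℝ) : Prop :=
  ∃ (C : ℝ) (c : ℕ), InNcoNPlus enc P (fun x => C * T x * Real.log (size x) ^ c)

/-! ### Directed weighted graphs -/

/-- A finite directed graph with vertices `0, …, n - 1` and edges `0, …, m - 1`, the edge `e` going
from `src e` to `tgt e` with rational weight `wt e`. (Loops and parallel edges are permitted.) -/
structure WDigraph where
  n : ℕ
  m : ℕ
  src : Fin m → Fin n
  tgt : Fin m → Fin n
  wt : Fin m → ℚ

namespace WDigraph

/-- `G.WalkLength u v L`: there is a directed walk from `u` to `v` of total weight `L`. -/
inductive WalkLength (G : WDigraph) : Fin G.n → Fin G.n → ℚ → Prop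
  | nil (u : Fin G.n) : WalkLength G u u 0
  | cons (e : Fin G.m) (v : Fin G.n) (L : ℚ) :
      WalkLength G (G.tgt e) v L → WalkLength G (G.src e) v (G.wt e + L)

/-- Every vertex is reachable from every vertex. -/
def StronglyConnected (G : WDigraph) : Prop :=
  ∀ u v, ∃ L, G.WalkLength u v L

/-- The distance from `u` to `v`: the least weight of a walk. -/
noncomputable def dist (G : WDigraph) (u v : Fin G.n) : ℝ :=
  sInf {r : ℝ | ∃ L : ℚ, G.WalkLength u v L ∧ r = (L : ℝ)}

/-- The diameter: the largest distance from a vertex to a vertex. -/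
noncomputable def diam (G : WDigraph) : ℝ :=
  ⨆ p : Fin G.n × Fin G.n, G.dist p.1 p.2

/-- The maximum edge weight. -/
noncomputable def Wmax (G : WDigraph) : ℝ := ⨆ e : Fin G.m, (G.wt e : ℝ)

/-- The minimum edge weight. -/
noncomputable def Wmin (G : WDigraph) : ℝ := ⨅ e : Fin G.m, (G.wt e : ℝ)

/-- The number of edges plus the largest value of `p + q` over the edge weights `p / q` (in lowest
terms). Its logarithm has the order of `log m` plus the largest bit length of a weight. -/
def magnitude (G : WDigraph) : ℕ :=
  G.m + Finset.univ.sup (fun e => (G.wt e).num.natAbs + (G.wt e).den)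

/-- Self-delimiting binary code of a natural number: each binary digit `d` (least significant first)
becomes the pair `1 d`, and a final `0` marks the end. -/
def encodeNat (a : ℕ) : List Bool :=
  a.bits.flatMap (fun d => [true, d]) ++ [false]

/-- Binary code of a graph: the number of vertices, followed by the edges in order, each as source,
target, numerator and denominator of the weight (used for nonnegative weights only). -/
def encode (G : WDigraph) : List Bool :=
  encodeNat G.n ++ (List.finRange G.m).flatMap (fun e =>
    encodeNat (G.src e) ++ encodeNat (G.tgt e) ++
      encodeNat (G.wt e).num.natAbs ++ encodeNat (G.wt e).den)

end WDigraph

/-! ### The gap problem for the diameter -/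

/-- The inputs of the diameter problem: strongly connected directed weighted graphs that have an
edge and all of whose edge weights are positive. -/
structure DiameterInput where
  G : WDigraph
  edge : 0 < G.m
  wt_pos : ∀ e, 0 < G.wt e
  strong : G.StronglyConnected

/-- For `lo < hi`, the promise problem to distinguish diameter at least `hi` (YES) from diameter at
most `lo` (NO). -/
def gapDiameter (hi lo : ℝ) (h : lo < hi) : PromiseProblem DiameterInput where
  yes := {x | hi ≤ x.G.diam}
  no := {x | x.G.diam ≤ lo}
  disjoint := by
    rw [Set.disjoint_left]
    intro x hx hx'
    exact absurd (lt_of_lt_of_le h hx) (not_lt.mpr hx')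

theorem gap_lt {k : ℕ} {ε D : ℝ} (hk : 1 ≤ k) (hε : 0 < ε) (hD : 0 < D) :
    D < (2 - 1 / (k : ℝ) + ε) * D := by
  have h1 : (1 : ℝ) ≤ k := by exact_mod_cast hk
  have h2 : 1 / (k : ℝ) ≤ 1 := by
    rw [div_le_one (by linarith)]
    exact h1
  nlinarith

/-! Choose b slightly above D so that (2 - 1/k) b is still below D'. A graph of diameter greater
than b has a short proof that its diameter exceeds D, and a graph of diameter at most b has a short
proof that its diameter is below D'. The two machines guess and check such proofs
(`exists_far_machine`, `exists_near_machine`). Soundness of the proofs settles the inputs in the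
promise, and since every diameter is either above b or not, one of the two proofs exists for every
input, which is the third condition.

A proof of a large distance is a potential: integer labels of the vertices that grow along each edge
by at most its rounded weight, with two vertices whose labels differ by much (`Cert.far`,
`div_le_dist_of_far`). The distances from one end of a large distance serve as labels, so about m
records suffice.

A proof of small distances consists of vertex sets H and W and radii R1, R2, R3. Each vertex reaches
H within R1 and is reached from W within R3, both witnessed by labels that are justified edge by
edge; for each pair in H × W a path of length at most R2 is written out. All distances are then at
most R1 + R2 + R3 (`Cert.near`).

`WGraph.exists_cover` finds H and W. Let B bound the distances and y the edge weights, let η be a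
small fraction of B and L = ⌊η/y⌋ + 1, and measure a ball by the number of edges whose source it
contains. Balls of radius η have at least L edges, as a shortest path longer than η has L edges near
its start (a vertex within η of everything is an easy case). No ball has more than L·m edges. So for
some i < k all balls of radius η + iB/k have at least L·m^(i/k) edges, while some x has at most
L·m^((i+1)/k) edges in its ball of radius η + (i+1)B/k. A hitting set for the former balls gives H,
of size about m^(1-i/k)/L. A shortest path from x to a vertex z farther than η contains L edges that
start in the larger ball of x and end within η + B - (i+1)B/k of z; hitting these edge sets, all
inside one small ball, gives W, of size about m^((i+1)/k). The radii add up to about (2 - 1/k)B +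
2η, and |H||W|L is about m^(1+1/k), up to logarithms. A path of length B has at most B/Wmin edges,
and L is of order at least η/Wmax, so writing out all paths costs about m^(1+1/k)·Wmax/Wmin.

A certificate is a collection of instances of rules, each of which provides some records and
requires others; it is accepted if every required record is provided (`checker`). Requirements may
be circular, so soundness always rests on an induction on a decreasing quantity. Completeness within
the time limit uses a radix sort of the required records on three stacks and one merging pass
(`exists_run_checker`). The machine merely guesses the moves of the sort; all sequences of moves are
sound.

Machines are written as regular programs over stack instructions and compiled to Turing machines
(`exists_machine`). All computations must halt in time, so the checker runs against a unary clock
(`tickify`) of length 2^K that is computed from the input. The exponent K is built from bit lengths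
of the weights of guessed edges and from guessed lower bounds of logarithms: no guess makes 2^K much
larger than the time bound (`two_pow_le_of_isExp`), and the extreme edges attain it up to a constant
(`exists_isExp`). -/

/-! ### Regular programs -/

/-- Regular programs over a set `I` of instructions: an instruction, sequential composition,
nondeterministic choice, and nondeterministic iteration. -/
inductive Prog (I : Type) where
  | ins (i : I)
  | seq (p q : Prog I)
  | alt (p q : Prog I)
  | star (p : Prog I)

namespace Prog

variable {I J σ τ : Type}

/-- `Run sem p s n s'`: a complete run of `p` leads from `s` to `s'` in `n` steps. -/
inductive Run (sem : I → σ → σ → Prop) : Prog I → σ → ℕ → σ → Prop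
  | ins {i s s'} : sem i s s' → Run sem (.ins i) s 1 s'
  | seq {p q s s1 s' m n} : Run sem p s m s1 → Run sem q s1 n s' → Run sem (.seq p q) s (m + n) s'
  | altl {p q s n s'} : Run sem p s n s' → Run sem (.alt p q) s (n + 1) s'
  | altr {p q s n s'} : Run sem q s n s' → Run sem (.alt p q) s (n + 1) s'
  | done {p s} : Run sem (.star p) s 1 s
  | more {p s s1 s' m n} : Run sem p s m s1 → Run sem (.star p) s1 n s' →
      Run sem (.star p) s (m + n + 1) s'

/-- `Part sem p s n`: a run of `p` from `s` may be interrupted after `n` steps. -/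
inductive Part (sem : I → σ → σ → Prop) : Prog I → σ → ℕ → Prop
  | zero {p s} : Part sem p s 0
  | seql {p q s n} : Part sem p s n → Part sem (.seq p q) s n
  | seqr {p q s s1 m n} : Run sem p s m s1 → Part sem q s1 n → Part sem (.seq p q) s (m + n)
  | altl {p q s n} : Part sem p s n → Part sem (.alt p q) s (n + 1)
  | altr {p q s n} : Part sem q s n → Part sem (.alt p q) s (n + 1)
  | starl {p s n} : Part sem p s n → Part sem (.star p) s (n + 1)
  | starr {p s s1 m n} : Run sem p s m s1 → Part sem (.star p) s1 n →
      Part sem (.star p) s (m + n + 1)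

section inversion

variable {sem : I → σ → σ → Prop} {p q : Prog I} {s s' : σ} {n : ℕ}

theorem run_ins_iff {i : I} : Run sem (.ins i) s n s' ↔ n = 1 ∧ sem i s s' := by
  constructor
  · rintro ⟨h⟩; exact ⟨rfl, h⟩
  · rintro ⟨rfl, h⟩; exact .ins h

theorem run_seq_iff : Run sem (.seq p q) s n s' ↔
    ∃ a b s1, n = a + b ∧ Run sem p s a s1 ∧ Run sem q s1 b s' := by
  constructor
  · intro h
    cases h with
    | seq h1 h2 => exact ⟨_, _, _, rfl, h1, h2⟩
  · rintro ⟨a, b, s1, rfl, h1, h2⟩; exact .seq h1 h2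

theorem run_alt_iff : Run sem (.alt p q) s n s' ↔
    ∃ a, n = a + 1 ∧ (Run sem p s a s' ∨ Run sem q s a s') := by
  constructor
  · intro h
    cases h with
    | altl h => exact ⟨_, rfl, .inl h⟩
    | altr h => exact ⟨_, rfl, .inr h⟩
  · rintro ⟨a, rfl, h | h⟩
    exacts [.altl h, .altr h]

theorem run_star_induction {P : σ → Prop} (h : Run sem (.star p) s n s') (h0 : P s)
    (hs : ∀ a m b, P a → Run sem p a m b → P b) : P s' := by
  generalize hp : Prog.star p = r at h
  induction h with
  | done => exact h0
  | more h1 _ _ ih2 => cases hp; exact ih2 (hs _ _ _ h0 h1) rfl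
  | _ => cases hp

end inversion

/-! ### Control automaton of a program -/

/-- Control points of a program. -/
def Ctl : Prog I → Type
  | .ins _ => Unit
  | .seq p q => Ctl p ⊕ Ctl q
  | .alt p q => Option (Ctl p ⊕ Ctl q)
  | .star p => Option (Ctl p)

theorem finite_ctl : ∀ p : Prog I, Finite (Ctl p)
  | .ins _ => inferInstanceAs (Finite Unit)
  | .seq p q => by
    have := finite_ctl p; have := finite_ctl q
    exact inferInstanceAs (Finite (Ctl p ⊕ Ctl q))
  | .alt p q => by
    have := finite_ctl p; have := finite_ctl q
    exact inferInstanceAs (Finite (Option (Ctl p ⊕ Ctl q)))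
  | .star p => by
    have := finite_ctl p
    exact inferInstanceAs (Finite (Option (Ctl p)))

/-- The initial control point. -/
def start : (p : Prog I) → Ctl p
  | .ins _ => ()
  | .seq p _ => Sum.inl (start p)
  | .alt _ _ => none
  | .star _ => none

/-- The transitions between control points, labelled with an instruction or with `none` if no
instruction is carried out; the target `none` is the exit. -/
def Tr : (p : Prog I) → Ctl p → Option I → Option (Ctl p) → Prop
  | .ins i, _, l, t => l = some i ∧ t = none
  | .seq p q, .inl c, l, t => ∃ d, Tr p c l d ∧ t = some (d.elim (Sum.inr (start q)) Sum.inl)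
  | .seq _ q, .inr c, l, t => ∃ d, Tr q c l d ∧ t = d.map Sum.inr
  | .alt p q, none, l, t => l = none ∧ (t = some (some (.inl (start p))) ∨
      t = some (some (.inr (start q))))
  | .alt p _, some (.inl c), l, t => ∃ d, Tr p c l d ∧ t = d.map (fun x => some (.inl x))
  | .alt _ q, some (.inr c), l, t => ∃ d, Tr q c l d ∧ t = d.map (fun x => some (.inr x))
  | .star p, none, l, t => l = none ∧ (t = none ∨ t = some (some (start p)))
  | .star p, some c, l, t => ∃ d, Tr p c l d ∧ t = some d

/-- Effect of a label. -/
def lsem (sem : I → σ → σ → Prop) : Option I → σ → σ → Prop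
  | none, s, s' => s' = s
  | some i, s, s' => sem i s s'

/-- Paths in the control automaton, with their number of steps. -/
inductive Path (sem : I → σ → σ → Prop) (p : Prog I) :
    Option (Ctl p) → σ → ℕ → Option (Ctl p) → σ → Prop
  | refl {c s} : Path sem p c s 0 c s
  | head {c l c1 c2 s s1 s2 n} : Tr p c l c1 → lsem sem l s s1 → Path sem p c1 s1 n c2 s2 →
      Path sem p (some c) s (n + 1) c2 s2

namespace Path

variable {sem : I → σ → σ → Prop} {p q : Prog I}

theorem trans {a b c : Option (Ctl p)} {s s1 s2 : σ} {m n : ℕ} (h1 : Path sem p a s m b s1)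
    (h2 : Path sem p b s1 n c s2) : Path sem p a s (m + n) c s2 := by
  induction h1 with
  | refl => simpa using h2
  | head ht hl _ ih =>
    have := Path.head ht hl (ih h2)
    rwa [show ∀ x : ℕ, x + 1 + n = x + n + 1 by intros; omega]

theorem map (f : Option (Ctl p) → Option (Ctl q))
    (hf : ∀ c l c', Tr p c l c' → ∃ d, f (some c) = some d ∧ Tr q d l (f c'))
    {a b : Option (Ctl p)} {s s' : σ} {n : ℕ} (h : Path sem p a s n b s') :
    Path sem q (f a) s n (f b) s' := by
  induction h with
  | refl => exact .refl
  | head ht hl _ ih =>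
    obtain ⟨d, hd, htd⟩ := hf _ _ _ ht
    rw [hd]
    exact .head htd hl ih

end Path

variable {sem : I → σ → σ → Prop}

/-- The control automaton of a compound program contains those of its parts. Paths of the parts are
carried over by maps of control points that send the exit of one part to the entry of what follows,
and are then concatenated; the step counts of `Run` are chosen to match. -/
theorem Run.path {p : Prog I} {s s' : σ} {n : ℕ} (h : Run sem p s n s') :
    Path sem p (some (start p)) s n none s' := by
  induction h with
  | ins h => exact .head (l := some _) ⟨rfl, rfl⟩ h .refl
  | @seq p q s s1 s' m n _ _ ih1 ih2 =>
    refine Path.trans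
      (ih1.map (q := .seq p q) (fun d => some (d.elim (Sum.inr (start q)) Sum.inl)) ?_)
      (ih2.map (q := .seq p q) (fun d => d.map Sum.inr) ?_)
    · intro c l c' h; exact ⟨_, rfl, c', h, rfl⟩
    · intro c l c' h; exact ⟨_, rfl, c', h, rfl⟩
  | @altl p q s n s' _ ih =>
    refine .head (l := none) ⟨rfl, .inl rfl⟩ rfl
      (ih.map (q := .alt p q) (fun d => d.map (fun x => some (.inl x))) ?_)
    intro c l c' h; exact ⟨_, rfl, c', h, rfl⟩
  | @altr p q s n s' _ ih =>
    refine .head (l := none) ⟨rfl, .inr rfl⟩ rfl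
      (ih.map (q := .alt p q) (fun d => d.map (fun x => some (.inr x))) ?_)
    intro c l c' h; exact ⟨_, rfl, c', h, rfl⟩
  | done => exact .head (l := none) ⟨rfl, .inl rfl⟩ rfl .refl
  | @more p s s1 s' m n _ _ ih1 ih2 =>
    refine .head (l := none) ⟨rfl, .inr rfl⟩ rfl
      (Path.trans (ih1.map (q := .star p) (fun d => some d) ?_) ih2)
    intro c l c' h; exact ⟨_, rfl, c', h, rfl⟩

theorem Path.seq_inr {p q : Prog I} {a c : Option (Ctl (.seq p q))} {s s' : σ} {n : ℕ}
    (h : Path sem (.seq p q) a s n c s') :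
    ∀ b : Option (Ctl q), a = b.map Sum.inr →
      ∃ d : Option (Ctl q), c = d.map Sum.inr ∧ Path sem q b s n d s' := by
  induction h with
  | refl => intro b hb; exact ⟨b, hb, .refl⟩
  | head ht hl _ ih =>
    intro b hb
    cases b with
    | none => simp at hb
    | some b =>
      cases hb
      obtain ⟨d, hd, rfl⟩ := ht
      obtain ⟨d', hd', hp⟩ := ih d rfl
      exact ⟨d', hd', .head hd hl hp⟩

/-- No transition leads from the second half back to the first, so the path can be cut at the only
moment at which it crosses over. -/
theorem Path.seq_inl {p q : Prog I} {a c : Option (Ctl (.seq p q))} {s s' : σ} {n : ℕ}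
    (h : Path sem (.seq p q) a s n c s') :
    ∀ b : Ctl p, a = some (Sum.inl b) →
      (∃ d, c = some (Sum.inl d) ∧ Path sem p (some b) s n (some d) s') ∨
      ∃ m k s1, n = m + k ∧ Path sem p (some b) s m none s1 ∧
        Path sem (.seq p q) (some (Sum.inr (start q))) s1 k c s' := by
  induction h with
  | refl => intro b hb; exact .inl ⟨b, hb, .refl⟩
  | @head _ _ _ _ _ _ _ n ht hl hp ih =>
    intro b hb
    cases hb
    obtain ⟨d, hd, rfl⟩ := ht
    cases d with
    | none => exact .inr ⟨1, n, _, by omega, .head hd hl .refl, hp⟩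
    | some d =>
      rcases ih d rfl with ⟨d', hd', hp'⟩ | ⟨m, k, s1, rfl, hp', hq⟩
      · exact .inl ⟨d', hd', .head hd hl hp'⟩
      · exact .inr ⟨m + 1, k, s1, by omega, .head hd hl hp', hq⟩

theorem Path.alt_inl {p q : Prog I} {a c : Option (Ctl (.alt p q))} {s s' : σ} {n : ℕ}
    (h : Path sem (.alt p q) a s n c s') :
    ∀ b : Option (Ctl p), a = b.map (fun x => some (.inl x)) →
      ∃ d : Option (Ctl p), c = d.map (fun x => some (.inl x)) ∧ Path sem p b s n d s' := by
  induction h with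
  | refl => intro b hb; exact ⟨b, hb, .refl⟩
  | head ht hl _ ih =>
    intro b hb
    cases b with
    | none => simp at hb
    | some b =>
      cases hb
      obtain ⟨d, hd, rfl⟩ := ht
      obtain ⟨d', hd', hp⟩ := ih d rfl
      exact ⟨d', hd', .head hd hl hp⟩

theorem Path.alt_inr {p q : Prog I} {a c : Option (Ctl (.alt p q))} {s s' : σ} {n : ℕ}
    (h : Path sem (.alt p q) a s n c s') :
    ∀ b : Option (Ctl q), a = b.map (fun x => some (.inr x)) →
      ∃ d : Option (Ctl q), c = d.map (fun x => some (.inr x)) ∧ Path sem q b s n d s' := by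
  induction h with
  | refl => intro b hb; exact ⟨b, hb, .refl⟩
  | head ht hl _ ih =>
    intro b hb
    cases b with
    | none => simp at hb
    | some b =>
      cases hb
      obtain ⟨d, hd, rfl⟩ := ht
      obtain ⟨d', hd', hp⟩ := ih d rfl
      exact ⟨d', hd', .head hd hl hp⟩

theorem Path.star_some {p : Prog I} {a c : Option (Ctl (.star p))} {s s' : σ} {n : ℕ}
    (h : Path sem (.star p) a s n c s') :
    ∀ b : Ctl p, a = some (some b) →
      (∃ d, c = some (some d) ∧ Path sem p (some b) s n (some d) s') ∨
      ∃ m k s1, n = m + k ∧ Path sem p (some b) s m none s1 ∧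
        Path sem (.star p) (some none) s1 k c s' := by
  induction h with
  | refl => intro b hb; exact .inl ⟨b, hb, .refl⟩
  | @head _ _ _ _ _ _ _ n ht hl hp ih =>
    intro b hb
    cases hb
    obtain ⟨d, hd, rfl⟩ := ht
    cases d with
    | none => exact .inr ⟨1, n, _, by omega, .head hd hl .refl, hp⟩
    | some d =>
      rcases ih d rfl with ⟨d', hd', hp'⟩ | ⟨m, k, s1, rfl, hp', hq⟩
      · exact .inl ⟨d', hd', .head hd hl hp'⟩
      · exact .inr ⟨m + 1, k, s1, by omega, .head hd hl hp', hq⟩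

theorem Path.exit_eq {p : Prog I} {c : Option (Ctl p)} {s s' : σ} {n : ℕ}
    (h : Path sem p none s n c s') : n = 0 ∧ c = none ∧ s' = s := by
  cases h; exact ⟨rfl, rfl, rfl⟩

/-- A path that starts at the initial control point is a complete or an interrupted run. -/
theorem Path.run_or_part : ∀ (p : Prog I) (n : ℕ) (s s' : σ) (c : Option (Ctl p)),
    Path sem p (some (start p)) s n c s' →
      (c = none → Run sem p s n s') ∧ (c ≠ none → Part sem p s n)
  | .ins i, n, s, s', c, h => by
    cases h with
    | refl => exact ⟨by simp, fun _ => .zero⟩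
    | head ht hl hp =>
      obtain ⟨rfl, rfl⟩ := ht
      obtain ⟨rfl, rfl, rfl⟩ := hp.exit_eq
      exact ⟨fun _ => .ins hl, by simp⟩
  | .seq p q, n, s, s', c, h => by
    rcases h.seq_inl _ rfl with ⟨d, rfl, hp⟩ | ⟨m, k, s1, rfl, hp, hq⟩
    · exact ⟨by simp, fun _ => .seql ((run_or_part p _ _ _ _ hp).2 (by simp))⟩
    · obtain ⟨d, rfl, hq'⟩ := hq.seq_inr (some (start q)) rfl
      have h1 := (run_or_part p _ _ _ _ hp).1 rfl
      have h2 := run_or_part q _ _ _ _ hq'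
      refine ⟨fun hd => .seq h1 (h2.1 (Option.map_eq_none_iff.1 hd)),
        fun hd => .seqr h1 (h2.2 (mt Option.map_eq_none_iff.2 hd))⟩
  | .alt p q, n, s, s', c, h => by
    cases h with
    | refl => exact ⟨by simp [start], fun _ => .zero⟩
    | head ht hl hp =>
      obtain ⟨rfl, rfl | rfl⟩ := ht
      · cases hl
        obtain ⟨d, rfl, hp'⟩ := hp.alt_inl (some (start p)) rfl
        have h1 := run_or_part p _ _ _ _ hp'
        exact ⟨fun hd => .altl (h1.1 (Option.map_eq_none_iff.1 hd)),
          fun hd => .altl (h1.2 (mt Option.map_eq_none_iff.2 hd))⟩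
      · cases hl
        obtain ⟨d, rfl, hp'⟩ := hp.alt_inr (some (start q)) rfl
        have h1 := run_or_part q _ _ _ _ hp'
        exact ⟨fun hd => .altr (h1.1 (Option.map_eq_none_iff.1 hd)),
          fun hd => .altr (h1.2 (mt Option.map_eq_none_iff.2 hd))⟩
  | .star p, n, s, s', c, h => by
    -- After one pass through the body the path is at the entry of the same loop, so the structural
    -- recursion has to be supplemented by an induction on the number of steps.
    induction n using Nat.strong_induction_on generalizing s s' c with
    | _ n ihn =>
      cases h with
      | refl => exact ⟨by simp [start], fun _ => .zero⟩
      | @head _ _ _ _ _ _ _ n ht hl hp =>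
        obtain ⟨rfl, rfl | rfl⟩ := ht
        · cases hl
          obtain ⟨rfl, rfl, rfl⟩ := hp.exit_eq
          exact ⟨fun _ => .done, by simp⟩
        · cases hl
          rcases hp.star_some _ rfl with ⟨d, rfl, hp'⟩ | ⟨m, k, s1, rfl, hp', hq⟩
          · exact ⟨by simp, fun _ => .starl ((run_or_part p _ _ _ _ hp').2 (by simp))⟩
          · have h1 := (run_or_part p _ _ _ _ hp').1 rfl
            have h2 := ihn k (by omega) _ _ _ hq
            exact ⟨fun hd => .more h1 (h2.1 hd), fun hd => .starr h1 (h2.2 hd)⟩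

/-! ### Replacing instructions by programs -/

/-- Replace every instruction by a program. -/
def bind (f : I → Prog J) : Prog I → Prog J
  | .ins i => f i
  | .seq p q => .seq (p.bind f) (q.bind f)
  | .alt p q => .alt (p.bind f) (q.bind f)
  | .star p => .star (p.bind f)

/-- Only complete runs matter here: each implementation leads from codes of states to codes of
states, so a complete run passes through codes between instructions, whatever happens inside them.
The times of the two runs are unrelated; they are bounded separately. -/
theorem Run.of_bind {semJ : J → τ → τ → Prop} {f : I → Prog J} {enc : σ → τ}
    (hf : ∀ i v t w, Run semJ (f i) (enc v) t w → ∃ v', sem i v v' ∧ w = enc v') (p : Prog I) :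
    ∀ (v : σ) (t : ℕ) (w : τ), Run semJ (p.bind f) (enc v) t w →
      ∃ n v', Run sem p v n v' ∧ w = enc v' := by
  induction p with
  | ins i =>
    intro v t w h
    obtain ⟨v', h1, h2⟩ := hf _ _ _ _ h
    exact ⟨1, v', .ins h1, h2⟩
  | seq p q ihp ihq =>
    intro v t w h
    obtain ⟨a, b, s1, rfl, h1, h2⟩ := run_seq_iff.1 h
    obtain ⟨n, v1, r1, rfl⟩ := ihp _ _ _ h1
    obtain ⟨k, v2, r2, rfl⟩ := ihq _ _ _ h2
    exact ⟨_, _, .seq r1 r2, rfl⟩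
  | alt p q ihp ihq =>
    intro v t w h
    obtain ⟨a, rfl, h | h⟩ := run_alt_iff.1 h
    · obtain ⟨n, v1, r1, rfl⟩ := ihp _ _ _ h
      exact ⟨_, _, .altl r1, rfl⟩
    · obtain ⟨n, v1, r1, rfl⟩ := ihq _ _ _ h
      exact ⟨_, _, .altr r1, rfl⟩
  | star p ihp =>
    intro v t w h
    generalize hr : (Prog.star p).bind f = r at h
    generalize hw : enc v = w0 at h
    induction h generalizing v with
    | done => exact ⟨_, v, .done, hw.symm⟩
    | more h1 _ _ ih2 =>
      cases hr; subst hw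
      obtain ⟨n, v1, r1, rfl⟩ := ihp _ _ _ h1
      obtain ⟨k, v2, r2, rfl⟩ := ih2 _ rfl rfl
      exact ⟨_, _, .more r1 r2, rfl⟩
    | _ => cases hr

theorem Run.exists_bind {semJ : J → τ → τ → Prop} {f : I → Prog J} {enc : σ → τ}
    (hf : ∀ i v v', sem i v v' → ∃ t, Run semJ (f i) (enc v) t (enc v'))
    {p : Prog I} {v v' : σ} {n : ℕ} (h : Run sem p v n v') :
    ∃ t, Run semJ (p.bind f) (enc v) t (enc v') := by
  induction h with
  | ins h => exact hf _ _ _ h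
  | seq _ _ ih1 ih2 =>
    obtain ⟨t1, r1⟩ := ih1
    obtain ⟨t2, r2⟩ := ih2
    exact ⟨_, .seq r1 r2⟩
  | altl _ ih1 =>
    obtain ⟨t1, r1⟩ := ih1
    exact ⟨_, .altl r1⟩
  | altr _ ih1 =>
    obtain ⟨t1, r1⟩ := ih1
    exact ⟨_, .altr r1⟩
  | done => exact ⟨1, .done⟩
  | more _ _ ih1 ih2 =>
    obtain ⟨t1, r1⟩ := ih1
    obtain ⟨t2, r2⟩ := ih2
    exact ⟨_, .more r1 r2⟩

end Prog

open Function (update)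
open WDigraph (encodeNat)

/-! ### Stack programs and their Turing machines -/

/-- Stack symbols: the two bits, and a separator `none`. -/
abbrev StackSym := Option Bool

/-- The contents of stacks indexed by `κ`. -/
abbrev Stacks (κ : Type) := κ → List StackSym

/-- Instructions on stacks indexed by `κ`. -/
inductive SInstr (κ : Type) where
  | push (i : κ) (a : StackSym)
  | pop (i : κ) (a : StackSym)
  | empty (i : κ)
  | nop

namespace SInstr

variable {κ : Type} [DecidableEq κ]

/-- The effect of an instruction. -/
def sem : SInstr κ → Stacks κ → Stacks κ → Prop
  | .push i a, s, s' => s' = update s i (a :: s i)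
  | .pop i a, s, s' => ∃ l, s i = a :: l ∧ s' = update s i l
  | .empty i, s, s' => s i = [] ∧ s' = s
  | .nop, s, s' => s' = s

end SInstr

/-- Complete runs of programs on stacks. -/
notation:max "SRun" => Prog.Run SInstr.sem

/-- The tape that holds a stack, with the head on its top. -/
noncomputable def stackTape (l : List StackSym) : Turing.Tape (Option StackSym) := Turing.Tape.mk₁ (l.map some)

theorem stackTape_head (l : List StackSym) : (stackTape l).head = l.head? := by
  cases l <;> rfl

theorem stackTape_cons (l : List StackSym) (a : StackSym) :
    ((stackTape l).move .left).write (some a) = stackTape (a :: l) := by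
  cases l with
  | nil =>
    simp only [stackTape, Turing.Tape.mk₁, Turing.Tape.mk₂, Turing.Tape.mk', List.map_nil,
      Turing.Tape.move, Turing.Tape.write, List.map_cons]
    congr 1
    -- Half tapes are lists up to trailing blanks, and the two sides differ by one blank.
    refine Quotient.sound' (Or.inr ⟨1, ?_⟩)
    rfl
  | cons b l => rfl

theorem stackTape_tail (l : List StackSym) (a : StackSym) :
    ((stackTape (a :: l)).write none).move .right = stackTape l := by
  cases l with
  | nil =>
    simp only [stackTape, Turing.Tape.mk₁, Turing.Tape.mk₂, Turing.Tape.mk', List.map_nil,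
      Turing.Tape.move, Turing.Tape.write, List.map_cons]
    congr 1
    refine Quotient.sound' (Or.inr ⟨1, ?_⟩)
    rfl
  | cons b l =>
    simp only [stackTape, Turing.Tape.mk₁, Turing.Tape.mk₂, Turing.Tape.mk',
      Turing.Tape.move, Turing.Tape.write, List.map_cons]
    congr 1
    refine Quotient.sound' (Or.inr ⟨1, ?_⟩)
    rfl

namespace Prog

variable {κ : Type} [DecidableEq κ] {N : ℕ}

instance [Finite κ] : Finite (SInstr κ) := by
  let f : SInstr κ → Option (κ ⊕ (κ × StackSym) ⊕ (κ × StackSym))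
    | .nop => none
    | .empty i => some (.inl i)
    | .push i a => some (.inr (.inl (i, a)))
    | .pop i a => some (.inr (.inr (i, a)))
  refine Finite.of_injective f ?_
  intro x y h
  cases x <;> cases y <;> simp_all [f]

/-- States of the machine of `p`: `none` is the rejecting state. -/
abbrev MState (p : Prog (SInstr κ)) : Type :=
  Option (Option (Ctl p) ⊕ (Option (SInstr κ) × Option (Ctl p)))

/-- Test whether a label may be carried out, when the heads read `s`. -/
def enabled (e : κ ≃ Fin (N + 1)) (s : Fin (N + 1) → Option StackSym) : Option (SInstr κ) → Prop
  | some (.pop i a) => s (e i) = some a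
  | some (.empty i) => s (e i) = none
  | _ => True

/-- First half of the effect of a label. -/
def act₁ (e : κ ≃ Fin (N + 1)) (s : Fin (N + 1) → Option StackSym) :
    Option (SInstr κ) → Fin (N + 1) → Option StackSym × Option Turing.Dir
  | some (.push i _), j => (s j, if j = e i then some .left else none)
  | some (.pop i _), j => if j = e i then (none, some .right) else (s j, none)
  | _, j => (s j, none)

/-- Second half of the effect of a label. -/
def act₂ (e : κ ≃ Fin (N + 1)) (s : Fin (N + 1) → Option StackSym) :
    Option (SInstr κ) → Fin (N + 1) → Option StackSym × Option Turing.Dir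
  | some (.push i a), j => (if j = e i then some a else s j, none)
  | _, j => (s j, none)

/-- The machine of a stack program, with the `N + 1` stacks on the tapes. It outputs `b` if it
completes a run, and it may give up at any time and output `!b`. -/
def machine [Finite κ] (p : Prog (SInstr κ)) (e : κ ≃ Fin (N + 1)) (b : Bool) : NTM where
  aux := N
  Q := MState p
  Γ := Option StackSym
  finQ := by
    have := finite_ctl p
    infer_instance
  bit d := some (some d)
  bit_injective := by intro x y h; simpa using h
  bit_ne_blank := by intro d h; cases h
  start := some (.inl (some (start p)))
  output
    | none => some !b
    | some (.inl none) => some b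
    | _ => none
  δ q s := {a | a = (none, fun j => (s j, none)) ∨
    (∃ c l t, q = some (.inl (some c)) ∧ Tr p c l t ∧ enabled e s l ∧
      a = (some (.inr (l, t)), act₁ e s l)) ∨
    (∃ l t, q = some (.inr (l, t)) ∧ a = (some (.inl t), act₂ e s l))}
  δ_nonempty q s _ := ⟨_, .inl rfl⟩

variable {p : Prog (SInstr κ)} {e : κ ≃ Fin (N + 1)} {b : Bool}

/-- The configuration with control point `c` and stacks `s`. -/
noncomputable def cfg [Finite κ] (p : Prog (SInstr κ)) (e : κ ≃ Fin (N + 1)) (b : Bool) (c : Option (Ctl p))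
    (s : Stacks κ) : (machine p e b).Cfg where
  state := some (.inl c)
  tape := fun j => stackTape (s (e.symm j))

theorem act_self {Γ : Type} [Inhabited Γ] (t : Turing.Tape Γ) : NTM.act (t.head, none) t = t := by
  simp [NTM.act]

/-- A transition of the machine writes before it moves, whereas a push has to move off the old top
before it writes. Hence each label takes two transitions, with the label remembered in the
intermediate state. -/
theorem act_two_steps {l : Option (SInstr κ)} {s : Stacks κ}
    (h : enabled e (fun j => (stackTape (s (e.symm j))).head) l) :
    ∃ s', lsem SInstr.sem l s s' ∧ ∀ j,
      NTM.act (act₂ e (fun j => (NTM.act (act₁ e (fun j => (stackTape (s (e.symm j))).head) l j)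
        (stackTape (s (e.symm j)))).head) l j)
        (NTM.act (act₁ e (fun j => (stackTape (s (e.symm j))).head) l j)
        (stackTape (s (e.symm j)))) = stackTape (s' (e.symm j)) := by
  rcases l with _ | (⟨i, a⟩ | ⟨i, a⟩ | i | _)
  · exact ⟨s, rfl, fun j => by simp only [act₁, act₂, act_self]⟩
  · refine ⟨_, rfl, fun j => ?_⟩
    by_cases hj : j = e i
    · subst hj
      simp only [act₁, act₂, if_true, NTM.act, Turing.Tape.write_self]
      simp [stackTape_cons]
    · have : e.symm j ≠ i := fun h => hj (by rw [← h]; simp)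
      simp only [act₁, act₂, if_neg hj, act_self, Function.update_of_ne this]
  · simp only [enabled, stackTape_head, Equiv.symm_apply_apply, List.head?_eq_some_iff] at h
    obtain ⟨t, ht⟩ := h
    refine ⟨_, ⟨t, ht, rfl⟩, fun j => ?_⟩
    by_cases hj : j = e i
    · subst hj
      simp only [act₁, act₂, if_true, act_self]
      simp [NTM.act, ht, stackTape_tail]
    · have : e.symm j ≠ i := fun h => hj (by rw [← h]; simp)
      simp only [act₁, act₂, if_neg hj, act_self, Function.update_of_ne this]
  · simp only [enabled, stackTape_head, Equiv.symm_apply_apply, List.head?_eq_none_iff] at h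
    exact ⟨s, ⟨h, rfl⟩, fun j => by simp only [act₁, act₂, act_self]⟩
  · exact ⟨s, rfl, fun j => by simp only [act₁, act₂, act_self]⟩

theorem enabled_of_lsem {l : Option (SInstr κ)} {s s' : Stacks κ}
    (h : lsem SInstr.sem l s s') : enabled e (fun j => (stackTape (s (e.symm j))).head) l := by
  rcases l with _ | (⟨i, a⟩ | ⟨i, a⟩ | i | _)
  · trivial
  · trivial
  · obtain ⟨t, ht, -⟩ := h
    simp [enabled, stackTape_head, ht]
  · simp [enabled, stackTape_head, h.1]
  · trivial

theorem lsem_unique {l : Option (SInstr κ)} {s s1 s2 : Stacks κ}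
    (h1 : lsem SInstr.sem l s s1) (h2 : lsem SInstr.sem l s s2) : s1 = s2 := by
  rcases l with _ | (⟨i, a⟩ | ⟨i, a⟩ | i | _)
  · exact h1.trans h2.symm
  · exact Eq.trans (b := _) h1 (Eq.symm h2)
  · obtain ⟨t, ht, rfl⟩ := h1
    obtain ⟨t', ht', rfl⟩ := h2
    rw [ht] at ht'
    cases ht'
    rfl
  · exact h1.2.trans h2.2.symm
  · exact Eq.trans (b := _) h1 (Eq.symm h2)

theorem reachIn_of_path [Finite κ] {c c' : Option (Ctl p)} {s s' : Stacks κ} {n : ℕ}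
    (h : Path SInstr.sem p c s n c' s') :
    (machine p e b).ReachIn (2 * n) (cfg p e b c s) (cfg p e b c' s') := by
  induction h with
  | refl => rfl
  | @head c l c1 c2 s s1 s2 n ht hl _ ih =>
    have he := enabled_of_lsem (e := e) hl
    obtain ⟨s', hs', hact⟩ := act_two_steps he
    obtain rfl := lsem_unique hs' hl
    refine ⟨_, ⟨rfl, _, .inr (.inl ⟨c, l, c1, rfl, ht, he, rfl⟩), rfl⟩, _,
      ⟨rfl, _, .inr (.inr ⟨l, c1, rfl, rfl⟩), rfl⟩, ?_⟩
    exact (show cfg p e b c1 s' = _ from congrArg (NTM.Cfg.mk (M := machine p e b) _)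
      (funext fun j => (hact j).symm)) ▸ ih

theorem reachIn_reject [Finite κ] {t : ℕ} {x y : (machine p e b).Cfg} (h : (machine p e b).ReachIn t x y)
    (hx : x.state = (none : MState p)) : t = 0 ∧ y = x := by
  cases t with
  | zero => exact ⟨rfl, h.symm⟩
  | succ t =>
    obtain ⟨_, ⟨ho, _⟩, _⟩ := h
    rw [hx] at ho
    cases ho

theorem output_reject [Finite κ] {x : (machine p e b).Cfg} (hx : x.state = (none : MState p)) :
    (machine p e b).output x.state ≠ some b := by
  rw [hx]
  intro h
  replace h : some (!b) = some b := h
  cases b <;> simp at h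

/-- A computation is a path with every step doubled, possibly stopped between two halves or ended by
giving up; the additional 2 covers an unfinished label and the step into the rejecting state. As
that state outputs the opposite answer, the output `b` is possible only at the exit. -/
theorem path_of_reachIn [Finite κ] (T : ℕ) : ∀ (c : Option (Ctl p)) (s : Stacks κ)
    (y : (machine p e b).Cfg), (machine p e b).ReachIn T (cfg p e b c s) y →
      ∃ n c' s', Path SInstr.sem p c s n c' s' ∧ T ≤ 2 * n + 2 ∧
        ((machine p e b).output y.state = some b → c' = none) := by
  induction T using Nat.strong_induction_on with
  | _ T ih =>
    intro c s y h
    cases T with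
    | zero =>
      cases h
      refine ⟨0, c, s, .refl, by omega, fun ho => ?_⟩
      cases c with
      | none => rfl
      | some c => cases ho
    | succ T =>
      obtain ⟨x, ⟨ho, a, ha, hx⟩, h⟩ := h
      cases c with
      | none => cases ho
      | some c =>
        rcases ha with rfl | ⟨c', l, t, hc, ht, he, rfl⟩ | ⟨l, t, hc, -⟩
        · obtain ⟨hT, hy⟩ := reachIn_reject h (by rw [hx])
          subst hT
          refine ⟨0, _, s, .refl, by omega, fun ho => absurd ho (output_reject ?_)⟩
          rw [hy, hx]
        · cases hc
          cases T with
          | zero =>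
            refine ⟨0, _, s, .refl, by omega, fun ho => ?_⟩
            have hy : x = y := h
            rw [← hy, hx] at ho
            cases ho
          | succ T =>
            obtain ⟨z, ⟨_, a, ha, hz⟩, h⟩ := h
            subst hx
            rcases ha with rfl | ⟨c', l', t', hc, -⟩ | ⟨l', t', hc, rfl⟩
            · obtain ⟨hT, hy⟩ := reachIn_reject h (by rw [hz])
              subst hT
              refine ⟨0, _, s, .refl, by omega, fun ho => absurd ho (output_reject ?_)⟩
              rw [hy, hz]
            · cases hc
            · cases hc
              obtain ⟨s', hs', hact⟩ := act_two_steps he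
              have hz' : z = cfg p e b t s' := hz.trans (congrArg (NTM.Cfg.mk _) (funext hact))
              subst hz'
              obtain ⟨n, c', s'', hp, hT, hout⟩ := ih T (by omega) _ _ _ h
              exact ⟨n + 1, c', s'', .head ht hs' hp, by omega, hout⟩
        · cases hc

/-- A bound on the length of all complete and interrupted runs. -/
def Bounded {I σ : Type} (sem : I → σ → σ → Prop) (p : Prog I) (s : σ) (B : ℕ) : Prop :=
  (∀ n, Part sem p s n → n ≤ B) ∧ ∀ n s', Run sem p s n s' → n ≤ B

theorem init_eq [Finite κ] (i0 : κ) (h0 : e i0 = 0) (x : List Bool) :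
    (machine p e b).init x = cfg p e b (some (start p))
      (update (fun _ => []) i0 (x.map some)) := by
  have key : ∀ j : Fin (N + 1), (if j = 0 then Turing.Tape.mk₁ (x.map fun d => some (some d)) else
      Turing.Tape.mk₁ []) = stackTape (update (fun _ => []) i0 (x.map some) (e.symm j)) := by
    intro j
    by_cases hj : j = 0
    · have : e.symm j = i0 := by rw [hj, ← h0]; simp
      rw [if_pos hj, this, Function.update_self, stackTape, List.map_map]
      rfl
    · have : e.symm j ≠ i0 := by
        intro h
        apply hj
        rw [← h0, ← h]
        simp
      rw [if_neg hj, Function.update_of_ne this]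
      rfl
  exact congrArg (NTM.Cfg.mk (M := machine p e b) _) (funext key)

/-- Every stack program gives a Turing machine whose tape `0` holds the stack `i0`. -/
theorem exists_machine [Finite κ] (p : Prog (SInstr κ)) (i0 : κ) (b : Bool) : ∃ M : NTM,
    (∀ (x : List Bool) (B : ℕ),
      Bounded SInstr.sem p (update (fun _ => []) i0 (x.map some)) B →
        M.RunsInTime x (2 * B + 2)) ∧
    (∀ x : List Bool, M.CanOutput x b ↔
      ∃ n s', SRun p (update (fun _ => []) i0 (x.map some)) n s') ∧
    (∀ x : List Bool, ¬ M.CanOutput x b → M.AlwaysOutputs x !b) := by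
  obtain ⟨N, hN⟩ : ∃ N, Nat.card κ = N + 1 :=
    ⟨Nat.card κ - 1, by
      have : Nonempty κ := ⟨i0⟩
      have := Nat.card_pos (α := κ)
      omega⟩
  obtain ⟨e0⟩ : Nonempty (κ ≃ Fin (N + 1)) := ⟨(Finite.equivFin κ).trans (finCongr hN)⟩
  let e : κ ≃ Fin (N + 1) := e0.trans (Equiv.swap (e0 i0) 0)
  have he : e i0 = 0 := by simp [e]
  refine ⟨machine p e b, ?_, ?_, ?_⟩
  · intro x B hB t c h
    rw [init_eq i0 he] at h
    obtain ⟨n, c', s', hp, hT, -⟩ := path_of_reachIn _ _ _ _ h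
    have hr := Path.run_or_part _ _ _ _ _ hp
    have hn : n ≤ B := by
      by_cases hc : c' = none
      · exact hB.2 _ _ (hr.1 hc)
      · exact hB.1 _ (hr.2 hc)
    have : t ≤ 2 * B + 2 := by omega
    exact_mod_cast this
  · intro x
    constructor
    · rintro ⟨t, c, h, ho⟩
      rw [init_eq i0 he] at h
      obtain ⟨n, c', s', hp, -, hc⟩ := path_of_reachIn _ _ _ _ h
      exact ⟨n, s', (Path.run_or_part _ _ _ _ _ hp).1 (hc ho)⟩
    · rintro ⟨n, s', h⟩
      refine ⟨2 * n, cfg p e b none s', ?_, rfl⟩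
      rw [init_eq i0 he]
      exact reachIn_of_path h.path
  · intro x hx t c h a ha
    by_contra hne
    exact hx ⟨t, c, h, by rw [ha]; cases a <;> cases b <;> simp_all⟩

end Prog

namespace Prog

/-! ### Straight-line programs and loops over bits -/

section line

variable {κ : Type} [DecidableEq κ]

/-- Effect of an instruction on the stack `i`. -/
def opAt (i : κ) : SInstr κ → List StackSym → List StackSym → Prop
  | .push j a, s, t => if j = i then t = a :: s else t = s
  | .pop j a, s, t => if j = i then s = a :: t else t = s
  | .empty j, s, t => (j = i → s = []) ∧ t = s
  | .nop, s, t => t = s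

/-- Effect of a sequence of instructions on the stack `i`. -/
def execAt (i : κ) : List (SInstr κ) → List StackSym → List StackSym → Prop
  | [], s, t => t = s
  | a :: l, s, t => ∃ m, opAt i a s m ∧ execAt i l m t

theorem sem_iff {a : SInstr κ} {s t : Stacks κ} :
    a.sem s t ↔ ∀ i, opAt i a (s i) (t i) := by
  cases a with
  | push j a =>
    constructor
    · rintro rfl i
      by_cases h : j = i
      · subst h; simp [opAt]
      · simp [opAt, h, Function.update_of_ne (Ne.symm h)]
    · intro h
      funext i
      have := h i
      by_cases hj : j = i
      · subst hj; simpa [opAt] using this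
      · simpa [opAt, hj, Function.update_of_ne (Ne.symm hj)] using this
  | pop j a =>
    constructor
    · rintro ⟨l, hl, rfl⟩ i
      by_cases h : j = i
      · subst h; simp [opAt, hl]
      · simp [opAt, h, Function.update_of_ne (Ne.symm h)]
    · intro h
      refine ⟨t j, by simpa [opAt] using h j, ?_⟩
      funext i
      have := h i
      by_cases hj : j = i
      · subst hj; simp
      · simpa [opAt, hj, Function.update_of_ne (Ne.symm hj)] using this
  | empty j =>
    constructor
    · rintro ⟨h, rfl⟩ i
      exact ⟨fun e => e ▸ h, rfl⟩
    · intro h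
      exact ⟨(h j).1 rfl, funext fun i => (h i).2⟩
  | nop =>
    exact ⟨fun h i => congrFun h i, fun h => funext h⟩

/-- A sequence of instructions. -/
def line : List (SInstr κ) → Prog (SInstr κ)
  | [] => .ins .nop
  | a :: l => .seq (.ins a) (line l)

/-- The instructions of a line act on each stack without regard to the others, so the effect can be
computed one stack at a time. This turns the analysis of all small programs below into equations
between lists. -/
theorem run_line_iff {l : List (SInstr κ)} {s t : Stacks κ} {n : ℕ} :
    SRun (line l) s n t ↔ n = l.length + 1 ∧ ∀ i, execAt i l (s i) (t i) := by
  induction l generalizing s n with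
  | nil => 
    rw [line, run_ins_iff]
    simp [SInstr.sem, execAt, funext_iff]
  | cons a l ih =>
    rw [line, run_seq_iff]
    simp only [run_ins_iff, ih]
    constructor
    · rintro ⟨_, _, s1, rfl, ⟨rfl, h1⟩, rfl, h2⟩
      exact ⟨by simp; omega, fun i => ⟨s1 i, sem_iff.1 h1 i, h2 i⟩⟩
    · rintro ⟨rfl, h⟩
      choose m h1 h2 using h
      exact ⟨1, _, m, by simp; omega, ⟨rfl, sem_iff.2 h1⟩, rfl, h2⟩

theorem execAt_append {i : κ} {l l' : List (SInstr κ)} {s t : List StackSym} :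
    execAt i (l ++ l') s t ↔ ∃ m, execAt i l s m ∧ execAt i l' m t := by
  induction l generalizing s with
  | nil => simp [execAt]
  | cons a l ih =>
    simp only [List.cons_append, execAt, ih]
    constructor
    · rintro ⟨m, h, m', h', h''⟩; exact ⟨m', ⟨m, h, h'⟩, h''⟩
    · rintro ⟨m', ⟨m, h, h'⟩, h''⟩; exact ⟨m, h, m', h', h''⟩

/-- Repeat `f b` for bits `b`. -/
def each (f : Bool → List (SInstr κ)) : Prog (SInstr κ) :=
  .star (.alt (line (f false)) (line (f true)))

/-- A run of the loop is determined by the word of bits chosen in it. Each round costs `c + 1` for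
the line, one for the choice and one for the loop. -/
theorem run_each_iff {f : Bool → List (SInstr κ)} {c : ℕ} (hc : ∀ b, (f b).length = c)
    {s t : Stacks κ} {n : ℕ} : SRun (each f) s n t ↔
      ∃ bs : List Bool, n = (c + 3) * bs.length + 1 ∧
        ∀ i, execAt i (bs.flatMap f) (s i) (t i) := by
  constructor
  · intro h
    generalize hp : each f = p at h
    induction h with
    | done => exact ⟨[], by simp, fun i => rfl⟩
    | more h1 _ _ ih2 =>
      cases hp
      obtain ⟨bs, rfl, h2⟩ := ih2 rfl
      obtain ⟨a, rfl, h | h⟩ := run_alt_iff.1 h1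
      · obtain ⟨rfl, h'⟩ := run_line_iff.1 h
        refine ⟨false :: bs, by simp [hc, mul_add]; omega, fun i => ?_⟩
        exact execAt_append.2 ⟨_, h' i, h2 i⟩
      · obtain ⟨rfl, h'⟩ := run_line_iff.1 h
        refine ⟨true :: bs, by simp [hc, mul_add]; omega, fun i => ?_⟩
        exact execAt_append.2 ⟨_, h' i, h2 i⟩
    | _ => cases hp
  · rintro ⟨bs, rfl, h⟩
    induction bs generalizing s with
    | nil =>
      obtain rfl : t = s := funext fun i => h i
      exact .done
    | cons b bs ih =>
      simp only [List.flatMap_cons, execAt_append] at h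
      choose m h1 h2 using h
      have r1 : SRun (line (f b)) s (c + 1) m := run_line_iff.2 ⟨by rw [hc], h1⟩
      have r2 := ih h2
      have := Run.more (p := .alt (line (f false)) (line (f true)))
        (by cases b; exacts [.altl r1, .altr r1]) r2
      rw [show (c + 3) * (b :: bs).length + 1 = c + 1 + 1 + ((c + 3) * bs.length + 1) + 1 by
        simp; ring]
      exact this

variable {i : κ} {f : Bool → List (SInstr κ)} {bs : List Bool} {s t : List StackSym}

theorem execAt_flatMap_same (h : ∀ b s t, execAt i (f b) s t ↔ t = s) :
    execAt i (bs.flatMap f) s t ↔ t = s := by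
  induction bs generalizing s with
  | nil => rfl
  | cons b bs ih => simp [execAt_append, h, ih]

theorem execAt_flatMap_pop (h : ∀ b s t, execAt i (f b) s t ↔ s = some b :: t) :
    execAt i (bs.flatMap f) s t ↔ s = bs.map some ++ t := by
  induction bs generalizing s with
  | nil => exact eq_comm
  | cons b bs ih => simp [execAt_append, h, ih]

theorem execAt_flatMap_push (h : ∀ b s t, execAt i (f b) s t ↔ t = some b :: s) :
    execAt i (bs.flatMap f) s t ↔ t = bs.reverse.map some ++ s := by
  induction bs generalizing s with
  | nil => rfl
  | cons b bs ih => simp [execAt_append, h, ih]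

/-- Code of a word, with a mark before every bit if `p`. -/
def code (p : Bool) (l : List Bool) : List Bool := l.flatMap fun b => if p then [true, b] else [b]

theorem execAt_flatMap_code {p : Bool}
    (h : ∀ b s t, execAt i (f b) s t ↔ s = (code p [b]).map some ++ t) :
    execAt i (bs.flatMap f) s t ↔ s = (code p bs).map some ++ t := by
  simp only [code] at *
  induction bs generalizing s with
  | nil => exact eq_comm
  | cons b bs ih => simp [execAt_append, h, ih]

/-- Pop the bit `b` from every stack in `I` and push it on every stack in `J`. -/
def xfer (I J : List κ) (b : Bool) : List (SInstr κ) :=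
  I.map (fun i => .pop i (some b)) ++ J.map (fun j => .push j (some b))

theorem execAt_map_pop {I : List κ} {k : κ} {b : Bool} (hI : I.Nodup) :
    execAt k (I.map fun i => .pop i (some b)) s t ↔ if k ∈ I then s = some b :: t else t = s := by
  induction I generalizing s with
  | nil => simp [execAt]
  | cons j I ih =>
    obtain ⟨hj, hI⟩ := List.nodup_cons.1 hI
    simp only [List.map_cons, execAt, ih hI, opAt, List.mem_cons]
    by_cases hk : j = k
    · subst hk; simp [hj]
    · simp [hk, Ne.symm hk]

theorem execAt_map_push {I : List κ} {k : κ} {b : Bool} (hI : I.Nodup) :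
    execAt k (I.map fun i => .push i (some b)) s t ↔ if k ∈ I then t = some b :: s else t = s := by
  induction I generalizing s with
  | nil => simp [execAt]
  | cons j I ih =>
    obtain ⟨hj, hI⟩ := List.nodup_cons.1 hI
    simp only [List.map_cons, execAt, ih hI, opAt, List.mem_cons]
    by_cases hk : j = k
    · subst hk; simp [hj]
    · simp [hk, Ne.symm hk]

theorem run_xfer_iff {I J : List κ} (h : (I ++ J).Nodup) {s t : Stacks κ} {n : ℕ} :
    SRun (each (xfer I J)) s n t ↔ ∃ bs : List Bool,
      n = (I.length + J.length + 3) * bs.length + 1 ∧ (∀ i ∈ I, s i = bs.map some ++ t i) ∧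
      (∀ j ∈ J, t j = bs.reverse.map some ++ s j) ∧ ∀ k, k ∉ I → k ∉ J → t k = s k := by
  rw [run_each_iff (c := I.length + J.length) (fun b => by simp [xfer])]
  obtain ⟨hI, hJ, hd⟩ := List.nodup_append.1 h
  have key : ∀ (k : κ) (bs : List Bool), execAt k (bs.flatMap (xfer I J)) (s k) (t k) ↔
      if k ∈ I then s k = bs.map some ++ t k else
        if k ∈ J then t k = bs.reverse.map some ++ s k else t k = s k := by
    intro k bs
    split_ifs with h1 h2
    · refine execAt_flatMap_pop fun b s t => ?_
      simp [xfer, execAt_append, execAt_map_pop hI, execAt_map_push hJ, h1,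
        show k ∉ J from fun h => hd _ h1 _ h rfl]
    · refine execAt_flatMap_push fun b s t => ?_
      simp [xfer, execAt_append, execAt_map_pop hI, execAt_map_push hJ, h1, h2]
    · refine execAt_flatMap_same fun b s t => ?_
      simp [xfer, execAt_append, execAt_map_pop hI, execAt_map_push hJ, h1, h2]
  simp only [key]
  constructor
  · rintro ⟨bs, hn, h⟩
    refine ⟨bs, hn, fun i hi => by simpa [hi] using h i, fun j hj => ?_, fun k h1 h2 => by
      simpa [h1, h2] using h k⟩
    have : j ∉ I := fun h => hd _ h _ hj rfl
    simpa [this, hj] using h j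
  · rintro ⟨bs, hn, h1, h2, h3⟩
    refine ⟨bs, hn, fun k => ?_⟩
    split_ifs with hk hk'
    exacts [h1 k hk, h2 k hk', h3 k hk hk']

/-- Move the bits on the stack `i` to the stacks in `J`. -/
def mvBits (i : κ) (J : List κ) : Prog (SInstr κ) :=
  .seq (each (xfer [i] J)) (.ins (.empty i))

theorem run_mvBits_iff {i : κ} {J : List κ} (h : (i :: J).Nodup) {s t : Stacks κ} {n : ℕ} :
    SRun (mvBits i J) s n t ↔ ∃ bs : List Bool, n = (J.length + 4) * bs.length + 2 ∧
      s i = bs.map some ∧ t i = [] ∧ (∀ j ∈ J, t j = bs.reverse.map some ++ s j) ∧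
      ∀ k, k ≠ i → k ∉ J → t k = s k := by
  rw [mvBits, run_seq_iff]
  simp only [run_ins_iff, run_xfer_iff (I := [i]) (J := J) h]
  constructor
  · rintro ⟨a, b, s1, rfl, ⟨bs, rfl, h1, h2, h3⟩, rfl, h0, rfl⟩
    refine ⟨bs, by rw [List.length_singleton]; ring, by simpa [h0] using h1 i (by simp), h0, h2, fun k hk hk' =>
      h3 k (by simpa using hk) hk'⟩
  · rintro ⟨bs, rfl, h1, h0, h2, h3⟩
    exact ⟨_, 1, t, by rw [List.length_singleton]; ring, ⟨bs, rfl, by simpa [h0] using h1, h2, fun k hk hk' =>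
      h3 k (by simpa using hk) hk'⟩, rfl, h0, rfl⟩

end line

end Prog

/-! ### Words on stacks: copying, comparing, guessing and testing binary numbers -/

namespace Prog

section words

variable {κ : Type} [DecidableEq κ] {tmp r s : κ}

theorem map_some_injective {α : Type} {l l' : List α} (h : l.map some = l'.map some) : l = l' :=
  List.map_injective_iff.2 (Option.some_injective _) h

/-- The mark at the end of a word. -/
def sep (p : Bool) : StackSym := if p then some false else none

/-- Both codes are self-delimiting. With `p = true` every bit is preceded by a mark and the end is a
`false` in place of a mark, as in the encoding of the input; with `p = false` the bits are plain and
end with the separator `none`, as in records. -/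
theorem code_unique {p : Bool} {l l' : List Bool} {u u' : List StackSym}
    (h : (code p l).map some ++ sep p :: u = (code p l').map some ++ sep p :: u') :
    l = l' ∧ u = u' := by
  induction l generalizing l' with
  | nil => cases l' with
    | nil => simpa [code] using h
    | cons => cases p <;> simp [code, sep] at h
  | cons a l ih => cases l' with
    | nil => cases p <;> simp [code, sep] at h
    | cons b l' =>
      have : a = b ∧ (code p l).map some ++ sep p :: u = (code p l').map some ++ sep p :: u' := by
        cases p <;> simpa [code] using h
      obtain ⟨h1, h2⟩ := ih this.2
      exact ⟨by rw [this.1, h1], h2⟩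

/-- Copy the bits in `r` to the top of the stack `s`. -/
def copyW (tmp s r : κ) : Prog (SInstr κ) :=
  .seq (mvBits r [tmp]) (mvBits tmp [r, s])

/-- Moving a word to `tmp` reverses it, and moving it back to both `r` and `s` restores the order.
The empty `tmp` ensures that nothing but the word comes back. -/
theorem run_copyW {σ τ : Stacks κ} {l : List Bool} {n : ℕ} (hsr : s ≠ r) (hst : s ≠ tmp)
    (hrt : r ≠ tmp) (ht : σ tmp = []) (hr : σ r = l.map some)
    (h : SRun (copyW tmp s r) σ n τ) :
    τ = update σ s (l.map some ++ σ s) := by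
  obtain ⟨_, _, σ1, rfl, h1, h3⟩ := run_seq_iff.1 h
  obtain ⟨bs, -, a1, a2, a3, a4⟩ := (run_mvBits_iff (by simp [hrt])).1 h1
  obtain ⟨cs, -, b1, b2, b3, b4⟩ := (run_mvBits_iff (by simp [hrt.symm, hst.symm, hsr.symm])).1 h3
  rw [hr] at a1
  obtain rfl := map_some_injective a1
  rw [a3 tmp (by simp), ht, List.append_nil] at b1
  obtain rfl := map_some_injective b1
  funext k
  by_cases hks : k = s
  · subst hks
    rw [b3 k (by simp), a4 k hsr (by simpa using hst)]; simp
  rw [Function.update_of_ne hks]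
  by_cases hkr : k = r
  · subst hkr
    rw [b3 k (by simp), a2, hr]; simp
  by_cases hkt : k = tmp
  · subst hkt
    rw [b2, ht]
  rw [b4 k hkt (by simp [hkr, hks]), a4 k hkr (by simpa using hkt)]

theorem exists_run_copyW {σ : Stacks κ} {l : List Bool} (hsr : s ≠ r) (hst : s ≠ tmp)
    (hrt : r ≠ tmp) (ht : σ tmp = []) (hr : σ r = l.map some) :
    SRun (copyW tmp s r) σ (11 * l.length + 4)
      (update σ s (l.map some ++ σ s)) := by
  have h1 : SRun (mvBits r [tmp]) σ (5 * l.length + 2)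
      (update (update σ r []) tmp (l.reverse.map some)) := by
    refine (run_mvBits_iff (by simp [hrt])).2 ⟨l, by simp, hr, by simp [hrt], ?_, ?_⟩
    · simp [ht]
    · intro k h1 h2
      simp only [List.mem_singleton] at h2
      simp [h1, h2]
  have h3 : SRun (mvBits tmp [r, s])
      (update (update σ r []) tmp (l.reverse.map some))
      (6 * l.length + 2) (update σ s (l.map some ++ σ s)) := by
    refine (run_mvBits_iff (by simp [hrt.symm, hst.symm, hsr.symm])).2
      ⟨l.reverse, by simp, by simp, by simp [hst.symm, ht], ?_, ?_⟩
    · simp [hsr.symm, hsr, hst, hrt, hr]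
    · intro k h1 h2
      simp only [List.mem_cons, List.not_mem_nil, or_false, not_or] at h2
      simp [h1, h2]
  have := Run.seq h1 h3
  rwa [show 11 * l.length + 4 = 5 * l.length + 2 + (6 * l.length + 2) by ring]

/-- Push the bits in `r`, above a separator, on the stack `s`. -/
def pushW (tmp s r : κ) : Prog (SInstr κ) :=
  .seq (.ins (.push s none)) (copyW tmp s r)

theorem run_pushW {σ τ : Stacks κ} {l : List Bool} {n : ℕ} (hsr : s ≠ r) (hst : s ≠ tmp)
    (hrt : r ≠ tmp) (ht : σ tmp = []) (hr : σ r = l.map some)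
    (h : SRun (pushW tmp s r) σ n τ) :
    τ = update σ s (l.map some ++ none :: σ s) := by
  obtain ⟨_, _, σ1, rfl, h1, h2⟩ := run_seq_iff.1 h
  have h3 : σ1 = update σ s (none :: σ s) := (run_ins_iff.1 h1).2
  subst h3
  rw [run_copyW (l := l) hsr hst hrt (by simpa [hst.symm]) (by simpa [hsr.symm]) h2]
  simp

theorem exists_run_pushW {σ : Stacks κ} {l : List Bool} (hsr : s ≠ r) (hst : s ≠ tmp)
    (hrt : r ≠ tmp) (ht : σ tmp = []) (hr : σ r = l.map some) :
    SRun (pushW tmp s r) σ (11 * l.length + 5)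
      (update σ s (l.map some ++ none :: σ s)) := by
  have h1 : SRun (.ins (.push s none)) σ 1 (update σ s (none :: σ s)) := .ins rfl
  have := Run.seq h1 (exists_run_copyW (l := l) hsr hst hrt (by simpa [hst.symm])
    (by simpa [hsr.symm]))
  rw [show 11 * l.length + 5 = 1 + (11 * l.length + 4) by ring]
  simpa [pushW] using this

/-- Pop a code from the stack `s`, which must be that of the bits in `r`. -/
def popW (p : Bool) (tmp s r : κ) : Prog (SInstr κ) :=
  .seq (each fun b => (code p [b]).map (fun a => .pop s (some a)) ++
      [.pop r (some b), .push tmp (some b)])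
    (.seq (line [.pop s (sep p), .empty r]) (mvBits tmp [r]))

theorem execAt_popW {p : Bool} (hsr : s ≠ r) (hst : s ≠ tmp) (hrt : r ≠ tmp) {k : κ} {b : Bool}
    {u v : List StackSym} : execAt k ((code p [b]).map (fun a => .pop s (some a)) ++
      [.pop r (some b), .push tmp (some b)]) u v ↔
    if k = s then u = (code p [b]).map some ++ v else if k = r then u = some b :: v else
      if k = tmp then v = some b :: u else v = u := by
  by_cases h1 : k = s
  · subst h1; cases p <;> simp [execAt, opAt, code, hsr.symm, hst.symm]
  by_cases h2 : k = r
  · subst h2; cases p <;> simp [execAt, opAt, code, hsr, h1, hrt.symm]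
  by_cases h3 : k = tmp
  · subst h3; cases p <;> simp [execAt, opAt, code, hst, h1, hrt, h2]
  cases p <;> simp [execAt, opAt, code, h1, h2, h3, Ne.symm h1, Ne.symm h2, Ne.symm h3]

/-- A number is read by comparing it, bit by bit, with one that has been guessed in `r`; `tmp`
collects the bits so that `r` can be restored. If the guess is wrong there is no complete run. -/
theorem run_popW {p : Bool} {σ τ : Stacks κ} {l : List Bool} {n : ℕ} (hsr : s ≠ r)
    (hst : s ≠ tmp) (hrt : r ≠ tmp) (ht : σ tmp = []) (hr : σ r = l.map some)
    (h : SRun (popW p tmp s r) σ n τ) :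
    ∃ u, σ s = (code p l).map some ++ sep p :: u ∧ τ = update σ s u := by
  obtain ⟨_, _, σ1, rfl, h1, h⟩ := run_seq_iff.1 h
  obtain ⟨_, _, σ2, rfl, h2, h3⟩ := run_seq_iff.1 h
  obtain ⟨bs, -, h1⟩ := (run_each_iff (c := (code p [true]).length + 2)
    (fun b => by cases p <;> cases b <;> rfl)).1 h1
  have a1 := (execAt_flatMap_code (p := p) fun b s' t => by simp [execAt_popW hsr hst hrt]).1 (h1 s)
  have a2 := (execAt_flatMap_pop fun b s' t => by
    simp [execAt_popW hsr hst hrt, hsr.symm]).1 (h1 r)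
  have a3 := (execAt_flatMap_push fun b s' t => by
    simp [execAt_popW hsr hst hrt, hst.symm, hrt.symm]).1 (h1 tmp)
  have a4 : ∀ k, k ≠ s → k ≠ r → k ≠ tmp → σ1 k = σ k := fun k h2 h3 h4 =>
    (execAt_flatMap_same fun b s' t => by
      simp [execAt_popW hsr hst hrt, h2, h3, h4]).1 (h1 k)
  obtain ⟨-, h2⟩ := run_line_iff.1 h2
  obtain ⟨cs, -, b1, b2, b3, b4⟩ := (run_mvBits_iff (by simp [hrt.symm])).1 h3
  obtain ⟨e2, e2'⟩ : σ1 r = [] ∧ σ2 r = σ1 r := by simpa [execAt, opAt, hsr] using h2 r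
  rw [hr, e2, List.append_nil] at a2
  obtain rfl := map_some_injective a2
  have e0 : ∀ k, k ≠ s → σ2 k = σ1 k := fun k hk => by
    have := h2 k
    simp only [execAt, opAt, Ne.symm hk, if_false] at this
    obtain ⟨m, rfl, m', ⟨-, rfl⟩, h''⟩ := this
    exact h''
  rw [e0 tmp hst.symm, a3, ht, List.append_nil] at b1
  obtain rfl := map_some_injective b1
  have e3 : σ1 s = sep p :: σ2 s := by
    have := h2 s
    simp only [execAt, opAt, if_true] at this
    obtain ⟨m, h, m', ⟨-, rfl⟩, h''⟩ := this
    rw [h'', h]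
  refine ⟨σ2 s, by rw [← e3, a1], funext fun k => ?_⟩
  by_cases hks : k = s
  · subst hks
    rw [b4 k hst (by simpa using hsr)]; simp
  rw [Function.update_of_ne hks]
  by_cases hkr : k = r
  · subst hkr
    rw [b3 k (by simp), e2', e2, hr]; simp
  by_cases hkt : k = tmp
  · subst hkt
    rw [b2, ht]
  rw [b4 k hkt (by simp [hkr]), e0 k hks, a4 k hks hkr hkt]

theorem exists_run_popW {p : Bool} {σ : Stacks κ} {l : List Bool} {u : List StackSym}
    (hsr : s ≠ r) (hst : s ≠ tmp) (hrt : r ≠ tmp) (ht : σ tmp = []) (hr : σ r = l.map some)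
    (hs : σ s = (code p l).map some ++ sep p :: u) :
    ∃ n ≤ 12 * l.length + 6, SRun (popW p tmp s r) σ n (update σ s u) := by
  set σ1 := update (update σ r []) tmp (l.reverse.map some) with hσ1
  have h1 := (run_each_iff (c := (code p [true]).length + 2) (s := σ)
    (t := update σ1 s (sep p :: u))
    (f := fun b => (code p [b]).map (fun a => .pop s (some a)) ++
      [.pop r (some b), .push tmp (some b)])
    (fun b => by cases p <;> cases b <;> rfl)).2 ⟨l, rfl, fun k => by
      by_cases hks : k = s
      · subst hks
        refine (execAt_flatMap_code (p := p) fun b s' t => by simp [execAt_popW hsr hst hrt]).2 ?_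
        simp [hs]
      by_cases hkr : k = r
      · subst hkr
        refine (execAt_flatMap_pop fun b s' t => by simp [execAt_popW hsr hst hrt, hks]).2 ?_
        simp [hr, hsr.symm, hrt, hσ1]
      by_cases hkt : k = tmp
      · subst hkt
        refine (execAt_flatMap_push fun b s' t => by
          simp [execAt_popW hsr hst hrt, hks, hkr]).2 ?_
        simp [ht, hst.symm, hσ1]
      refine (execAt_flatMap_same fun b s' t => by
        simp [execAt_popW hsr hst hrt, hks, hkr, hkt]).2 ?_
      simp [hks, hkr, hkt, hσ1]⟩
  have h2 : SRun (line [.pop s (sep p), .empty r])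
      (update σ1 s (sep p :: u)) 3 (update σ1 s u) := by
    refine run_line_iff.2 ⟨rfl, fun k => ?_⟩
    by_cases hks : k = s
    · subst hks
      simp [execAt, opAt, hsr.symm]
    · by_cases hkr : k = r
      · subst hkr; simp [execAt, opAt, hsr, hsr.symm, hrt, hσ1]
      · simp [execAt, opAt, hks, Ne.symm hks, Ne.symm hkr]
  have h3 : SRun (mvBits tmp [r]) (update σ1 s u) (5 * l.length + 2)
      (update σ s u) := by
    refine (run_mvBits_iff (by simp [hrt.symm])).2
      ⟨l.reverse, by simp, by simp [hst.symm, hσ1], by simp [hst.symm, ht], ?_, ?_⟩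
    · simp [hsr.symm, hrt, hr, hσ1]
    · intro k h1 h2
      simp only [List.mem_cons, List.not_mem_nil, or_false] at h2
      by_cases hks : k = s
      · subst hks; simp
      · simp [h1, h2, hks, hσ1]
  refine ⟨_, ?_, .seq h1 (.seq h2 h3)⟩
  cases p <;> simp [code] <;> omega

/-- Replace the empty stack `r` by the binary digits of some number. -/
def guessW (r : κ) : Prog (SInstr κ) :=
  .alt (.ins .nop) (.seq (.ins (.push r (some true))) (each (xfer [] [r])))

/-- Together with `bits_eq` this says that, apart from the empty word, the digit words are precisely
those with the last digit `true`. Therefore `guessW` puts `true` at the bottom and arbitrary bits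
above it, and no number has two representations. -/
theorem exists_bits (l : List Bool) : ∃ x : ℕ, x ≠ 0 ∧ x.bits = l ++ [true] := by
  induction l with
  | nil => exact ⟨1, by simp, by simp⟩
  | cons b l ih =>
    obtain ⟨x, hx, h⟩ := ih
    refine ⟨Nat.bit b x, by simp [Nat.bit_eq_zero_iff, hx], ?_⟩
    rw [Nat.bits_append_bit _ _ (fun h => absurd h hx), h]
    rfl

theorem bits_eq (x : ℕ) : x = 0 ∨ ∃ l, x.bits = l ++ [true] := by
  induction x using Nat.binaryRec' with
  | zero => exact .inl rfl
  | bit b n hn ih =>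
    right
    rw [Nat.bits_append_bit _ _ hn]
    rcases ih with rfl | ⟨l, hl⟩
    · exact ⟨[], by simp [hn rfl]⟩
    · exact ⟨b :: l, by rw [hl]; rfl⟩

theorem run_guessW {σ τ : Stacks κ} {n : ℕ} (hr : σ r = [])
    (h : SRun (guessW r) σ n τ) :
    ∃ x : ℕ, τ = update σ r (x.bits.map some) := by
  obtain ⟨_, rfl, h | h⟩ := run_alt_iff.1 h
  · obtain ⟨rfl, h'⟩ := run_ins_iff.1 h
    refine ⟨0, ?_⟩
    rw [show τ = σ from h']
    simp [← hr]
  · obtain ⟨_, _, σ1, rfl, h1, h2⟩ := run_seq_iff.1 h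
    obtain ⟨rfl, h1'⟩ := run_ins_iff.1 h1
    obtain ⟨bs, -, -, h3, h4⟩ := (run_xfer_iff (by simp)).1 h2
    obtain ⟨x, -, hx⟩ := exists_bits bs.reverse
    refine ⟨x, ?_⟩
    rw [show σ1 = update σ r (some true :: σ r) from h1'] at h3 h4
    funext k
    by_cases hk : k = r
    · subst hk
      rw [h3 k (by simp), hx, hr]
      simp
    · rw [h4 k (by simp) (by simpa using hk)]
      simp [hk]

theorem exists_run_guessW {σ : Stacks κ} (hr : σ r = []) (x : ℕ) :
    ∃ n ≤ 4 * x.bits.length + 4,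
      SRun (guessW r) σ n (update σ r (x.bits.map some)) := by
  rcases bits_eq x with rfl | ⟨l, hl⟩
  · refine ⟨2, by omega, .altl (.ins ?_)⟩
    change _ = _
    simp [← hr]
  · refine ⟨_, ?_, .altr (.seq (.ins rfl) ((run_xfer_iff (by simp)).2
      ⟨l.reverse, rfl, by simp, ?_, ?_⟩))⟩
    · rw [hl]; simp; omega
    · simp [hl, hr]
    · intro k _ hk
      simp only [List.mem_singleton] at hk
      simp [hk]

/-- Empty the stack `r`, which must consist of bits. -/
def clearW (r : κ) : Prog (SInstr κ) := mvBits r []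

theorem run_clearW {σ τ : Stacks κ} {n : ℕ} (h : SRun (clearW r) σ n τ) :
    τ = update σ r [] := by
  obtain ⟨bs, -, h1, h2, -, h3⟩ := (run_mvBits_iff (by simp)).1 h
  funext k
  by_cases hk : k = r
  · subst hk; simpa using h2
  · simpa [hk] using h3 k hk

theorem exists_run_clearW {σ : Stacks κ} {l : List Bool} (hr : σ r = l.map some) :
    SRun (clearW r) σ (4 * l.length + 2) (update σ r []) :=
  (run_mvBits_iff (by simp)).2 ⟨l, by simp, hr, by simp, by simp, fun k hk _ => by simp [hk]⟩

/-- Test that the stack `r` consists of the bits `l`. -/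
def testW (r : κ) (l : List Bool) : Prog (SInstr κ) :=
  line (l.map (fun b => .pop r (some b)) ++ .empty r :: l.reverse.map (fun b => .push r (some b)))

theorem execAt_pops {k : κ} {l : List Bool} {u v : List StackSym} :
    execAt k (l.map fun b => .pop r (some b)) u v ↔ if k = r then u = l.map some ++ v else v = u := by
  induction l generalizing u with
  | nil => simp [execAt, eq_comm]
  | cons b l ih =>
    simp only [List.map_cons, execAt, ih, opAt]
    by_cases hk : r = k
    · subst hk; simp
    · simp [hk, Ne.symm hk]

theorem execAt_pushes {k : κ} {l : List Bool} {u v : List StackSym} :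
    execAt k (l.map fun b => .push r (some b)) u v ↔
      if k = r then v = l.reverse.map some ++ u else v = u := by
  induction l generalizing u with
  | nil => simp [execAt]
  | cons b l ih =>
    simp only [List.map_cons, execAt, ih, opAt]
    by_cases hk : r = k
    · subst hk; simp
    · simp [hk, Ne.symm hk]

theorem run_testW_iff {σ τ : Stacks κ} {n : ℕ} {l : List Bool} :
    SRun (testW r l) σ n τ ↔ n = 2 * l.length + 2 ∧ σ r = l.map some ∧ τ = σ := by
  rw [testW, run_line_iff]
  simp only [List.length_append, List.length_map, List.length_cons, List.length_reverse,
    execAt_append, execAt, opAt, execAt_pops, execAt_pushes]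
  constructor
  · rintro ⟨rfl, h⟩
    refine ⟨by omega, ?_, ?_⟩
    · obtain ⟨m, h1, m', ⟨h2, rfl⟩, h3⟩ := h r
      simpa [h2 rfl] using h1
    · funext k
      obtain ⟨m, h1, m', ⟨h2, rfl⟩, h3⟩ := h k
      by_cases hk : k = r
      · subst hk
        simp only [if_true] at h1 h3
        rw [h3, h1, h2 rfl]
        simp
      · simp only [hk, if_false] at h1 h3
        rw [h3, h1]
  · rintro ⟨rfl, h, rfl⟩
    refine ⟨by omega, fun k => ?_⟩
    by_cases hk : k = r
    · subst hk
      exact ⟨[], by simp [h], [], by simp, by simp [h]⟩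
    · exact ⟨τ k, by simp [hk], τ k, by simp [Ne.symm hk], by simp [hk]⟩

end words

end Prog

/-! ### Finite choices and binary addition -/

namespace Prog

/-- Nondeterministic choice from a nonempty list of programs. -/
def alts {I : Type} : Prog I → List (Prog I) → Prog I
  | p, [] => p
  | p, q :: l => .alt p (alts q l)

theorem run_alts {I σ : Type} {sem : I → σ → σ → Prop} {p : Prog I} {l : List (Prog I)} {s t : σ}
    {n : ℕ} (h : Run sem (alts p l) s n t) : ∃ q ∈ p :: l, ∃ m, Run sem q s m t := by
  induction l generalizing p n with
  | nil => exact ⟨p, by simp, n, h⟩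
  | cons q l ih =>
    obtain ⟨a, rfl, h | h⟩ := run_alt_iff.1 h
    · exact ⟨p, by simp, a, h⟩
    · obtain ⟨q', hq', m, h⟩ := ih h
      exact ⟨q', List.mem_cons_of_mem _ hq', m, h⟩

theorem exists_run_alts {I σ : Type} {sem : I → σ → σ → Prop} {p q : Prog I} {l : List (Prog I)}
    {s t : σ} {m : ℕ} (hq : q ∈ p :: l) (h : Run sem q s m t) :
    ∃ n ≤ m + l.length, Run sem (alts p l) s n t := by
  induction l generalizing p with
  | nil =>
    obtain rfl : q = p := by simpa using hq
    exact ⟨m, by simp, h⟩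
  | cons p' l ih =>
    rcases List.mem_cons.1 hq with rfl | hq
    · exact ⟨m + 1, by simp, .altl h⟩
    · obtain ⟨n, hn, h⟩ := ih hq
      exact ⟨_, by simp; omega, .altr h⟩

/-- The value of a list of binary digits. -/
def bval : List Bool → ℕ
  | [] => 0
  | b :: l => b.toNat + 2 * bval l

theorem bval_bits (x : ℕ) : bval x.bits = x := by
  induction x using Nat.binaryRec' with
  | zero => rfl
  | bit b n hn ih =>
    rw [Nat.bits_append_bit _ _ hn, bval, ih, Nat.bit_val]
    ring

section add

variable {κ : Type} [DecidableEq κ]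

/-- Pop the bit `b` from the stack `x`, an empty stack being treated as if it held `false`. -/
def popZ (x : κ) : Bool → Prog (SInstr κ)
  | true => line [.pop x (some true)]
  | false => .alt (line [.pop x (some false)]) (line [.empty x])

theorem run_popZ {x : κ} {b : Bool} {σ τ : Stacks κ} {n : ℕ}
    (h : SRun (popZ x b) σ n τ) :
    (σ x = some b :: τ x ∨ b = false ∧ σ x = [] ∧ τ x = []) ∧ ∀ k, k ≠ x → τ k = σ k := by
  have h1 : ∀ b n, SRun (line [.pop x (some b)]) σ n τ →
      σ x = some b :: τ x ∧ ∀ k, k ≠ x → τ k = σ k := by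
    intro b n h
    obtain ⟨-, h⟩ := run_line_iff.1 h
    refine ⟨?_, fun k hk => ?_⟩
    · obtain ⟨m, h', h''⟩ := h x
      simp only [execAt, opAt, if_true] at h' h''
      rw [h', h'']
    · obtain ⟨m, h', h''⟩ := h k
      simp only [execAt, opAt, Ne.symm hk, if_false] at h' h''
      rw [h'', h']
  cases b with
  | true => exact ⟨.inl (h1 _ _ h).1, (h1 _ _ h).2⟩
  | false =>
    obtain ⟨_, rfl, h | h⟩ := run_alt_iff.1 h
    · exact ⟨.inl (h1 _ _ h).1, (h1 _ _ h).2⟩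
    · obtain ⟨-, h⟩ := run_line_iff.1 h
      refine ⟨.inr ⟨rfl, ?_⟩, fun k hk => ?_⟩
      · obtain ⟨m, ⟨h', h''⟩, h'''⟩ := h x
        simp only [execAt] at h'''
        exact ⟨h' rfl, by rw [h''', h'', h' rfl]⟩
      · obtain ⟨m, ⟨h', h''⟩, h'''⟩ := h k
        rw [show τ k = m from h''', h'']

theorem exists_run_popZ {x : κ} {l : List Bool} {σ : Stacks κ} (h : σ x = l.map some) :
    ∃ n ≤ 3, SRun (popZ x (l.headD false)) σ n
      (update σ x (l.tail.map some)) := by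
  have key : ∀ b, σ x = some b :: l.tail.map some →
      SRun (line [.pop x (some b)]) σ 2 (update σ x (l.tail.map some)) := by
    intro b hb
    refine run_line_iff.2 ⟨rfl, fun k => ?_⟩
    by_cases hk : x = k
    · subst hk; simp [execAt, opAt, hb]
    · simp [execAt, opAt, hk, Ne.symm hk]
  cases l with
  | nil =>
    refine ⟨3, le_rfl, .altr (run_line_iff.2 ⟨rfl, fun k => ?_⟩)⟩
    by_cases hk : x = k
    · subst hk; simpa [execAt, opAt] using h
    · simp [execAt, opAt, hk, Ne.symm hk]
  | cons b l =>
    cases b with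
    | true => exact ⟨2, by omega, key true h⟩
    | false => exact ⟨3, by omega, .altl (key false h)⟩

/-- One step of binary addition, with the carry on the stack `c`. -/
def addStep (x y z c : κ) (b : Bool × Bool × Bool) : Prog (SInstr κ) :=
  .seq (.ins (.pop c (some b.1))) (.seq (popZ x b.2.1) (.seq (popZ y b.2.2)
    (.seq (popZ z (b.1 ^^ (b.2.1 ^^ b.2.2)))
      (.ins (.push c (some ((b.1 && b.2.1) || (b.1 && b.2.2) || (b.2.1 && b.2.2))))))))

/-- All steps of binary addition. -/
def addSteps (x y z c : κ) : Prog (SInstr κ) :=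
  .star (alts (addStep x y z c (false, false, false)) (([(false, false, true),
    (false, true, false), (false, true, true), (true, false, false), (true, false, true),
    (true, true, false), (true, true, true)] : List _).map (addStep x y z c)))

variable {x y z c : κ}

theorem tail_of_map {l : List Bool} {b : Bool} {u : List StackSym}
    (h : l.map some = some b :: u ∨ b = false ∧ l.map some = [] ∧ u = []) :
    ∃ l', u = l'.map some ∧ bval l = b.toNat + 2 * bval l' := by
  rcases h with h | ⟨rfl, h, rfl⟩
  · cases l with
    | nil => cases h
    | cons a l =>
      simp only [List.map_cons, List.cons.injEq, Option.some.injEq] at h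
      exact ⟨l, h.2.symm, by rw [h.1]; rfl⟩
  · obtain rfl : l = [] := by simpa using h
    exact ⟨[], rfl, rfl⟩

omit [DecidableEq κ] in
theorem ne_of_nodup (hd : [x, y, z, c].Nodup) :
    (x ≠ y ∧ x ≠ z ∧ x ≠ c) ∧ (y ≠ z ∧ y ≠ c) ∧ z ≠ c := by
  simpa [List.nodup_cons, not_or] using hd

/-- The implication between sums goes from the remaining digits back to all digits, because the
equation becomes known only at the end, when the stacks are tested to be empty and the carry to be
`false`. -/
theorem run_addStep {b : Bool × Bool × Bool} {σ τ : Stacks κ} {n : ℕ}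
    (hd : [x, y, z, c].Nodup) (h : SRun (addStep x y z c b) σ n τ)
    {lx ly lz : List Bool} {a : Bool} (hx : σ x = lx.map some) (hy : σ y = ly.map some)
    (hz : σ z = lz.map some) (hc : σ c = [some a]) :
    ∃ (lx' ly' lz' : List Bool) (a' : Bool), τ x = lx'.map some ∧ τ y = ly'.map some ∧
      τ z = lz'.map some ∧ τ c = [some a'] ∧ (∀ k, k ∉ [x, y, z, c] → τ k = σ k) ∧
      (bval lx' + bval ly' + a'.toNat = bval lz' → bval lx + bval ly + a.toNat = bval lz) := by
  obtain ⟨⟨hxy, hxz, hxc⟩, ⟨hyz, hyc⟩, hzc⟩ := ne_of_nodup hd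
  obtain ⟨_, _, σ1, -, h1, h⟩ := run_seq_iff.1 h
  obtain ⟨_, _, σ2, -, h2, h⟩ := run_seq_iff.1 h
  obtain ⟨_, _, σ3, -, h3, h⟩ := run_seq_iff.1 h
  obtain ⟨_, _, σ4, -, h4, h5⟩ := run_seq_iff.1 h
  obtain ⟨u, hu, e1⟩ := (run_ins_iff.1 h1).2
  have e5 : τ = _ := (run_ins_iff.1 h5).2
  obtain ⟨e2, f2⟩ := run_popZ h2
  obtain ⟨e3, f3⟩ := run_popZ h3
  obtain ⟨e4, f4⟩ := run_popZ h4
  rw [hc] at hu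
  simp only [List.cons.injEq, Option.some.injEq] at hu
  obtain ⟨hab, rfl⟩ := hu
  have g1 : ∀ k, k ≠ c → σ1 k = σ k := fun k hk => by rw [e1, Function.update_of_ne hk]
  have g5 : ∀ k, k ≠ c → τ k = σ4 k := fun k hk => by rw [e5, Function.update_of_ne hk]
  rw [g1 x hxc, hx] at e2
  rw [f2 y hxy.symm, g1 y hyc, hy] at e3
  rw [f3 z hyz.symm, f2 z hxz.symm, g1 z hzc, hz] at e4
  obtain ⟨lx', ux, vx⟩ := tail_of_map e2
  obtain ⟨ly', uy, vy⟩ := tail_of_map e3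
  obtain ⟨lz', uz, vz⟩ := tail_of_map e4
  refine ⟨lx', ly', lz', (b.1 && b.2.1) || (b.1 && b.2.2) || (b.2.1 && b.2.2), ?_, ?_, ?_, ?_, ?_,
    ?_⟩
  · rw [g5 x hxc, f4 x hxz, f3 x hxy, ux]
  · rw [g5 y hyc, f4 y hyz, uy]
  · rw [g5 z hzc, uz]
  · rw [e5, Function.update_self, f4 c (Ne.symm hzc), f3 c hyc.symm, f2 c hxc.symm, e1,
      Function.update_self]
  · intro k hk
    simp only [List.mem_cons, List.not_mem_nil, or_false, not_or] at hk
    rw [g5 k hk.2.2.2, f4 k hk.2.2.1, f3 k hk.2.1, f2 k hk.1, g1 k hk.2.2.2]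
  · rw [vx, vy, vz, hab]
    obtain ⟨b1, b2, b3⟩ := b
    cases b1 <;> cases b2 <;> cases b3 <;> simp <;> omega

theorem run_addSteps {σ τ : Stacks κ} {n : ℕ} (hd : [x, y, z, c].Nodup)
    (h : SRun (addSteps x y z c) σ n τ) : ∀ {lx ly lz : List Bool} {a : Bool},
    σ x = lx.map some → σ y = ly.map some → σ z = lz.map some → σ c = [some a] →
    ∃ (lx' ly' lz' : List Bool) (a' : Bool), τ x = lx'.map some ∧ τ y = ly'.map some ∧
      τ z = lz'.map some ∧ τ c = [some a'] ∧ (∀ k, k ∉ [x, y, z, c] → τ k = σ k) ∧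
      (bval lx' + bval ly' + a'.toNat = bval lz' → bval lx + bval ly + a.toNat = bval lz) := by
  generalize hp : addSteps x y z c = p at h
  induction h with
  | done =>
    intro lx ly lz a hx hy hz hc
    exact ⟨lx, ly, lz, a, hx, hy, hz, hc, fun _ _ => rfl, id⟩
  | more h1 _ _ ih2 =>
    cases hp
    intro lx ly lz a hx hy hz hc
    obtain ⟨q, hq, m, h⟩ := run_alts h1
    obtain ⟨b, rfl⟩ : ∃ b, q = addStep x y z c b := by
      rcases List.mem_cons.1 hq with rfl | hq
      · exact ⟨_, rfl⟩
      · obtain ⟨b, -, rfl⟩ := List.mem_map.1 hq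
        exact ⟨_, rfl⟩
    obtain ⟨lx', ly', lz', a', hx', hy', hz', hc', hk, hv⟩ := run_addStep hd h hx hy hz hc
    obtain ⟨lx'', ly'', lz'', a'', hx'', hy'', hz'', hc'', hk', hv'⟩ := ih2 rfl hx' hy' hz' hc'
    exact ⟨lx'', ly'', lz'', a'', hx'', hy'', hz'', hc'', fun k h => (hk' k h).trans (hk k h),
      hv ∘ hv'⟩
  | _ => cases hp

theorem bval_head_tail (l : List Bool) :
    bval l = (l.headD false).toNat + 2 * bval l.tail := by
  cases l <;> rfl

theorem mem_bit_triples : ∀ a p q : Bool, (a, p, q) ∈ [(false, false, false),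
    (false, false, true), (false, true, false), (false, true, true), (true, false, false),
    (true, false, true), (true, true, false), (true, true, true)] := by
  decide

/-- The 19 steps per digit are at most 11 for the step itself (three digits at a cost of up to 3
each, and two operations on the carry), 7 for selecting one of eight alternatives, and 1 for the
loop. -/
theorem exists_run_addSteps (hd : [x, y, z, c].Nodup) (N : ℕ) : ∀ {σ : Stacks κ}
    {lx ly lz : List Bool} {a : Bool}, lx.length ≤ N → ly.length ≤ N → lz.length ≤ N →
    σ x = lx.map some → σ y = ly.map some → σ z = lz.map some → σ c = [some a] →
    bval lx + bval ly + a.toNat = bval lz →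
    ∃ n ≤ 19 * N + 1, SRun (addSteps x y z c) σ n
      (update (update (update (update σ x []) y []) z [])
        c [some false]) := by
  obtain ⟨⟨hxy, hxz, hxc⟩, ⟨hyz, hyc⟩, hzc⟩ := ne_of_nodup hd
  induction N with
  | zero =>
    intro σ lx ly lz a h1 h2 h3 hx hy hz hc hv
    obtain rfl : lx = [] := by simpa using h1
    obtain rfl : ly = [] := by simpa using h2
    obtain rfl : lz = [] := by simpa using h3
    obtain rfl : a = false := by cases a <;> simp_all [bval]
    refine ⟨1, le_rfl, ?_⟩
    suffices h : update (update (update (update σ x []) y [])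
        z []) c [some false] = σ by rw [h]; exact .done
    funext k
    simp only [Function.update_apply]
    split_ifs <;> simp_all
  | succ N ih =>
    intro σ lx ly lz a h1 h2 h3 hx hy hz hc hv
    have vx := bval_head_tail lx
    have vy := bval_head_tail ly
    have vz := bval_head_tail lz
    set bx := lx.headD false
    set b_y := ly.headD false
    set bz := lz.headD false with hbz
    have hbz' : bz = (a ^^ (bx ^^ b_y)) := by
      rw [vx, vy, vz] at hv
      generalize bx = p at *
      generalize b_y = q at *
      generalize bz = r at *
      cases a <;> cases p <;> cases q <;> cases r <;> simp at hv ⊢ <;> omega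
    set a' : Bool := (a && bx) || (a && b_y) || (bx && b_y) with ha'
    have hv' : bval lx.tail + bval ly.tail + a'.toNat = bval lz.tail := by
      rw [vx, vy, vz, hbz'] at hv
      rw [ha']
      generalize bx = p at *
      generalize b_y = q at *
      cases a <;> cases p <;> cases q <;> simp at hv ⊢ <;> omega
    let σ1 := update σ c []
    let σ2 := update σ1 x (lx.tail.map some)
    let σ3 := update σ2 y (ly.tail.map some)
    let σ4 := update σ3 z (lz.tail.map some)
    let σ5 := update σ4 c [some a']
    have r1 : SRun (.ins (.pop c (some a))) σ 1 σ1 := .ins ⟨[], hc, rfl⟩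
    obtain ⟨n2, hn2, r2⟩ := exists_run_popZ (x := x) (l := lx) (σ := σ1) (by simp [σ1, hxc, hx])
    obtain ⟨n3, hn3, r3⟩ := exists_run_popZ (x := y) (l := ly) (σ := σ2)
      (by simp [σ1, σ2, hyc, hxy.symm, hy])
    obtain ⟨n4, hn4, r4⟩ := exists_run_popZ (x := z) (l := lz) (σ := σ3)
      (by simp [σ1, σ2, σ3, hzc, hxz.symm, hyz.symm, hz])
    have r5 : SRun (.ins (.push c (some a'))) σ4 1 σ5 := .ins (by
      change _ = _
      simp [σ5, σ4, σ3, σ2, σ1, hxc.symm, hyc.symm, Ne.symm hzc])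
    rw [show lz.headD false = bz from rfl, hbz'] at r4
    have r := Run.seq r1 (Run.seq r2 (Run.seq r3 (Run.seq r4 r5)))
    obtain ⟨n6, hn6, r6⟩ := exists_run_alts (p := addStep x y z c (false, false, false))
      (q := addStep x y z c (a, bx, b_y))
      (l := (([(false, false, true), (false, true, false), (false, true, true),
        (true, false, false), (true, false, true), (true, true, false), (true, true, true)] :
          List _).map (addStep x y z c))) (by
        rw [← List.map_cons]
        exact List.mem_map_of_mem (mem_bit_triples a bx b_y)) r
    obtain ⟨n7, hn7, r7⟩ := ih (σ := σ5) (lx := lx.tail) (ly := ly.tail) (lz := lz.tail) (a := a')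
      (by simp; omega) (by simp; omega) (by simp; omega)
      (by simp [σ5, σ4, σ3, σ2, hxc, hxz, hxy])
      (by simp [σ5, σ4, σ3, hyc, hyz])
      (by simp [σ5, σ4, hzc]) (by simp [σ5]) hv'
    refine ⟨n6 + n7 + 1, ?_, ?_⟩
    · simp only [List.length_map, List.length_cons, List.length_nil] at hn6
      omega
    · suffices h : update (update (update (update σ x []) y [])
          z []) c [some false] = update (update (update
          (update σ5 x []) y []) z []) c [some false] by rw [h]; exact .more r6 r7
      funext k
      simp only [Function.update_apply, σ5, σ4, σ3, σ2, σ1]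
      split_ifs <;> rfl

/-- Test that the numbers in `i` and `j` add up to the number in `k`. -/
def addW (tmp x y z c i j k : κ) : Prog (SInstr κ) :=
  .seq (copyW tmp x i) (.seq (copyW tmp y j) (.seq (copyW tmp z k)
    (.seq (.ins (.push c (some false))) (.seq (addSteps x y z c)
      (line [.pop c (some false), .empty x, .empty y, .empty z])))))

theorem run_addW {tmp i j k : κ} {σ τ : Stacks κ} {n : ℕ} {li lj lk : List Bool}
    (hd : [tmp, x, y, z, c].Nodup) (hi : i ∉ [tmp, x, y, z, c]) (hj : j ∉ [tmp, x, y, z, c])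
    (hk : k ∉ [tmp, x, y, z, c]) (he : ∀ a ∈ [tmp, x, y, z, c], σ a = [])
    (hli : σ i = li.map some) (hlj : σ j = lj.map some) (hlk : σ k = lk.map some)
    (h : SRun (addW tmp x y z c i j k) σ n τ) :
    bval li + bval lj = bval lk ∧ τ = σ := by
  obtain ⟨htmp, hd⟩ := List.nodup_cons.1 hd
  obtain ⟨⟨hxy, hxz, hxc⟩, ⟨hyz, hyc⟩, hzc⟩ := ne_of_nodup hd
  simp only [List.mem_cons, List.not_mem_nil, or_false, not_or, forall_eq_or_imp,
    forall_eq] at hi hj hk he htmp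
  obtain ⟨het, hex, hey, hez, hec⟩ := he
  obtain ⟨_, _, σ1, -, h1, h⟩ := run_seq_iff.1 h
  obtain ⟨_, _, σ2, -, h2, h⟩ := run_seq_iff.1 h
  obtain ⟨_, _, σ3, -, h3, h⟩ := run_seq_iff.1 h
  obtain ⟨_, _, σ4, -, h4, h⟩ := run_seq_iff.1 h
  obtain ⟨_, _, σ5, -, h5, h6⟩ := run_seq_iff.1 h
  have e1 := run_copyW (Ne.symm hi.2.1) (Ne.symm htmp.1) hi.1 het hli h1
  have e2 := run_copyW (l := lj) (Ne.symm hj.2.2.1) (Ne.symm htmp.2.1) hj.1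
    (by rw [e1]; simpa [htmp.1] using het) (by rw [e1]; simpa [hj.2.1] using hlj) h2
  have e3 := run_copyW (l := lk) (Ne.symm hk.2.2.2.1) (Ne.symm htmp.2.2.1) hk.1
    (by rw [e2, e1]; simpa [htmp.1, htmp.2.1] using het)
    (by rw [e2, e1]; simpa [hk.2.1, hk.2.2.1] using hlk) h3
  have e4 : σ4 = _ := (run_ins_iff.1 h4).2
  obtain ⟨lx, ly, lz, a, ux, uy, uz, uc, hk', hv⟩ := run_addSteps hd h5 (lx := li) (ly := lj)
    (lz := lk) (a := false)
    (by rw [e4, e3, e2, e1]; simp [hxc, hxz, hxy, hex])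
    (by rw [e4, e3, e2, e1]; simp [hyc, hyz, hxy.symm, hey])
    (by rw [e4, e3, e2, e1]; simp [hzc, hxz.symm, hyz.symm, hez])
    (by rw [e4, e3, e2, e1]; simp [Ne.symm hzc, hxc.symm, hyc.symm, hec])
  obtain ⟨-, h6⟩ := run_line_iff.1 h6
  simp only [execAt, opAt] at h6
  have gx : σ5 x = [] ∧ τ x = [] := by
    obtain ⟨m, p1, m2, ⟨p2, q2⟩, m3, ⟨-, q3⟩, m4, ⟨-, q4⟩, q5⟩ := h6 x
    rw [if_neg hxc.symm] at p1
    have := p2 rfl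
    exact ⟨by rw [← p1, this], by rw [q5, q4, q3, q2, this]⟩
  have gy : σ5 y = [] ∧ τ y = [] := by
    obtain ⟨m, p1, m2, ⟨-, q2⟩, m3, ⟨p2, q3⟩, m4, ⟨-, q4⟩, q5⟩ := h6 y
    rw [if_neg hyc.symm] at p1
    have := p2 rfl
    exact ⟨by rw [← p1, ← q2, this], by rw [q5, q4, q3, this]⟩
  have gz : σ5 z = [] ∧ τ z = [] := by
    obtain ⟨m, p1, m2, ⟨-, q2⟩, m3, ⟨-, q3⟩, m4, ⟨p2, q4⟩, q5⟩ := h6 z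
    rw [if_neg (Ne.symm hzc)] at p1
    have := p2 rfl
    exact ⟨by rw [← p1, ← q2, ← q3, this], by rw [q5, q4, this]⟩
  have gc : σ5 c = some false :: τ c := by
    obtain ⟨m, p1, m2, ⟨-, q2⟩, m3, ⟨-, q3⟩, m4, ⟨-, q4⟩, q5⟩ := h6 c
    rw [if_pos rfl] at p1
    rw [q5, q4, q3, q2, p1]
  rw [gx.1] at ux
  rw [gy.1] at uy
  rw [gz.1] at uz
  rw [gc] at uc
  obtain rfl : lx = [] := by simpa using ux.symm
  obtain rfl : ly = [] := by simpa using uy.symm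
  obtain rfl : lz = [] := by simpa using uz.symm
  simp only [List.cons.injEq, Option.some.injEq] at uc
  obtain ⟨rfl, uc⟩ := uc
  refine ⟨by simpa [bval] using hv, ?_⟩
  funext l
  by_cases l1 : l = x
  · subst l1; rw [gx.2, hex]
  by_cases l2 : l = y
  · subst l2; rw [gy.2, hey]
  by_cases l3 : l = z
  · subst l3; rw [gz.2, hez]
  by_cases l4 : l = c
  · subst l4; rw [uc, hec]
  obtain ⟨m, p1, m2, ⟨-, q2⟩, m3, ⟨-, q3⟩, m4, ⟨-, q4⟩, q5⟩ := h6 l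
  rw [if_neg (Ne.symm l4)] at p1
  rw [q5, q4, q3, q2, p1, hk' l (by simp [l1, l2, l3, l4]), e4, e3, e2, e1]
  simp [l1, l2, l3, l4]

theorem exists_run_addW {tmp i j k : κ} {σ : Stacks κ} {li lj lk : List Bool} {N : ℕ}
    (hd : [tmp, x, y, z, c].Nodup) (hi : i ∉ [tmp, x, y, z, c]) (hj : j ∉ [tmp, x, y, z, c])
    (hk : k ∉ [tmp, x, y, z, c]) (he : ∀ a ∈ [tmp, x, y, z, c], σ a = [])
    (hli : σ i = li.map some) (hlj : σ j = lj.map some) (hlk : σ k = lk.map some)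
    (hN : li.length ≤ N ∧ lj.length ≤ N ∧ lk.length ≤ N) (h : bval li + bval lj = bval lk) :
    ∃ n ≤ 52 * N + 19, SRun (addW tmp x y z c i j k) σ n σ := by
  obtain ⟨htmp, hd⟩ := List.nodup_cons.1 hd
  obtain ⟨⟨hxy, hxz, hxc⟩, ⟨hyz, hyc⟩, hzc⟩ := ne_of_nodup hd
  simp only [List.mem_cons, List.not_mem_nil, or_false, not_or, forall_eq_or_imp,
    forall_eq] at hi hj hk he htmp
  obtain ⟨het, hex, hey, hez, hec⟩ := he
  let σ1 := update σ x (li.map some ++ σ x)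
  let σ2 := update σ1 y (lj.map some ++ σ1 y)
  let σ3 := update σ2 z (lk.map some ++ σ2 z)
  let σ4 := update σ3 c (some false :: σ3 c)
  have r1 := exists_run_copyW (Ne.symm hi.2.1) (Ne.symm htmp.1) hi.1 het hli
  have r2 := exists_run_copyW (σ := σ1) (l := lj) (Ne.symm hj.2.2.1) (Ne.symm htmp.2.1) hj.1
    (by simpa [σ1, htmp.1] using het) (by simpa [σ1, hj.2.1] using hlj)
  have r3 := exists_run_copyW (σ := σ2) (l := lk) (Ne.symm hk.2.2.2.1) (Ne.symm htmp.2.2.1) hk.1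
    (by simpa [σ2, σ1, htmp.1, htmp.2.1] using het)
    (by simpa [σ2, σ1, hk.2.1, hk.2.2.1] using hlk)
  have r4 : SRun (.ins (.push c (some false))) σ3 1 σ4 := .ins rfl
  obtain ⟨n, hn, r5⟩ := exists_run_addSteps hd N (σ := σ4) (lx := li) (ly := lj) (lz := lk)
    (a := false) hN.1 hN.2.1 hN.2.2
    (by simp [σ4, σ3, σ2, σ1, hxc, hxz, hxy, hex])
    (by simp [σ4, σ3, σ2, σ1, hyc, hyz, hxy.symm, hey])
    (by simp [σ4, σ3, σ2, σ1, hzc, hxz.symm, hyz.symm, hez])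
    (by simp [σ4, σ3, σ2, σ1, Ne.symm hzc, hxc.symm, hyc.symm, hec]) (by simpa using h)
  have r6 : SRun (line [.pop c (some false), .empty x, .empty y, .empty z])
      (update (update (update (update σ4 x []) y []) z [])
        c [some false]) 5 σ := by
    refine run_line_iff.2 ⟨rfl, fun l => ?_⟩
    by_cases l1 : l = c
    · subst l1; simp [execAt, opAt, hxc, hyc, hzc, hec]
    by_cases l2 : l = x
    · subst l2; simp [execAt, opAt, l1, Ne.symm l1, hxy, hxz, hxy.symm, hxz.symm, hex]
    by_cases l3 : l = y
    · subst l3; simp [execAt, opAt, l1, Ne.symm l1, hyz, hxy, hyz.symm, hey]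
    by_cases l4 : l = z
    · subst l4; simp [execAt, opAt, l1, Ne.symm l1, hyz, hxz, hez]
    simp [execAt, opAt, l1, l2, l3, l4, Ne.symm l1, Ne.symm l2, Ne.symm l3, Ne.symm l4, σ4, σ3,
      σ2, σ1]
  exact ⟨_, by omega, .seq r1 (.seq r2 (.seq r3 (.seq r4 (.seq r5 r6))))⟩

end add

end Prog

/-! ### A register machine with stacks of records -/

namespace Prog

/-- Registers. -/
abbrev Reg := Fin 32

/-- A record of four numbers. -/
abbrev Rec := ℕ × ℕ × ℕ × ℕ

/-- The stacks by which the register machine is implemented. -/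
inductive Cell where
  | inp
  | reg (i : Reg)
  | aux (i : Fin 5)
  | stk (i : Fin 5)
  deriving DecidableEq

instance : Finite Cell :=
  Finite.of_surjective (fun x : Option (Reg ⊕ Fin 5 ⊕ Fin 5) => match x with
    | none => Cell.inp
    | some (.inl i) => .reg i
    | some (.inr (.inl i)) => .aux i
    | some (.inr (.inr i)) => .stk i) (by
    rintro (_ | i | i | i)
    exacts [⟨none, rfl⟩, ⟨some (.inl i), rfl⟩, ⟨some (.inr (.inl i)), rfl⟩,
      ⟨some (.inr (.inr i)), rfl⟩])

/-- State of the register machine: the numbers still to be read and the stacks of records. -/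
@[ext]
structure VState where
  inp : List ℕ
  stk : Fin 5 → List Rec

/-- Elementary actions, depending on the values of the registers. -/
inductive Act where
  | add (i j k : Reg)
  | cst (i : Reg) (c : ℕ)
  | push (s : Fin 5) (i j k l : Reg)
  | pop (s : Fin 5) (i j k l : Reg)
  | emp (s : Fin 5)
  | read (i : Reg)
  | eof

/-- Effect of an elementary action. -/
def Act.sem (ρ : Reg → ℕ) : Act → VState → VState → Prop
  | .add i j k, v, v' => ρ i + ρ j = ρ k ∧ v' = v
  | .cst i c, v, v' => ρ i = c ∧ v' = v
  | .push s i j k l, v, v' =>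
      v' = ⟨v.inp, update v.stk s ((ρ i, ρ j, ρ k, ρ l) :: v.stk s)⟩
  | .pop s i j k l, v, v' => ∃ u, v.stk s = (ρ i, ρ j, ρ k, ρ l) :: u ∧
      v' = ⟨v.inp, update v.stk s u⟩
  | .emp s, v, v' => v.stk s = [] ∧ v' = v
  | .read i, v, v' => ∃ u, v.inp = ρ i :: u ∧ v' = ⟨u, v.stk⟩
  | .eof, v, v' => v.inp = [] ∧ v' = v

/-- Effect of a sequence of elementary actions. -/
def actsSem (ρ : Reg → ℕ) : List Act → VState → VState → Prop
  | [], v, v' => v' = v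
  | a :: l, v, v' => ∃ w, a.sem ρ v w ∧ actsSem ρ l w v'

/-- Effect of a rule: a sequence of elementary actions for some values of the registers that
satisfy `P`. -/
def ruleSem (P : ℕ → Prop) (l : List Act) (v v' : VState) : Prop :=
  ∃ ρ : Reg → ℕ, (∀ i, P (ρ i)) ∧ actsSem ρ l v v'

theorem actsSem_append {ρ : Reg → ℕ} {l l' : List Act} {v v' : VState} :
    actsSem ρ (l ++ l') v v' ↔ ∃ w, actsSem ρ l v w ∧ actsSem ρ l' w v' := by
  induction l generalizing v with
  | nil => simp [actsSem]
  | cons a l ih =>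
    simp only [List.cons_append, actsSem, ih]
    constructor
    · rintro ⟨w, h, w', h1, h2⟩; exact ⟨w', ⟨w, h, h1⟩, h2⟩
    · rintro ⟨w', ⟨w, h, h1⟩, h2⟩; exact ⟨w, h, w', h1, h2⟩

/-- Code of a number on a stack of records. -/
def word (x : ℕ) : List StackSym := x.bits.map some ++ [none]

/-- Code of a record. -/
def encRec (r : Rec) : List StackSym := word r.1 ++ word r.2.1 ++ word r.2.2.1 ++ word r.2.2.2

/-- Code of registers and state. -/
def encState (ρ : Reg → ℕ) (v : VState) : Stacks Cell
  | .inp => (v.inp.flatMap encodeNat).map some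
  | .reg i => (ρ i).bits.map some
  | .aux _ => []
  | .stk s => (v.stk s).flatMap encRec

theorem bits_injective {a b : ℕ} (h : a.bits = b.bits) : a = b := by
  rw [← bval_bits a, h, bval_bits]

theorem word_append_injective {a b : ℕ} {u u' : List StackSym} (h : word a ++ u = word b ++ u') :
    a = b ∧ u = u' := by
  obtain ⟨h1, h2⟩ := code_unique (p := false) (by simpa [code, sep, word] using h)
  exact ⟨bits_injective h1, h2⟩

theorem update_encState_reg (ρ : Reg → ℕ) (v : VState) (i : Reg) (x : ℕ) :
    update (encState ρ v) (.reg i) (x.bits.map some) =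
      encState (update ρ i x) v := by
  funext k
  rcases k with _ | j | j | j
  · simp [encState]
  · by_cases h : j = i
    · subst h; simp [encState]
    · simp [encState, h]
  · simp [encState]
  · simp [encState]

theorem update_encState_stk (ρ : Reg → ℕ) (v : VState) (s : Fin 5) (l : List Rec) :
    update (encState ρ v) (.stk s) (l.flatMap encRec) =
      encState ρ ⟨v.inp, update v.stk s l⟩ := by
  funext k
  rcases k with _ | j | j | j
  · simp [encState]
  · simp [encState]
  · simp [encState]
  · by_cases h : j = s
    · subst h; simp [encState]
    · simp [encState, h]

theorem update_encState_inp (ρ : Reg → ℕ) (v : VState) (l : List ℕ) :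
    update (encState ρ v) .inp ((l.flatMap encodeNat).map some) =
      encState ρ ⟨l, v.stk⟩ := by
  funext k
  rcases k with _ | j | j | j <;> simp [encState]

theorem run_pushW_word {ρ : Reg → ℕ} {v : VState} {σ τ : Stacks Cell} {s : Fin 5} {i : Reg}
    {w : List StackSym} {n : ℕ} (hσ : σ = update (encState ρ v) (.stk s) w)
    (h : SRun (pushW (.aux 0) (.stk s) (.reg i)) σ n τ) :
    τ = update (encState ρ v) (.stk s) (word (ρ i) ++ w) := by
  subst hσ
  rw [run_pushW (l := (ρ i).bits) (by simp) (by simp) (by simp) (by simp [encState])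
    (by simp [encState]) h]
  simp [word]

theorem exists_run_pushW_word {ρ : Reg → ℕ} {v : VState} {s : Fin 5} {i : Reg}
    {w : List StackSym} :
    SRun (pushW (.aux 0) (.stk s) (.reg i)) (update (encState ρ v) (.stk s) w)
      (11 * (ρ i).bits.length + 5)
      (update (encState ρ v) (.stk s) (word (ρ i) ++ w)) := by
  have := exists_run_pushW (σ := update (encState ρ v) (.stk s) w) (tmp := .aux 0)
    (s := .stk s) (r := .reg i) (l := (ρ i).bits) (by simp) (by simp) (by simp) (by simp [encState])
    (by simp [encState])
  simpa [word] using this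

theorem run_popW_word {ρ : Reg → ℕ} {v : VState} {σ τ : Stacks Cell} {s : Fin 5} {i : Reg}
    {w : List StackSym} {n : ℕ} (hσ : σ = update (encState ρ v) (.stk s) w)
    (h : SRun (popW false (.aux 0) (.stk s) (.reg i)) σ n τ) :
    ∃ u, w = word (ρ i) ++ u ∧ τ = update (encState ρ v) (.stk s) u := by
  subst hσ
  obtain ⟨u, h1, rfl⟩ := run_popW (l := (ρ i).bits) (by simp) (by simp) (by simp)
    (by simp [encState]) (by simp [encState]) h
  exact ⟨u, by simpa [word, code, sep] using h1, by simp⟩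

theorem exists_run_popW_word {ρ : Reg → ℕ} {v : VState} {s : Fin 5} {i : Reg}
    {u : List StackSym} : ∃ n ≤ 12 * (ρ i).bits.length + 6,
    SRun (popW false (.aux 0) (.stk s) (.reg i))
      (update (encState ρ v) (.stk s) (word (ρ i) ++ u)) n
      (update (encState ρ v) (.stk s) u) := by
  simpa using exists_run_popW (p := false)
    (σ := update (encState ρ v) (.stk s) (word (ρ i) ++ u))
    (tmp := .aux 0) (s := .stk s) (r := .reg i) (l := (ρ i).bits) (u := u) (by simp) (by simp)
    (by simp) (by simp [encState]) (by simp [encState]) (by simp [word, code, sep])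

/-- Implementation of an elementary action. -/
def Act.prog : Act → Prog (SInstr Cell)
  | .add i j k => addW (.aux 0) (.aux 1) (.aux 2) (.aux 3) (.aux 4) (.reg i) (.reg j) (.reg k)
  | .cst i c => testW (.reg i) c.bits
  | .push s i j k l => .seq (pushW (.aux 0) (.stk s) (.reg l))
      (.seq (pushW (.aux 0) (.stk s) (.reg k)) (.seq (pushW (.aux 0) (.stk s) (.reg j))
        (pushW (.aux 0) (.stk s) (.reg i))))
  | .pop s i j k l => .seq (popW false (.aux 0) (.stk s) (.reg i))
      (.seq (popW false (.aux 0) (.stk s) (.reg j)) (.seq (popW false (.aux 0) (.stk s) (.reg k))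
        (popW false (.aux 0) (.stk s) (.reg l))))
  | .emp s => .ins (.empty (.stk s))
  | .read i => popW true (.aux 0) .inp (.reg i)
  | .eof => .ins (.empty .inp)

theorem flatMap_encRec_eq_nil {l : List Rec} : l.flatMap encRec = [] ↔ l = [] := by
  cases l <;> simp [encRec, word]

theorem flatMap_encodeNat_eq_nil {l : List ℕ} :
    (l.flatMap encodeNat).map (some : Bool → StackSym) = [] ↔ l = [] := by
  cases l <;> simp [encodeNat]

theorem encState_stk (ρ : Reg → ℕ) (v : VState) (s : Fin 5) : encState ρ v =
    update (encState ρ v) (.stk s) ((v.stk s).flatMap encRec) := by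
  rw [update_encState_stk]; simp

theorem Act.run_prog {a : Act} {ρ : Reg → ℕ} {v : VState} {τ : Stacks Cell} {n : ℕ}
    (h : SRun a.prog (encState ρ v) n τ) : ∃ v', a.sem ρ v v' ∧ τ = encState ρ v' := by
  cases a with
  | add i j k =>
    obtain ⟨h1, h2⟩ := run_addW (κ := Cell) (tmp := .aux 0) (x := .aux 1) (y := .aux 2)
      (z := .aux 3) (c := .aux 4) (i := .reg i) (j := .reg j) (k := .reg k) (σ := encState ρ v)
      (li := (ρ i).bits) (lj := (ρ j).bits) (lk := (ρ k).bits)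
      (by decide) (by simp) (by simp) (by simp) (by simp [encState]) rfl rfl rfl h
    simp only [bval_bits] at h1
    exact ⟨v, ⟨h1, rfl⟩, h2⟩
  | cst i c =>
    obtain ⟨-, h1, h2⟩ := run_testW_iff.1 h
    exact ⟨v, ⟨bits_injective (map_some_injective h1), rfl⟩, h2⟩
  | push s i j k l =>
    obtain ⟨_, _, σ1, -, h1, h⟩ := run_seq_iff.1 h
    obtain ⟨_, _, σ2, -, h2, h⟩ := run_seq_iff.1 h
    obtain ⟨_, _, σ3, -, h3, h4⟩ := run_seq_iff.1 h
    have e := run_pushW_word (run_pushW_word (run_pushW_word (run_pushW_word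
      (encState_stk ρ v s) h1) h2) h3) h4
    refine ⟨_, rfl, ?_⟩
    rw [e, ← update_encState_stk]
    simp [encRec]
  | pop s i j k l =>
    obtain ⟨_, _, σ1, -, h1, h⟩ := run_seq_iff.1 h
    obtain ⟨_, _, σ2, -, h2, h⟩ := run_seq_iff.1 h
    obtain ⟨_, _, σ3, -, h3, h4⟩ := run_seq_iff.1 h
    obtain ⟨u1, e1, f1⟩ := run_popW_word (encState_stk ρ v s) h1
    obtain ⟨u2, e2, f2⟩ := run_popW_word f1 h2
    obtain ⟨u3, e3, f3⟩ := run_popW_word f2 h3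
    obtain ⟨u4, e4, f4⟩ := run_popW_word f3 h4
    subst e2 e3 e4
    match hv : v.stk s, e1 with
    | [], e1 => simp [word] at e1
    | (a, b, c, d) :: l', e1 =>
      simp only [List.flatMap_cons, encRec, List.append_assoc] at e1
      obtain ⟨ha, ea⟩ := word_append_injective e1
      obtain ⟨hb, eb⟩ := word_append_injective ea
      obtain ⟨hc, ec⟩ := word_append_injective eb
      obtain ⟨hd, ed⟩ := word_append_injective ec
      exact ⟨_, ⟨l', by rw [hv, ha, hb, hc, hd], rfl⟩, by rw [f4, ← ed, update_encState_stk]⟩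
  | emp s =>
    obtain ⟨-, h1, h2⟩ := run_ins_iff.1 h
    exact ⟨v, ⟨flatMap_encRec_eq_nil.1 h1, rfl⟩, h2⟩
  | read i =>
    obtain ⟨u, h1, h2⟩ := run_popW (l := (ρ i).bits) (by simp) (by simp) (by simp)
      (by simp [encState]) (by simp [encState]) h
    match hv : v.inp with
    | [] => simp [encState, hv] at h1
    | y :: l' =>
      simp only [encState, hv, List.flatMap_cons, encodeNat, List.map_append,
        List.map_cons, List.append_assoc, List.singleton_append] at h1
      obtain ⟨e, rfl⟩ := code_unique (p := true) h1
      obtain rfl := bits_injective e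
      refine ⟨_, ⟨l', hv, rfl⟩, ?_⟩
      rw [h2]
      exact update_encState_inp ρ v l'
  | eof =>
    obtain ⟨-, h1, h2⟩ := run_ins_iff.1 h
    exact ⟨v, ⟨flatMap_encodeNat_eq_nil.1 h1, rfl⟩, h2⟩

/-- Only the registers and the tops of the stacks are touched, so the cost is linear in the bit
length of the registers and does not depend on how much is stored. -/
theorem Act.exists_run_prog (a : Act) : ∃ c, ∀ (ρ : Reg → ℕ) (v v' : VState) (b : ℕ),
    (∀ i, (ρ i).bits.length ≤ b) → a.sem ρ v v' →
    ∃ n ≤ c * (b + 1), SRun a.prog (encState ρ v) n (encState ρ v') := by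
  cases a with
  | add i j k =>
    refine ⟨52, fun ρ v v' b hb h => ?_⟩
    obtain ⟨h, rfl⟩ := h
    obtain ⟨n, hn, h⟩ := exists_run_addW (σ := encState ρ v') (N := b) (tmp := .aux 0)
      (x := .aux 1) (y := .aux 2) (z := .aux 3) (c := .aux 4)
      (li := (ρ i).bits) (lj := (ρ j).bits) (lk := (ρ k).bits) (i := .reg i) (j := .reg j)
      (k := .reg k) (by decide) (by simp) (by simp) (by simp) (by simp [encState]) rfl rfl rfl
      ⟨hb i, hb j, hb k⟩ (by simpa [bval_bits] using h)
    exact ⟨n, by omega, h⟩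
  | cst i c =>
    refine ⟨2 * c.bits.length + 2, fun ρ v v' b _ h => ?_⟩
    obtain ⟨rfl, rfl⟩ := h
    exact ⟨_, by nlinarith, run_testW_iff.2 ⟨rfl, rfl, rfl⟩⟩
  | push s i j k l =>
    refine ⟨44, fun ρ v v' b hb h => ?_⟩
    obtain rfl := h
    have r1 := exists_run_pushW_word (ρ := ρ) (v := v) (s := s) (i := l)
      (w := (v.stk s).flatMap encRec)
    have r2 := exists_run_pushW_word (ρ := ρ) (v := v) (s := s) (i := k)
      (w := word (ρ l) ++ (v.stk s).flatMap encRec)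
    have r3 := exists_run_pushW_word (ρ := ρ) (v := v) (s := s) (i := j)
      (w := word (ρ k) ++ (word (ρ l) ++ (v.stk s).flatMap encRec))
    have r4 := exists_run_pushW_word (ρ := ρ) (v := v) (s := s) (i := i)
      (w := word (ρ j) ++ (word (ρ k) ++ (word (ρ l) ++ (v.stk s).flatMap encRec)))
    rw [← encState_stk] at r1
    rw [show word (ρ i) ++ (word (ρ j) ++ (word (ρ k) ++ (word (ρ l) ++
      (v.stk s).flatMap encRec))) = ((ρ i, ρ j, ρ k, ρ l) :: v.stk s).flatMap encRec by
        simp [encRec], update_encState_stk] at r4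
    refine ⟨_, ?_, .seq r1 (.seq r2 (.seq r3 r4))⟩
    have := hb i; have := hb j; have := hb k; have := hb l; omega
  | pop s i j k l =>
    refine ⟨48, fun ρ v v' b hb h => ?_⟩
    obtain ⟨u, hu, rfl⟩ := h
    obtain ⟨n1, l1, r1⟩ := exists_run_popW_word (ρ := ρ) (v := v) (s := s) (i := i)
      (u := word (ρ j) ++ (word (ρ k) ++ (word (ρ l) ++ u.flatMap encRec)))
    obtain ⟨n2, l2, r2⟩ := exists_run_popW_word (ρ := ρ) (v := v) (s := s) (i := j)
      (u := word (ρ k) ++ (word (ρ l) ++ u.flatMap encRec))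
    obtain ⟨n3, l3, r3⟩ := exists_run_popW_word (ρ := ρ) (v := v) (s := s) (i := k)
      (u := word (ρ l) ++ u.flatMap encRec)
    obtain ⟨n4, l4, r4⟩ := exists_run_popW_word (ρ := ρ) (v := v) (s := s) (i := l) (u := u.flatMap encRec)
    rw [show word (ρ i) ++ (word (ρ j) ++ (word (ρ k) ++ (word (ρ l) ++ u.flatMap encRec))) =
      (v.stk s).flatMap encRec by simp [hu, encRec], ← encState_stk] at r1
    rw [update_encState_stk] at r4
    refine ⟨_, ?_, .seq r1 (.seq r2 (.seq r3 r4))⟩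
    have := hb i; have := hb j; have := hb k; have := hb l; omega
  | emp s =>
    refine ⟨1, fun ρ v v' b hb h => ?_⟩
    obtain ⟨h, rfl⟩ := h
    exact ⟨1, by omega, .ins ⟨by simp [encState, h], rfl⟩⟩
  | read i =>
    refine ⟨12, fun ρ v v' b hb h => ?_⟩
    obtain ⟨u, hu, rfl⟩ := h
    obtain ⟨n, hn, h⟩ := exists_run_popW (p := true) (σ := encState ρ v) (tmp := .aux 0) (s := .inp) (r := .reg i)
      (l := (ρ i).bits) (u := (u.flatMap encodeNat).map some) (by simp) (by simp) (by simp)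
      (by simp [encState]) (by simp [encState]) (by
        simp [encState, hu, List.flatMap_cons, encodeNat, code, sep])
    rw [update_encState_inp] at h
    exact ⟨n, by have := hb i; omega, h⟩
  | eof =>
    refine ⟨1, fun ρ v v' b hb h => ?_⟩
    obtain ⟨h, rfl⟩ := h
    exact ⟨1, by omega, .ins ⟨by simp [encState, h], rfl⟩⟩

/-- Implementation of a sequence of elementary actions. -/
def actsProg : List Act → Prog (SInstr Cell)
  | [] => .ins .nop
  | a :: l => .seq a.prog (actsProg l)

theorem run_actsProg {ρ : Reg → ℕ} : ∀ {l : List Act} {v : VState} {τ : Stacks Cell}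
    {n : ℕ}, SRun (actsProg l) (encState ρ v) n τ →
    ∃ v', actsSem ρ l v v' ∧ τ = encState ρ v'
  | [], v, τ, n, h => ⟨v, rfl, (run_ins_iff.1 h).2⟩
  | a :: l, v, τ, n, h => by
    obtain ⟨_, _, _, -, h1, h2⟩ := run_seq_iff.1 h
    obtain ⟨w, hw, rfl⟩ := a.run_prog h1
    obtain ⟨v', hv, rfl⟩ := run_actsProg h2
    exact ⟨v', ⟨w, hw, hv⟩, rfl⟩

theorem exists_run_actsProg : ∀ l : List Act, ∃ c, ∀ (ρ : Reg → ℕ) (v v' : VState) (b : ℕ),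
    (∀ i, (ρ i).bits.length ≤ b) → actsSem ρ l v v' →
    ∃ n ≤ c * (b + 1), SRun (actsProg l) (encState ρ v) n (encState ρ v')
  | [] => ⟨1, fun ρ v v' b _ h => ⟨1, by omega, .ins (by obtain rfl := h; rfl)⟩⟩
  | a :: l => by
    obtain ⟨c, hc⟩ := a.exists_run_prog
    obtain ⟨c', hc'⟩ := exists_run_actsProg l
    refine ⟨c + c', fun ρ v v' b hb ⟨w, h1, h2⟩ => ?_⟩
    obtain ⟨n, hn, r⟩ := hc ρ v w b hb h1
    obtain ⟨n', hn', r'⟩ := hc' ρ w v' b hb h2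
    exact ⟨_, by rw [add_mul]; omega, .seq r r'⟩

/-- Guess the values of registers. -/
def guessAll : List Reg → Prog (SInstr Cell)
  | [] => .ins .nop
  | i :: l => .seq (guessW (.reg i)) (guessAll l)

/-- Clear registers. -/
def clearAll : List Reg → Prog (SInstr Cell)
  | [] => .ins .nop
  | i :: l => .seq (clearW (.reg i)) (clearAll l)

theorem run_guessAll : ∀ {l : List Reg} {ρ : Reg → ℕ} {v : VState} {τ : Stacks Cell}
    {n : ℕ}, l.Nodup → (∀ i ∈ l, ρ i = 0) → SRun (guessAll l) (encState ρ v) n τ →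
    ∃ ρ', τ = encState ρ' v
  | [], ρ, v, τ, n, _, _, h => ⟨ρ, (run_ins_iff.1 h).2⟩
  | i :: l, ρ, v, τ, n, hl, h0, h => by
    obtain ⟨_, _, _, -, h1, h2⟩ := run_seq_iff.1 h
    obtain ⟨x, rfl⟩ := run_guessW (by simp [encState, h0 i]) h1
    rw [update_encState_reg] at h2
    obtain ⟨hil, hl⟩ := List.nodup_cons.1 hl
    refine run_guessAll hl (fun j hj => ?_) h2
    rw [Function.update_of_ne (by rintro rfl; exact hil hj)]
    exact h0 j (List.mem_cons_of_mem _ hj)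

theorem exists_run_guessAll {b : ℕ} {v : VState} {ρ' : Reg → ℕ} (hb : ∀ i, (ρ' i).bits.length ≤ b) :
    ∀ {l : List Reg} {ρ : Reg → ℕ}, l.Nodup → (∀ i, ρ i = if i ∈ l then 0 else ρ' i) →
    ∃ n ≤ l.length * (4 * (b + 1)) + 1,
      SRun (guessAll l) (encState ρ v) n (encState ρ' v)
  | [], ρ, _, h => ⟨1, by omega, .ins (by
      obtain rfl : ρ = ρ' := funext fun i => by simpa using h i
      rfl)⟩
  | i :: l, ρ, hl, h => by
    obtain ⟨hil, hl⟩ := List.nodup_cons.1 hl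
    obtain ⟨n, hn, r⟩ := exists_run_guessW (σ := encState ρ v) (r := .reg i)
      (by simp [encState, h]) (ρ' i)
    rw [update_encState_reg] at r
    obtain ⟨n', hn', r'⟩ := exists_run_guessAll hb (ρ := update ρ i (ρ' i)) hl (by
      intro j
      by_cases hj : j = i
      · subst hj; simp [hil]
      · simp [hj, h])
    refine ⟨_, ?_, .seq r r'⟩
    have := hb i
    rw [List.length_cons, add_mul]
    omega

theorem run_clearAll : ∀ {l : List Reg} {ρ : Reg → ℕ} {v : VState} {τ : Stacks Cell}
    {n : ℕ}, SRun (clearAll l) (encState ρ v) n τ →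
    τ = encState (fun i => if i ∈ l then 0 else ρ i) v
  | [], ρ, v, τ, n, h => by
    have := (run_ins_iff.1 h).2
    simpa [SInstr.sem] using this
  | i :: l, ρ, v, τ, n, h => by
    obtain ⟨_, _, _, -, h1, h2⟩ := run_seq_iff.1 h
    have := run_clearW h1
    have e := update_encState_reg ρ v i 0
    rw [Nat.zero_bits, List.map_nil] at e
    rw [this, e] at h2
    rw [run_clearAll h2]
    congr 1
    funext j
    by_cases hj : j = i
    · subst hj; simp
    · simp [hj]

theorem exists_run_clearAll {b : ℕ} {v : VState} :
    ∀ {l : List Reg} {ρ : Reg → ℕ}, (∀ i, (ρ i).bits.length ≤ b) →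
    ∃ n ≤ l.length * (4 * (b + 1)) + 1, SRun (clearAll l) (encState ρ v) n
      (encState (fun i => if i ∈ l then 0 else ρ i) v)
  | [], ρ, hb => ⟨1, by omega, .ins (by simp [SInstr.sem])⟩
  | i :: l, ρ, hb => by
    have r := exists_run_clearW (σ := encState ρ v) (r := .reg i) (l := (ρ i).bits) rfl
    have e := update_encState_reg ρ v i 0
    rw [Nat.zero_bits, List.map_nil] at e
    rw [e] at r
    obtain ⟨n', hn', r'⟩ := exists_run_clearAll (v := v) (l := l) (ρ := update ρ i 0)
      (b := b) (by
        intro j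
        by_cases hj : j = i
        · subst hj; simp
        · simp [hj, hb])
    rw [show (fun j => if j ∈ l then 0 else update ρ i 0 j) =
      fun j => if j ∈ i :: l then 0 else ρ j by
        funext j
        by_cases hj : j = i
        · subst hj; simp
        · simp [hj]] at r'
    refine ⟨_, ?_, .seq r r'⟩
    have := hb i
    rw [List.length_cons, add_mul]
    omega

/-- Implementation of a rule. -/
def ruleProg (l : List Act) : Prog (SInstr Cell) :=
  .seq (guessAll (List.finRange 32)) (.seq (actsProg l) (clearAll (List.finRange 32)))

/-- A rule guesses all registers, carries out its actions and clears the registers. It thus begins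
and ends with zero registers, and between two rules the state is described by a `VState` alone. -/
theorem run_ruleProg {l : List Act} {v : VState} {τ : Stacks Cell} {n : ℕ}
    (h : SRun (ruleProg l) (encState 0 v) n τ) :
    ∃ v', ruleSem (fun _ => True) l v v' ∧ τ = encState 0 v' := by
  obtain ⟨_, _, _, -, h1, h⟩ := run_seq_iff.1 h
  obtain ⟨_, _, _, -, h2, h3⟩ := run_seq_iff.1 h
  obtain ⟨ρ, rfl⟩ := run_guessAll (List.nodup_finRange 32) (fun _ _ => rfl) h1
  obtain ⟨v', hv, rfl⟩ := run_actsProg h2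
  exact ⟨v', ⟨ρ, fun _ => trivial, hv⟩, by rw [run_clearAll h3]; congr 1; funext i; simp⟩

theorem exists_run_ruleProg (l : List Act) : ∃ c, ∀ (v v' : VState) (b : ℕ),
    ruleSem (fun x => x.bits.length ≤ b) l v v' →
    ∃ n ≤ c * (b + 1), SRun (ruleProg l) (encState 0 v) n (encState 0 v') := by
  obtain ⟨c, hc⟩ := exists_run_actsProg l
  refine ⟨c + 258, fun v v' b ⟨ρ, hb, h⟩ => ?_⟩
  obtain ⟨n1, h1, r1⟩ := exists_run_guessAll (v := v) (ρ := 0) hb (List.nodup_finRange 32)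
    (by simp)
  obtain ⟨n2, h2, r2⟩ := hc ρ v v' b hb h
  obtain ⟨n3, h3, r3⟩ := exists_run_clearAll (v := v') (l := List.finRange 32) hb
  rw [show (fun i => if i ∈ List.finRange 32 then 0 else ρ i) = 0 by funext i; simp] at r3
  refine ⟨_, ?_, .seq r1 (.seq r2 r3)⟩
  rw [List.length_finRange] at h1 h3
  rw [add_mul]
  omega

theorem run_bind_ruleProg {p : Prog (List Act)} {v : VState} {τ : Stacks Cell} {n : ℕ}
    (h : SRun (p.bind ruleProg) (encState 0 v) n τ) :
    ∃ n' v', Run (ruleSem fun _ => True) p v n' v' ∧ τ = encState 0 v' :=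
  Run.of_bind (sem := ruleSem fun _ => True) (enc := encState 0)
    (fun _ _ _ _ h => run_ruleProg h) p v n τ h

theorem exists_run_bind_ruleProg (p : Prog (List Act)) : ∃ c, ∀ (v v' : VState) (b n : ℕ),
    Run (ruleSem fun x => x.bits.length ≤ b) p v n v' →
    ∃ n' ≤ c * (b + 1) * n, SRun (p.bind ruleProg) (encState 0 v) n' (encState 0 v') := by
  induction p with
  | ins i =>
    obtain ⟨c, hc⟩ := exists_run_ruleProg i
    refine ⟨c, fun v v' b n h => ?_⟩
    obtain ⟨rfl, h'⟩ := run_ins_iff.1 h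
    rw [mul_one]
    exact hc v v' b h'
  | seq p q ihp ihq =>
    obtain ⟨c, hc⟩ := ihp
    obtain ⟨d, hd⟩ := ihq
    refine ⟨c + d, fun v v' b n h => ?_⟩
    obtain ⟨n1, n2, w, rfl, h1, h2⟩ := run_seq_iff.1 h
    obtain ⟨t1, l1, r1⟩ := hc _ _ _ _ h1
    obtain ⟨t2, l2, r2⟩ := hd _ _ _ _ h2
    exact ⟨_, by nlinarith [Nat.zero_le (c * (b + 1) * n2), Nat.zero_le (d * (b + 1) * n1)],
      .seq r1 r2⟩
  | alt p q ihp ihq =>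
    obtain ⟨c, hc⟩ := ihp
    obtain ⟨d, hd⟩ := ihq
    refine ⟨c + d + 1, fun v v' b n h => ?_⟩
    obtain ⟨n, rfl, h | h⟩ := run_alt_iff.1 h
    · obtain ⟨t, l, r⟩ := hc _ _ _ _ h
      exact ⟨_, by nlinarith [Nat.zero_le (c * (b + 1)), Nat.zero_le (d * (b + 1) * n),
        Nat.zero_le (d * (b + 1)), Nat.zero_le ((b + 1) * n)], .altl r⟩
    · obtain ⟨t, l, r⟩ := hd _ _ _ _ h
      exact ⟨_, by nlinarith [Nat.zero_le (c * (b + 1)), Nat.zero_le (c * (b + 1) * n),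
        Nat.zero_le (d * (b + 1)), Nat.zero_le ((b + 1) * n)], .altr r⟩
  | star p ih =>
    obtain ⟨c, hc⟩ := ih
    refine ⟨c + 1, fun v v' b n h => ?_⟩
    generalize hr : Prog.star p = r at h
    induction h with
    | done => exact ⟨1, by nlinarith [Nat.zero_le (c * (b + 1))], .done⟩
    | @more _ _ _ _ n1 n2 h1 _ _ ih2 =>
      cases hr
      obtain ⟨t1, l1, r1⟩ := hc _ _ _ _ h1
      obtain ⟨t2, l2, r2⟩ := ih2 rfl
      exact ⟨_, by nlinarith [Nat.zero_le (c * (b + 1)), Nat.zero_le ((b + 1) * n1)],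
        .more r1 r2⟩
    | _ => cases hr

end Prog

/-! ### Checking that required facts are provided -/

namespace Prog

/-- `Iter r n a b`: `n` steps of the relation `r` lead from `a` to `b`. -/
inductive Iter {σ : Type} (r : σ → σ → Prop) : ℕ → σ → σ → Prop
  | zero {a} : Iter r 0 a a
  | succ {n a b c} : r a b → Iter r n b c → Iter r (n + 1) a c

theorem Iter.trans {σ : Type} {r : σ → σ → Prop} {a b c : σ} {m n : ℕ} (h₁ : Iter r m a b)
    (h2 : Iter r n b c) : Iter r (m + n) a c := by
  induction h₁ with
  | zero => simpa using h2
  | succ h _ ih =>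
    have := Iter.succ h (ih h2)
    rwa [show ∀ x : ℕ, x + 1 + n = x + n + 1 by intros; omega]

section

variable {I σ : Type} {sem : I → σ → σ → Prop}

/-- One of the instructions in a list. -/
def oneOf (i : I) (l : List I) : Prog I := alts (.ins i) (l.map .ins)

theorem run_star_oneOf {i : I} {l : List I} {P : σ → Prop} {s t : σ} {n : ℕ}
    (h : Run sem (.star (oneOf i l)) s n t) (h0 : P s)
    (hs : ∀ a b, P a → ∀ j ∈ i :: l, sem j a b → P b) : P t := by
  refine run_star_induction h h0 fun a m b ha hab => ?_
  obtain ⟨q, hq, m, hr⟩ := run_alts hab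
  rw [← List.map_cons (f := Prog.ins)] at hq
  obtain ⟨j, hj, rfl⟩ := List.mem_map.1 hq
  exact hs a b ha j hj (run_ins_iff.1 hr).2

theorem exists_run_star_oneOf {i : I} {l : List I} {s t : σ} {n : ℕ}
    (h : Iter (fun a b => ∃ j ∈ i :: l, sem j a b) n s t) :
    ∃ m ≤ n * (l.length + 2) + 1, Run sem (.star (oneOf i l)) s m t := by
  induction h with
  | zero => exact ⟨1, by omega, .done⟩
  | succ h _ ih =>
    obtain ⟨j, hj, h⟩ := h
    obtain ⟨m, hm, r⟩ := ih
    have hq : Prog.ins j ∈ Prog.ins i :: l.map Prog.ins := by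
      rw [← List.map_cons (f := Prog.ins)]; exact List.mem_map_of_mem hj
    obtain ⟨k, hk, r'⟩ := exists_run_alts hq (.ins h)
    refine ⟨_, ?_, .more r' r⟩
    rw [List.length_map] at hk
    rw [add_mul]
    omega

end

/-- A rule: under conditions on the registers it provides some facts and requires some facts. -/
structure FRule where
  adds : List (Reg × Reg × Reg)
  csts : List (Reg × ℕ)
  prov : List (Reg × Reg × Reg × Reg)
  req : List (Reg × Reg × Reg × Reg)

/-- Instance of a fact. -/
def instRec (ρ : Reg → ℕ) (q : Reg × Reg × Reg × Reg) : Rec := (ρ q.1, ρ q.2.1, ρ q.2.2.1, ρ q.2.2.2)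

namespace FRule

/-- The conditions of a rule. -/
def Holds (r : FRule) (ρ : Reg → ℕ) : Prop :=
  (∀ x ∈ r.adds, ρ x.1 + ρ x.2.1 = ρ x.2.2) ∧ ∀ x ∈ r.csts, ρ x.1 = x.2

/-- The actions by which a rule is applied. -/
def acts (r : FRule) : List Act :=
  (r.adds.map fun x => .add x.1 x.2.1 x.2.2) ++ ((r.csts.map fun x => .cst x.1 x.2) ++
    ((r.prov.map fun q => .push 0 q.1 q.2.1 q.2.2.1 q.2.2.2) ++
      r.req.map fun q => .push 1 q.1 q.2.1 q.2.2.1 q.2.2.2))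

theorem actsSem_adds {ρ : Reg → ℕ} {v v' : VState} : ∀ {l : List (Reg × Reg × Reg)},
    actsSem ρ (l.map fun x => .add x.1 x.2.1 x.2.2) v v' ↔
      (∀ x ∈ l, ρ x.1 + ρ x.2.1 = ρ x.2.2) ∧ v' = v
  | [] => by simp [actsSem]
  | x :: l => by
    simp only [List.map_cons, actsSem, Act.sem, actsSem_adds (l := l), List.forall_mem_cons]
    constructor
    · rintro ⟨w, ⟨h, rfl⟩, h', rfl⟩; exact ⟨⟨h, h'⟩, rfl⟩
    · rintro ⟨⟨h, h'⟩, rfl⟩; exact ⟨_, ⟨h, rfl⟩, h', rfl⟩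

theorem actsSem_csts {ρ : Reg → ℕ} {v v' : VState} : ∀ {l : List (Reg × ℕ)},
    actsSem ρ (l.map fun x => .cst x.1 x.2) v v' ↔ (∀ x ∈ l, ρ x.1 = x.2) ∧ v' = v
  | [] => by simp [actsSem]
  | x :: l => by
    simp only [List.map_cons, actsSem, Act.sem, actsSem_csts (l := l), List.forall_mem_cons]
    constructor
    · rintro ⟨w, ⟨h, rfl⟩, h', rfl⟩; exact ⟨⟨h, h'⟩, rfl⟩
    · rintro ⟨⟨h, h'⟩, rfl⟩; exact ⟨_, ⟨h, rfl⟩, h', rfl⟩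

theorem actsSem_pushes {ρ : Reg → ℕ} {s : Fin 5} : ∀ {l : List (Reg × Reg × Reg × Reg)}
    {v v' : VState}, actsSem ρ (l.map fun q => .push s q.1 q.2.1 q.2.2.1 q.2.2.2) v v' ↔
      v' = ⟨v.inp, update v.stk s ((l.map (instRec ρ)).reverse ++ v.stk s)⟩
  | [], v, v' => by simp [actsSem]
  | x :: l, v, v' => by
    simp only [List.map_cons, actsSem, Act.sem, actsSem_pushes (l := l)]
    simp [instRec]

/-- The facts provided by an instance of a rule. -/
def provs (x : FRule × (Reg → ℕ)) : List Rec := (x.1.prov.map (instRec x.2)).reverse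

/-- The facts required by an instance of a rule. -/
def reqs (x : FRule × (Reg → ℕ)) : List Rec := (x.1.req.map (instRec x.2)).reverse

theorem actsSem_acts {r : FRule} {ρ : Reg → ℕ} {v v' : VState} : actsSem ρ r.acts v v' ↔
    r.Holds ρ ∧ v' = ⟨v.inp, update (update v.stk 0
      (provs (r, ρ) ++ v.stk 0)) 1 (reqs (r, ρ) ++ v.stk 1)⟩ := by
  simp only [acts, actsSem_append, actsSem_adds, actsSem_csts, actsSem_pushes, Holds]
  constructor
  · rintro ⟨_, ⟨h, rfl⟩, _, ⟨h', rfl⟩, _, rfl, rfl⟩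
    exact ⟨⟨h, h'⟩, by simp [provs, reqs]⟩
  · rintro ⟨⟨h, h'⟩, rfl⟩
    exact ⟨_, ⟨h, rfl⟩, _, ⟨h', rfl⟩, _, rfl, by simp [provs, reqs]⟩

end FRule

/-- Move the top record from a stack to another one. -/
def moveAct (s t : Fin 5) : List Act := [.pop s 0 1 2 3, .push t 0 1 2 3]

/-- Provide the next fact in the enumeration of a sequence. -/
def enumAct : List Act :=
  [.pop 4 0 1 1 1, .cst 1 0, .cst 2 1, .add 0 2 3, .push 4 3 1 1 1, .cst 4 3, .push 0 4 0 5 1]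

/-- Discharge a required fact. -/
def matchAct : List Act := [.pop 1 0 1 2 3, .pop 0 0 1 2 3, .push 0 0 1 2 3]

/-- Read the four numbers that describe an edge and apply a rule. -/
def edgeAct (r : FRule) : List Act := .read 0 :: .read 1 :: .read 2 :: .read 3 :: r.acts

/-- Read the number of vertices and apply a rule. -/
def initAct (r : FRule) : List Act := .read 0 :: .cst 31 0 :: .push 4 31 31 31 31 :: r.acts

/-- The actions of the main loop of a checker. -/
def loopActs (rules : List FRule) : List (List Act) :=
  enumAct :: matchAct :: [.pop 0 0 1 2 3] :: moveAct 1 2 :: moveAct 1 3 :: moveAct 2 1 ::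
    moveAct 3 1 :: rules.map FRule.acts

/-- A program that checks the existence of instances of rules such that all required facts are
provided. -/
def checker (init edge : FRule) (rules : List FRule) : Prog (List Act) :=
  .seq (.ins (initAct init)) (.seq (.star (oneOf (edgeAct edge) (loopActs rules)))
    (.ins [.eof, .emp 1, .emp 2, .emp 3]))

/-- The enumeration of a sequence. -/
def enumFacts (W : List ℕ) : List Rec := W.zipIdx.map fun x => (3, x.2, x.1, 0)

/-- The facts provided by some instances of rules and an enumerated sequence. -/
def facts (I : List (FRule × (Reg → ℕ))) (W : List ℕ) : List Rec :=
  I.flatMap FRule.provs ++ enumFacts W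

/-- All instances of rules in a certificate. -/
def allInst (init edge : FRule) (ρ0 : Reg → ℕ) (E : List (Reg → ℕ))
    (I : List (FRule × (Reg → ℕ))) : List (FRule × (Reg → ℕ)) :=
  (init, ρ0) :: (E.map (Prod.mk edge) ++ I)

/-- The condition that instances of rules and a sequence make up a certificate for an input. -/
structure Cert (init edge : FRule) (rules : List FRule) (inp : List ℕ) (ρ0 : Reg → ℕ)
    (E : List (Reg → ℕ)) (I : List (FRule × (Reg → ℕ))) (W : List ℕ) : Prop where
  holds_init : init.Holds ρ0
  holds_edge : ∀ ρ ∈ E, edge.Holds ρ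
  holds_rule : ∀ x ∈ I, x.1 ∈ rules ∧ x.1.Holds x.2
  inp_eq : inp = ρ0 0 :: E.flatMap fun ρ => [ρ 0, ρ 1, ρ 2, ρ 3]
  sub : ∀ x ∈ allInst init edge ρ0 E I, ∀ f ∈ FRule.reqs x, f ∈ facts (allInst init edge ρ0 E I) W

theorem enumFacts_append (W : List ℕ) (w : ℕ) :
    enumFacts (W ++ [w]) = enumFacts W ++ [(3, W.length, w, 0)] := by
  simp [enumFacts, List.zipIdx_append]

/-- Invariant of the main loop of a checker. -/
structure Inv (init edge : FRule) (rules : List FRule) (inp : List ℕ) (ρ0 : Reg → ℕ)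
    (E : List (Reg → ℕ)) (I : List (FRule × (Reg → ℕ))) (W : List ℕ) (v : VState) : Prop where
  holds_edge : ∀ ρ ∈ E, edge.Holds ρ
  holds_rule : ∀ x ∈ I, x.1 ∈ rules ∧ x.1.Holds x.2
  inp_eq : inp = ρ0 0 :: (E.flatMap fun ρ => [ρ 0, ρ 1, ρ 2, ρ 3]) ++ v.inp
  prov : ∀ f ∈ v.stk 0, f ∈ facts (allInst init edge ρ0 E I) W
  req : ∀ x ∈ allInst init edge ρ0 E I, ∀ f ∈ FRule.reqs x, f ∈ v.stk 1 ∨ f ∈ v.stk 2 ∨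
    f ∈ v.stk 3 ∨ f ∈ facts (allInst init edge ρ0 E I) W
  count : v.stk 4 = [(W.length, 0, 0, 0)]

theorem mem_facts {I : List (FRule × (Reg → ℕ))} {W : List ℕ} {f : Rec} :
    f ∈ facts I W ↔ (∃ x ∈ I, f ∈ FRule.provs x) ∨ f ∈ enumFacts W := by
  simp [facts]

section

variable {init edge : FRule} {rules : List FRule} {inp : List ℕ} {ρ0 : Reg → ℕ}
    {E : List (Reg → ℕ)} {I : List (FRule × (Reg → ℕ))} {W : List ℕ} {v : VState}

theorem mem_allInst {x : FRule × (Reg → ℕ)} : x ∈ allInst init edge ρ0 E I ↔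
    x = (init, ρ0) ∨ (∃ ρ ∈ E, x = (edge, ρ)) ∨ x ∈ I := by
  simp [allInst, eq_comm]

/-- Soundness does not depend on the order of records: a required record may wander among the stacks
1, 2 and 3, and it may vanish only if it occurs on stack 0, which holds nothing but provided
records. -/
theorem Inv.of_moves (h : Inv init edge rules inp ρ0 E I W v) {w : VState} (hi : w.inp = v.inp)
    (h0 : ∀ f ∈ w.stk 0, f ∈ v.stk 0)
    (h1 : ∀ f, f ∈ v.stk 1 ∨ f ∈ v.stk 2 ∨ f ∈ v.stk 3 → f ∈ w.stk 1 ∨ f ∈ w.stk 2 ∨ f ∈ w.stk 3 ∨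
      f ∈ v.stk 0)
    (h4 : w.stk 4 = v.stk 4) : Inv init edge rules inp ρ0 E I W w := by
  refine ⟨h.holds_edge, h.holds_rule, by rw [hi]; exact h.inp_eq, fun f hf => h.prov f (h0 f hf), ?_,
    by rw [h4]; exact h.count⟩
  intro x hx f hf
  have key : f ∈ v.stk 1 ∨ f ∈ v.stk 2 ∨ f ∈ v.stk 3 → f ∈ w.stk 1 ∨ f ∈ w.stk 2 ∨
      f ∈ w.stk 3 ∨ f ∈ facts (allInst init edge ρ0 E I) W := fun H => by
    rcases h1 f H with h' | h' | h' | h'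
    exacts [.inl h', .inr (.inl h'), .inr (.inr (.inl h')), .inr (.inr (.inr (h.prov f h')))]
  rcases h.req x hx f hf with h' | h' | h' | h'
  exacts [key (.inl h'), key (.inr (.inl h')), key (.inr (.inr h')), .inr (.inr (.inr h'))]

theorem Inv.step (h : Inv init edge rules inp ρ0 E I W v) {w : VState} {l : List Act}
    (hl : l ∈ edgeAct edge :: loopActs rules) (hw : ruleSem (fun _ => True) l v w) :
    ∃ E' I' W', Inv init edge rules inp ρ0 E' I' W' w := by
  obtain ⟨ρ, -, hw⟩ := hw
  rw [List.mem_cons] at hl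
  rcases hl with rfl | hl
  · obtain ⟨_, ⟨u1, e1, rfl⟩, _, ⟨u2, e2, rfl⟩, _, ⟨u3, e3, rfl⟩, _, ⟨u4, e4, rfl⟩, hw⟩ := hw
    simp only at e2 e3 e4
    subst e2 e3 e4
    obtain ⟨hρ, rfl⟩ := FRule.actsSem_acts.1 hw
    have hmem : ∀ x, x ∈ allInst init edge ρ0 (E ++ [ρ]) I ↔
        x ∈ allInst init edge ρ0 E I ∨ x = (edge, ρ) := fun x => by
      simp only [mem_allInst, List.mem_append, List.mem_singleton]
      constructor
      · rintro (h | ⟨a, h | h, rfl⟩ | h)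
        exacts [.inl (.inl h), .inl (.inr (.inl ⟨a, h, rfl⟩)), .inr (by rw [h]),
          .inl (.inr (.inr h))]
      · rintro ((h | ⟨a, h, rfl⟩ | h) | h)
        exacts [.inl h, .inr (.inl ⟨a, .inl h, rfl⟩), .inr (.inr h), .inr (.inl ⟨ρ, .inr rfl, h⟩)]
    -- The collection of provided records only grows, so records accounted for earlier stay so.
    have hf : ∀ f ∈ facts (allInst init edge ρ0 E I) W,
        f ∈ facts (allInst init edge ρ0 (E ++ [ρ]) I) W := fun f hf => by
      rw [mem_facts] at hf ⊢
      rcases hf with ⟨x, hx, hf⟩ | hf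
      exacts [.inl ⟨x, (hmem x).2 (.inl hx), hf⟩, .inr hf]
    refine ⟨E ++ [ρ], I, W, ?_, h.holds_rule, ?_, ?_, ?_, ?_⟩
    · intro a ha
      rcases List.mem_append.1 ha with ha | ha
      · exact h.holds_edge a ha
      · rw [List.mem_singleton] at ha; rwa [ha]
    · rw [h.inp_eq, e1]; simp
    · intro f hf'
      simp only [Function.update_apply, Fin.isValue, zero_ne_one, if_false, if_true,
        List.mem_append] at hf'
      rcases hf' with hf' | hf'
      · exact mem_facts.2 (.inl ⟨_, (hmem _).2 (.inr rfl), hf'⟩)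
      · exact hf f (h.prov f hf')
    · intro x hx f hfx
      rcases (hmem x).1 hx with hx | rfl
      · rcases h.req x hx f hfx with h' | h' | h' | h'
        · exact .inl (by simp [h'])
        · exact .inr (.inl (by simpa using h'))
        · exact .inr (.inr (.inl (by simpa using h')))
        · exact .inr (.inr (.inr (hf f h')))
      · exact .inl (by simp [hfx])
    · simpa using h.count
  simp only [loopActs, List.mem_cons] at hl
  rcases hl with rfl | rfl | rfl | rfl | rfl | rfl | rfl | hl
  -- The counter on stack 4 forces the indices to appear once each and in order. This is what makes
  -- the records `(3, j, x, 0)` the graph of a function, although the values `x` are guessed.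
  · obtain ⟨_, ⟨u, e1, rfl⟩, _, ⟨e2, rfl⟩, _, ⟨e3, rfl⟩, _, ⟨e4, rfl⟩, _, rfl, _, ⟨e5, rfl⟩,
      _, rfl, rfl⟩ := hw
    rw [h.count] at e1
    simp only [e2, e3, e5, List.cons.injEq, Prod.mk.injEq, and_true] at e1 e4 ⊢
    obtain ⟨e1, rfl⟩ := e1
    have hf : ∀ f, f ∈ facts (allInst init edge ρ0 E I) (W ++ [ρ 5]) ↔
        f ∈ facts (allInst init edge ρ0 E I) W ∨ f = (3, W.length, ρ 5, 0) := fun f => by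
      simp only [mem_facts, enumFacts_append, List.mem_append, List.mem_singleton, or_assoc]
    refine ⟨E, I, W ++ [ρ 5], h.holds_edge, h.holds_rule, h.inp_eq, ?_, ?_, ?_⟩
    · intro f hf'
      simp only [Function.update_apply, Fin.isValue, if_true, List.mem_cons] at hf'
      rcases hf' with rfl | hf'
      · exact (hf _).2 (.inr (by rw [e1]))
      · exact (hf _).2 (.inl (h.prov f (by simpa using hf')))
    · intro x hx f hfx
      rcases h.req x hx f hfx with h' | h' | h' | h'
      · exact .inl (by simpa using h')
      · exact .inr (.inl (by simpa using h'))
      · exact .inr (.inr (.inl (by simpa using h')))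
      · exact .inr (.inr (.inr ((hf f).2 (.inl h'))))
    · simp [e1, e4.symm]
  · obtain ⟨_, ⟨u, e1, rfl⟩, _, ⟨u', e2, rfl⟩, _, rfl, rfl⟩ := hw
    simp only [Function.update_apply, Fin.isValue, zero_ne_one, if_false] at e2
    refine ⟨E, I, W, h.of_moves rfl ?_ ?_ (by simp)⟩
    · simp [e2]
    · intro f hf
      simp only [e1, List.mem_cons] at hf
      rcases hf with (rfl | hf) | hf | hf
      · exact .inr (.inr (.inr (by simp [e2])))
      · exact .inl (by simpa using hf)
      · exact .inr (.inl (by simpa using hf))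
      · exact .inr (.inr (.inl (by simpa using hf)))
  · obtain ⟨_, ⟨u, e1, rfl⟩, rfl⟩ := hw
    refine ⟨E, I, W, h.of_moves rfl ?_ ?_ (by simp)⟩
    · intro f hf
      rw [e1]
      exact List.mem_cons_of_mem _ (by simpa using hf)
    · intro f hf
      simp only [Function.update_apply, Fin.isValue]
      simpa using by tauto
  iterate 4
    · obtain ⟨_, ⟨u, e1, rfl⟩, _, rfl, rfl⟩ := hw
      refine ⟨E, I, W, h.of_moves rfl (by simp) ?_ (by simp)⟩
      intro f hf
      simp only [e1, List.mem_cons] at hf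
      simp
      tauto
  · obtain ⟨r, hr, rfl⟩ := List.mem_map.1 hl
    obtain ⟨hρ, rfl⟩ := FRule.actsSem_acts.1 hw
    have hmem : ∀ x, x ∈ allInst init edge ρ0 E (I ++ [(r, ρ)]) ↔
        x ∈ allInst init edge ρ0 E I ∨ x = (r, ρ) := fun x => by
      simp only [mem_allInst, List.mem_append, List.mem_singleton, or_assoc]
    have hf : ∀ f ∈ facts (allInst init edge ρ0 E I) W,
        f ∈ facts (allInst init edge ρ0 E (I ++ [(r, ρ)])) W := fun f hf => by
      rw [mem_facts] at hf ⊢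
      rcases hf with ⟨x, hx, hf⟩ | hf
      exacts [.inl ⟨x, (hmem x).2 (.inl hx), hf⟩, .inr hf]
    refine ⟨E, I ++ [(r, ρ)], W, h.holds_edge, ?_, h.inp_eq, ?_, ?_, ?_⟩
    · intro a ha
      rcases List.mem_append.1 ha with ha | ha
      · exact h.holds_rule a ha
      · rw [List.mem_singleton] at ha; rw [ha]; exact ⟨hr, hρ⟩
    · intro f hf'
      simp only [Function.update_apply, Fin.isValue, zero_ne_one, if_false, if_true,
        List.mem_append] at hf'
      rcases hf' with hf' | hf'
      · exact mem_facts.2 (.inl ⟨_, (hmem _).2 (.inr rfl), hf'⟩)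
      · exact hf f (h.prov f hf')
    · intro x hx f hfx
      rcases (hmem x).1 hx with hx | rfl
      · rcases h.req x hx f hfx with h' | h' | h' | h'
        · exact .inl (by simp [h'])
        · exact .inr (.inl (by simpa using h'))
        · exact .inr (.inr (.inl (by simpa using h')))
        · exact .inr (.inr (.inr (hf f h')))
      · exact .inl (by simp [hfx])
    · simpa using h.count

/-- At the end the stacks 1, 2 and 3 are empty, so the invariant leaves only one possibility for
each required record: it is provided. Stack 0 need not be empty. -/
theorem run_checker {v' : VState} {n : ℕ}
    (h : Run (ruleSem fun _ => True) (checker init edge rules) ⟨inp, fun _ => []⟩ n v') :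
    ∃ ρ0 E I W, Cert init edge rules inp ρ0 E I W := by
  obtain ⟨_, _, w, -, h₁, h⟩ := run_seq_iff.1 h
  obtain ⟨_, _, w', -, h2, h3⟩ := run_seq_iff.1 h
  obtain ⟨-, ρ0, -, _, ⟨u, e1, rfl⟩, _, ⟨e2, rfl⟩, _, rfl, h₁⟩ := run_ins_iff.1 h₁
  obtain ⟨hρ, rfl⟩ := FRule.actsSem_acts.1 h₁
  obtain ⟨E, I, W, hI⟩ := run_star_oneOf (P := fun w => ∃ E I W, Inv init edge rules inp ρ0 E I W w)
    h2 ⟨[], [], [], by simp, by simp, by simp at e1; simp [e1], by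
        intro f hf
        exact mem_facts.2 (.inl ⟨_, mem_allInst.2 (.inl rfl), by simpa using hf⟩), by
        intro x hx f hf
        simp only [mem_allInst, List.not_mem_nil, false_and, exists_false, or_false] at hx
        subst hx
        exact .inl (by simp [hf]), by simp [e2]⟩
    (fun a b ⟨E, I, W, ha⟩ j hj hab => ha.step hj hab)
  obtain ⟨-, _, -, _, ⟨f1, rfl⟩, _, ⟨f2, rfl⟩, _, ⟨f3, rfl⟩, _, ⟨f4, rfl⟩, -⟩ := run_ins_iff.1 h3
  refine ⟨ρ0, E, I, W, hρ, hI.holds_edge, hI.holds_rule, by rw [hI.inp_eq, f1]; simp, ?_⟩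
  intro x hx f hf
  simpa [f2, f3, f4] using hI.req x hx f hf

end

end Prog

/-! ### Completeness of the checker in quasilinear time: radix sort and merging -/

namespace Prog

theorem bits_length_le {n b : ℕ} : n.bits.length ≤ b ↔ n < 2 ^ b := by
  rw [← Nat.size_le, Nat.size_eq_bits_len]

theorem bits_length_mono {m n : ℕ} (h : m ≤ n) : m.bits.length ≤ n.bits.length := by
  rw [Nat.size_eq_bits_len, Nat.size_eq_bits_len]
  exact Nat.size_le_size h

/-- A bound on the length of all numbers in a record. -/
def RecLe (b : ℕ) (f : Rec) : Prop := f.1.bits.length ≤ b ∧ f.2.1.bits.length ≤ b ∧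
  f.2.2.1.bits.length ≤ b ∧ f.2.2.2.bits.length ≤ b

/-- The state of the register machine with given stacks. -/
def mkState (inp : List ℕ) (L R X Y Z : List Rec) : VState := ⟨inp, ![L, R, X, Y, Z]⟩

/-- Registers that hold a record. -/
def regs (f : Rec) (a b : ℕ) (i : Reg) : ℕ :=
  if i = 0 then f.1 else if i = 1 then f.2.1 else if i = 2 then f.2.2.1 else
    if i = 3 then f.2.2.2 else if i = 4 then a else if i = 5 then b else 0

theorem regs_le {f : Rec} {a c b : ℕ} (hf : RecLe b f) (ha : a.bits.length ≤ b)
    (hc : c.bits.length ≤ b) (i : Reg) : (regs f a c i).bits.length ≤ b := by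
  unfold regs
  split_ifs
  exacts [hf.1, hf.2.1, hf.2.2.1, hf.2.2.2, ha, hc, by simp]

/-- One step of the main loop of a checker, with numbers of bounded length. -/
def LoopStep (edge : FRule) (rules : List FRule) (b : ℕ) (v w : VState) : Prop :=
  ∃ l ∈ edgeAct edge :: loopActs rules, ruleSem (fun x => x.bits.length ≤ b) l v w

section

variable {edge : FRule} {rules : List FRule} {b : ℕ} {inp : List ℕ} {L R X Y Z : List Rec} {f : Rec}

theorem moveAct_sem {s t : Fin 5} (hf : RecLe b f) {v w : VState} {u : List Rec}
    (h : v.stk s = f :: u) (hst : s ≠ t) (hi : w.inp = v.inp)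
    (hw : ∀ i, w.stk i = Function.update (Function.update v.stk s u) t (f :: v.stk t) i) :
    ruleSem (fun x => x.bits.length ≤ b) (moveAct s t) v w := by
  refine ⟨regs f 0 0, regs_le hf (by simp) (by simp), _, ⟨u, h, rfl⟩, _, rfl, ?_⟩
  ext1
  · exact hi
  · funext i
    rw [hw]
    simp [regs, hst.symm]

theorem LoopStep.move₁₂ (hf : RecLe b f) :
    LoopStep edge rules b (mkState inp L (f :: R) X Y Z) (mkState inp L R (f :: X) Y Z) :=
  ⟨moveAct 1 2, by simp [loopActs], moveAct_sem hf rfl (by simp) rfl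
    fun i => by fin_cases i <;> rfl⟩

theorem LoopStep.move₁₃ (hf : RecLe b f) :
    LoopStep edge rules b (mkState inp L (f :: R) X Y Z) (mkState inp L R X (f :: Y) Z) :=
  ⟨moveAct 1 3, by simp [loopActs], moveAct_sem hf rfl (by simp) rfl
    fun i => by fin_cases i <;> rfl⟩

theorem LoopStep.move₂₁ (hf : RecLe b f) :
    LoopStep edge rules b (mkState inp L R (f :: X) Y Z) (mkState inp L (f :: R) X Y Z) :=
  ⟨moveAct 2 1, by simp [loopActs], moveAct_sem hf rfl (by simp) rfl
    fun i => by fin_cases i <;> rfl⟩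

theorem LoopStep.move₃₁ (hf : RecLe b f) :
    LoopStep edge rules b (mkState inp L R X (f :: Y) Z) (mkState inp L (f :: R) X Y Z) :=
  ⟨moveAct 3 1, by simp [loopActs], moveAct_sem hf rfl (by simp) rfl
    fun i => by fin_cases i <;> rfl⟩

theorem LoopStep.discharge (hf : RecLe b f) :
    LoopStep edge rules b (mkState inp (f :: L) (f :: R) X Y Z) (mkState inp (f :: L) R X Y Z) := by
  refine ⟨matchAct, by simp [loopActs], regs f 0 0, regs_le hf (by simp) (by simp), _, ⟨R, rfl, rfl⟩,
    _, ⟨L, rfl, rfl⟩, _, rfl, ?_⟩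
  exact VState.ext rfl (by funext i; fin_cases i <;> rfl)

theorem LoopStep.drop (hf : RecLe b f) :
    LoopStep edge rules b (mkState inp (f :: L) R X Y Z) (mkState inp L R X Y Z) := by
  refine ⟨[.pop 0 0 1 2 3], by simp [loopActs], regs f 0 0, regs_le hf (by simp) (by simp), _,
    ⟨L, rfl, rfl⟩, ?_⟩
  exact VState.ext rfl (by funext i; fin_cases i <;> rfl)

theorem LoopStep.enum {j w : ℕ} (hj : (j + 1).bits.length ≤ b) (hj' : j.bits.length ≤ b)
    (hw : w.bits.length ≤ b) (hb : 2 ≤ b) :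
    LoopStep edge rules b (mkState inp L R X Y [(j, 0, 0, 0)])
      (mkState inp ((3, j, w, 0) :: L) R X Y [(j + 1, 0, 0, 0)]) := by
  refine ⟨enumAct, by simp [loopActs], regs (j, 0, 1, j + 1) 3 w,
    regs_le ⟨hj', by simp, by simpa using by omega, hj⟩ (bits_length_le.2 (lt_of_lt_of_le (by norm_num)
      (Nat.pow_le_pow_right (by norm_num) hb))) hw,
    _, ⟨[], rfl, rfl⟩, _, ⟨rfl, rfl⟩, _, ⟨rfl, rfl⟩, _, ⟨rfl, rfl⟩, _, rfl, _, ⟨rfl, rfl⟩, _, rfl, ?_⟩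
  exact VState.ext rfl (by funext i; fin_cases i <;> rfl)

theorem LoopStep.rule {r : FRule} {ρ : Reg → ℕ} (hr : r ∈ rules) (h : r.Holds ρ)
    (hb : ∀ i, (ρ i).bits.length ≤ b) : LoopStep edge rules b (mkState inp L R X Y Z)
      (mkState inp (FRule.provs (r, ρ) ++ L) (FRule.reqs (r, ρ) ++ R) X Y Z) := by
  refine ⟨r.acts, ?_, ρ, hb, FRule.actsSem_acts.2 ⟨h, ?_⟩⟩
  · simp only [loopActs, List.mem_cons]
    iterate 8 right
    exact List.mem_map_of_mem hr
  · exact VState.ext rfl (by funext i; fin_cases i <;> rfl)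

theorem LoopStep.read {ρ : Reg → ℕ} (h : edge.Holds ρ) (hb : ∀ i, (ρ i).bits.length ≤ b) :
    LoopStep edge rules b (mkState (ρ 0 :: ρ 1 :: ρ 2 :: ρ 3 :: inp) L R X Y Z)
      (mkState inp (FRule.provs (edge, ρ) ++ L) (FRule.reqs (edge, ρ) ++ R) X Y Z) := by
  refine ⟨edgeAct edge, by simp, ρ, hb, _, ⟨_, rfl, rfl⟩, _, ⟨_, rfl, rfl⟩, _, ⟨_, rfl, rfl⟩, _,
    ⟨_, rfl, rfl⟩, FRule.actsSem_acts.2 ⟨h, ?_⟩⟩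
  exact VState.ext rfl (by funext i; fin_cases i <;> rfl)

/-! #### Applying instances -/

theorem iter_edges : ∀ {E : List (Reg → ℕ)} {L R : List Rec}, (∀ ρ ∈ E, edge.Holds ρ) →
    (∀ ρ ∈ E, ∀ i, (ρ i).bits.length ≤ b) → Iter (LoopStep edge rules b) E.length
    (mkState (E.flatMap fun ρ => [ρ 0, ρ 1, ρ 2, ρ 3]) L R X Y Z)
    (mkState [] ((E.map (Prod.mk edge)).reverse.flatMap FRule.provs ++ L)
      ((E.map (Prod.mk edge)).reverse.flatMap FRule.reqs ++ R) X Y Z)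
  | [], L, R, _, _ => .zero
  | ρ :: E, L, R, h, hb => by
    rw [List.forall_mem_cons] at h hb
    have := iter_edges (L := FRule.provs (edge, ρ) ++ L) (R := FRule.reqs (edge, ρ) ++ R) h.2 hb.2
    change Iter _ (E.length + 1) (mkState (ρ 0 :: ρ 1 :: ρ 2 :: ρ 3 ::
      E.flatMap fun ρ => [ρ 0, ρ 1, ρ 2, ρ 3]) L R X Y Z) _
    refine .succ (.read h.1 hb.1) ?_
    simpa using this

theorem iter_rules : ∀ {I : List (FRule × (Reg → ℕ))} {L R : List Rec},
    (∀ x ∈ I, x.1 ∈ rules ∧ x.1.Holds x.2) → (∀ x ∈ I, ∀ i, (x.2 i).bits.length ≤ b) →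
    Iter (LoopStep edge rules b) I.length (mkState inp L R X Y Z)
    (mkState inp (I.reverse.flatMap FRule.provs ++ L) (I.reverse.flatMap FRule.reqs ++ R) X Y Z)
  | [], L, R, _, _ => .zero
  | x :: I, L, R, h, hb => by
    rw [List.forall_mem_cons] at h hb
    have := iter_rules (L := FRule.provs x ++ L) (R := FRule.reqs x ++ R) h.2 hb.2
    refine .succ (.rule h.1.1 h.1.2 hb.1) ?_
    simpa using this

theorem iter_enum (hb : 2 ≤ b) : ∀ {W : List ℕ} {L : List Rec} {j : ℕ},
    (j + W.length).bits.length ≤ b → (∀ w ∈ W, w.bits.length ≤ b) →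
    Iter (LoopStep edge rules b) W.length (mkState inp L R X Y [(j, 0, 0, 0)])
      (mkState inp (((W.zipIdx j).map fun x => (3, x.2, x.1, 0)).reverse ++ L) R X Y
        [(j + W.length, 0, 0, 0)])
  | [], L, j, _, _ => .zero
  | w :: W, L, j, h, hW => by
    rw [List.forall_mem_cons] at hW
    rw [List.length_cons] at h
    have := iter_enum hb (W := W) (L := (3, j, w, 0) :: L) (j := j + 1)
      (by rwa [show j + 1 + W.length = j + (W.length + 1) by omega]) hW.2
    refine .succ (.enum ((bits_length_mono (by omega)).trans h) ((bits_length_mono (by omega)).trans h)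
      hW.1 hb) ?_
    rw [List.length_cons, show j + (W.length + 1) = j + 1 + W.length by omega]
    simpa using this

/-! #### Sorting and matching -/

theorem iter_unshuffle (p : Rec × ℕ → Bool) : ∀ {P : List (Rec × ℕ)} {X Y : List Rec},
    (∀ x ∈ P, RecLe b x.1) → Iter (LoopStep edge rules b) P.length
      (mkState inp L (P.map Prod.fst) X Y Z)
      (mkState inp L [] (((P.filter p).map Prod.fst).reverse ++ X)
        (((P.filter fun x => !p x).map Prod.fst).reverse ++ Y) Z)
  | [], X, Y, _ => .zero
  | x :: P, X, Y, h => by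
    rw [List.forall_mem_cons] at h
    by_cases hp : p x
    · have := iter_unshuffle p (P := P) (X := x.1 :: X) (Y := Y) h.2
      refine .succ (.move₁₂ h.1) ?_
      simpa [hp] using this
    · have := iter_unshuffle p (P := P) (X := X) (Y := x.1 :: Y) h.2
      refine .succ (.move₁₃ h.1) ?_
      simpa [hp] using this

theorem iter_gather₂ : ∀ {X R : List Rec}, (∀ f ∈ X, RecLe b f) →
    Iter (LoopStep edge rules b) X.length (mkState inp L R X Y Z)
      (mkState inp L (X.reverse ++ R) [] Y Z)
  | [], R, _ => .zero
  | f :: X, R, h => by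
    rw [List.forall_mem_cons] at h
    have := iter_gather₂ (X := X) (R := f :: R) h.2
    refine .succ (.move₂₁ h.1) ?_
    simpa using this

theorem iter_gather₃ : ∀ {Y R : List Rec}, (∀ f ∈ Y, RecLe b f) →
    Iter (LoopStep edge rules b) Y.length (mkState inp L R X Y Z)
      (mkState inp L (Y.reverse ++ R) X [] Z)
  | [], R, _ => .zero
  | f :: Y, R, h => by
    rw [List.forall_mem_cons] at h
    have := iter_gather₃ (Y := Y) (R := f :: R) h.2
    refine .succ (.move₃₁ h.1) ?_
    simpa using this

/-- Distributing stack 1 over the stacks 2 and 3 reverses each class, and gathering the classes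
reverses them again. The partition is therefore stable, and each record is moved twice. -/
theorem iter_partition (p : Rec × ℕ → Bool) {P : List (Rec × ℕ)} (h : ∀ x ∈ P, RecLe b x.1) :
    Iter (LoopStep edge rules b) (2 * P.length) (mkState inp L (P.map Prod.fst) [] [] Z)
      (mkState inp L ((P.filter p ++ P.filter fun x => !p x).map Prod.fst) [] [] Z) := by
  have h1 := iter_unshuffle (edge := edge) (rules := rules) (inp := inp) (L := L) (Z := Z) p
    (X := []) (Y := []) h
  have h₂ := iter_gather₃ (edge := edge) (rules := rules) (b := b) (inp := inp) (L := L) (Z := Z)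
    (R := [])
    (X := ((P.filter p).map Prod.fst).reverse)
    (Y := ((P.filter fun x => !p x).map Prod.fst).reverse) (by
      intro f hf
      simp only [List.mem_reverse, List.mem_map, List.mem_filter] at hf
      obtain ⟨x, ⟨hx, -⟩, rfl⟩ := hf
      exact h x hx)
  have h3 := iter_gather₂ (edge := edge) (rules := rules) (b := b) (inp := inp) (L := L) (Z := Z)
    (R := (P.filter fun x => !p x).map Prod.fst) (Y := [])
    (X := ((P.filter p).map Prod.fst).reverse) (by
      intro f hf
      simp only [List.mem_reverse, List.mem_map, List.mem_filter] at hf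
      obtain ⟨x, ⟨hx, -⟩, rfl⟩ := hf
      exact h x hx)
  simp only [List.append_nil, List.reverse_reverse, List.length_reverse, List.length_map] at h1 h₂ h3
  have := h1.trans (h₂.trans h3)
  have hl : ∀ P : List (Rec × ℕ), (P.filter fun x => !p x).length + (P.filter p).length = P.length := by
    intro P
    induction P with
    | nil => rfl
    | cons x P ih => by_cases hx : p x <;> simp [hx] <;> omega
  rw [hl] at this
  rw [two_mul]
  simpa using this

/-- Radix sort, starting with the least significant bit. The tags by which the records are sorted
exist only in the proof: the machine guesses to which stack each record goes. -/
theorem iter_radix {P : List (Rec × ℕ)} (h : ∀ x ∈ P, RecLe b x.1) (t : ℕ) :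
    ∃ P' : List (Rec × ℕ), P'.Perm P ∧ P'.Pairwise (fun x y => x.2 % 2 ^ t ≤ y.2 % 2 ^ t) ∧
      Iter (LoopStep edge rules b) (t * (2 * P.length)) (mkState inp L (P.map Prod.fst) [] [] Z)
        (mkState inp L (P'.map Prod.fst) [] [] Z) := by
  induction t with
  | zero =>
    refine ⟨P, .refl _, ?_, by simpa using .zero⟩
    simp only [pow_zero, Nat.mod_one, le_refl]
    exact List.pairwise_of_forall fun _ _ => trivial
  | succ t ih =>
    obtain ⟨P', hP, hs, hi⟩ := ih
    -- Records whose bit `t` is 0 come first; by stability each class remains sorted by the lower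
    -- bits.
    set p : Rec × ℕ → Bool := fun x => x.2 / 2 ^ t % 2 == 0 with hp
    refine ⟨_, (List.filter_append_perm p P').trans hP, ?_, ?_⟩
    · have key : ∀ x : ℕ, x % 2 ^ (t + 1) = x % 2 ^ t + 2 ^ t * (x / 2 ^ t % 2) := fun x => by
        rw [pow_succ, Nat.mod_mul]
      have h2 : ∀ x : ℕ, x % 2 ^ t < 2 ^ t := fun x => Nat.mod_lt _ (by positivity)
      have hz : ∀ x ∈ P'.filter p, x.2 / 2 ^ t % 2 = 0 := fun x hx => by
        simpa [hp] using (List.mem_filter.1 hx).2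
      have ho : ∀ x ∈ P'.filter (fun x => !p x), x.2 / 2 ^ t % 2 = 1 := fun x hx => by
        simpa [hp] using (List.mem_filter.1 hx).2
      rw [List.pairwise_append]
      refine ⟨(hs.filter _).imp_of_mem ?_, (hs.filter _).imp_of_mem ?_, ?_⟩
      · intro x y hx hy hxy
        rw [key, key, hz x hx, hz y hy]; omega
      · intro x y hx hy hxy
        rw [key, key, ho x hx, ho y hy]; omega
      · intro x hx y hy
        rw [key, key, hz x hx, ho y hy]
        have := h2 x.2
        omega
    · have := hi.trans (iter_partition (edge := edge) (rules := rules) (inp := inp) (L := L) (Z := Z)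
        p (P := P') (fun x hx => h x (hP.subset hx)))
      rwa [hP.length_eq, ← Nat.succ_mul] at this

/-- The tag of a required record is its position among the provided ones. When the tags are sorted,
one pass suffices: either the two tops agree and the required record is discharged, or the provided
record is no longer needed and is dropped. -/
theorem iter_match (hL : ∀ f ∈ L, RecLe b f) : ∀ (n i : ℕ) (P : List (Rec × ℕ)),
    (L.length - i) + P.length ≤ n → P.Pairwise (fun x y => x.2 ≤ y.2) →
    (∀ x ∈ P, i ≤ x.2 ∧ L[x.2]? = some x.1) → ∃ m ≤ n, ∃ L',
      Iter (LoopStep edge rules b) m (mkState inp (L.drop i) (P.map Prod.fst) X Y Z)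
        (mkState inp L' [] X Y Z)
  | n, i, [], _, _, _ => ⟨0, by omega, _, .zero⟩
  | n, i, x :: P, hn, hs, h => by
    rw [List.length_cons] at hn
    obtain ⟨n, rfl⟩ : ∃ n', n = n' + 1 := ⟨n - 1, by omega⟩
    have hx := h x (by simp)
    obtain ⟨hlt, hxL⟩ := List.getElem?_eq_some_iff.1 hx.2
    rcases hx.1.eq_or_lt with rfl | hlt'
    · obtain ⟨m, hm, L', hi⟩ := iter_match hL n x.2 P (by omega) (List.pairwise_cons.1 hs).2
        (fun y hy => ⟨(List.pairwise_cons.1 hs).1 y hy, (h y (by simp [hy])).2⟩)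
      refine ⟨m + 1, by omega, L', ?_⟩
      rw [List.drop_eq_getElem_cons hlt, hxL] at hi ⊢
      exact .succ (.discharge (hxL ▸ hL _ (List.getElem_mem hlt))) hi
    · obtain ⟨m, hm, L', hi⟩ := iter_match hL n (i + 1) (x :: P) (by simp; omega) hs
        (fun y hy => ⟨by
          rcases List.mem_cons.1 hy with rfl | hy
          · omega
          · have := (List.pairwise_cons.1 hs).1 y hy; omega, (h y hy).2⟩)
      refine ⟨m + 1, by omega, L', ?_⟩
      rw [List.drop_eq_getElem_cons (show i < L.length by omega)]
      exact .succ (.drop (hL _ (List.getElem_mem _))) hi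

/-- The tag is the first position of the record in `L`. A record required several times has one tag,
which does no harm since discharging leaves the provided record in place. -/
theorem iter_discharge (hL : ∀ f ∈ L, RecLe b f) (hR : ∀ f ∈ R, f ∈ L) {t : ℕ}
    (ht : L.length ≤ 2 ^ t) : ∃ m ≤ t * (2 * R.length) + (L.length + R.length), ∃ L',
      Iter (LoopStep edge rules b) m (mkState inp L R [] [] Z) (mkState inp L' [] [] [] Z) := by
  classical
  set P : List (Rec × ℕ) := R.map fun f => (f, L.idxOf f) with hP
  have hPR : P.map Prod.fst = R := by simp [hP, Function.comp_def]
  have hPL : P.length = R.length := by simp [hP]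
  have hm : ∀ x ∈ P, L[x.2]? = some x.1 := by
    intro x hx
    obtain ⟨f, hf, rfl⟩ := List.mem_map.1 hx
    exact List.getElem?_idxOf (hR f hf)
  have hlt : ∀ x ∈ P, x.2 < 2 ^ t := fun x hx =>
    lt_of_lt_of_le (List.getElem?_eq_some_iff.1 (hm x hx)).1 ht
  obtain ⟨P', hp, hs, hi⟩ := iter_radix (edge := edge) (rules := rules) (inp := inp) (L := L)
    (Z := Z) (P := P) (fun x hx => by
      obtain ⟨f, hf, rfl⟩ := List.mem_map.1 hx
      exact hL f (hR f hf)) t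
  obtain ⟨m, hm', L', hi'⟩ := iter_match (edge := edge) (rules := rules) (inp := inp) (X := [])
    (Y := []) (Z := Z) hL (L.length + R.length) 0 P' (by rw [hp.length_eq, hPL]; omega)
    (hs.imp_of_mem fun {x y} hx hy hxy => by
      rwa [Nat.mod_eq_of_lt (hlt x (hp.subset hx)), Nat.mod_eq_of_lt (hlt y (hp.subset hy))] at hxy)
    (fun x hx => ⟨Nat.zero_le _, hm x (hp.subset hx)⟩)
  rw [hPR, hPL] at hi
  rw [List.drop_zero] at hi'
  exact ⟨_, by omega, L', hi.trans hi'⟩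

end

theorem length_flatMap_le {α β : Type} {f : α → List β} {K : ℕ} {l : List α}
    (h : ∀ x ∈ l, (f x).length ≤ K) : (l.flatMap f).length ≤ K * l.length := by
  induction l with
  | nil => simp
  | cons x l ih =>
    rw [List.forall_mem_cons] at h
    have := ih h.2
    simp only [List.flatMap_cons, List.length_append, List.length_cons, mul_add]
    omega

theorem exists_run_checker (init edge : FRule) (rules : List FRule) : ∃ C : ℕ,
    ∀ (inp : List ℕ) (ρ0 : Reg → ℕ) (E : List (Reg → ℕ)) (I : List (FRule × (Reg → ℕ)))
      (W : List ℕ) (b N : ℕ), Cert init edge rules inp ρ0 E I W → ρ0 31 = 0 →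
      (∀ x ∈ allInst init edge ρ0 E I, ∀ i, (x.2 i).bits.length ≤ b) →
      (∀ w ∈ W, w.bits.length ≤ b) → W.length.bits.length ≤ b → 2 ≤ b →
      1 + E.length + I.length + W.length ≤ N →
      ∃ n ≤ C * (N * (N.size + 1)), ∃ v',
        Run (ruleSem fun x => x.bits.length ≤ b) (checker init edge rules) ⟨inp, fun _ => []⟩ n v' := by
  obtain ⟨K, hK⟩ : ∃ K, ∀ r ∈ init :: edge :: rules, r.prov.length ≤ K ∧ r.req.length ≤ K := by
    generalize init :: edge :: rules = l
    induction l with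
    | nil => exact ⟨0, by simp⟩
    | cons r l ih =>
      obtain ⟨K, hK⟩ := ih
      refine ⟨K + r.prov.length + r.req.length, ?_⟩
      rw [List.forall_mem_cons]
      exact ⟨by omega, fun s hs => by have := hK s hs; omega⟩
  -- The cost of one round of the main loop, including the choice of an action.
  obtain ⟨c, hc⟩ : ∃ c, c = (loopActs rules).length + 2 := ⟨_, rfl⟩
  refine ⟨c * (1 + 2 * K * ((K + 1).size + 1) + 2 * K + 1) + 3,
    fun inp ρ0 E I W b N h h31 hb hW hWb hb2 hN => ?_⟩
  have hinst : ∀ x ∈ allInst init edge ρ0 E I, (FRule.provs x).length ≤ K ∧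
      (FRule.reqs x).length ≤ K := by
    intro x hx
    simp only [FRule.provs, FRule.reqs, List.length_reverse, List.length_map]
    refine hK _ ?_
    rcases mem_allInst.1 hx with rfl | ⟨ρ, hρ, rfl⟩ | hx
    · simp
    · simp
    · simp [(h.holds_rule x hx).1]
  set J := I.reverse ++ ((E.map (Prod.mk edge)).reverse ++ [(init, ρ0)]) with hJ
  have hJm : ∀ x, x ∈ J ↔ x ∈ allInst init edge ρ0 E I := fun x => by
    simp only [hJ, allInst, List.mem_append, List.mem_reverse, List.mem_cons, List.not_mem_nil,
      or_false]
    tauto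
  have hJl : J.length + W.length ≤ N := by simp [hJ]; omega
  set L := (enumFacts W).reverse ++ J.flatMap FRule.provs with hL
  set R := J.flatMap FRule.reqs with hR
  have hlR : R.length ≤ K * N := (length_flatMap_le fun x hx => (hinst x ((hJm x).1 hx)).2).trans
    (Nat.mul_le_mul_left K (by omega))
  have hlL : L.length ≤ (K + 1) * N := by
    have h1 : (J.flatMap FRule.provs).length ≤ K * J.length :=
      length_flatMap_le fun x hx => (hinst x ((hJm x).1 hx)).1
    have h₂ : K * J.length ≤ K * N := Nat.mul_le_mul_left K (by omega)
    simp only [hL, List.length_append, List.length_reverse, enumFacts, List.length_map,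
      List.length_zipIdx]
    rw [add_mul]
    omega
  have hfacts : ∀ f, f ∈ L ↔ f ∈ facts (allInst init edge ρ0 E I) W := fun f => by
    simp only [hL, facts, List.mem_append, List.mem_reverse, List.mem_flatMap, hJm]
    exact or_comm
  have hRL : ∀ f ∈ R, f ∈ L := fun f hf => by
    obtain ⟨x, hx, hf⟩ := List.mem_flatMap.1 hf
    exact (hfacts f).2 (h.sub x ((hJm x).1 hx) f hf)
  have hLb : ∀ f ∈ L, RecLe b f := by
    intro f hf
    rcases mem_facts.1 ((hfacts f).1 hf) with ⟨x, hx, hf⟩ | hf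
    · simp only [FRule.provs, List.mem_reverse, List.mem_map] at hf
      obtain ⟨q, -, rfl⟩ := hf
      exact ⟨hb x hx _, hb x hx _, hb x hx _, hb x hx _⟩
    · simp only [enumFacts, List.mem_map] at hf
      obtain ⟨⟨w, j⟩, hx, rfl⟩ := hf
      obtain ⟨hj, hw⟩ := List.mem_zipIdx' hx
      exact ⟨bits_length_le.2 (lt_of_lt_of_le (by norm_num) (Nat.pow_le_pow_right (by norm_num) hb2)),
        (bits_length_mono hj.le).trans hWb, hw ▸ hW _ (List.getElem_mem hj), by simp⟩
  -- All positions have logarithmically many bits, which bounds the number of passes of the radix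
  -- sort.
  have ht : L.length ≤ 2 ^ ((K + 1).size + N.size) := by
    refine hlL.trans ?_
    rw [pow_add]
    exact Nat.mul_le_mul (Nat.lt_size_self _).le (Nat.lt_size_self _).le
  obtain ⟨m, hm, L', hi⟩ := iter_discharge (edge := edge) (rules := rules) (inp := [])
    (Z := [(0 + W.length, 0, 0, 0)]) hLb hRL ht
  have i1 := iter_edges (rules := rules) (X := []) (Y := []) (Z := [(0, 0, 0, 0)])
    (L := FRule.provs (init, ρ0)) (R := FRule.reqs (init, ρ0)) h.holds_edge (fun ρ hρ =>
      hb _ (mem_allInst.2 (.inr (.inl ⟨ρ, hρ, rfl⟩))))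
  have i2 := iter_rules (edge := edge) (b := b) (inp := []) (X := []) (Y := [])
    (Z := [(0, 0, 0, 0)])
    (L := (E.map (Prod.mk edge)).reverse.flatMap FRule.provs ++ FRule.provs (init, ρ0))
    (R := (E.map (Prod.mk edge)).reverse.flatMap FRule.reqs ++ FRule.reqs (init, ρ0))
    h.holds_rule (fun x hx => hb _ (mem_allInst.2 (.inr (.inr hx))))
  have i3 := iter_enum (edge := edge) (rules := rules) (inp := []) (R := R) (X := []) (Y := []) hb2
    (W := W) (j := 0) (L := J.flatMap FRule.provs) (by simpa using hWb) hW
  have hRe : I.reverse.flatMap FRule.reqs ++ ((E.map (Prod.mk edge)).reverse.flatMap FRule.reqs ++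
      FRule.reqs (init, ρ0)) = R := by simp [hR, hJ]
  have hLe : I.reverse.flatMap FRule.provs ++ ((E.map (Prod.mk edge)).reverse.flatMap FRule.provs ++
      FRule.provs (init, ρ0)) = J.flatMap FRule.provs := by simp [hJ]
  rw [hRe, hLe] at i2
  obtain ⟨n, hn, r⟩ := exists_run_star_oneOf (i1.trans (i2.trans (i3.trans hi)))
  have r0 : ruleSem (fun x => x.bits.length ≤ b) (initAct init) ⟨inp, fun _ => []⟩
      (mkState (E.flatMap fun ρ => [ρ 0, ρ 1, ρ 2, ρ 3]) (FRule.provs (init, ρ0))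
        (FRule.reqs (init, ρ0)) [] [] [(0, 0, 0, 0)]) := by
    refine ⟨ρ0, hb _ (mem_allInst.2 (.inl rfl)), _, ⟨_, h.inp_eq, rfl⟩, _, ⟨h31, rfl⟩, _, rfl,
      FRule.actsSem_acts.2 ⟨h.holds_init, VState.ext rfl ?_⟩⟩
    funext i
    rw [h31]
    fin_cases i <;> simp [mkState]
  have r1 : ruleSem (fun x => x.bits.length ≤ b) [.eof, .emp 1, .emp 2, .emp 3]
      (mkState [] L' [] [] [] [(0 + W.length, 0, 0, 0)])
      (mkState [] L' [] [] [] [(0 + W.length, 0, 0, 0)]) :=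
    ⟨0, by simp, _, ⟨rfl, rfl⟩, _, ⟨rfl, rfl⟩, _, ⟨rfl, rfl⟩, _, ⟨rfl, rfl⟩, rfl⟩
  refine ⟨_, ?_, _, .seq (.ins r0) (.seq r (.ins r1))⟩
  rw [← hc] at hn
  have hN1 : 1 ≤ N := by omega
  have hm' : E.length + (I.length + (W.length + m)) ≤
      (1 + 2 * K * ((K + 1).size + 1) + 2 * K + 1) * (N * (N.size + 1)) := by
    have h1 : ((K + 1).size + N.size) * (2 * R.length) ≤ 2 * K * ((K + 1).size + 1) *
        (N * (N.size + 1)) := by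
      calc _ ≤ ((K + 1).size + N.size) * (2 * (K * N)) := by gcongr
        _ ≤ (((K + 1).size + 1) * (N.size + 1)) * (2 * (K * N)) := by
          gcongr
          nlinarith [Nat.zero_le ((K + 1).size * N.size)]
        _ = _ := by ring
    have h₂ : N ≤ N * (N.size + 1) := Nat.le_mul_of_pos_right _ (by omega)
    have h3 : (K + 1) * N + K * N ≤ (2 * K + 1) * (N * (N.size + 1)) := by
      calc _ = (2 * K + 1) * N := by ring
        _ ≤ _ := by gcongr
    have e : (1 + 2 * K * ((K + 1).size + 1) + 2 * K + 1) * (N * (N.size + 1)) =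
      N * (N.size + 1) + 2 * K * ((K + 1).size + 1) * (N * (N.size + 1)) +
        (2 * K + 1) * (N * (N.size + 1)) := by ring
    omega
  have h3 : 1 ≤ N * (N.size + 1) := by nlinarith
  have h4 := Nat.mul_le_mul_right c hm'
  have e : (c * (1 + 2 * K * ((K + 1).size + 1) + 2 * K + 1) + 3) * (N * (N.size + 1)) =
    (1 + 2 * K * ((K + 1).size + 1) + 2 * K + 1) * (N * (N.size + 1)) * c +
      3 * (N * (N.size + 1)) := by ring
  rw [e]
  omega

end Prog

/-! ### Time bounds -/

namespace Prog

section Bounded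

variable {I σ : Type} {sem : I → σ → σ → Prop} {p q : Prog I} {s : σ} {B B' : ℕ}

theorem Bounded.seq (hp : Bounded sem p s B) (hq : ∀ n s', Run sem p s n s' → Bounded sem q s' B') :
    Bounded sem (.seq p q) s (B + B') := by
  constructor
  · intro n h
    cases h with
    | zero => omega
    | seql h => have := hp.1 _ h; omega
    | seqr h1 h2 => have := hp.2 _ _ h1; have := (hq _ _ h1).1 _ h2; omega
  · intro n s' h
    obtain ⟨a, b, s1, rfl, h1, h2⟩ := run_seq_iff.1 h
    have := hp.2 _ _ h1; have := (hq _ _ h1).2 _ _ h2; omega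

theorem Bounded.mono (hp : Bounded sem p s B) (h : B ≤ B') : Bounded sem p s B' :=
  ⟨fun n hn => (hp.1 n hn).trans h, fun n s' hn => (hp.2 n s' hn).trans h⟩

/-- The potential `Φ` pays for the running time of `p`, up to the constant `a`. -/
def Pot (sem : I → σ → σ → Prop) (Φ : σ → ℤ) (p : Prog I) (a : ℤ) : Prop :=
  (∀ s n s', Run sem p s n s' → n + Φ s' ≤ Φ s + a) ∧ ∃ b : ℕ, ∀ s n, Part sem p s n → n ≤ Φ s + b

variable {Φ : σ → ℤ} {a a' : ℤ}

theorem Pot.ins (hΦ : ∀ s, 0 ≤ Φ s) {i : I} (h : ∀ s s', sem i s s' → 1 + Φ s' ≤ Φ s + a) :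
    Pot sem Φ (.ins i) a := by
  refine ⟨fun s n s' h' => ?_, 0, fun s n h' => ?_⟩
  · obtain ⟨rfl, h''⟩ := run_ins_iff.1 h'
    exact_mod_cast h s s' h''
  · cases h' with
    | zero => simpa using hΦ s

theorem Pot.seq (hΦ : ∀ s, 0 ≤ Φ s) (hp : Pot sem Φ p a) (hq : Pot sem Φ q a') :
    Pot sem Φ (.seq p q) (a + a') := by
  obtain ⟨hp, b, hb⟩ := hp
  obtain ⟨hq, b', hb'⟩ := hq
  refine ⟨fun s n s' h => ?_, b + a.natAbs + b', fun s n h => ?_⟩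
  · obtain ⟨m, k, s1, rfl, h1, h2⟩ := run_seq_iff.1 h
    have := hp _ _ _ h1
    have := hq _ _ _ h2
    push_cast
    omega
  · cases h with
    | zero => have := hΦ s; omega
    | seql h => have := hb _ _ h; omega
    | seqr h1 h2 => have := hp _ _ _ h1; have := hb' _ _ h2; omega

theorem Pot.mono (hp : Pot sem Φ p a) (h : a ≤ a') : Pot sem Φ p a' :=
  ⟨fun s n s' hn => by have := hp.1 s n s' hn; omega, hp.2⟩

theorem Pot.alt (hΦ : ∀ s, 0 ≤ Φ s) (hp : Pot sem Φ p a) (hq : Pot sem Φ q a) :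
    Pot sem Φ (.alt p q) (a + 1) := by
  obtain ⟨hp, b, hb⟩ := hp
  obtain ⟨hq, b', hb'⟩ := hq
  refine ⟨fun s n s' h => ?_, b + b' + 1, fun s n h => ?_⟩
  · obtain ⟨m, rfl, h | h⟩ := run_alt_iff.1 h
    · have := hp _ _ _ h; push_cast; omega
    · have := hq _ _ _ h; push_cast; omega
  · cases h with
    | zero => have := hΦ s; omega
    | altl h => have := hb _ _ h; omega
    | altr h => have := hb' _ _ h; omega

/-- Each round must lower the potential enough to pay for its own time and for one step of the loop.
Then the loop costs, beyond the potential, only the step by which it is left. -/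
theorem Pot.star (hΦ : ∀ s, 0 ≤ Φ s) (hp : Pot sem Φ p a) (ha : a + 1 ≤ 0) :
    Pot sem Φ (.star p) 1 := by
  obtain ⟨hp, b, hb⟩ := hp
  refine ⟨fun s n s' h => ?_, b + 1, fun s n h => ?_⟩
  · generalize hr : Prog.star p = r at h
    induction h with
    | done => push_cast; omega
    | more h1 _ _ ih =>
      cases hr
      have := hp _ _ _ h1
      have := ih rfl
      push_cast
      omega
    | _ => cases hr
  · generalize hr : Prog.star p = r at h
    induction h with
    | zero => have := hΦ (by assumption); omega
    | starl h => cases hr; have := hb _ _ h; push_cast; omega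
    | starr h1 _ ih =>
      cases hr
      have := hp _ _ _ h1
      have := ih rfl
      push_cast
      omega
    | _ => cases hr

theorem Pot.bounded (hΦ : ∀ s, 0 ≤ Φ s) (hp : Pot sem Φ p a) :
    ∃ c : ℕ, ∀ s, Bounded sem p s ((Φ s).toNat + c) := by
  obtain ⟨hp, b, hb⟩ := hp
  refine ⟨a.natAbs + b, fun s => ⟨fun n h => ?_, fun n s' h => ?_⟩⟩
  · have := hb _ _ h; have := hΦ s; omega
  · have := hp _ _ _ h; have := hΦ s; have := hΦ s'; omega

end Bounded

section weights

variable {κ : Type} [DecidableEq κ] [Fintype κ]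

/-- The weighted number of symbols on all stacks. -/
def weight (w : κ → ℤ) (s : Stacks κ) : ℤ := ∑ k, w k * (s k).length

/-- Potentials that are weighted numbers of symbols. -/
notation:max "SPot" w:max => Pot SInstr.sem (weight w)

theorem weight_update (w : κ → ℤ) (s : Stacks κ) (k : κ) (l : List StackSym) :
    weight w (update s k l) = weight w s + w k * (l.length - (s k).length) := by
  have : ∀ j, w j * ((update s k l j).length : ℤ) = w j * (s j).length +
      if j = k then w k * (l.length - (s k).length) else 0 := by
    intro j
    by_cases h : j = k
    · subst h; simp; ring
    · simp [h]
  simp only [weight, this, Finset.sum_add_distrib, Finset.sum_ite_eq', Finset.mem_univ, if_true]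

omit [DecidableEq κ] in
theorem weight_nonneg {w : κ → ℤ} (hw : ∀ k, 0 ≤ w k) (s : Stacks κ) : 0 ≤ weight w s :=
  Finset.sum_nonneg fun k _ => mul_nonneg (hw k) (by positivity)

/-- The contribution of an instruction to the time and the weight. -/
def _root_.SInstr.net (w : κ → ℤ) : SInstr κ → ℤ
  | .push k _ => 1 + w k
  | .pop k _ => 1 - w k
  | .empty _ => 1
  | .nop => 1

theorem pot_ins {w : κ → ℤ} (hw : ∀ k, 0 ≤ w k) (i : SInstr κ) :
    SPot w (.ins i) (i.net w) := by
  refine .ins (weight_nonneg hw) fun s s' h => ?_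
  cases i with
  | push k a =>
    obtain rfl := h
    rw [weight_update]; simp [SInstr.net]; linarith
  | pop k a =>
    obtain ⟨l, hl, rfl⟩ := h
    rw [weight_update, hl]; simp [SInstr.net]; linarith
  | empty k => obtain ⟨-, rfl⟩ := h; simp [SInstr.net]; linarith
  | nop => obtain rfl := h; simp [SInstr.net]; linarith

theorem pot_line {w : κ → ℤ} (hw : ∀ k, 0 ≤ w k) : ∀ l : List (SInstr κ),
    SPot w (line l) ((l.map (SInstr.net w)).sum + 1)
  | [] => (pot_ins hw SInstr.nop).mono (by simp [SInstr.net])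
  | a :: l => by
    have := (pot_ins hw a).seq (weight_nonneg hw) (pot_line hw l)
    rw [List.map_cons, List.sum_cons, add_assoc]
    exact this

end weights

/-! ### Programs with a clock -/

section tick

variable {κ0 κ : Type} [DecidableEq κ0] [DecidableEq κ]

/-- Renaming of stacks. -/
def _root_.SInstr.map (f : κ0 → κ) : SInstr κ0 → SInstr κ
  | .push k a => .push (f k) a
  | .pop k a => .pop (f k) a
  | .empty k => .empty (f k)
  | .nop => .nop

/-- The program `p` on some of the stacks, provided with a clock: a stack `c` from which one symbol
is taken at each step. -/
def tickify (f : κ0 → κ) (c : κ) : Prog (SInstr κ0) → Prog (SInstr κ)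
  | .ins i => .seq (.ins (.pop c (some true))) (.ins (i.map f))
  | .seq p q => .seq (tickify f c p) (tickify f c q)
  | .alt p q => .seq (.ins (.pop c (some true))) (.alt (tickify f c p) (tickify f c q))
  | .star p => .seq (.ins (.pop c (some true)))
      (.star (.seq (.ins (.pop c (some true))) (tickify f c p)))

variable {f : κ0 → κ} {c : κ}

theorem _root_.SInstr.sem_map (hf : Function.Injective f) (hc : ∀ k, f k ≠ c) {i : SInstr κ0}
    {s s' : Stacks κ} (h : (i.map f).sem s s') :
    i.sem (s ∘ f) (s' ∘ f) ∧ s' c = s c := by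
  cases i with
  | push k a =>
    obtain rfl := h
    refine ⟨?_, by simp [(hc k).symm]⟩
    change _ = _
    rw [Function.update_comp_eq_of_injective _ hf]; rfl
  | pop k a =>
    obtain ⟨l, hl, rfl⟩ := h
    exact ⟨⟨l, hl, by rw [Function.update_comp_eq_of_injective _ hf]⟩, by simp [(hc k).symm]⟩
  | empty k => obtain ⟨h, rfl⟩ := h; exact ⟨⟨h, rfl⟩, rfl⟩
  | nop => obtain rfl := h; exact ⟨rfl, rfl⟩

theorem _root_.SInstr.exists_sem_map (hf : Function.Injective f) (hc : ∀ k, f k ≠ c) {i : SInstr κ0}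
    {s : Stacks κ} {t' : κ0 → List StackSym} (h : i.sem (s ∘ f) t') :
    ∃ s', (i.map f).sem s s' ∧ s' ∘ f = t' ∧ s' c = s c := by
  cases i with
  | push k a =>
    obtain rfl := h
    refine ⟨_, rfl, ?_, by simp [(hc k).symm]⟩
    rw [Function.update_comp_eq_of_injective _ hf]; rfl
  | pop k a =>
    obtain ⟨l, hl, rfl⟩ := h
    exact ⟨_, ⟨l, hl, rfl⟩, by rw [Function.update_comp_eq_of_injective _ hf],
      by simp [(hc k).symm]⟩
  | empty k => obtain ⟨h, rfl⟩ := h; exact ⟨s, ⟨h, rfl⟩, rfl, rfl⟩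
  | nop => obtain rfl := h; exact ⟨s, rfl, rfl, rfl⟩

theorem run_tick {s s' : Stacks κ} {n : ℕ}
    (h : SRun (.ins (.pop c (some true))) s n s') :
    n = 1 ∧ (s c).length = (s' c).length + 1 ∧ ∀ k, k ≠ c → s' k = s k := by
  obtain ⟨rfl, l, hl, rfl⟩ := run_ins_iff.1 h
  exact ⟨rfl, by simp [hl], fun k hk => by simp [hk]⟩

theorem run_star_pos {I σ : Type} {sem : I → σ → σ → Prop} {p : Prog I} {s s' : σ} {n : ℕ}
    (h : Run sem (.star p) s n s') : 1 ≤ n := by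
  cases h <;> omega

theorem part_ins {I σ : Type} {sem : I → σ → σ → Prop} {i : I} {s : σ} {n : ℕ}
    (h : Part sem (.ins i) s n) : n = 0 := by
  cases h; rfl

/-- Every instruction, choice, loop and round of a loop is preceded by a tick that removes a symbol
from the clock, so the steps are bounded by a multiple of the symbols removed. On the other stacks
the clock is invisible. -/
theorem run_tickify (hf : Function.Injective f) (hc : ∀ k, f k ≠ c) (p : Prog (SInstr κ0)) :
    ∀ {s s' : Stacks κ} {n : ℕ}, SRun (tickify f c p) s n s' →
      n + 4 * (s' c).length ≤ 4 * (s c).length ∧ ∃ m, SRun p (s ∘ f) m (s' ∘ f) := by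
  have hcomp : ∀ {s s' : Stacks κ}, (∀ k, k ≠ c → s' k = s k) → s' ∘ f = s ∘ f :=
    fun h => funext fun k => h _ (hc k)
  induction p with
  | ins i =>
    intro s s' n h
    obtain ⟨a, b, s1, rfl, h1, h2⟩ := run_seq_iff.1 h
    obtain ⟨rfl, h3, h4⟩ := run_tick h1
    obtain ⟨rfl, h5⟩ := run_ins_iff.1 h2
    obtain ⟨h6, h7⟩ := SInstr.sem_map hf hc h5
    rw [hcomp h4] at h6
    exact ⟨by rw [h7]; omega, 1, .ins h6⟩
  | seq p q ihp ihq =>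
    intro s s' n h
    obtain ⟨a, b, s1, rfl, h1, h2⟩ := run_seq_iff.1 h
    obtain ⟨e1, m1, r1⟩ := ihp h1
    obtain ⟨e2, m2, r2⟩ := ihq h2
    exact ⟨by omega, _, .seq r1 r2⟩
  | alt p q ihp ihq =>
    intro s s' n h
    obtain ⟨a, b, s1, rfl, h1, h2⟩ := run_seq_iff.1 h
    obtain ⟨rfl, h3, h4⟩ := run_tick h1
    rw [← hcomp h4]
    obtain ⟨a, rfl, h | h⟩ := run_alt_iff.1 h2
    · obtain ⟨e, m, r⟩ := ihp h
      exact ⟨by omega, _, .altl r⟩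
    · obtain ⟨e, m, r⟩ := ihq h
      exact ⟨by omega, _, .altr r⟩
  | star p ih =>
    intro s s' n h
    obtain ⟨a, b, s1, rfl, h1, h2⟩ := run_seq_iff.1 h
    obtain ⟨rfl, h3, h4⟩ := run_tick h1
    rw [← hcomp h4]
    suffices b + 4 * (s' c).length ≤ 4 * (s1 c).length + 1 ∧
        ∃ m, SRun (.star p) (s1 ∘ f) m (s' ∘ f) from ⟨by omega, this.2⟩
    clear h h1 h3 h4
    generalize hr : Prog.star _ = r at h2
    induction h2 with
    | done => cases hr; exact ⟨by omega, _, .done⟩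
    | more h1 _ _ ih2 =>
      cases hr
      obtain ⟨a, b, s2, rfl, h1, h2⟩ := run_seq_iff.1 h1
      obtain ⟨rfl, h3, h4⟩ := run_tick h1
      obtain ⟨e1, m1, r1⟩ := ih h2
      obtain ⟨e2, m2, r2⟩ := ih2 rfl
      rw [hcomp h4] at r1
      exact ⟨by omega, _, .more r1 r2⟩
    | _ => cases hr

theorem part_tickify (hf : Function.Injective f) (hc : ∀ k, f k ≠ c) (p : Prog (SInstr κ0)) :
    ∀ {s : Stacks κ} {n : ℕ}, Part SInstr.sem (tickify f c p) s n →
      n ≤ 4 * (s c).length := by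
  induction p with
  | ins i =>
    intro s n h
    cases h with
    | zero => omega
    | seql h => have := part_ins h; omega
    | seqr h1 h2 => have := part_ins h2; have := run_tick h1; omega
  | seq p q ihp ihq =>
    intro s n h
    cases h with
    | zero => omega
    | seql h => exact ihp h
    | seqr h1 h2 => have := ihq h2; have := (run_tickify hf hc p h1).1; omega
  | alt p q ihp ihq =>
    intro s n h
    cases h with
    | zero => omega
    | seql h => have := part_ins h; omega
    | seqr h1 h2 =>
      have := run_tick h1
      cases h2 with
      | zero => omega
      | altl h => have := ihp h; omega
      | altr h => have := ihq h; omega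
  | star p ih =>
    intro s n h
    cases h with
    | zero => omega
    | seql h => have := part_ins h; omega
    | @seqr _ _ _ s1 m b h1 h2 =>
      have := run_tick h1
      suffices b ≤ 4 * (s1 c).length + 1 by omega
      clear h1 this
      generalize hr : Prog.star _ = r at h2
      induction h2 with
      | zero => omega
      | starl h =>
        cases hr
        cases h with
        | zero => omega
        | seql h => have := part_ins h; omega
        | seqr h1 h2 => have := run_tick h1; have := ih h2; omega
      | starr h1 _ ih2 =>
        cases hr
        have := ih2 rfl
        obtain ⟨a, b, s2, rfl, h1, h2⟩ := run_seq_iff.1 h1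
        have := run_tick h1
        have := (run_tickify hf hc p h2).1
        omega
      | _ => cases hr

theorem bounded_tickify (hf : Function.Injective f) (hc : ∀ k, f k ≠ c) (p : Prog (SInstr κ0))
    (s : Stacks κ) : Bounded SInstr.sem (tickify f c p) s (4 * (s c).length) :=
  ⟨fun _ h => part_tickify hf hc p h,
    fun _ _ h => (Nat.le_add_right _ _).trans (run_tickify hf hc p h).1⟩

theorem exists_run_tick {s : Stacks κ} {K : ℕ}
    (h : s c = List.replicate (K + 1) (some true)) :
    SRun (.ins (.pop c (some true))) s 1
      (update s c (List.replicate K (some true))) :=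
  .ins ⟨_, by rw [h, List.replicate_succ], rfl⟩

/-- A run of `m` steps needs exactly `m` ticks; the other `K` symbols remain, so a clock that is too
long does not matter. -/
theorem exists_run_tickify (hf : Function.Injective f) (hc : ∀ k, f k ≠ c) {p : Prog (SInstr κ0)}
    {t t' : κ0 → List StackSym} {m : ℕ} (h : SRun p t m t') :
    ∀ {s : Stacks κ} {K : ℕ}, s ∘ f = t → s c = List.replicate (K + m) (some true) →
      ∃ n s', SRun (tickify f c p) s n s' ∧ s' ∘ f = t' ∧
        s' c = List.replicate K (some true) := by
  have hcomp : ∀ {s : Stacks κ} {l : List StackSym}, update s c l ∘ f = s ∘ f :=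
    funext fun k => Function.update_of_ne (hc k) _ _
  induction h with
  | ins h =>
    intro s K hs hK
    have r1 := exists_run_tick hK
    rw [← hs, ← hcomp (s := s) (l := List.replicate K (some true))] at h
    obtain ⟨s', r2, e, e'⟩ := SInstr.exists_sem_map hf hc h
    exact ⟨_, s', .seq r1 (.ins r2), e, by rw [e']; simp⟩
  | @seq _ _ _ _ _ m n _ _ ih1 ih2 =>
    intro s K hs hK
    obtain ⟨_, s1, r1, e1, f1⟩ := ih1 (K := K + n) hs (by rw [hK]; congr 1; omega)
    obtain ⟨_, s2, r2, e2, f2⟩ := ih2 e1 f1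
    exact ⟨_, s2, .seq r1 r2, e2, f2⟩
  | @altl p q s n s' _ ih =>
    intro s K hs hK
    have r1 := exists_run_tick (K := K + n) hK
    obtain ⟨_, s1, r, e1, f1⟩ := ih (K := K) (hcomp.trans hs)
      (Function.update_self c (List.replicate (K + n) (some true)) s)
    exact ⟨_, s1, .seq r1 (.altl r), e1, f1⟩
  | @altr p q s n s' _ ih =>
    intro s K hs hK
    have r1 := exists_run_tick (K := K + n) hK
    obtain ⟨_, s1, r, e1, f1⟩ := ih (K := K) (hcomp.trans hs)
      (Function.update_self c (List.replicate (K + n) (some true)) s)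
    exact ⟨_, s1, .seq r1 (.altr r), e1, f1⟩
  | done =>
    intro s K hs hK
    exact ⟨_, _, .seq (exists_run_tick hK) .done, hcomp.trans hs, by simp⟩
  | @more p _ _ _ m n _ hr ih1 ih2 =>
    intro s K hs hK
    have r1 := exists_run_tick (K := K + m + n) (s := s) (by rw [hK]; congr 1; omega)
    set s0 := update s c (List.replicate (K + m + n) (some true)) with hs0
    obtain ⟨k, hk⟩ : ∃ k, n = k + 1 := ⟨n - 1, by have := run_star_pos hr; omega⟩
    have r2 := exists_run_tick (K := K + k + m) (s := s0) (by
      rw [hs0, Function.update_self]; congr 1; omega)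
    set s1 := update s0 c (List.replicate (K + k + m) (some true)) with hs1
    obtain ⟨_, s2, r3, e2, f2⟩ := ih1 (s := s1) (K := K + k) (by rw [hs1, hcomp, hs0, hcomp, hs])
      (by rw [hs1, Function.update_self])
    -- By induction the remaining rounds have a run of their own that begins with the tick on
    -- entering a loop. Here the loop has been entered already, so that run is given one extra
    -- symbol and its first tick is cut off.
    obtain ⟨_, s3, r4, e3, f3⟩ := ih2 (s := update s2 c
      (List.replicate (K + n) (some true))) (K := K) (hcomp.trans e2) (by rw [Function.update_self])
    obtain ⟨_, _, s4, -, h1, h2⟩ := run_seq_iff.1 r4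
    obtain ⟨-, l, hl, rfl⟩ := run_ins_iff.1 h1
    rw [Function.update_self, hk, ← add_assoc, List.replicate_succ, List.cons.injEq] at hl
    rw [Function.update_idem, ← hl.2, ← f2, Function.update_eq_self] at h2
    exact ⟨_, s3, .seq r1 (.more (.seq r2 r3) h2), e3, f3⟩

end tick

end Prog

/-! ### A counter machine that reads the input -/

namespace Prog

/-- Counters. -/
inductive Ctr where
  | bu | mn | sA | sA2 | la | la2 | u | te | tf | tg | clk | clk2
  deriving DecidableEq

instance : Fintype Ctr :=
  ⟨{.bu, .mn, .sA, .sA2, .la, .la2, .u, .te, .tf, .tg, .clk, .clk2}, fun x => by cases x <;> decide⟩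

/-- The stacks by which the counter machine is implemented. -/
inductive CCell where
  | raw
  | tmp
  | ctr (k : Ctr)
  deriving DecidableEq

instance : Fintype CCell :=
  ⟨{.raw, .tmp} ∪ Finset.univ.image .ctr, fun x => by cases x <;> simp⟩

/-- All stacks. -/
abbrev Full := Cell ⊕ CCell

noncomputable instance : Fintype Cell := Fintype.ofFinite _

/-- States of the counter machine: the numbers still to be read, those already read, and the values
of the counters. -/
structure CState where
  inp : List ℕ
  out : List ℕ
  get : Ctr → ℕ

namespace CState

/-- Set a counter. -/
def set (s : CState) (x : ℕ) (k : Ctr) : CState := { s with get := update s.get k x }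

theorem get_set (s : CState) (x : ℕ) (k j : Ctr) :
    (s.set x k).get j = if j = k then x else s.get j := Function.update_apply ..

/-- Increase counters. -/
def incs (n : ℕ) : List Ctr → CState → CState
  | [], s => s
  | k :: l, s => incs n l (s.set (s.get k + n) k)

end CState

/-- Instructions of the counter machine. -/
inductive CInstr where
  | rd (l : List Ctr)
  | inc (k : Ctr)
  | dec (k : Ctr)
  | zero (k : Ctr)
  | eof

/-- Effect of an instruction of the counter machine; the instruction `rd l` reads a number and adds
its length to the counters in `l`. -/
def CInstr.sem : CInstr → CState → CState → Prop
  | .rd l, s, s' => ∃ x r, s.inp = x :: r ∧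
      s' = CState.incs x.bits.length l { s with inp := r, out := s.out ++ [x] }
  | .inc k, s, s' => s' = s.set (s.get k + 1) k
  | .dec k, s, s' => ∃ x, s.get k = x + 1 ∧ s' = s.set x k
  | .zero k, s, s' => s.get k = 0 ∧ s' = s
  | .eof, s, s' => s.inp = [] ∧ s' = s

/-- Effect of a sequence of instructions of the counter machine. -/
def cSem : List CInstr → CState → CState → Prop
  | [], s, s' => s' = s
  | i :: l, s, s' => ∃ t, i.sem s t ∧ cSem l t s'

/-- Code of partly read input and counters. -/
def encRaw (r t : List Bool) (c : Ctr → ℕ) : Stacks Full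
  | .inl _ => []
  | .inr .raw => r.map some
  | .inr .tmp => t.map some
  | .inr (.ctr k) => List.replicate (c k) (some true)

/-- Code of a state of the counter machine. -/
def encC (s : CState) : Stacks Full :=
  encRaw (s.inp.flatMap encodeNat) (s.out.flatMap encodeNat).reverse s.get

section encRaw

variable {r t : List Bool} {c : Ctr → ℕ}

theorem update_raw (r' : List Bool) :
    update (encRaw r t c) (.inr .raw) (r'.map some) = encRaw r' t c := by
  funext k
  rcases k with k | _ | _ | k <;> simp [encRaw]

theorem update_tmp (t' : List Bool) :
    update (encRaw r t c) (.inr .tmp) (t'.map some) = encRaw r t' c := by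
  funext k
  rcases k with k | _ | _ | k <;> simp [encRaw]

theorem update_ctr (k : Ctr) (x : ℕ) : update (encRaw r t c) (.inr (.ctr k))
    (List.replicate x (some true)) = encRaw r t (update c k x) := by
  funext j
  rcases j with j | _ | _ | j
  · simp [encRaw]
  · simp [encRaw]
  · simp [encRaw]
  · by_cases h : j = k
    · subst h; simp [encRaw]
    · simp [encRaw, h]

theorem sem_pop_raw {b : Bool} {τ : Stacks Full} :
    (SInstr.pop (.inr .raw) (some b)).sem (encRaw r t c) τ ↔
      ∃ r', r = b :: r' ∧ τ = encRaw r' t c := by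
  constructor
  · rintro ⟨l, hl, rfl⟩
    cases r with
    | nil => simp [encRaw] at hl
    | cons a r =>
      simp only [encRaw, List.map_cons, List.cons.injEq, Option.some.injEq] at hl
      obtain ⟨rfl, rfl⟩ := hl
      exact ⟨r, rfl, update_raw r⟩
  · rintro ⟨r', rfl, rfl⟩
    exact ⟨r'.map some, rfl, (update_raw r').symm⟩

theorem sem_push_tmp {b : Bool} {τ : Stacks Full} :
    (SInstr.push (.inr .tmp) (some b)).sem (encRaw r t c) τ ↔ τ = encRaw r (b :: t) c := by
  rw [← update_tmp (t := t) (b :: t)]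
  rfl

theorem sem_push_ctr {k : Ctr} {τ : Stacks Full} :
    (SInstr.push (.inr (.ctr k)) (some true)).sem (encRaw r t c) τ ↔
      τ = encRaw r t (update c k (c k + 1)) := by
  rw [← update_ctr]
  rfl

theorem sem_pop_ctr {k : Ctr} {τ : Stacks Full} :
    (SInstr.pop (.inr (.ctr k)) (some true)).sem (encRaw r t c) τ ↔
      ∃ x, c k = x + 1 ∧ τ = encRaw r t (update c k x) := by
  constructor
  · rintro ⟨l, hl, rfl⟩
    cases hk : c k with
    | zero => simp [encRaw, hk] at hl
    | succ x =>
      simp only [encRaw, hk, List.replicate_succ, List.cons.injEq, true_and] at hl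
      exact ⟨x, rfl, by rw [← update_ctr, hl]⟩
  · rintro ⟨x, hx, rfl⟩
    exact ⟨List.replicate x (some true), by simp [encRaw, hx, List.replicate_succ],
      (update_ctr k x).symm⟩

theorem sem_empty_ctr {k : Ctr} {τ : Stacks Full} :
    (SInstr.empty (.inr (.ctr k))).sem (encRaw r t c) τ ↔ c k = 0 ∧ τ = encRaw r t c := by
  simp [SInstr.sem, encRaw]

theorem sem_empty_raw {τ : Stacks Full} :
    (SInstr.empty (.inr .raw)).sem (encRaw r t c) τ ↔ r = [] ∧ τ = encRaw r t c := by
  simp [SInstr.sem, encRaw]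

end encRaw

/-- Push one symbol on the stacks of some counters. -/
def pushCtrs : List Ctr → Prog (SInstr Full)
  | [] => .ins .nop
  | k :: l => .seq (.ins (.push (.inr (.ctr k)) (some true))) (pushCtrs l)

theorem run_pushCtrs_iff {r t : List Bool} {τ : Stacks Full} : ∀ {l : List Ctr} {c : Ctr → ℕ}
    {n : ℕ}, SRun (pushCtrs l) (encRaw r t c) n τ ↔
      n = l.length + 1 ∧ τ = encRaw r t (fun k => c k + l.count k)
  | [], c, n => by simp [pushCtrs, run_ins_iff, SInstr.sem]
  | k :: l, c, n => by
    have key : (fun j => update c k (c k + 1) j + l.count j) =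
        fun j => c j + (k :: l).count j := by
      funext j
      by_cases h : j = k
      · subst h; simp; omega
      · simp [h, Ne.symm h]
    simp only [pushCtrs, run_seq_iff, run_ins_iff, sem_push_ctr]
    constructor
    · rintro ⟨_, b, _, rfl, ⟨rfl, rfl⟩, h⟩
      obtain ⟨rfl, rfl⟩ := run_pushCtrs_iff.1 h
      exact ⟨by simp; omega, by rw [key]⟩
    · rintro ⟨rfl, rfl⟩
      exact ⟨1, l.length + 1, _, by simp; omega, ⟨rfl, rfl⟩, run_pushCtrs_iff.2 ⟨rfl, by rw [key]⟩⟩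

/-- Read one bit of a number. -/
def rdBit (l : List Ctr) (b : Bool) : Prog (SInstr Full) :=
  .seq (.ins (.pop (.inr .raw) (some b))) (.seq (.ins (.push (.inr .tmp) (some true)))
    (.seq (.ins (.push (.inr .tmp) (some b))) (pushCtrs l)))

/-- Read a number. -/
def rdProg (l : List Ctr) : Prog (SInstr Full) :=
  .seq (.star (.seq (.ins (.pop (.inr .raw) (some true))) (.alt (rdBit l true) (rdBit l false))))
    (.seq (.ins (.pop (.inr .raw) (some false))) (.ins (.push (.inr .tmp) (some false))))

theorem run_rdBit_iff {r t : List Bool} {c : Ctr → ℕ} {τ : Stacks Full} {l : List Ctr}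
    {b : Bool} {n : ℕ} : SRun (rdBit l b) (encRaw r t c) n τ ↔ n = l.length + 4 ∧
      ∃ r', r = b :: r' ∧ τ = encRaw r' (b :: true :: t) (fun k => c k + l.count k) := by
  simp only [rdBit, run_seq_iff, run_ins_iff, sem_pop_raw]
  constructor
  · rintro ⟨_, _, _, rfl, ⟨rfl, r', rfl, rfl⟩, _, _, _, rfl, ⟨rfl, h⟩, _, _, _, rfl, ⟨rfl, h'⟩, h''⟩
    obtain rfl := sem_push_tmp.1 h
    obtain rfl := sem_push_tmp.1 h'
    obtain ⟨rfl, rfl⟩ := run_pushCtrs_iff.1 h''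
    exact ⟨by omega, r', rfl, rfl⟩
  · rintro ⟨rfl, r', rfl, rfl⟩
    exact ⟨1, l.length + 3, _, by omega, ⟨rfl, r', rfl, rfl⟩, 1, l.length + 2, _, by omega,
      ⟨rfl, sem_push_tmp.2 rfl⟩, 1, l.length + 1, _, by omega, ⟨rfl, sem_push_tmp.2 rfl⟩,
      run_pushCtrs_iff.2 ⟨rfl, rfl⟩⟩

theorem run_rdProg {r t : List Bool} {c : Ctr → ℕ} {τ : Stacks Full} {l : List Ctr}
    {n : ℕ} (h : SRun (rdProg l) (encRaw r t c) n τ) : ∃ (bs r' : List Bool),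
      r = bs.flatMap (fun b => [true, b]) ++ false :: r' ∧
      τ = encRaw r' ((bs.flatMap (fun b => [true, b]) ++ [false]).reverse ++ t)
        (fun k => c k + bs.length * l.count k) := by
  obtain ⟨_, _, σ1, -, h1, h⟩ := run_seq_iff.1 h
  obtain ⟨_, _, σ2, -, h2, h3⟩ := run_seq_iff.1 h
  obtain ⟨bs, r', rfl, rfl⟩ := run_star_induction (P := fun σ => ∃ bs r' : List Bool,
      r = bs.flatMap (fun b => [true, b]) ++ r' ∧
      σ = encRaw r' ((bs.flatMap (fun b => [true, b])).reverse ++ t)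
        (fun k => c k + bs.length * l.count k)) h1 ⟨[], r, by simp⟩ (by
    rintro a m b ⟨bs, r', rfl, rfl⟩ hab
    obtain ⟨_, _, _, -, g1, g2⟩ := run_seq_iff.1 hab
    obtain ⟨-, g1⟩ := run_ins_iff.1 g1
    obtain ⟨r1, rfl, rfl⟩ := sem_pop_raw.1 g1
    have : ∃ (b' : Bool) (n : ℕ), SRun (rdBit l b') (encRaw r1
        ((bs.flatMap (fun b => [true, b])).reverse ++ t)
        (fun k => c k + bs.length * l.count k)) n b := by
      obtain ⟨_, -, g | g⟩ := run_alt_iff.1 g2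
      exacts [⟨_, _, g⟩, ⟨_, _, g⟩]
    obtain ⟨b', _, g⟩ := this
    obtain ⟨-, r2, rfl, rfl⟩ := run_rdBit_iff.1 g
    refine ⟨bs ++ [b'], r2, by simp, ?_⟩
    congr 1
    · simp
    · funext k; simp; ring)
  obtain ⟨-, h2⟩ := run_ins_iff.1 h2
  obtain ⟨r1, rfl, rfl⟩ := sem_pop_raw.1 h2
  obtain ⟨-, h3⟩ := run_ins_iff.1 h3
  obtain rfl := sem_push_tmp.1 h3
  exact ⟨bs, r1, rfl, by simp⟩

theorem exists_run_rdProg {r : List Bool} {l : List Ctr} : ∀ {bs : List Bool} {t : List Bool}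
    {c : Ctr → ℕ},
    ∃ n, SRun (rdProg l) (encRaw (bs.flatMap (fun b => [true, b]) ++ false :: r) t c) n
      (encRaw r ((bs.flatMap (fun b => [true, b]) ++ [false]).reverse ++ t)
        (fun k => c k + bs.length * l.count k))
  | [], t, c => ⟨_, .seq .done (.seq (.ins (sem_pop_raw.2 ⟨_, rfl, rfl⟩))
      (.ins (sem_push_tmp.2 (by simp))))⟩
  | b :: bs, t, c => by
    obtain ⟨n, h⟩ := exists_run_rdProg (bs := bs) (t := b :: true :: t)
      (c := fun k => c k + l.count k)
    have h1 : SRun (.seq (.ins (.pop (.inr .raw) (some true)))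
        (.alt (rdBit l true) (rdBit l false)))
        (encRaw ((b :: bs).flatMap (fun b => [true, b]) ++ false :: r) t c) (1 + (l.length + 4 + 1))
        (encRaw (bs.flatMap (fun b => [true, b]) ++ false :: r) (b :: true :: t)
          (fun k => c k + l.count k)) := by
      refine .seq (.ins (sem_pop_raw.2 ⟨b :: (bs.flatMap (fun b => [true, b]) ++ false :: r), by simp,
        rfl⟩)) ?_
      have := (run_rdBit_iff (l := l) (b := b) (t := t) (c := c)
        (r := b :: (bs.flatMap (fun b => [true, b]) ++ false :: r))).2 ⟨rfl, _, rfl, rfl⟩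
      cases b
      · exact .altr this
      · exact .altl this
    obtain ⟨_, _, σ1, -, h2, h3⟩ := run_seq_iff.1 h
    have h4 := Run.seq (Run.more h1 h2) h3
    have e1 : (((b :: bs).flatMap fun b => [true, b]) ++ [false]).reverse ++ t =
        ((bs.flatMap fun b => [true, b]) ++ [false]).reverse ++ b :: true :: t := by simp
    have e2 : (fun k => c k + (b :: bs).length * l.count k) =
        fun k => c k + l.count k + bs.length * l.count k := by
      funext k; simp; ring
    rw [e1, e2]
    exact ⟨_, h4⟩

/-- Implementation of an instruction of the counter machine. -/
def CInstr.prog : CInstr → Prog (SInstr Full)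
  | .rd l => rdProg l
  | .inc k => .ins (.push (.inr (.ctr k)) (some true))
  | .dec k => .ins (.pop (.inr (.ctr k)) (some true))
  | .zero k => .ins (.empty (.inr (.ctr k)))
  | .eof => .ins (.empty (.inr .raw))

theorem encC_incs (n : ℕ) : ∀ (l : List Ctr) (s : CState), encC (CState.incs n l s) =
    encRaw (s.inp.flatMap encodeNat) (s.out.flatMap encodeNat).reverse
      (fun k => s.get k + n * l.count k)
  | [], s => by simp [CState.incs, encC]
  | k :: l, s => by
    rw [CState.incs, encC_incs n l]
    congr 1
    funext j
    by_cases h : j = k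
    · subst h; simp [CState.set]; ring
    · simp [CState.set, h, Ne.symm h]

theorem CInstr.run_prog {i : CInstr} {s : CState} {n : ℕ} {τ : Stacks Full}
    (h : SRun i.prog (encC s) n τ) : ∃ s', i.sem s s' ∧ τ = encC s' := by
  cases i with
  | rd l =>
    obtain ⟨bs, r', h1, rfl⟩ := run_rdProg h
    match hs : s.inp with
    | [] => simp [hs] at h1
    | x :: u =>
      simp only [hs, List.flatMap_cons, encodeNat, List.append_assoc,
        List.singleton_append] at h1
      have := congrArg (List.map (some : Bool → StackSym)) h1
      simp only [List.map_append, List.map_cons] at this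
      obtain ⟨e, e'⟩ := code_unique (p := true) this
      obtain rfl := map_some_injective e'
      refine ⟨_, ⟨x, u, hs, rfl⟩, ?_⟩
      rw [encC_incs, ← e]
      simp only [List.flatMap_append, List.reverse_append]
      congr 1
      simp [encodeNat]
  | inc k =>
    obtain ⟨-, h⟩ := run_ins_iff.1 h
    exact ⟨_, rfl, sem_push_ctr.1 h⟩
  | dec k =>
    obtain ⟨-, h⟩ := run_ins_iff.1 h
    obtain ⟨x, hx, h⟩ := sem_pop_ctr.1 h
    exact ⟨_, ⟨x, hx, rfl⟩, h⟩
  | zero k =>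
    obtain ⟨-, h⟩ := run_ins_iff.1 h
    obtain ⟨hx, h⟩ := sem_empty_ctr.1 h
    exact ⟨_, ⟨hx, rfl⟩, h⟩
  | eof =>
    obtain ⟨-, h⟩ := run_ins_iff.1 h
    obtain ⟨hx, h⟩ := sem_empty_raw.1 h
    refine ⟨_, ⟨?_, rfl⟩, h⟩
    have := flatMap_encodeNat_eq_nil (l := s.inp)
    rw [hx] at this
    exact this.1 rfl

theorem CInstr.exists_run_prog {i : CInstr} {s s' : CState} (h : i.sem s s') :
    ∃ n, SRun i.prog (encC s) n (encC s') := by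
  cases i with
  | rd l =>
    obtain ⟨x, u, hx, rfl⟩ := h
    obtain ⟨n, r⟩ := exists_run_rdProg (l := l) (bs := x.bits)
      (t := (s.out.flatMap encodeNat).reverse) (c := s.get)
      (r := u.flatMap encodeNat)
    refine ⟨n, ?_⟩
    have e1 : s.inp.flatMap encodeNat =
        x.bits.flatMap (fun b => [true, b]) ++ false :: u.flatMap encodeNat := by
      simp [hx, encodeNat]
    have e2 : ((s.out ++ [x]).flatMap encodeNat).reverse =
        (x.bits.flatMap (fun b => [true, b]) ++ [false]).reverse ++
          (s.out.flatMap encodeNat).reverse := by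
      simp [encodeNat]
    rw [encC_incs, e2, encC, e1]
    exact r
  | inc k =>
    obtain rfl := h
    exact ⟨1, .ins (sem_push_ctr.2 rfl)⟩
  | dec k =>
    obtain ⟨x, hx, rfl⟩ := h
    exact ⟨1, .ins (sem_pop_ctr.2 ⟨x, hx, rfl⟩)⟩
  | zero k =>
    obtain ⟨hx, rfl⟩ := h
    exact ⟨1, .ins (sem_empty_ctr.2 ⟨hx, rfl⟩)⟩
  | eof =>
    obtain ⟨hx, rfl⟩ := h
    exact ⟨1, .ins (sem_empty_raw.2 ⟨by simp [hx], rfl⟩)⟩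

/-- Implementation of a sequence of instructions of the counter machine. -/
def cProg : List CInstr → Prog (SInstr Full)
  | [] => .ins .nop
  | i :: l => .seq i.prog (cProg l)

theorem run_cProg : ∀ {l : List CInstr} {s : CState} {n : ℕ} {τ : Stacks Full},
    SRun (cProg l) (encC s) n τ → ∃ s', cSem l s s' ∧ τ = encC s'
  | [], s, n, τ, h => ⟨s, rfl, (run_ins_iff.1 h).2⟩
  | i :: l, s, n, τ, h => by
    obtain ⟨_, _, _, -, h1, h2⟩ := run_seq_iff.1 h
    obtain ⟨t, ht, rfl⟩ := CInstr.run_prog h1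
    obtain ⟨s', hs, rfl⟩ := run_cProg h2
    exact ⟨s', ⟨t, ht, hs⟩, rfl⟩

theorem exists_run_cProg : ∀ {l : List CInstr} {s s' : CState}, cSem l s s' →
    ∃ n, SRun (cProg l) (encC s) n (encC s')
  | [], s, s', h => ⟨1, .ins (by obtain rfl := h; rfl)⟩
  | i :: l, s, s', ⟨t, h1, h2⟩ => by
    obtain ⟨_, r1⟩ := CInstr.exists_run_prog h1
    obtain ⟨_, r2⟩ := exists_run_cProg h2
    exact ⟨_, .seq r1 r2⟩

/-! #### Potentials -/

section pot

variable {w : Full → ℤ}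

theorem pot_pushCtrs (hw : ∀ k, 0 ≤ w k) : ∀ l : List Ctr, SPot w (pushCtrs l)
    ((l.map fun k => 1 + w (.inr (.ctr k))).sum + 1)
  | [] => (pot_ins hw SInstr.nop).mono (by simp [SInstr.net])
  | k :: l => ((pot_ins hw _).seq (weight_nonneg hw) (pot_pushCtrs hw l)).mono (by
      simp [SInstr.net]; linarith)

/-- Each bit of a number takes two symbols from the raw input, puts two on `tmp` and one on each
counter in `l`. The hypothesis says that the weight of the two raw symbols pays for all this. -/
theorem pot_rdProg (hw : ∀ k, 0 ≤ w k) {l : List Ctr}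
    (hl : (l.map fun k => 1 + w (.inr (.ctr k))).sum + 7 + 2 * w (.inr .tmp) ≤
      2 * w (.inr .raw)) :
    SPot w (rdProg l) (3 + w (.inr .tmp) - w (.inr .raw)) := by
  have h0 := weight_nonneg hw
  have hb : ∀ b, SPot w (rdBit l b) _ := fun b => (pot_ins hw _).seq h0
    ((pot_ins hw _).seq h0 ((pot_ins hw _).seq h0 (pot_pushCtrs hw l)))
  refine (((pot_ins hw _).seq h0 ((hb true).alt h0 (hb false))).star h0 ?_ |>.seq h0
    ((pot_ins hw _).seq h0 (pot_ins hw _))).mono ?_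
  · simp only [SInstr.net]; linarith
  · simp only [SInstr.net]; linarith

/-- The contribution of an instruction to the time and the weight. -/
def CInstr.net (w : Full → ℤ) : CInstr → ℤ
  | .rd _ => 3 + w (.inr .tmp) - w (.inr .raw)
  | .inc k => 1 + w (.inr (.ctr k))
  | .dec k => 1 - w (.inr (.ctr k))
  | .zero _ => 1
  | .eof => 1

theorem pot_cProg (hw : ∀ k, 0 ≤ w k) : ∀ {l : List CInstr},
    (∀ l', CInstr.rd l' ∈ l → (l'.map fun k => 1 + w (.inr (.ctr k))).sum + 7 + 2 * w (.inr .tmp) ≤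
      2 * w (.inr .raw)) → SPot w (cProg l) ((l.map (CInstr.net w)).sum + 1)
  | [], _ => (pot_ins hw SInstr.nop).mono (by simp [SInstr.net])
  | i :: l, h => by
    have hi : SPot w i.prog (i.net w) := by
      cases i with
      | rd l' => exact pot_rdProg hw (h l' (by simp))
      | inc k => exact pot_ins hw _
      | dec k => exact pot_ins hw _
      | zero k => exact pot_ins hw _
      | eof => exact pot_ins hw _
    exact (hi.seq (weight_nonneg hw) (pot_cProg hw fun l' hl => h l' (by simp [hl]))).mono (by
      simp; linarith)

end pot

end Prog

/-! ### Computing a clock -/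

namespace Prog

namespace CState

/-- The state with the given values of the counters. -/
def withCtr (s : CState) (f : Ctr → ℕ) : CState := { s with get := f }

@[simp]
theorem get_withCtr (s : CState) (f : Ctr → ℕ) : (s.withCtr f).get = f := rfl

end CState

theorem cSem_append {l l' : List CInstr} {s t : CState} :
    cSem (l ++ l') s t ↔ ∃ r, cSem l s r ∧ cSem l' r t := by
  induction l generalizing s with
  | nil => simp [cSem]
  | cons a l ih =>
    simp only [List.cons_append, cSem, ih]
    constructor
    · rintro ⟨w, h, w', h1, h₂⟩; exact ⟨w', ⟨w, h, h1⟩, h₂⟩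
    · rintro ⟨w', ⟨w, h, h1⟩, h₂⟩; exact ⟨w, h, w', h1, h₂⟩

theorem cSem_decs : ∀ {D : List Ctr} {s t : CState}, cSem (D.map .dec) s t ↔
    (∀ k, D.count k ≤ s.get k) ∧ t = s.withCtr fun k => s.get k - D.count k
  | [], s, t => by simp [cSem, CState.withCtr]
  | a :: D, s, t => by
    simp only [List.map_cons, cSem, CInstr.sem, cSem_decs]
    have key : ∀ x, s.get a = x + 1 → ∀ k, (s.set x a).get k - D.count k =
        s.get k - (a :: D).count k := fun x hx k => by
      rw [CState.get_set]
      by_cases h : k = a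
      · subst h; simp [hx]
      · simp [h, Ne.symm h]
    have key' : ∀ x, s.get a = x + 1 → ∀ k, D.count k ≤ (s.set x a).get k ↔
        (a :: D).count k ≤ s.get k := fun x hx k => by
      rw [CState.get_set]
      by_cases h : k = a
      · subst h; simp [hx]
      · simp [h, Ne.symm h]
    constructor
    · rintro ⟨_, ⟨x, hx, rfl⟩, h, rfl⟩
      exact ⟨fun k => (key' x hx k).1 (h k), by simp only [key x hx]; rfl⟩
    · rintro ⟨h, rfl⟩
      have ha := h a
      rw [List.count_cons_self] at ha
      have hx : s.get a = s.get a - 1 + 1 := by omega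
      exact ⟨_, ⟨_, hx, rfl⟩, fun k => (key' _ hx k).2 (h k), by simp only [key _ hx]; rfl⟩

theorem cSem_incs : ∀ {U : List Ctr} {s t : CState}, cSem (U.map .inc) s t ↔
    t = s.withCtr fun k => s.get k + U.count k
  | [], s, t => by simp [cSem, CState.withCtr]
  | a :: U, s, t => by
    have key : ∀ k, (s.set (s.get a + 1) a).get k + U.count k = s.get k + (a :: U).count k :=
      fun k => by
      rw [CState.get_set]
      by_cases h : k = a
      · subst h; simp; omega
      · simp [h, Ne.symm h]
    simp only [List.map_cons, cSem, CInstr.sem, cSem_incs, exists_eq_left, key]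
    rfl

/-- Decrease some counters and increase others. -/
def chg (D U : List Ctr) : List CInstr := D.map .dec ++ U.map .inc

theorem cSem_chg {D U : List Ctr} {s t : CState} : cSem (chg D U) s t ↔
    (∀ k, D.count k ≤ s.get k) ∧ t = s.withCtr fun k => s.get k - D.count k + U.count k := by
  simp only [chg, cSem_append, cSem_decs, cSem_incs]
  constructor
  · rintro ⟨r, ⟨h, rfl⟩, rfl⟩
    exact ⟨h, rfl⟩
  · rintro ⟨h, rfl⟩
    exact ⟨_, ⟨h, rfl⟩, rfl⟩

/-- `Chg D U j s t`: the state `t` is obtained from `s` by `j` times decreasing the counters in `D`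
and increasing those in `U`. -/
def Chg (D U : List Ctr) (j : ℕ) (s t : CState) : Prop :=
  t.inp = s.inp ∧ t.out = s.out ∧ ∀ k, t.get k + j * D.count k = s.get k + j * U.count k

/-- Repeatedly decrease some counters and increase others. -/
def loop (D U : List Ctr) : Prog (List CInstr) := .star (.ins (chg D U))

theorem run_loop {D U : List Ctr} {s t : CState} {n : ℕ} (h : Run cSem (loop D U) s n t) :
    ∃ j, Chg D U j s t := by
  refine run_star_induction (P := fun t => ∃ j, Chg D U j s t) h ⟨0, rfl, rfl, by simp⟩ ?_
  rintro a m b ⟨j, h1, h₂, h3⟩ hab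
  obtain ⟨hd, rfl⟩ := cSem_chg.1 (run_ins_iff.1 hab).2
  refine ⟨j + 1, h1, h₂, fun k => ?_⟩
  have := h3 k
  have := hd k
  simp only [CState.get_withCtr, add_mul]
  omega

theorem exists_run_loop {D U : List Ctr} (j : ℕ) : ∀ {s : CState}, (∀ k ∈ D, j * D.count k ≤ s.get k) →
    ∃ n t, Run cSem (loop D U) s n t ∧ Chg D U j s t := by
  induction j with
  | zero => exact fun {s} _ => ⟨_, s, .done, rfl, rfl, by simp⟩
  | succ j ih =>
    intro s h
    have h1 : ∀ k, D.count k ≤ s.get k := fun k => by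
      by_cases hk : k ∈ D
      · exact (Nat.le_mul_of_pos_left _ (by omega)).trans (h k hk)
      · simp [List.count_eq_zero_of_not_mem hk]
    obtain ⟨n, t, r, e1, e2, e3⟩ := ih
      (s := s.withCtr fun k => s.get k - D.count k + U.count k) (fun k hk => by
        have := h k hk
        rw [add_mul] at this
        simp only [CState.get_withCtr]
        omega)
    refine ⟨_, t, .more (.ins (cSem_chg.2 ⟨h1, rfl⟩)) r, e1, e2, fun k => ?_⟩
    have q : _ = (s.get k - D.count k + U.count k) + _ := e3 k
    have := h1 k
    rw [add_mul, add_mul]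
    omega

/-! #### Logarithms -/

/-- Repeatedly divide the counter `a` by two, and increase the counters in `U` each time. -/
def halve (a b : Ctr) (U : List Ctr) : Prog (List CInstr) :=
  .seq (loop [a] []) (.seq (.star (.seq (.ins (chg [a, a] [b])) (.seq (loop [a, a] [b])
    (.seq (.ins [.zero a]) (.seq (loop [b] [a]) (.ins (.zero b :: chg [] U)))))))
    (.ins [.dec a, .zero a]))

/-- Result of `halve`. -/
def Halved (a : Ctr) (U : List Ctr) (j : ℕ) (s t : CState) : Prop :=
  t.inp = s.inp ∧ t.out = s.out ∧ t.get a = 0 ∧ ∀ k, k ≠ a → t.get k = s.get k + j * U.count k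

theorem run_zero {a : Ctr} {s t : CState} {n : ℕ} (h : Run cSem (.ins [.zero a]) s n t) :
    s.get a = 0 ∧ t = s := by
  obtain ⟨-, _, ⟨h, rfl⟩, rfl⟩ := run_ins_iff.1 h
  exact ⟨h, rfl⟩

/-- After an arbitrary decrease, `a` is halved exactly in each round, as the zero tests permit no
remainder, until it is 1. So the number `j` of rounds can only underestimate the logarithm: the
value of `a` times `2 ^ j` never exceeds the initial value. -/
theorem run_halve {a b : Ctr} {U : List Ctr} (hab : a ≠ b) (ha : a ∉ U) (hb : b ∉ U)
    {s t : CState} {n : ℕ} (hs : s.get b = 0) (h : Run cSem (halve a b U) s n t) :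
    ∃ j, 2 ^ j ≤ s.get a ∧ Halved a U j s t := by
  have ha' : U.count a = 0 := List.count_eq_zero.2 ha
  have hb' : U.count b = 0 := List.count_eq_zero.2 hb
  obtain ⟨_, _, s1, -, h1, h⟩ := run_seq_iff.1 h
  obtain ⟨_, _, s2, -, h₂, h3⟩ := run_seq_iff.1 h
  obtain ⟨i, i1, o1, e1⟩ := run_loop h1
  obtain ⟨j, i2, o2, e2, e2', e2''⟩ := run_star_induction (P := fun t => ∃ j, t.inp = s.inp ∧
      t.out = s.out ∧ t.get a * 2 ^ j ≤ s.get a ∧ t.get b = 0 ∧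
      ∀ k, k ≠ a → t.get k = s.get k + j * U.count k) h₂
    ⟨0, i1, o1, by have := e1 a; simp at this ⊢; omega, by have := e1 b; simp [hab] at this; omega,
      fun k hk => by have := e1 k; simpa [hk.symm] using this⟩ (by
    rintro x m y ⟨j, i2, o2, e2, e2', e2''⟩ hxy
    obtain ⟨_, _, s3, -, h3, h⟩ := run_seq_iff.1 hxy
    obtain ⟨_, _, s4, -, h4, h⟩ := run_seq_iff.1 h
    obtain ⟨_, _, s5, -, h5, h⟩ := run_seq_iff.1 h
    obtain ⟨_, _, s6, -, h6, h7⟩ := run_seq_iff.1 h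
    obtain ⟨hd, rfl⟩ := cSem_chg.1 (run_ins_iff.1 h3).2
    obtain ⟨i4, i5, o5, e5⟩ := run_loop h4
    obtain ⟨z1, rfl⟩ := run_zero h5
    obtain ⟨i6, i7, o7, e7⟩ := run_loop h6
    obtain ⟨-, s7, ⟨z2, e⟩, h8⟩ := run_ins_iff.1 h7
    subst e
    obtain ⟨-, rfl⟩ := cSem_chg.1 h8
    simp only [CState.get_withCtr] at e5
    have c1 := hd a
    have c2 := e5 a
    have c3 := e5 b
    have c4 := e7 a
    have c5 := e7 b
    simp [hab, Ne.symm hab, e2'] at c1 c2 c3 c4 c5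
    refine ⟨j + 1, i7.trans (i5.trans i2), o7.trans (o5.trans o2), ?_, by simp [z2, hb'], ?_⟩
    · simp only [CState.get_withCtr, ha']
      rw [pow_succ]
      have : x.get a = 2 * s7.get a := by omega
      rw [this] at e2
      simp only [List.count_nil, Nat.sub_zero, Nat.add_zero]
      linarith
    · intro k hk
      have d1 := e5 k
      have d2 := e7 k
      have d3 := e2'' k hk
      by_cases hkb : k = b
      · subst hkb; simp [z2, hb', hs]
      · simp [Ne.symm hk, Ne.symm hkb] at d1 d2 ⊢
        rw [d2, d1, d3]; ring)
  obtain ⟨-, _, ⟨x, hx, rfl⟩, _, ⟨z, rfl⟩, rfl⟩ := run_ins_iff.1 h3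
  rw [CState.get_set, if_pos rfl] at z
  subst z
  refine ⟨j, by simpa [hx] using e2, i2, o2,
    by rw [CState.get_set, if_pos rfl], fun k hk => ?_⟩
  rw [CState.get_set, if_neg hk, e2'' k hk]

theorem exists_run_halve {a b : Ctr} {U : List Ctr} (hab : a ≠ b) (ha : a ∉ U) (hb : b ∉ U)
    {s : CState} {j : ℕ} (hs : s.get b = 0) (hj : 2 ^ j ≤ s.get a) :
    ∃ n t, Run cSem (halve a b U) s n t ∧ Halved a U j s t := by
  have ha' : U.count a = 0 := List.count_eq_zero.2 ha
  have hb' : U.count b = 0 := List.count_eq_zero.2 hb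
  -- Lowering `a` to exactly `2 ^ j` makes the following `j` halvings exact.
  obtain ⟨n1, s1, r1, i1, o1, e1⟩ := exists_run_loop (D := [a]) (U := []) (s.get a - 2 ^ j)
    (s := s) (by simp)
  have ea := e1 a
  have eb := e1 b
  simp [hab, hs] at ea eb
  have : ∀ (j : ℕ) (s1 : CState), s1.get a = 2 ^ j → s1.get b = 0 → ∃ n t, Run cSem
      (.star (.seq (.ins (chg [a, a] [b])) (.seq (loop [a, a] [b]) (.seq (.ins [.zero a])
        (.seq (loop [b] [a]) (.ins (.zero b :: chg [] U))))))) s1 n t ∧ t.inp = s1.inp ∧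
        t.out = s1.out ∧ t.get a = 1 ∧ ∀ k, k ≠ a → t.get k = s1.get k + j * U.count k := by
    intro j
    induction j with
    | zero => exact fun s1 h _ => ⟨_, s1, .done, rfl, rfl, by simpa using h, by simp⟩
    | succ j ih =>
      intro s1 h h'
      have h2 : 1 ≤ 2 ^ j := Nat.one_le_two_pow
      rw [pow_succ] at h
      have q1 : cSem (chg [a, a] [b]) s1 _ := cSem_chg.2 ⟨fun k => by
        by_cases hk : k = a
        · subst hk; simp; omega
        · simp [Ne.symm hk], rfl⟩
      obtain ⟨_, s2, q2, i2, o2, e2⟩ := exists_run_loop (D := [a, a]) (U := [b]) (2 ^ j - 1)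
        (s := s1.withCtr fun k => s1.get k - [a, a].count k + [b].count k) (by simp; omega)
      have c1 := e2 a
      have c2 := e2 b
      simp [hab, Ne.symm hab, h, h'] at c1 c2
      obtain ⟨_, s3, q3, i3, o3, e3⟩ := exists_run_loop (D := [b]) (U := [a]) (2 ^ j)
        (s := s2) (by simp; omega)
      have c3 := e3 a
      have c4 := e3 b
      simp [hab, Ne.symm hab] at c3 c4
      obtain ⟨_, t, q4, i4, o4, e4, e4'⟩ := ih (s3.withCtr fun k => s3.get k - [].count k + U.count k)
        (by simp [ha']; omega) (by simp [hb']; omega)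
      refine ⟨_, t, .more (.seq (.ins q1) (.seq q2 (.seq (.ins ⟨_, ⟨by omega, rfl⟩, rfl⟩)
        (.seq q3 (.ins ⟨_, ⟨by omega, rfl⟩, cSem_chg.2 ⟨by simp, rfl⟩⟩))))) q4, ?_, ?_, e4, ?_⟩
      · exact i4.trans (i3.trans i2)
      · exact o4.trans (o3.trans o2)
      · intro k hk
        have d2 := e2 k
        have d3 := e3 k
        rw [e4' k hk]
        by_cases hkb : k = b
        · subst hkb; simp [hb', h']; omega
        · simp [Ne.symm hk, Ne.symm hkb] at d2 d3 ⊢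
          rw [d3, d2]; ring
  obtain ⟨_, s2, r2, i2, o2, e2, e2'⟩ := this j s1 (by omega) (by omega)
  refine ⟨_, s2.set 0 a, .seq r1 (.seq r2 (.ins ⟨_, ⟨0, e2, rfl⟩, _, ⟨?_, rfl⟩, rfl⟩)), ?_, ?_, ?_, ?_⟩
  · rw [CState.get_set, if_pos rfl]
  · exact i2.trans i1
  · exact o2.trans o1
  · rw [CState.get_set, if_pos rfl]
  · intro k hk
    have := e1 k
    rw [CState.get_set, if_neg hk, e2' k hk]
    simp [Ne.symm hk] at this
    rw [this]

end Prog

/-! ### Reading a graph -/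

namespace Prog

/-- The counters increased by the length of a numerator, or with the first two arguments exchanged
of a denominator. -/
def marks (e f g : Bool) : List Ctr :=
  (if e then [.bu] else []) ++ ((if f then [.mn] else []) ++ if g then [.la] else [])

/-- Read an edge, which may be chosen to be one of three special edges. -/
def edgeRd (x : Bool × Bool × Bool) : List CInstr :=
  chg ((if x.1 then [.te] else []) ++ ((if x.2.1 then [.tf] else []) ++
    if x.2.2 then [.tg] else [])) [.sA] ++
  [.rd [], .rd [], .rd (marks x.1 x.2.1 x.2.2), .rd (marks x.2.1 x.1 x.2.2)]

/-- States while a graph is being read. -/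
def rdState (i o : List ℕ) (bu mn sA la te tf tg : ℕ) : CState where
  inp := i
  out := o
  get
    | .bu => bu
    | .mn => mn
    | .sA => sA
    | .la => la
    | .te => te
    | .tf => tf
    | .tg => tg
    | _ => 0

/-- The four numbers of a record. -/
def quad (e : Rec) : List ℕ := [e.1, e.2.1, e.2.2.1, e.2.2.2]

section rdState

variable {i o : List ℕ} {bu mn sA la te tf tg : ℕ} {t : CState}

theorem cSem_rd_marks {e f g : Bool} {l : List CInstr} :
    cSem (.rd (marks e f g) :: l) (rdState i o bu mn sA la te tf tg) t ↔ ∃ x r, i = x :: r ∧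
      cSem l (rdState r (o ++ [x]) (bu + e.toNat * x.bits.length) (mn + f.toNat * x.bits.length) sA
        (la + g.toNat * x.bits.length) te tf tg) t := by
  have : ∀ x r, CState.incs (Nat.bits x).length (marks e f g)
      ⟨r, o ++ [x], (rdState i o bu mn sA la te tf tg).get⟩ =
      rdState r (o ++ [x]) (bu + e.toNat * x.bits.length) (mn + f.toNat * x.bits.length) sA
        (la + g.toNat * x.bits.length) te tf tg := by
    intro x r
    cases e <;> cases f <;> cases g <;>
      refine congrArg (CState.mk r (o ++ [x])) (funext fun k => ?_) <;> cases k <;>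
      simp [CState.set, rdState]
  simp only [cSem, CInstr.sem]
  constructor
  · rintro ⟨_, ⟨x, r, h, rfl⟩, h'⟩
    exact ⟨x, r, h, by rwa [← this]⟩
  · rintro ⟨x, r, h, h'⟩
    exact ⟨_, ⟨x, r, h, rfl⟩, by rwa [← this] at h'⟩

theorem cSem_rd_nil {l : List CInstr} :
    cSem (.rd [] :: l) (rdState i o bu mn sA la te tf tg) t ↔
      ∃ x r, i = x :: r ∧ cSem l (rdState r (o ++ [x]) bu mn sA la te tf tg) t := by
  simpa [marks] using cSem_rd_marks (e := false) (f := false) (g := false)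

theorem cSem_edgeRd {x : Bool × Bool × Bool} :
    cSem (edgeRd x) (rdState i o bu mn sA la te tf tg) t ↔
    ∃ e r, i = quad e ++ r ∧ (x.1.toNat ≤ te ∧ x.2.1.toNat ≤ tf ∧ x.2.2.toNat ≤ tg) ∧
      t = rdState r (o ++ quad e)
        (bu + x.1.toNat * e.2.2.1.bits.length + x.2.1.toNat * e.2.2.2.bits.length)
        (mn + x.2.1.toNat * e.2.2.1.bits.length + x.1.toNat * e.2.2.2.bits.length) (sA + 1)
        (la + x.2.2.toNat * e.2.2.1.bits.length + x.2.2.toNat * e.2.2.2.bits.length)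
        (te - x.1.toNat) (tf - x.2.1.toNat) (tg - x.2.2.toNat) := by
  obtain ⟨e, f, g⟩ := x
  have hget : (rdState i o bu mn sA la te tf tg).withCtr (fun k =>
      (rdState i o bu mn sA la te tf tg).get k - ((if e then [Ctr.te] else []) ++
      ((if f then [Ctr.tf] else []) ++ if g then [Ctr.tg] else [])).count k + [Ctr.sA].count k) =
      rdState i o bu mn (sA + 1) la (te - e.toNat) (tf - f.toNat) (tg - g.toNat) := by
    simp only [rdState, CState.withCtr, CState.mk.injEq, true_and]
    funext k
    cases e <;> cases f <;> cases g <;> cases k <;> rfl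
  have hle : (∀ k, ((if e then [Ctr.te] else []) ++ ((if f then [Ctr.tf] else []) ++
      if g then [Ctr.tg] else [])).count k ≤ (rdState i o bu mn sA la te tf tg).get k) ↔
      e.toNat ≤ te ∧ f.toNat ≤ tf ∧ g.toNat ≤ tg := by
    constructor
    · intro h
      have h1 := h .te
      have h2 := h .tf
      have h3 := h .tg
      revert h1 h2 h3
      cases e <;> cases f <;> cases g <;> simp [rdState] <;> omega
    · rintro ⟨h1, h2, h3⟩ k
      revert h1 h2 h3
      cases e <;> cases f <;> cases g <;> cases k <;> simp [rdState] <;> omega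
  simp only [edgeRd, cSem_append, cSem_chg, hget, hle, and_assoc, exists_and_left, exists_eq_left,
    cSem_rd_nil, cSem_rd_marks]
  constructor
  · rintro ⟨h, h', h'', a, _, h1, b, _, rfl, p, _, rfl, q, r, rfl, rfl⟩
    exact ⟨(a, b, p, q), r, h1, h, h', h'', by simp [quad]⟩
  · rintro ⟨⟨a, b, p, q⟩, r, h1, h, h', h'', rfl⟩
    exact ⟨h, h', h'', a, _, h1, b, _, rfl, p, _, rfl, q, r, rfl, by simp [quad, cSem]⟩

end rdState

theorem exists_run_oneOf {I σ : Type} {sem : I → σ → σ → Prop} {i j : I} {l : List I} {s t : σ}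
    (hj : j ∈ i :: l) (h : sem j s t) : ∃ m, Run sem (oneOf i l) s m t := by
  have hq : Prog.ins j ∈ Prog.ins i :: l.map Prog.ins := by
    rw [← List.map_cons (f := Prog.ins)]; exact List.mem_map_of_mem hj
  obtain ⟨k, -, r⟩ := exists_run_alts hq (.ins h)
  exact ⟨k, r⟩

/-- Read an edge. -/
def edgeAny : Prog (List CInstr) :=
  oneOf (edgeRd (true, true, true)) ([(true, true, false), (true, false, true),
    (true, false, false), (false, true, true), (false, true, false), (false, false, true),
    (false, false, false)].map edgeRd)

theorem exists_run_edgeAny {x : Bool × Bool × Bool} {s t : CState} (h : cSem (edgeRd x) s t) :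
    ∃ m, Run cSem edgeAny s m t :=
  exists_run_oneOf (by
    rw [← List.map_cons (f := edgeRd)]
    exact List.mem_map_of_mem (a := x) (by obtain ⟨_ | _, _ | _, _ | _⟩ := x <;> simp)) h

/-- Read a graph, choosing three edges. -/
def readC : Prog (List CInstr) :=
  .seq (.ins [.inc .te, .inc .tf, .inc .tg, .rd []])
    (.seq (.star edgeAny) (.ins [.eof, .zero .te, .zero .tf, .zero .tg]))

/-- The initial state of the counter machine. -/
def initC (inp : List ℕ) : CState := ⟨inp, [], fun _ => 0⟩

/-- The state after a graph has been read. -/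
def readOut (n : ℕ) (es : List Rec) (e f g : Rec) : CState :=
  rdState [] (n :: es.flatMap quad) (e.2.2.1.bits.length + f.2.2.2.bits.length)
    (f.2.2.1.bits.length + e.2.2.2.bits.length) es.length
    (g.2.2.1.bits.length + g.2.2.2.bits.length) 0 0 0

theorem cSem_init {n : ℕ} {r : List ℕ} {t : CState} :
    cSem [.inc .te, .inc .tf, .inc .tg, .rd []] (initC (n :: r)) t ↔
      t = rdState r [n] 0 0 0 0 1 1 1 := by
  have : (⟨r, [n], (((initC (n :: r)).set 1 .te).set 1 .tf).set 1 .tg |>.get⟩ : CState) =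
      rdState r [n] 0 0 0 0 1 1 1 := by
    simp only [rdState, CState.mk.injEq, true_and]
    funext k
    cases k <;> rfl
  rw [← this]
  constructor
  · rintro ⟨_, rfl, _, rfl, _, rfl, _, ⟨x, r', hx, rfl⟩, rfl⟩
    obtain ⟨rfl, rfl⟩ := List.cons.inj hx
    rfl
  · rintro rfl
    exact ⟨_, rfl, _, rfl, _, rfl, _, ⟨n, r, rfl, rfl⟩, rfl⟩

/-- Whether a special edge has been chosen, with two numbers that depend on it. -/
def Chosen (done : List Rec) (t x y : ℕ) : Prop :=
  t = 1 ∧ x = 0 ∧ y = 0 ∨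
    t = 0 ∧ ∃ e ∈ done, x = e.2.2.1.bits.length ∧ y = e.2.2.2.bits.length

theorem Chosen.step {done : List Rec} {t x y : ℕ} (h : Chosen done t x y) {b : Bool} {e : Rec}
    (hb : b.toNat ≤ t) : Chosen (done ++ [e]) (t - b.toNat) (x + b.toNat * e.2.2.1.bits.length)
      (y + b.toNat * e.2.2.2.bits.length) := by
  rcases h with ⟨rfl, rfl, rfl⟩ | ⟨rfl, e', he', rfl, rfl⟩
  · cases b
    · exact .inl ⟨rfl, by simp, by simp⟩
    · exact .inr ⟨rfl, e, by simp, by simp, by simp⟩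
  · cases b
    · exact .inr ⟨rfl, e', by simp [he'], by simp, by simp⟩
    · simp at hb

/-- The counters `te`, `tf`, `tg` act as tokens: each starts at 1, is spent when an edge is chosen
for the role, and must be 0 at the end. Hence one edge is chosen for each role, possibly the same
one. -/
theorem run_readC {n m : ℕ} {es : List Rec} {t : CState}
    (h : Run cSem readC (initC (n :: es.flatMap quad)) m t) :
    ∃ e ∈ es, ∃ f ∈ es, ∃ g ∈ es, t = readOut n es e f g := by
  obtain ⟨_, _, s1, -, h1, h⟩ := run_seq_iff.1 h
  obtain ⟨_, _, s2, -, h2, h3⟩ := run_seq_iff.1 h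
  obtain rfl := cSem_init.1 (run_ins_iff.1 h1).2
  obtain ⟨done, rest, rfl, pe, qe, pf, qf, pg, qg, te, tf, tg, ce, cf, cg, rfl⟩ :=
    run_star_oneOf (P := fun s2 => ∃ done rest, es = done ++ rest ∧
      ∃ pe qe pf qf pg qg te tf tg,
      Chosen done te pe qe ∧ Chosen done tf pf qf ∧ Chosen done tg pg qg ∧ s2 =
        rdState (rest.flatMap quad) (n :: done.flatMap quad) (pe + qf) (pf + qe) done.length
          (pg + qg) te tf tg) h2
    ⟨[], es, rfl, 0, 0, 0, 0, 0, 0, 1, 1, 1, .inl ⟨rfl, rfl, rfl⟩, .inl ⟨rfl, rfl, rfl⟩,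
        .inl ⟨rfl, rfl, rfl⟩, rfl⟩ (by
      rintro _ t ⟨done, rest, rfl, pe, qe, pf, qf, pg, qg, te, tf, tg, ce, cf, cg, rfl⟩ j hj hjt
      rw [← List.map_cons (f := edgeRd)] at hj
      obtain ⟨x, -, rfl⟩ := List.mem_map.1 hj
      obtain ⟨e, r, hr, ⟨hte, htf, htg⟩, rfl⟩ := cSem_edgeRd.1 hjt
      match rest, hr with
      | [], hr => simp [quad] at hr
      | e' :: rest, hr =>
        simp only [List.flatMap_cons, quad, List.cons_append, List.nil_append, List.cons.injEq] at hr
        obtain ⟨h1, h2, h3, h4, rfl⟩ := hr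
        obtain rfl : e' = e := Prod.ext h1 (Prod.ext h2 (Prod.ext h3 h4))
        refine ⟨done ++ [e'], rest, by simp, _, _, _, _, _, _, _, _, _, ce.step hte, cf.step htf,
          cg.step htg, ?_⟩
        congr 1
        · simp
        · ring
        · ring
        · simp
        · ring)
  obtain ⟨-, _, ⟨z1, rfl⟩, _, ⟨z2, rfl⟩, _, ⟨z3, rfl⟩, _, ⟨z4, rfl⟩, rfl⟩ := run_ins_iff.1 h3
  simp only [rdState] at z2 z3 z4
  subst z2 z3 z4
  obtain rfl : rest = [] := by
    cases rest with
    | nil => rfl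
    | cons => simp [rdState, quad] at z1
  simp only [Chosen, zero_ne_one, false_and, true_and, false_or] at ce cf cg
  obtain ⟨e, he, rfl, rfl⟩ := ce
  obtain ⟨f, hf, rfl, rfl⟩ := cf
  obtain ⟨g, hg, rfl, rfl⟩ := cg
  exact ⟨e, by simpa using he, f, by simpa using hf, g, by simpa using hg, by simp [readOut]⟩

/-- Each token is spent at the first occurrence of its record. The flags `ce`, `cf`, `cg` in the
induction tell which tokens are still to be spent. -/
theorem exists_run_readC {n : ℕ} {es : List Rec} {e f g : Rec} (he : e ∈ es) (hf : f ∈ es)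
    (hg : g ∈ es) : ∃ m, Run cSem readC (initC (n :: es.flatMap quad)) m (readOut n es e f g) := by
  classical
  obtain ⟨S, hS⟩ : ∃ S : List Rec → List Rec → Bool → Bool → Bool → CState,
      ∀ rest done ce cf cg, S rest done ce cf cg = rdState (rest.flatMap quad)
        (n :: done.flatMap quad)
        ((!ce).toNat * e.2.2.1.bits.length + (!cf).toNat * f.2.2.2.bits.length)
        ((!cf).toNat * f.2.2.1.bits.length + (!ce).toNat * e.2.2.2.bits.length) done.length
        ((!cg).toNat * g.2.2.1.bits.length + (!cg).toNat * g.2.2.2.bits.length)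
        ce.toNat cf.toNat cg.toNat := ⟨_, fun _ _ _ _ _ => rfl⟩
  have key : ∀ (rest done : List Rec) (ce cf cg : Bool), (ce → e ∈ rest) → (cf → f ∈ rest) →
      (cg → g ∈ rest) → ∃ m, Run cSem (.star edgeAny) (S rest done ce cf cg) m
        (readOut n (done ++ rest) e f g) := by
    intro rest
    induction rest with
    | nil =>
      intro done ce cf cg h1 h2 h3
      obtain rfl : ce = false := by simpa using h1
      obtain rfl : cf = false := by simpa using h2
      obtain rfl : cg = false := by simpa using h3
      have : S [] done false false false = readOut n (done ++ []) e f g := by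
        simp [hS, readOut]
      exact ⟨1, by rw [this]; exact .done⟩
    | cons h rest ih =>
      intro done ce cf cg h1 h2 h3
      have hc : ∀ {c : Bool} {a : Rec}, (c → a ∈ h :: rest) → (c && !decide (h = a)) →
          a ∈ rest := by
        intro c a hc h'
        simp only [Bool.and_eq_true, Bool.not_eq_true', decide_eq_false_iff_not] at h'
        exact (List.mem_cons.1 (hc h'.1)).resolve_left (Ne.symm h'.2)
      obtain ⟨m, r⟩ := ih (done ++ [h]) _ _ _ (hc h1) (hc h2) (hc h3)
      have htok : ∀ (c : Bool) (a : Rec), (c && decide (h = a)).toNat ≤ c.toNat := by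
        intro c a; cases c <;> simp [Bool.toNat_le]
      have hp : ∀ (c : Bool) (a : Rec) (φ : Rec → ℕ), (!c).toNat * φ a +
          (c && decide (h = a)).toNat * φ h = (!(c && !decide (h = a))).toNat * φ a := by
        intro c a φ
        cases c
        · simp
        · by_cases h' : h = a
          · subst h'; simp
          · simp [h']
      have ht : ∀ (c : Bool) (a : Rec), c.toNat - (c && decide (h = a)).toNat =
          (c && !decide (h = a)).toNat := by
        intro c a
        cases c
        · simp
        · by_cases h' : h = a <;> simp [h']
      obtain ⟨k, r1⟩ := exists_run_edgeAny (cSem_edgeRd (x := (ce && decide (h = e),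
        cf && decide (h = f), cg && decide (h = g))).2
        ⟨h, rest.flatMap quad, List.flatMap_cons, ⟨htok _ _, htok _ _, htok _ _⟩, rfl⟩)
      rw [List.append_assoc, List.singleton_append] at r
      rw [hS] at r ⊢
      refine ⟨k + m + 1, .more r1 ?_⟩
      convert r using 1
      have e1 := hp ce e fun a => a.2.2.1.bits.length
      have e2 := hp ce e fun a => a.2.2.2.bits.length
      have e3 := hp cf f fun a => a.2.2.1.bits.length
      have e4 := hp cf f fun a => a.2.2.2.bits.length
      have e5 := hp cg g fun a => a.2.2.1.bits.length
      have e6 := hp cg g fun a => a.2.2.2.bits.length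
      dsimp only
      congr 1
      · simp
      · omega
      · omega
      · simp
      · omega
      · exact ht ..
      · exact ht ..
      · exact ht ..
  obtain ⟨m, r⟩ := key es [] true true true (fun _ => he) (fun _ => hf) (fun _ => hg)
  exact ⟨_, .seq (.ins (cSem_init.2 rfl)) (.seq (by simpa [hS] using r) (.ins ⟨_, ⟨rfl, rfl⟩, _,
    ⟨rfl, rfl⟩, _, ⟨rfl, rfl⟩, _, ⟨rfl, rfl⟩, rfl⟩))⟩

end Prog

/-! ### The exponent of the clock -/

namespace Prog

section clockExp

variable (k c1 c2 : ℕ)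

/-- Compute an upper bound for the exponent of the time limit. -/
def clockArith : Prog (List CInstr) :=
  .seq (halve .sA .sA2 [.bu, .u, .la]) (.seq (halve .la .la2 (List.replicate c1 .bu))
    (.seq (loop (List.replicate k .u) [.bu]) (.seq (.ins (chg [] (List.replicate c2 .bu)))
      (.seq (loop [.mn, .bu] []) (.ins [.zero .mn])))))

variable {k c1 c2} {s t : CState}

/-- A lower bound `μ` for the logarithm of the number of edges is added to `bu`, to `u` and to `la`.
The logarithm of `la`, bounded below by `l`, contributes `c1 * l` and stands for the factor
polylogarithmic in the magnitude; part of `u` is divided by `k` and contributes `j`, which stands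
for `m ^ (1 / k)`. Finally `mn` is subtracted, exactly, because it must end at 0. -/
theorem run_clockArith {n : ℕ} (h1 : s.get .sA2 = 0) (h2 : s.get .la2 = 0) (hu : s.get .u = 0)
    (h : Run cSem (clockArith k c1 c2) s n t) : ∃ μ l j,
      2 ^ μ ≤ s.get .sA ∧ 2 ^ l ≤ s.get .la + μ ∧ k * j ≤ μ ∧
      t.get .bu + s.get .mn = s.get .bu + μ + c1 * l + j + c2 ∧
      t.inp = s.inp ∧ t.out = s.out ∧ ∀ x ∈ [.clk, .clk2], t.get x = s.get x := by
  obtain ⟨_, _, s1, -, r1, h⟩ := run_seq_iff.1 h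
  obtain ⟨_, _, s2, -, r2, h⟩ := run_seq_iff.1 h
  obtain ⟨_, _, s3, -, r3, h⟩ := run_seq_iff.1 h
  obtain ⟨_, _, s4, -, r4, h⟩ := run_seq_iff.1 h
  obtain ⟨_, _, s5, -, r5, r6⟩ := run_seq_iff.1 h
  obtain ⟨μ, hμ, i1, o1, -, e1⟩ := run_halve (by decide) (by decide) (by decide) h1 r1
  obtain ⟨l, hl, i2, o2, -, e2⟩ := run_halve (by decide) (by simp [List.mem_replicate])
    (by simp [List.mem_replicate]) (by rw [e1 _ (by decide), h2]; simp) r2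
  obtain ⟨j, i3, o3, e3⟩ := run_loop r3
  obtain ⟨-, rfl⟩ := cSem_chg.1 (run_ins_iff.1 r4).2
  obtain ⟨m, i5, o5, e5⟩ := run_loop r5
  obtain ⟨hz, rfl⟩ := run_zero r6
  refine ⟨μ, l, j, hμ, ?_, ?_, ?_, i5.trans (i3.trans (i2.trans i1)),
    o5.trans (o3.trans (o2.trans o1)), ?_⟩
  · have := e1 .la (by decide)
    simp at this
    omega
  · have q1 := e1 .u (by decide)
    have q2 := e2 .u (by decide)
    have q3 := e3 .u
    simp [List.count_replicate] at q1 q2 q3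
    rw [mul_comm]
    omega
  · have q1 := e1 .bu (by decide)
    have q2 := e2 .bu (by decide)
    have q3 := e3 .bu
    have q5 := e5 .bu
    have p1 := e1 .mn (by decide)
    have p2 := e2 .mn (by decide)
    have p3 := e3 .mn
    have p5 := e5 .mn
    simp [List.count_replicate] at q1 q2 q3 q5 p1 p2 p3 p5
    have := mul_comm c1 l
    omega
  · intro x hx
    have h1 : x ≠ .sA ∧ x ≠ .la := by cases x <;> simp at hx ⊢
    have q1 := e1 x h1.1
    have q2 := e2 x h1.2
    have q3 := e3 x
    have q5 := e5 x
    cases x <;> simp [List.count_replicate] at hx q1 q2 q3 q5 <;> omega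

theorem exists_run_clockArith (h1 : s.get .sA2 = 0) (h2 : s.get .la2 = 0) {μ l j K : ℕ}
    (hμ : 2 ^ μ ≤ s.get .sA) (hl : 2 ^ l ≤ s.get .la + μ) (hj : k * j ≤ μ)
    (hK : K + s.get .mn = s.get .bu + μ + c1 * l + j + c2) :
    ∃ n t, Run cSem (clockArith k c1 c2) s n t ∧ t.get .bu = K ∧
      t.inp = s.inp ∧ t.out = s.out ∧ ∀ x ∈ [.clk, .clk2], t.get x = s.get x := by
  obtain ⟨_, s1, r1, i1, o1, -, e1⟩ := exists_run_halve (a := .sA) (b := .sA2)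
    (U := [.bu, .u, .la]) (by decide) (by decide) (by decide) h1 hμ
  obtain ⟨_, s2, r2, i2, o2, -, e2⟩ := exists_run_halve (a := .la) (b := .la2)
    (U := List.replicate c1 .bu) (s := s1) (j := l) (by decide) (by simp [List.mem_replicate])
    (by simp [List.mem_replicate]) (by rw [e1 _ (by decide), h2]; simp)
    (by rw [e1 _ (by decide)]; simpa using hl)
  have u1 := e1 .u (by decide)
  have u2 := e2 .u (by decide)
  simp [List.count_replicate] at u1 u2
  obtain ⟨_, s3, r3, i3, o3, e3⟩ := exists_run_loop (D := List.replicate k .u) (U := [.bu]) j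
    (s := s2) (fun x hx => by
      obtain rfl := List.eq_of_mem_replicate hx
      rw [List.count_replicate_self, mul_comm]; omega)
  obtain ⟨s4, hs4⟩ : ∃ s4, s4 = s3.withCtr fun x =>
    s3.get x - [].count x + (List.replicate c2 Ctr.bu).count x := ⟨_, rfl⟩
  have r4 : cSem (chg [] (List.replicate c2 .bu)) s3 s4 := cSem_chg.2 ⟨by simp, hs4⟩
  have q1 := e1 .bu (by decide)
  have q2 := e2 .bu (by decide)
  have q3 := e3 .bu
  have p1 := e1 .mn (by decide)
  have p2 := e2 .mn (by decide)
  have p3 := e3 .mn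
  have q4 : s4.get .bu = s3.get .bu + c2 := by rw [hs4, CState.get_withCtr]; simp
  have p4 : s4.get .mn = s3.get .mn := by
    rw [hs4, CState.get_withCtr]; simp [List.count_replicate]
  simp [List.count_replicate] at q1 q2 q3 p1 p2 p3
  have hc := mul_comm c1 l
  obtain ⟨_, s5, r5, i5, o5, e5⟩ := exists_run_loop (D := [.mn, .bu]) (U := []) (s4.get .mn)
    (s := s4) (by simp; omega)
  have q5 := e5 .bu
  have p5 := e5 .mn
  simp at q5 p5
  refine ⟨_, s5, .seq r1 (.seq r2 (.seq r3 (.seq (.ins r4) (.seq r5 (.ins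
    ⟨_, ⟨p5, rfl⟩, rfl⟩))))), by omega, by rw [i5, hs4, ← i1, ← i2, ← i3]; rfl,
    by rw [o5, hs4, ← o1, ← o2, ← o3]; rfl, ?_⟩
  · intro x hx
    have h1 : x ≠ .sA ∧ x ≠ .la := by cases x <;> simp at hx ⊢
    have q1 := e1 x h1.1
    have q2 := e2 x h1.2
    have q3 := e3 x
    have q5 := e5 x
    rw [hs4] at q5
    cases x <;> simp [List.count_replicate] at hx q1 q2 q3 q5 <;> omega

variable (k c1 c2) in
/-- Read a graph and compute an upper bound for the exponent of the time limit. -/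
def clockExp : Prog (List CInstr) := .seq readC (clockArith k c1 c2)

variable (k c1 c2) in
/-- The exponents that the clock may have. -/
def IsExp (es : List Rec) (K : ℕ) : Prop :=
  ∃ e ∈ es, ∃ f ∈ es, ∃ g ∈ es, ∃ μ l j, 2 ^ μ ≤ es.length ∧
    2 ^ l ≤ g.2.2.1.bits.length + g.2.2.2.bits.length + μ ∧ k * j ≤ μ ∧
    K + (f.2.2.1.bits.length + e.2.2.2.bits.length) =
      e.2.2.1.bits.length + f.2.2.2.bits.length + μ + c1 * l + j + c2

/-- What matters in the state after the exponent has been computed. -/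
def ExpState (n : ℕ) (es : List Rec) (K : ℕ) (t : CState) : Prop :=
  t.get .bu = K ∧ t.inp = [] ∧ t.out = n :: es.flatMap quad ∧ t.get .clk = 0 ∧ t.get .clk2 = 0

theorem run_clockExp {n m : ℕ} {es : List Rec}
    (h : Run cSem (clockExp k c1 c2) (initC (n :: es.flatMap quad)) m t) :
    ∃ K, IsExp k c1 c2 es K ∧ ExpState n es K t := by
  obtain ⟨_, _, s1, -, r1, r2⟩ := run_seq_iff.1 h
  obtain ⟨e, he, f, hf, g, hg, rfl⟩ := run_readC r1
  obtain ⟨μ, l, j, h1, h2, h3, h4, h5, h6, h7⟩ := run_clockArith rfl rfl rfl r2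
  exact ⟨_, ⟨e, he, f, hf, g, hg, μ, l, j, h1, h2, h3, h4⟩, rfl, h5, h6, h7 _ (by simp),
    h7 _ (by simp)⟩

theorem exists_run_clockExp {n K : ℕ} {es : List Rec} (h : IsExp k c1 c2 es K) :
    ∃ m t, Run cSem (clockExp k c1 c2) (initC (n :: es.flatMap quad)) m t ∧ ExpState n es K t := by
  obtain ⟨e, he, f, hf, g, hg, μ, l, j, h1, h2, h3, h4⟩ := h
  obtain ⟨_, r1⟩ := exists_run_readC (n := n) he hf hg
  obtain ⟨_, t, r2, h5, h6, h7, h8⟩ := exists_run_clockArith (k := k) (c1 := c1) (c2 := c2)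
    (s := readOut n es e f g) rfl rfl h1 h2 h3 h4
  exact ⟨_, t, .seq r1 r2, h5, h6, h7, h8 _ (by simp), h8 _ (by simp)⟩

/-! #### Its running time -/

theorem chg_net (w : Full → ℤ) (D U : List Ctr) : ((chg D U).map (CInstr.net w)).sum =
    (D.map fun k => 1 - w (.inr (.ctr k))).sum + (U.map fun k => 1 + w (.inr (.ctr k))).sum := by
  simp only [chg, List.map_append, List.sum_append, List.map_map]
  rfl

theorem rd_notMem_chg {D U l : List Ctr} : CInstr.rd l ∉ chg D U := by
  simp [chg]

variable {w : Full → ℤ}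

theorem pot_chg (hw : ∀ k, 0 ≤ w k) (D U : List Ctr) :
    SPot w (cProg (chg D U)) ((D.map fun k => 1 - w (.inr (.ctr k))).sum +
      (U.map fun k => 1 + w (.inr (.ctr k))).sum + 1) := by
  rw [← chg_net]
  exact pot_cProg hw fun l h => absurd h rd_notMem_chg

theorem pot_loop (hw : ∀ k, 0 ≤ w k) {D U : List Ctr}
    (h : (D.map fun k => 1 - w (.inr (.ctr k))).sum +
      (U.map fun k => 1 + w (.inr (.ctr k))).sum + 2 ≤ 0) :
    SPot w ((loop D U).bind cProg) 1 :=
  (pot_chg hw D U).star (weight_nonneg hw) (by linarith)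

theorem pot_zero (hw : ∀ k, 0 ≤ w k) (a : Ctr) :
    SPot w ((Prog.ins [CInstr.zero a]).bind cProg) 2 :=
  (pot_cProg (l := [CInstr.zero a]) hw (by simp)).mono (by simp [CInstr.net])

/-- Symbols travel from `a` to `b` in pairs and back singly. The surplus of 4 in the weight of `b`
pays for the way back, and the weight that disappears when a pair is merged pays for everything else
in the round, including the increase of the counters in `U`. -/
theorem pot_halve (hw : ∀ k, 0 ≤ w k) {a b : Ctr} {U : List Ctr}
    (hb : w (.inr (.ctr b)) = w (.inr (.ctr a)) + 4)
    (ha : (U.map fun k => 1 + w (.inr (.ctr k))).sum + 15 ≤ w (.inr (.ctr a))) :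
    ∃ c, SPot w ((halve a b U).bind cProg) c := by
  have h0 := weight_nonneg hw
  have hU : 0 ≤ (U.map fun k => 1 + w (.inr (.ctr k))).sum :=
    List.sum_nonneg (by simp only [List.mem_map]; rintro _ ⟨k, -, rfl⟩; have := hw (.inr (.ctr k));
                        omega)
  have p1 : SPot w ((loop [a] []).bind cProg) 1 := pot_loop hw (by simp; omega)
  have p2 := pot_chg hw [a, a] [b]
  have p3 : SPot w ((loop [a, a] [b]).bind cProg) 1 :=
    pot_loop hw (by simp; omega)
  have p4 : SPot w ((loop [b] [a]).bind cProg) 1 := pot_loop hw (by simp; omega)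
  have p5 : SPot w (cProg (.zero b :: chg [] U)) _ := pot_cProg hw fun l h => by
    simp [chg] at h
  have p6 : SPot w (cProg [.dec a, .zero a]) _ := pot_cProg hw fun l h => by
    simp at h
  refine ⟨_, p1.seq h0 (Pot.seq h0 ((p2.seq h0 (p3.seq h0 ((pot_zero hw a).seq h0
    (p4.seq h0 p5)))).star h0 ?_) p6)⟩
  simp only [List.map_cons (f := CInstr.net w) (a := .zero b), List.sum_cons, chg_net]
  generalize (U.map fun k => 1 + w (.inr (.ctr k))).sum = x at ha hU ⊢
  simp [CInstr.net]
  omega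

theorem pot_alts {a : ℤ} (hw : ∀ k, 0 ≤ w k) : ∀ {l : List (Prog (SInstr Full))}
    {p : Prog (SInstr Full)}, (∀ q ∈ p :: l, SPot w q a) →
    SPot w (alts p l) (a + l.length)
  | [], p, h => (h p (by simp)).mono (by simp)
  | q :: l, p, h => by
    have h1 : SPot w (alts q l) (a + l.length) :=
      pot_alts hw fun r hr => h r (by simp at hr ⊢; tauto)
    exact (((h p (by simp)).mono (by omega)).alt (weight_nonneg hw) h1).mono (by
      push_cast [List.length_cons]; omega)

theorem bind_alts {I J : Type} (f : I → Prog J) : ∀ (p : Prog I) (l : List (Prog I)),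
    (alts p l).bind f = alts (p.bind f) (l.map fun q => q.bind f)
  | _, [] => rfl
  | p, q :: l => by
    change Prog.alt (p.bind f) ((alts q l).bind f) = _
    rw [bind_alts f q l]; rfl

theorem pot_readC (hw : ∀ k, 0 ≤ w k)
    (h : 50 + w (.inr (.ctr .bu)) + w (.inr (.ctr .mn)) + w (.inr (.ctr .la)) +
      w (.inr (.ctr .sA)) + 2 * w (.inr .tmp) ≤ w (.inr .raw)) :
    ∃ c, SPot w (readC.bind cProg) c := by
  have h0 := weight_nonneg hw
  have hbu := hw (.inr (.ctr .bu))
  have hmn := hw (.inr (.ctr .mn))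
  have hla := hw (.inr (.ctr .la))
  have hsA := hw (.inr (.ctr .sA))
  have htm := hw (.inr .tmp)
  have hte := hw (.inr (.ctr .te))
  have htf := hw (.inr (.ctr .tf))
  have htg := hw (.inr (.ctr .tg))
  have hm : ∀ e f g, ((marks e f g).map fun k => 1 + w (.inr (.ctr k))).sum + 7 +
      2 * w (.inr .tmp) ≤ 2 * w (.inr .raw) := by
    intro e f g
    cases e <;> cases f <;> cases g <;> simp [marks] <;> omega
  have p1 : SPot w (cProg [.inc .te, .inc .tf, .inc .tg, .rd []]) _ :=
    pot_cProg hw fun l h => by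
      obtain rfl : l = [] := by simpa using h
      simp; omega
  have p2 : ∀ x, SPot w (cProg (edgeRd x)) (-9) := by
    rintro ⟨e, f, g⟩
    refine (pot_cProg hw fun l h => ?_).mono ?_
    · simp only [edgeRd, List.mem_append, rd_notMem_chg, false_or, List.mem_cons, CInstr.rd.injEq,
        List.not_mem_nil, or_false] at h
      rcases h with rfl | rfl | rfl | rfl
      · simp; omega
      · simp; omega
      · exact hm _ _ _
      · exact hm _ _ _
    · rw [edgeRd, List.map_append, List.sum_append, chg_net]
      cases e <;> cases f <;> cases g <;> simp [CInstr.net] <;> omega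
  have p3 : SPot w (cProg [.eof, .zero .te, .zero .tf, .zero .tg]) _ :=
    pot_cProg hw fun l h => by simp at h
  have p4 : SPot w (edgeAny.bind cProg) (-9 + 7) := by
    rw [edgeAny, oneOf, bind_alts]
    refine pot_alts hw fun q hq => ?_
    simp only [List.map_cons, List.map_nil, List.mem_cons, List.not_mem_nil, or_false] at hq
    rcases hq with rfl | rfl | rfl | rfl | rfl | rfl | rfl | rfl <;> exact p2 _
  exact ⟨_, p1.seq h0 ((p4.star h0 (by norm_num)).seq h0 p3)⟩

variable (c1) in
/-- Weights of the stacks. -/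
def expWeight : Full → ℤ
  | .inr .raw => 200 + 2 * c1
  | .inr (.ctr .mn) => 4
  | .inr (.ctr .u) => 4
  | .inr (.ctr .la) => 20 + c1
  | .inr (.ctr .la2) => 24 + c1
  | .inr (.ctr .sA) => 50 + c1
  | .inr (.ctr .sA2) => 54 + c1
  | _ => 0

theorem expWeight_nonneg (k : Full) : 0 ≤ expWeight c1 k := by
  unfold expWeight
  split <;> omega

/-- The weights decrease along the flow of data: raw input, then `sA`, then `la`, then `u` and `mn`.
Each is heavy enough to pay for what is produced from it, so the whole computation is linear in the
input. `bu` needs no weight, as the loop that consumes it also consumes `mn`. -/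
theorem pot_clockExp (hk : 1 ≤ k) :
    ∃ c, SPot (expWeight c1) ((clockExp k c1 c2).bind cProg) c := by
  have hw := expWeight_nonneg (c1 := c1)
  have h0 := weight_nonneg hw
  obtain ⟨_, p1⟩ : ∃ c, SPot (expWeight c1) (readC.bind cProg) c :=
    pot_readC hw (by simp [expWeight]; omega)
  obtain ⟨_, p2⟩ : ∃ c, SPot (expWeight c1)
      ((halve .sA .sA2 [.bu, .u, .la]).bind cProg) c :=
    pot_halve hw (by simp [expWeight]; omega) (by simp [expWeight]; omega)
  obtain ⟨_, p3⟩ : ∃ c, SPot (expWeight c1)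
      ((halve .la .la2 (List.replicate c1 .bu)).bind cProg) c :=
    pot_halve hw (by simp [expWeight]; omega) (by simp [expWeight]; omega)
  have p4 : SPot (expWeight c1)
      ((loop (List.replicate k .u) [.bu]).bind cProg) 1 :=
    pot_loop hw (by
      simp only [List.map_replicate, List.sum_replicate, expWeight]
      simp
      omega)
  have p5 := pot_chg hw [] (List.replicate c2 .bu)
  have p6 : SPot (expWeight c1) ((loop [.mn, .bu] []).bind cProg) 1 :=
    pot_loop hw (by simp [expWeight])
  exact ⟨_, p1.seq h0 (p2.seq h0 (p3.seq h0 (p4.seq h0 (p5.seq h0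
    (p6.seq h0 (pot_zero hw .mn))))))⟩

end clockExp

end Prog

/-! ### Programs with a time limit -/

namespace Prog

theorem run_bind_cProg {p : Prog (List CInstr)} {s : CState} {n : ℕ} {τ : Stacks Full}
    (h : SRun (p.bind cProg) (encC s) n τ) : ∃ m t, Run cSem p s m t ∧ τ = encC t :=
  Run.of_bind (sem := cSem) (fun _ _ _ _ h => run_cProg h) _ _ _ _ h

theorem exists_run_bind_cProg {p : Prog (List CInstr)} {s t : CState} {n : ℕ}
    (h : Run cSem p s n t) : ∃ m, SRun (p.bind cProg) (encC s) m (encC t) :=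
  Run.exists_bind (fun _ _ _ h => exists_run_cProg h) h

/-- Double the counter `clk`, once. -/
def dblOnce : Prog (List CInstr) :=
  .seq (.seq (.ins [.dec .bu]) (.seq (loop [.clk] [.clk2, .clk2]) (.ins [.zero .clk])))
    (.seq (loop [.clk2] [.clk]) (.ins [.zero .clk2]))

/-- Compute a power of two in unary. -/
def dbl : Prog (List CInstr) :=
  .seq (.ins [.inc .clk]) (.seq (.star dblOnce) (.ins [.zero .bu]))

section dbl

variable {s t : CState} {n : ℕ}

theorem run_dblOnce (hs : s.get .clk2 = 0) (h : Run cSem dblOnce s n t) :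
    t.inp = s.inp ∧ t.out = s.out ∧ t.get .clk2 = 0 ∧ t.get .clk = 2 * s.get .clk ∧
      t.get .bu + 1 = s.get .bu := by
  obtain ⟨_, _, s1, -, h, h'⟩ := run_seq_iff.1 h
  obtain ⟨_, _, s2, -, r1, h⟩ := run_seq_iff.1 h
  obtain ⟨_, _, s3, -, r2, r3⟩ := run_seq_iff.1 h
  obtain ⟨_, _, s4, -, r4, r5⟩ := run_seq_iff.1 h'
  obtain ⟨-, _, ⟨x, hx, rfl⟩, rfl⟩ := run_ins_iff.1 r1
  obtain ⟨i, i2, o2, e2⟩ := run_loop r2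
  obtain ⟨z1, rfl⟩ := run_zero r3
  obtain ⟨j, i4, o4, e4⟩ := run_loop r4
  obtain ⟨z2, rfl⟩ := run_zero r5
  simp only [CState.get_set] at e2
  have q1 := e2 .clk
  have q2 := e2 .clk2
  have q3 := e2 .bu
  have p1 := e4 .clk
  have p2 := e4 .clk2
  have p3 := e4 .bu
  simp at q1 q2 q3 p1 p2 p3
  exact ⟨i4.trans i2, o4.trans o2, z2, by omega, by omega⟩

theorem exists_run_dblOnce (hs : s.get .clk2 = 0) (h : 0 < s.get .bu) :
    ∃ n t, Run cSem dblOnce s n t ∧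
    t.inp = s.inp ∧ t.out = s.out ∧ t.get .clk2 = 0 ∧ t.get .clk = 2 * s.get .clk ∧
      t.get .bu + 1 = s.get .bu := by
  obtain ⟨x, hx⟩ : ∃ x, s.get .bu = x + 1 := ⟨s.get .bu - 1, by omega⟩
  obtain ⟨_, s2, r2, i2, o2, e2⟩ := exists_run_loop (D := [.clk]) (U := [.clk2, .clk2])
    (s.get .clk) (s := s.set x .bu) (by simp [CState.get_set])
  simp only [CState.get_set] at e2
  have q1 := e2 .clk
  have q2 := e2 .clk2
  have q3 := e2 .bu
  simp at q1 q2 q3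
  obtain ⟨_, s4, r4, i4, o4, e4⟩ := exists_run_loop (D := [.clk2]) (U := [.clk])
    (s2.get .clk2) (s := s2) (by simp)
  have p1 := e4 .clk
  have p2 := e4 .clk2
  have p3 := e4 .bu
  simp at p1 p2 p3
  exact ⟨_, s4, .seq (.seq (.ins ⟨_, ⟨x, hx, rfl⟩, rfl⟩) (.seq r2 (.ins ⟨_, ⟨q1, rfl⟩, rfl⟩)))
    (.seq r4 (.ins ⟨_, ⟨p2, rfl⟩, rfl⟩)), i4.trans i2, o4.trans o2, p2, by omega, by omega⟩

theorem run_dbl (h₁ : s.get .clk = 0) (h2 : s.get .clk2 = 0) (h : Run cSem dbl s n t) :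
    t.inp = s.inp ∧ t.out = s.out ∧ t.get .clk = 2 ^ s.get .bu := by
  obtain ⟨_, _, s1, -, r1, h⟩ := run_seq_iff.1 h
  obtain ⟨_, _, s2, -, r2, r3⟩ := run_seq_iff.1 h
  obtain ⟨-, _, rfl, rfl⟩ := run_ins_iff.1 r1
  obtain ⟨i, o, -, e⟩ := run_star_induction (P := fun t => t.inp = s.inp ∧ t.out = s.out ∧
      t.get .clk2 = 0 ∧ t.get .clk * 2 ^ t.get .bu = 2 ^ s.get .bu) r2
    ⟨rfl, rfl, by simp [CState.get_set, h2],
      by simp [CState.get_set, h₁]⟩ (by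
    rintro x m y ⟨i, o, z, e⟩ hxy
    obtain ⟨i', o', z', e', b⟩ := run_dblOnce z hxy
    refine ⟨i'.trans i, o'.trans o, z', ?_⟩
    rw [← e, e', ← b, pow_succ]
    ring)
  obtain ⟨z, rfl⟩ := run_zero r3
  exact ⟨i, o, by simpa [z] using e⟩

theorem exists_run_dbl (h₁ : s.get .clk = 0) (h2 : s.get .clk2 = 0) : ∃ n t, Run cSem dbl s n t ∧
    t.inp = s.inp ∧ t.out = s.out ∧ t.get .clk = 2 ^ s.get .bu := by
  have key : ∀ (j : ℕ) (s : CState), s.get .bu = j → s.get .clk2 = 0 → ∃ n t,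
      Run cSem (.star dblOnce) s n t ∧ t.get .bu = 0 := by
    intro j
    induction j with
    | zero => exact fun s hs _ => ⟨_, s, .done, hs⟩
    | succ j ih =>
      intro s hs h2
      obtain ⟨_, s1, r, -, -, z, -, b⟩ := exists_run_dblOnce h2 (by omega)
      obtain ⟨_, t, r', e⟩ := ih s1 (by omega) z
      exact ⟨_, t, .more r r', e⟩
  obtain ⟨_, t, r, e⟩ := key _ (s.set (s.get .clk + 1) .clk) rfl (by simp [CState.get_set, h2])
  have r' : Run cSem dbl s _ t := .seq (.ins ⟨_, rfl, rfl⟩) (.seq r (.ins ⟨_, ⟨e, rfl⟩, rfl⟩))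
  exact ⟨_, t, r', run_dbl h₁ h2 r'⟩

theorem Bounded.star {I σ : Type} {sem : I → σ → σ → Prop} {p : Prog I} {s : σ} {B B' : ℕ}
    (hp : Bounded sem p s B) (h : ∀ n t, Run sem p s n t → Bounded sem (.star p) t B') :
    Bounded sem (.star p) s (B + B' + 1) := by
  constructor
  · intro n hn
    cases hn with
    | zero => omega
    | starl h₁ => have := hp.1 _ h₁; omega
    | starr h₁ h2 => have := hp.2 _ _ h₁; have := (h _ _ h₁).1 _ h2; omega
  · intro n t hn
    cases hn with
    | done => omega
    | more h₁ h2 => have := hp.2 _ _ h₁; have := (h _ _ h₁).2 _ _ h2; omega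

/-- The weight that counts the symbols on one stack. -/
def single (k : Full) (a : ℤ) : Full → ℤ := update (fun _ => 0) k a

theorem single_nonneg {k : Full} {a : ℤ} (ha : 0 ≤ a) (j : Full) : 0 ≤ single k a j := by
  unfold single
  by_cases h : j = k
  · subst h; simpa
  · simp [h]

theorem weight_single (k : Full) (a : ℤ) (s : Stacks Full) :
    weight (single k a) s = a * (s k).length := by
  unfold weight single
  rw [Finset.sum_eq_single k]
  · simp
  · intro j _ hj; simp [hj]
  · simp

/-- Each half is measured by its own potential: first only `clk` has weight, then only `clk2`. The
doubling in between is accounted for by the exact effect of the first half. -/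
theorem bounded_dblOnce : ∃ c, ∀ s : CState, s.get .clk2 = 0 →
    Bounded SInstr.sem (dblOnce.bind cProg) (encC s) (c * (s.get .clk + 1)) := by
  have hw := single_nonneg (k := .inr (.ctr .clk)) (a := 5) (by norm_num)
  have hw' := single_nonneg (k := .inr (.ctr .clk2)) (a := 4) (by norm_num)
  have p1 : SPot _ (cProg [.dec .bu]) _ := pot_cProg hw (by simp)
  have p2 : SPot _ ((loop [.clk] [.clk2, .clk2]).bind cProg) 1 :=
    pot_loop hw (by simp [single])
  have p3 : SPot _ ((loop [.clk2] [.clk]).bind cProg) 1 :=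
    pot_loop hw' (by simp [single])
  obtain ⟨c, hc⟩ := (p1.seq (weight_nonneg hw) (p2.seq (weight_nonneg hw)
    (pot_zero hw .clk))).bounded (weight_nonneg hw)
  obtain ⟨c', hc'⟩ := (p3.seq (weight_nonneg hw') (pot_zero hw' .clk2)).bounded (weight_nonneg hw')
  refine ⟨13 + c + c', fun s hs => ((hc (encC s)).seq (B' := 8 * s.get .clk + c')
    fun n τ h => ?_).mono ?_⟩
  · obtain ⟨_, t, r, rfl⟩ := run_bind_cProg
      (p := .seq (.ins [.dec .bu]) (.seq (loop [.clk] [.clk2, .clk2]) (.ins [.zero .clk]))) h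
    refine (hc' _).mono ?_
    obtain ⟨_, _, s2, -, r1, h⟩ := run_seq_iff.1 r
    obtain ⟨_, _, s3, -, r2, r3⟩ := run_seq_iff.1 h
    obtain ⟨-, _, ⟨x, hx, rfl⟩, rfl⟩ := run_ins_iff.1 r1
    obtain ⟨i, i2, o2, e2⟩ := run_loop r2
    obtain ⟨z1, rfl⟩ := run_zero r3
    simp only [CState.get_set] at e2
    have q1 := e2 .clk
    have q2 := e2 .clk2
    simp at q1 q2
    rw [weight_single]
    simp [encC, encRaw]
    omega
  · rw [weight_single]
    have : ((encC s (.inr (.ctr .clk))).length : ℤ) = s.get .clk := by simp [encC, encRaw]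
    rw [this]
    have : (5 * (s.get .clk : ℤ)).toNat = 5 * s.get .clk := by omega
    rw [this]
    nlinarith [Nat.zero_le (c * s.get .clk), Nat.zero_le (c' * s.get .clk)]

/-- The costs of the successive doublings form a geometric series, so they are dominated by the
final value of the clock. -/
theorem bounded_dbl : ∃ c, ∀ s : CState, s.get .clk = 0 → s.get .clk2 = 0 →
    Bounded SInstr.sem (dbl.bind cProg) (encC s) (c * 2 ^ s.get .bu) := by
  obtain ⟨c, hc⟩ := bounded_dblOnce
  have key : ∀ (j : ℕ) (s : CState), s.get .bu = j → s.get .clk2 = 0 → 1 ≤ s.get .clk →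
      Bounded SInstr.sem ((Prog.star dblOnce).bind cProg) (encC s)
        (2 * (c + 1) * (s.get .clk * (2 ^ (j + 1) - 1))) := by
    intro j
    induction j with
    | zero =>
      intro s hj hs h1
      refine ((hc s hs).star (B' := 0) fun n τ h => ?_).mono ?_
      · obtain ⟨_, t, r, rfl⟩ := run_bind_cProg (p := dblOnce) h
        have := (run_dblOnce hs r).2.2.2.2
        omega
      · norm_num
        nlinarith
    | succ j ih =>
      intro s hj hs h1
      refine ((hc s hs).star (B' := 2 * (c + 1) * (2 * s.get .clk * (2 ^ (j + 1) - 1)))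
        fun n τ h => ?_).mono ?_
      · obtain ⟨_, t, r, rfl⟩ := run_bind_cProg (p := dblOnce) h
        obtain ⟨-, -, e1, e2, e3⟩ := run_dblOnce hs r
        rw [← e2]
        exact ih t (by omega) e1 (by omega)
      · obtain ⟨y, hy⟩ : ∃ y, 2 ^ (j + 1) = y + 1 :=
          ⟨2 ^ (j + 1) - 1, by have := Nat.one_le_two_pow (n := j + 1); omega⟩
        rw [pow_succ 2 (j + 1), hy, show (y + 1) * 2 - 1 = 2 * y + 1 by omega,
          show y + 1 - 1 = y by omega]
        nlinarith
  have hw := single_nonneg (k := .inr (.ctr .clk)) (a := 0) le_rfl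
  have p1 : SPot _ (cProg [.inc .clk]) _ := pot_cProg hw (by simp)
  obtain ⟨c1, hc1⟩ := p1.bounded (weight_nonneg hw)
  obtain ⟨c2, hc2⟩ := (pot_zero hw .bu).bounded (weight_nonneg hw)
  refine ⟨c1 + 4 * (c + 1) + c2, fun s h₁ h2 => ((hc1 (encC s)).seq
    (B' := 4 * (c + 1) * 2 ^ s.get .bu + c2) fun n τ h => ?_).mono ?_⟩
  · obtain ⟨t, ht, rfl⟩ := run_cProg h
    obtain ⟨_, rfl, rfl⟩ := ht
    refine ((key _ _ rfl (by simp [CState.get_set, h2]) (by simp [CState.get_set])).seq (B' := c2)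
      fun n τ h => (hc2 τ).mono (by simp [weight_single])).mono ?_
    simp only [CState.get_set, h₁]
    simp only [reduceCtorEq, if_false, if_true, pow_succ]
    have : (0 + 1) * (2 ^ s.get .bu * 2 - 1) ≤ 2 ^ s.get .bu * 2 := by omega
    have := Nat.mul_le_mul_left (2 * (c + 1)) this
    linarith
  · rw [weight_single]
    have := Nat.one_le_two_pow (n := s.get .bu)
    simp
    nlinarith [Nat.mul_le_mul_left c1 this, Nat.mul_le_mul_left c2 this]

end dbl

/-- Move the input to where the program expects it. -/
def flip : Prog (SInstr Full) := mvBits (.inr .tmp) [.inl .inp]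

theorem bounded_flip : ∃ c, ∀ s : Stacks Full,
    Bounded SInstr.sem flip s (c * ((s (.inr .tmp)).length + 1)) := by
  have hw := single_nonneg (k := .inr .tmp) (a := 6) (by norm_num)
  have h0 := weight_nonneg hw
  have hp : ∀ b, SPot (single (.inr .tmp) 6)
      (line (xfer [(.inr .tmp : Full)] [.inl .inp] b)) (-3) := fun b =>
    (pot_line hw _).mono (by simp [xfer, SInstr.net, single])
  obtain ⟨c, hc⟩ := ((((hp false).alt h0 (hp true)).star h0 (by norm_num)).seq h0
    (pot_ins hw (.empty (.inr .tmp)))).bounded h0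
  refine ⟨6 + c, fun s => (hc s).mono ?_⟩
  rw [weight_single]
  have : (6 * ((s (.inr .tmp)).length : ℤ)).toNat = 6 * (s (.inr .tmp)).length := by omega
  rw [this]
  nlinarith [Nat.zero_le (c * (s (.inr .tmp)).length)]

variable {k c1 c2 : ℕ}

variable (k c1 c2) in
/-- The program `V` with a time limit that depends on the input. -/
def timed (V : Prog (SInstr Cell)) : Prog (SInstr Full) :=
  .seq ((clockExp k c1 c2).bind cProg) (.seq (dbl.bind cProg) (.seq flip
    (tickify .inl (.inr (.ctr .clk)) V)))

/-- The stacks when the input is given. -/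
def inputStacks (x : List Bool) : Stacks Full :=
  update (fun _ => []) (.inr .raw) (x.map some)

theorem inputStacks_eq (l : List ℕ) :
    inputStacks (l.flatMap encodeNat) = encC (initC l) := by
  funext j
  rcases j with j | _ | _ | j
  · simp [inputStacks, encC, encRaw]
  · simp [inputStacks, encC, encRaw, initC]
  · simp [inputStacks, encC, encRaw, initC]
  · cases j <;> simp [inputStacks, encC, encRaw, initC]

theorem run_clockExp_bind {n m : ℕ} {es : List Rec} {τ : Stacks Full}
    (h : SRun ((clockExp k c1 c2).bind cProg)
      (inputStacks ((n :: es.flatMap quad).flatMap encodeNat)) m τ) :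
    ∃ K t, IsExp k c1 c2 es K ∧ ExpState n es K t ∧ τ = encC t := by
  rw [inputStacks_eq] at h
  obtain ⟨_, t, r, rfl⟩ := run_bind_cProg h
  obtain ⟨K, h₁, h2⟩ := run_clockExp r
  exact ⟨K, t, h₁, h2, rfl⟩

theorem run_dbl_bind {n m K : ℕ} {es : List Rec} {s : CState} {τ : Stacks Full}
    (hs : ExpState n es K s) (h : SRun (dbl.bind cProg) (encC s) m τ) :
    τ (.inr .tmp) = ((n :: es.flatMap quad).flatMap encodeNat).reverse.map some ∧
      τ (.inr (.ctr .clk)) = List.replicate (2 ^ K) (some true) ∧ ∀ j, τ (.inl j) = [] := by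
  obtain ⟨_, t, r, rfl⟩ := run_bind_cProg h
  obtain ⟨rfl, -, ho, h₁, h2⟩ := hs
  obtain ⟨-, o, e⟩ := run_dbl h₁ h2 r
  simp [encC, encRaw, o, ho, e]

theorem encState_eq (l : List ℕ) (s : Stacks Full) (h : ∀ j, j ≠ Cell.inp → s (.inl j) = [])
    (hi : s (.inl .inp) = (l.flatMap encodeNat).map some) :
    s ∘ .inl = encState 0 ⟨l, fun _ => []⟩ := by
  funext j
  by_cases hj : j = .inp
  · subst hj; simpa [encState] using hi
  · rw [Function.comp_apply, h j hj]
    cases j <;> simp [encState] at hj ⊢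

theorem run_flip {n m : ℕ} {es : List Rec} {s τ : Stacks Full}
    (h₁ : s (.inr .tmp) = ((n :: es.flatMap quad).flatMap encodeNat).reverse.map some)
    (h2 : ∀ j, s (.inl j) = []) (h : SRun flip s m τ) :
    τ ∘ .inl = encState 0 ⟨n :: es.flatMap quad, fun _ => []⟩ ∧
      τ (.inr (.ctr .clk)) = s (.inr (.ctr .clk)) := by
  obtain ⟨bs, -, e1, -, e2, e3⟩ := (run_mvBits_iff (by simp)).1 h
  refine ⟨encState_eq _ _ (fun j hj => ?_) ?_, e3 _ (by simp) (by simp)⟩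
  · rw [e3 _ (by simp) (by simpa using hj), h2]
  · rw [e2 _ (by simp), h2, List.append_nil, ← map_some_injective (h₁.symm.trans e1),
      List.reverse_reverse]

theorem exists_run_flip {s : Stacks Full} {bs : List Bool}
    (h : s (.inr .tmp) = bs.map some) : ∃ m τ, SRun flip s m τ :=
  ⟨_, update (update s (.inl .inp) (bs.reverse.map some ++ s (.inl .inp)))
    (.inr .tmp) [], (run_mvBits_iff (by simp)).2 ⟨bs, rfl, h, by simp, by simp, fun k hk hk' => by
      simp at hk'; simp [hk, hk']⟩⟩

/-- The time limit must hold for all choices, also for those made while the clock is computed;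
therefore `B` is assumed to bound `2 ^ K` for every possible exponent. Nothing is assumed on `V`. -/
theorem bounded_timed (hk : 1 ≤ k) (V : Prog (SInstr Cell)) : ∃ c, ∀ (n : ℕ) (es : List Rec) (B : ℕ),
    (∀ K, IsExp k c1 c2 es K → 2 ^ K ≤ B) →
    Bounded SInstr.sem (timed k c1 c2 V)
      (inputStacks ((n :: es.flatMap quad).flatMap encodeNat))
      (c * (((n :: es.flatMap quad).flatMap encodeNat).length + B + 1)) := by
  have hw := expWeight_nonneg (c1 := c1)
  obtain ⟨_, p⟩ := pot_clockExp (k := k) (c1 := c1) (c2 := c2) hk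
  obtain ⟨b1, hb1⟩ := p.bounded (weight_nonneg hw)
  obtain ⟨b2, hb2⟩ := bounded_dbl
  obtain ⟨b3, hb3⟩ := bounded_flip
  refine ⟨(200 + 2 * c1) + b1 + b2 + b3 + 4, fun n es B hB => ?_⟩
  set x := (n :: es.flatMap quad).flatMap encodeNat with hx
  refine ((hb1 _).seq (B' := b2 * B + (b3 * (x.length + 1) + 4 * B)) fun m τ h => ?_).mono ?_
  · obtain ⟨K, s, h₁, h2, rfl⟩ := run_clockExp_bind h
    refine (((hb2 s h2.2.2.2.1 h2.2.2.2.2).mono ?_).seq fun m τ h => ?_)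
    · rw [h2.1]; exact Nat.mul_le_mul_left _ (hB K h₁)
    · obtain ⟨e1, e2, e3⟩ := run_dbl_bind h2 h
      refine ((hb3 τ).mono ?_).seq fun m τ' h => ?_
      · rw [e1, List.length_map, List.length_reverse]
      · refine (bounded_tickify Sum.inl_injective (by simp) V τ').mono ?_
        rw [(run_flip e1 e3 h).2, e2]
        simpa using hB K h₁
  · have : (weight (expWeight c1) (inputStacks x)).toNat = (200 + 2 * c1) * x.length := by
      unfold inputStacks
      rw [weight_update]
      simp only [weight, List.length_nil, Nat.cast_zero, mul_zero, Finset.sum_const_zero, zero_add,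
        sub_zero, List.length_map, expWeight]
      exact_mod_cast Int.toNat_natCast ((200 + 2 * c1) * x.length)
    rw [this]
    nlinarith [Nat.zero_le (b1 * x.length), Nat.zero_le (b1 * B), Nat.zero_le (b2 * x.length),
      Nat.zero_le (b3 * B), Nat.zero_le ((200 + 2 * c1) * B)]

theorem run_timed {V : Prog (SInstr Cell)} {n m : ℕ} {es : List Rec} {τ : Stacks Full}
    (h : SRun (timed k c1 c2 V)
      (inputStacks ((n :: es.flatMap quad).flatMap encodeNat)) m τ) :
    ∃ m' τ', SRun V (encState 0 ⟨n :: es.flatMap quad, fun _ => []⟩) m' τ' := by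
  obtain ⟨_, _, s1, -, r1, h⟩ := run_seq_iff.1 h
  obtain ⟨_, _, s2, -, r2, h⟩ := run_seq_iff.1 h
  obtain ⟨_, _, s3, -, r3, r4⟩ := run_seq_iff.1 h
  obtain ⟨K, s, h₁, h2, rfl⟩ := run_clockExp_bind r1
  obtain ⟨e1, e2, e3⟩ := run_dbl_bind h2 r2
  obtain ⟨-, m', r⟩ := run_tickify Sum.inl_injective (by simp) V r4
  rw [(run_flip e1 e3 r3).1] at r
  exact ⟨m', _, r⟩

theorem exists_run_timed {V : Prog (SInstr Cell)} {n m K : ℕ} {es : List Rec}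
    {τ : Stacks Cell} (hK : IsExp k c1 c2 es K) (hm : m ≤ 2 ^ K)
    (h : SRun V (encState 0 ⟨n :: es.flatMap quad, fun _ => []⟩) m τ) :
    ∃ m' τ', SRun (timed k c1 c2 V)
      (inputStacks ((n :: es.flatMap quad).flatMap encodeNat)) m' τ' := by
  obtain ⟨_, s, r, hs⟩ := exists_run_clockExp (n := n) hK
  obtain ⟨_, r1⟩ := exists_run_bind_cProg r
  obtain ⟨_, t, r', -⟩ := exists_run_dbl hs.2.2.2.1 hs.2.2.2.2
  obtain ⟨_, r2⟩ := exists_run_bind_cProg r'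
  obtain ⟨e1, e2, e3⟩ := run_dbl_bind hs r2
  obtain ⟨_, s3, r3⟩ := exists_run_flip e1
  obtain ⟨f1, f2⟩ := run_flip e1 e3 r3
  obtain ⟨_, s4, r4, -⟩ := exists_run_tickify Sum.inl_injective (c := (.inr (.ctr .clk) : Full))
    (by simp) h f1 (K := 2 ^ K - m) (by rw [f2, e2]; congr 1; omega)
  rw [inputStacks_eq]
  exact ⟨_, s4, .seq r1 (.seq r2 (.seq r3 r4))⟩

end Prog

/-! ### Machines that check certificates -/

namespace Prog

/-- The constant `C`, the cost of checking, is fixed before the parameters `c1` and `c2` of the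
clock, so the clock can afterwards be made long enough for the checker. -/
theorem exists_checker_machine {k : ℕ} (hk : 1 ≤ k) (init edge : FRule) (rules : List FRule)
    (b : Bool) : ∃ C : ℕ, ∀ c1 c2 : ℕ, ∃ (M : NTM) (c : ℕ),
      (∀ (n : ℕ) (es : List Rec) (B : ℕ), (∀ K, IsExp k c1 c2 es K → 2 ^ K ≤ B) →
        M.RunsInTime ((n :: es.flatMap quad).flatMap encodeNat)
          (2 * (c * (((n :: es.flatMap quad).flatMap encodeNat).length + B + 1) : ℕ) + 2)) ∧
      (∀ (n : ℕ) (es : List Rec),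
        M.CanOutput ((n :: es.flatMap quad).flatMap encodeNat) b →
          ∃ ρ0 E I W, Cert init edge rules (n :: es.flatMap quad) ρ0 E I W) ∧
      (∀ (n : ℕ) (es : List Rec) (ρ0 : Reg → ℕ) (E : List (Reg → ℕ)) (I : List (FRule × (Reg → ℕ)))
        (W : List ℕ) (l N K : ℕ), Cert init edge rules (n :: es.flatMap quad) ρ0 E I W →
        ρ0 31 = 0 → (∀ x ∈ allInst init edge ρ0 E I, ∀ i, (x.2 i).bits.length ≤ l) →
        (∀ w ∈ W, w.bits.length ≤ l) → W.length.bits.length ≤ l → 2 ≤ l →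
        1 + E.length + I.length + W.length ≤ N → IsExp k c1 c2 es K →
        C * (l + 1) * (N * (N.size + 1)) ≤ 2 ^ K →
        M.CanOutput ((n :: es.flatMap quad).flatMap encodeNat) b) ∧
      ∀ x, ¬ M.CanOutput x b → M.AlwaysOutputs x !b := by
  obtain ⟨C1, hC1⟩ := exists_run_checker init edge rules
  obtain ⟨C2, hC2⟩ := exists_run_bind_ruleProg (checker init edge rules)
  refine ⟨C2 * C1, fun c1 c2 => ?_⟩
  obtain ⟨M, h1, h2, h3⟩ := exists_machine
    (timed k c1 c2 ((checker init edge rules).bind ruleProg)) (.inr .raw) b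
  obtain ⟨c, hc⟩ := bounded_timed (c1 := c1) (c2 := c2) hk ((checker init edge rules).bind ruleProg)
  refine ⟨M, c, fun n es B hB => ?_, fun n es h => ?_, ?_, h3⟩
  · have := h1 _ _ (hc n es B hB)
    exact_mod_cast this
  · obtain ⟨_, _, r⟩ := (h2 _).1 h
    obtain ⟨_, _, r⟩ := run_timed r
    obtain ⟨_, _, r, -⟩ := run_bind_ruleProg r
    exact run_checker r
  · intro n es ρ0 E I W l N K hcert h31 hl hW hW' hl2 hN hK hb
    obtain ⟨m, hm, v', r⟩ := hC1 _ _ _ _ _ l N hcert h31 hl hW hW' hl2 hN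
    obtain ⟨m', hm', r⟩ := hC2 _ _ _ _ r
    refine (h2 _).2 (exists_run_timed hK (hm'.trans (le_trans ?_ hb)) r)
    calc C2 * (l + 1) * m ≤ C2 * (l + 1) * (C1 * (N * (N.size + 1))) := Nat.mul_le_mul_left _ hm
      _ = _ := by ring

end Prog

/-! ### Covering a weighted graph by paths between few vertices -/

/-- Greedy choice: by double counting some element lies in at least the fraction `s / |U|` of the
sets. After it is chosen, the logarithm of the number of remaining sets has dropped by at least `s /
|U|`, so the asserted bound drops by at least 1. -/
theorem exists_hitting_set {ι E : Type} [DecidableEq E] {S : ι → Finset E} {U : Finset E} {s : ℝ}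
    (hs : 0 < s) : ∀ F : Finset ι, F.Nonempty → (∀ i ∈ F, S i ⊆ U ∧ s ≤ (S i).card) →
      ∃ T : Finset E, T ⊆ U ∧ (∀ i ∈ F, ∃ e ∈ T, e ∈ S i) ∧
        (T.card : ℝ) ≤ U.card / s * (1 + Real.log F.card) := by
  classical
  intro F
  induction F using Finset.strongInduction with
  | H F ih =>
    intro hF hS
    have hFc : (0 : ℝ) < F.card := by exact_mod_cast hF.card_pos
    have hsum : ∑ e ∈ U, ((F.filter fun i => e ∈ S i).card : ℝ) = ∑ i ∈ F, ((S i).card : ℝ) := by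
      have := Finset.sum_card_bipartiteAbove_eq_sum_card_bipartiteBelow (s := U) (t := F)
        (fun e i => e ∈ S i)
      simp only [Finset.bipartiteAbove, Finset.bipartiteBelow] at this
      have h' : ∀ i ∈ F, U.filter (fun e => e ∈ S i) = S i := fun i hi => by
        ext e; simp only [Finset.mem_filter, and_iff_right_iff_imp]; exact fun h => (hS i hi).1 h
      rw [Finset.sum_congr (s₁ := F) rfl fun i hi => congrArg Finset.card (h' i hi)] at this
      exact_mod_cast this
    have hge : s * F.card ≤ ∑ e ∈ U, ((F.filter fun i => e ∈ S i).card : ℝ) := by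
      rw [hsum, mul_comm, ← nsmul_eq_mul]
      exact Finset.card_nsmul_le_sum _ _ _ fun i hi => (hS i hi).2
    obtain ⟨i0, hi0⟩ := hF
    have hU : s ≤ U.card := (hS i0 hi0).2.trans (by exact_mod_cast Finset.card_le_card (hS i0 hi0).1)
    have hU0 : (0 : ℝ) < U.card := hs.trans_le hU
    obtain ⟨e, heU, he⟩ : ∃ e ∈ U, s * F.card / U.card ≤ (F.filter fun i => e ∈ S i).card := by
      by_contra! h
      have := Finset.sum_lt_sum_of_nonempty (Finset.card_pos.1 (by exact_mod_cast hU0)) h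
      rw [Finset.sum_const, nsmul_eq_mul, mul_div_cancel₀ _ hU0.ne'] at this
      linarith
    have he0 : 0 < s * F.card / U.card := by positivity
    set F' := F.filter fun i => e ∉ S i with hF'
    have hcard : (F'.card : ℝ) ≤ F.card * (1 - s / U.card) := by
      have := Finset.card_filter_add_card_filter_not (s := F) (fun i => e ∈ S i)
      have : ((F.filter fun i => e ∈ S i).card : ℝ) + F'.card = F.card := by exact_mod_cast this
      have h2 : s * F.card / U.card = F.card * (s / U.card) := by ring
      linarith
    have h1 : 1 ≤ U.card / s := (one_le_div hs).2 hU
    by_cases hne : F'.Nonempty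
    · obtain ⟨T, hTU, hT, hTc⟩ := ih F' (Finset.filter_ssubset.2 (by
        have : 0 < (F.filter fun i => e ∈ S i).card := by exact_mod_cast he0.trans_le he
        obtain ⟨i, hi⟩ := Finset.card_pos.1 this
        exact ⟨i, (Finset.mem_filter.1 hi).1, by simpa using (Finset.mem_filter.1 hi).2⟩)) hne
        fun i hi => hS i (Finset.mem_filter.1 hi).1
      refine ⟨insert e T, Finset.insert_subset heU hTU, fun i hi => ?_, ?_⟩
      · by_cases hi' : e ∈ S i
        · exact ⟨e, by simp, hi'⟩
        · obtain ⟨e', h, h'⟩ := hT i (Finset.mem_filter.2 ⟨hi, hi'⟩)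
          exact ⟨e', by simp [h], h'⟩
      · have h3 : (0 : ℝ) < F'.card := by exact_mod_cast hne.card_pos
        have h4 : 0 < 1 - s / U.card := by
          by_contra h; push Not at h; nlinarith
        -- This uses log(1 - t) ≤ -t.
        have h5 : Real.log F'.card ≤ Real.log F.card - s / U.card := by
          have := Real.log_le_log h3 hcard
          rw [Real.log_mul hFc.ne' h4.ne'] at this
          have := Real.log_le_sub_one_of_pos h4
          linarith
        have h6 : ((insert e T).card : ℝ) ≤ T.card + 1 := by
          exact_mod_cast Finset.card_insert_le e T
        have h7 : (U.card / s : ℝ) * (1 + Real.log F'.card) ≤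
            U.card / s * (1 + Real.log F.card) - 1 := by
          have : (U.card / s : ℝ) * (s / U.card) = 1 := by field_simp
          nlinarith
        linarith
    · refine ⟨{e}, by simpa using heU, fun i hi => ⟨e, by simp, ?_⟩, ?_⟩
      · by_contra h
        exact hne ⟨i, Finset.mem_filter.2 ⟨hi, h⟩⟩
      · have : 0 ≤ Real.log F.card := Real.log_natCast_nonneg _
        simp only [Finset.card_singleton, Nat.cast_one]
        nlinarith

/-- A directed graph with edge weights that are natural numbers. -/
structure WGraph (V E : Type) where
  src : E → V
  tgt : E → V
  w : E → ℕ

namespace WGraph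

variable {V E : Type} (g : WGraph V E)

/-- The list of edges is a path. -/
def Path : V → List E → V → Prop
  | u, [], v => u = v
  | u, e :: l, v => g.src e = u ∧ Path (g.tgt e) l v

/-- The length of a path. -/
def len (l : List E) : ℕ := (l.map g.w).sum

/-- Distance. -/
noncomputable def d (u v : V) : ℕ := sInf {s | ∃ l, g.Path u l v ∧ g.len l = s}

variable {g} {u v x z : V} {l l' : List E} {e : E}

@[simp] theorem len_cons : g.len (e :: l) = g.w e + g.len l := by simp [len]

@[simp] theorem len_append : g.len (l ++ l') = g.len l + g.len l' := by simp [len]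

theorem path_append : g.Path u (l ++ l') v ↔ ∃ c, g.Path u l c ∧ g.Path c l' v := by
  induction l generalizing u with
  | nil => simp [Path]
  | cons e l ih => simp [Path, ih, and_assoc]

theorem d_le (h : g.Path u l v) : g.d u v ≤ g.len l := Nat.sInf_le ⟨l, h, rfl⟩

theorem exists_path (hc : ∃ l, g.Path u l v) : ∃ l, g.Path u l v ∧ g.len l = g.d u v := by
  obtain ⟨l, h⟩ := hc
  exact Nat.sInf_mem (s := {s | ∃ l, g.Path u l v ∧ g.len l = s}) ⟨_, l, h, rfl⟩

theorem d_self : g.d u u = 0 := Nat.le_zero.1 (d_le (l := []) rfl)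

theorem len_le {x : ℕ} (hx : ∀ e, g.w e ≤ x) : g.len l ≤ l.length * x := by
  induction l with
  | nil => simp [len]
  | cons e l ih => have := hx e; simp only [len_cons, List.length_cons]; linarith

theorem d_triangle (hc : ∀ u v, ∃ l, g.Path u l v) (c : V) : g.d u v ≤ g.d u c + g.d c v := by
  obtain ⟨l, h, hl⟩ := exists_path (hc u c)
  obtain ⟨l', h', hl'⟩ := exists_path (hc c v)
  rw [← hl, ← hl', ← len_append]
  exact d_le (path_append.2 ⟨c, h, h'⟩)

theorem d_edge (hc : ∀ u v, ∃ l, g.Path u l v) (e : E) (v : V) :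
    g.d (g.src e) v ≤ g.w e + g.d (g.tgt e) v := by
  refine (d_triangle hc (g.tgt e)).trans (Nat.add_le_add_right ?_ _)
  simpa [len] using d_le (g := g) (l := [e]) ⟨rfl, rfl⟩

theorem d_edge' (hc : ∀ u v, ∃ l, g.Path u l v) (e : E) (u : V) :
    g.d u (g.tgt e) ≤ g.d u (g.src e) + g.w e := by
  refine (d_triangle hc (g.src e)).trans (Nat.add_le_add_left ?_ _)
  simpa [len] using d_le (g := g) (l := [e]) ⟨rfl, rfl⟩

/-- A shortest path. -/
def Short (g : WGraph V E) (u : V) (l : List E) (v : V) : Prop := g.Path u l v ∧ g.len l = g.d u v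

theorem Short.tail (hc : ∀ u v, ∃ l, g.Path u l v) (h : g.Short u (e :: l) v) :
    g.Short (g.tgt e) l v := by
  obtain ⟨⟨rfl, h⟩, h'⟩ := h
  have := d_edge hc e v
  have := d_le h
  rw [len_cons] at h'
  exact ⟨h, by omega⟩

/-- A repeated edge would allow a shortcut from its first occurrence to a later one, strictly
shorter since weights are positive. Distinct edges are needed because a set of edges is to be
counted. -/
theorem Short.nodup (hc : ∀ u v, ∃ l, g.Path u l v) (hw : ∀ e, 1 ≤ g.w e) :
    ∀ {l : List E} {u : V}, g.Short u l v → l.Nodup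
  | [], _, _ => List.nodup_nil
  | e :: l, u, h => by
    refine List.nodup_cons.2 ⟨fun he => ?_, nodup hc hw (h.tail hc)⟩
    obtain ⟨l1, l2, rfl⟩ := List.append_of_mem he
    obtain ⟨c, -, hp⟩ := path_append.1 (h.tail hc).1
    have := d_le (l := e :: l2) (u := u) ⟨h.1.1, hp.2⟩
    have h' := h.2
    have := hw e
    simp only [len_cons, len_append] at *
    omega

section cover

variable [DecidableEq E] {k η B y R r : ℕ}

/-- The first `η / y + 1` edges work: at most `η / y` edges, of weight at most `y` each, precede the
source of any of them, and a path longer than `η` has that many edges. -/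
theorem Short.exists_first (hc : ∀ u v, ∃ l, g.Path u l v) (hw : ∀ e, 1 ≤ g.w e)
    (hy : ∀ e, g.w e ≤ y) (h : g.Short x l z) (hη : η < g.len l) :
    ∃ S : Finset E, S.card = η / y + 1 ∧ ∀ e ∈ S, e ∈ l ∧ g.d x (g.src e) ≤ η := by
  have hlen : η / y + 1 ≤ l.length := by
    have := len_le (l := l) hy
    by_contra hlt
    have := Nat.mul_le_mul_right y (show l.length ≤ η / y by omega)
    have := Nat.div_mul_le_self η y
    omega
  refine ⟨(l.take (η / y + 1)).toFinset, ?_, fun e he => ?_⟩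
  · rw [List.toFinset_card_of_nodup ((h.nodup hc hw).sublist (List.take_sublist _ _)),
      List.length_take]
    omega
  · have he := List.mem_toFinset.1 he
    refine ⟨List.mem_of_mem_take he, ?_⟩
    obtain ⟨l1, l2, hl⟩ := List.append_of_mem he
    have hp := h.1
    rw [← List.take_append_drop (η / y + 1) l, hl, List.append_assoc, path_append] at hp
    obtain ⟨c, h₁, h₂, -⟩ := hp
    have h₃ := congrArg List.length hl
    rw [List.length_take, List.length_append, List.length_cons] at h₃
    rw [h₂]
    calc g.d x c ≤ g.len l1 := d_le h₁
      _ ≤ l1.length * y := len_le hy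
      _ ≤ η / y * y := Nat.mul_le_mul_right y (by omega)
      _ ≤ η := Nat.div_mul_le_self η y

/-- Walk along the shortest path until the rest beyond the current edge has length at most `R`, and
take the first edges from there on. If the path is at most `r + R - η` long, this place is reached
while at least `η` of the budget `r` is left, which is what these edges may use. -/
theorem exists_near (hc : ∀ u v, ∃ l, g.Path u l v) (hw : ∀ e, 1 ≤ g.w e)
    (hy : ∀ e, g.w e ≤ y) (hR : η ≤ R) : ∀ {l : List E} {x : V} {r : ℕ},
    g.Short x l z → η < g.len l → η ≤ r → η + g.len l ≤ r + R →
    ∃ S : Finset E, S.card = η / y + 1 ∧ ∀ e ∈ S, g.d x (g.src e) ≤ r ∧ g.d (g.tgt e) z ≤ R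
  | [], x, r, _, hη, _, _ => by simp [len] at hη
  | e :: l, x, r, h, hη, hr, hs => by
    rw [len_cons] at hs
    by_cases hl : g.len l ≤ R
    · obtain ⟨S, hS, hS'⟩ := h.exists_first hc hw hy hη
      refine ⟨S, hS, fun f hf => ⟨(hS' f hf).2.trans hr, ?_⟩⟩
      obtain ⟨l1, l2, hl'⟩ := List.append_of_mem (hS' f hf).1
      have hp := h.1
      rw [hl', path_append] at hp
      obtain ⟨c, -, -, hp⟩ := hp
      refine (d_le hp).trans (le_trans ?_ hl)
      cases l1 with
      | nil => simp at hl'; rw [hl'.2]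
      | cons e' l1 =>
        simp at hl'
        rw [hl'.2, len_append, len_cons]; omega
    -- The rest is longer than `R ≥ η`, and by the bound on the total length the weight of the edge
    -- is less than `r - η`; so the hypotheses survive the step.
    · obtain ⟨S, hS, hS'⟩ := exists_near hc hw hy hR (h.tail hc) (r := r - g.w e) (by omega)
        (by omega) (by omega)
      refine ⟨S, hS, fun f hf => ⟨?_, (hS' f hf).2⟩⟩
      have h₁ := (hS' f hf).1
      have h₂ := d_edge hc e (g.src f)
      rw [h.1.1] at h₂
      omega

/-- The ball argument described at the beginning. The last two conclusions bound the number of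
pairs, and the number of pairs times `R2` times `η / y + 1`; the factor `η / y + 1` is the gain that
later pays for paths with many edges. `R2` appears as a quantity of its own because it vanishes in
the degenerate case, where this gain is not available. -/
theorem exists_cover [Fintype V] [Fintype E] [Nonempty V] (hc : ∀ u v, ∃ l, g.Path u l v)
    (hw : ∀ e, 1 ≤ g.w e) (hy : ∀ e, g.w e ≤ y) (hk : 1 ≤ k)
    (hE : 1 ≤ Fintype.card E) (hB : ∀ u v, g.d u v ≤ B) :
    ∃ (H W : Finset V) (R1 R2 R3 : ℕ), (∀ u, ∃ h ∈ H, g.d u h ≤ R1) ∧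
      (∀ z, ∃ x ∈ W, g.d x z ≤ R3) ∧ (∀ h ∈ H, ∀ x ∈ W, g.d h x ≤ R2) ∧
      R1 ≤ η + B ∧ R2 ≤ B ∧ R3 ≤ η + B ∧
      k * (R1 + R2 + R3) + B ≤ k * (2 * B + 2 * η + 1) ∧
      (H.card * W.card : ℝ) ≤ 2 * (Fintype.card E : ℝ) ^ (1 + 1 / (k : ℝ)) *
        (1 + Real.log (Fintype.card V)) ^ 2 ∧
      (H.card * W.card : ℝ) * R2 * (η / y + 1 : ℕ) ≤
        2 * (Fintype.card E : ℝ) ^ (1 + 1 / (k : ℝ)) * (1 + Real.log (Fintype.card V)) ^ 2 * B := by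
  classical
  set m : ℝ := (Fintype.card E : ℝ) with hm
  set lg : ℝ := 1 + Real.log (Fintype.card V) with hlg
  have hm1 : 1 ≤ m := Nat.one_le_cast.2 hE
  have hm0 : 0 < m := by linarith
  have hlg1 : 1 ≤ lg := by have := Real.log_natCast_nonneg (Fintype.card V); linarith
  have hk0 : (0 : ℝ) < k := by exact_mod_cast hk
  have hpow : ∀ {a : ℝ}, 0 ≤ a → 1 ≤ m ^ a := fun ha => Real.one_le_rpow hm1 ha
  have hbig : 1 ≤ m ^ (1 + 1 / (k : ℝ)) := hpow (by positivity)
  -- If one vertex is within `η` of all others, it serves alone as both sets, at total cost `B + η`.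
  by_cases hcase : ∃ x, ∀ z, g.d x z ≤ η
  · obtain ⟨x, hx⟩ := hcase
    refine ⟨{x}, {x}, B, 0, η, by simp [hB], by simpa using hx, by simp [d_self], by omega,
      by omega, by omega, by nlinarith, ?_, by simp; positivity⟩
    simp only [Finset.card_singleton, Nat.cast_one]
    nlinarith [mul_le_mul hbig (one_le_pow₀ hlg1 (n := 2)) zero_le_one (by linarith)]
  push Not at hcase
  set L : ℕ := η / y + 1 with hL
  have hL0 : (0 : ℝ) < L := by rw [hL]; positivity
  let ball : V → ℕ → Finset E := fun x r => Finset.univ.filter fun e => g.d x (g.src e) ≤ r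
  have hball : ∀ {x r e}, e ∈ ball x r ↔ g.d x (g.src e) ≤ r := by simp [ball]
  -- All balls of the `i`-th radius are large.
  let P : ℕ → Prop := fun i => ∀ x, (L : ℝ) * m ^ ((i : ℝ) / k) ≤ (ball x (η + i * B / k)).card
  have hP0 : P 0 := by
    intro x
    obtain ⟨z, hz⟩ := hcase x
    obtain ⟨l, hl⟩ := exists_path (hc x z)
    obtain ⟨S, hS, hS'⟩ := Short.exists_first hc hw hy hl (by rw [hl.2]; exact hz)
    simp only [Nat.cast_zero, zero_div, Real.rpow_zero, mul_one, Nat.zero_mul, Nat.zero_div,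
      Nat.add_zero]
    rw [hL, ← hS]
    exact_mod_cast Finset.card_le_card fun e he => hball.2 (hS' e he).2
  -- Otherwise largeness would propagate from `i = 0` up to `k`, where a ball would have more than
  -- `L * m` edges.
  obtain ⟨i, hik, hPi, x, hx⟩ : ∃ i < k, P i ∧ ∃ x,
      ((ball x (η + (i + 1) * B / k)).card : ℝ) ≤ L * m ^ (((i + 1 : ℕ) : ℝ) / k) := by
    by_contra! hcon
    have hall : ∀ i, i ≤ k → P i := by
      intro i
      induction i with
      | zero => exact fun _ => hP0
      | succ i ih => exact fun hi x => (hcon i (by omega) (ih (by omega)) x).le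
    obtain ⟨x⟩ := ‹Nonempty V›
    have h₁ := hcon (k - 1) (by omega) (hall _ (by omega)) x
    rw [Nat.sub_add_cancel hk, div_self hk0.ne', Real.rpow_one] at h₁
    have h₂ : ((ball x (η + k * B / k)).card : ℝ) ≤ m := by
      rw [hm]; exact_mod_cast Finset.card_le_univ _
    have : (1 : ℝ) ≤ L := by rw [hL]; push_cast; linarith [Nat.cast_nonneg (α := ℝ) (η / y)]
    nlinarith
  obtain ⟨q, hq⟩ : ∃ q, q = (i + 1) * B / k := ⟨_, rfl⟩
  obtain ⟨p, hp⟩ : ∃ p, p = i * B / k := ⟨_, rfl⟩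
  rw [← hq] at hx
  simp only [P, ← hp] at hPi
  -- All balls of radius `η + p` are large, so few edges hit them; the sources of these edges form
  -- `H`.
  obtain ⟨T, -, hT, hTc⟩ := exists_hitting_set (S := fun u => ball u (η + p))
    (U := Finset.univ) (s := L * m ^ ((i : ℝ) / k)) (by positivity) (Finset.univ : Finset V)
    Finset.univ_nonempty fun u _ => ⟨Finset.subset_univ _, hPi u⟩
  have hqB : q ≤ B := hq ▸ Nat.div_le_of_le_mul (Nat.mul_le_mul_right _ (by omega))
  have hpB : p ≤ B := hp ▸ Nat.div_le_of_le_mul (Nat.mul_le_mul_right _ (by omega))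
  -- The budgets `η + q` and `η + B - q` add up to `B + 2η`, which leaves the surplus `η` required
  -- by `exists_near`, as the path has length at most `B`.
  have hnear : ∀ z : V, η < g.d x z → ∃ S : Finset E, S.card = L ∧
      ∀ e ∈ S, g.d x (g.src e) ≤ η + q ∧ g.d (g.tgt e) z ≤ η + B - q := by
    intro z hz
    obtain ⟨l, hl⟩ := exists_path (hc x z)
    refine exists_near hc hw hy (by omega) hl (by rw [hl.2]; exact hz) (by omega) ?_
    have := hB x z
    rw [hl.2]
    omega
  choose! S hS hS' using hnear
  obtain ⟨z0, hz0⟩ := hcase x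
  -- All these sets lie in the single small ball of `x`, and it is the size of this ball that enters
  -- the bound. The vertices within `η` of `x` are served by `x` itself.
  obtain ⟨T', -, hT', hTc'⟩ := exists_hitting_set (S := S) (U := ball x (η + q)) (s := L) hL0
    (Finset.univ.filter fun z => η < g.d x z) ⟨z0, by simpa using hz0⟩ fun z hz =>
      ⟨fun e he => hball.2 (hS' z (Finset.mem_filter.1 hz).2 e he).1,
        by rw [hS z (Finset.mem_filter.1 hz).2]⟩
  have hcard : ((T.image g.src).card * (insert x (T'.image g.tgt)).card : ℝ) * L ≤
      2 * m ^ (1 + 1 / (k : ℝ)) * lg ^ 2 := by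
    have h₁ : ((T.image g.src).card : ℝ) * (L * m ^ ((i : ℝ) / k)) ≤ m * lg := by
      refine (mul_le_mul_of_nonneg_right (Nat.cast_le.2 Finset.card_image_le) (by positivity)).trans
        ((mul_le_mul_of_nonneg_right hTc (by positivity)).trans (le_of_eq ?_))
      rw [Finset.card_univ, Finset.card_univ, ← hm, ← hlg]
      field_simp
    have h₂ : ((insert x (T'.image g.tgt)).card : ℝ) ≤ 2 * (m ^ (((i + 1 : ℕ) : ℝ) / k) * lg) := by
      have a1 : ((insert x (T'.image g.tgt)).card : ℝ) ≤ T'.card + 1 := by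
        exact_mod_cast (Finset.card_insert_le _ _).trans (Nat.add_le_add_right Finset.card_image_le 1)
      have a2 : ((ball x (η + q)).card : ℝ) / L ≤ m ^ (((i + 1 : ℕ) : ℝ) / k) := by
        rw [div_le_iff₀ hL0, mul_comm]; exact hx
      have a3 : 1 + Real.log (Finset.univ.filter fun z => η < g.d x z).card ≤ lg := by
        rw [hlg]
        gcongr
        · exact_mod_cast Finset.card_pos.2 ⟨z0, by simpa using hz0⟩
        · exact Finset.card_le_univ _
      have a4 : 1 ≤ m ^ (((i + 1 : ℕ) : ℝ) / k) := hpow (by positivity)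
      have a5 : (T'.card : ℝ) ≤ m ^ (((i + 1 : ℕ) : ℝ) / k) * lg :=
        hTc'.trans (mul_le_mul a2 a3 (by
          have := Real.log_natCast_nonneg (Finset.univ.filter fun z => η < g.d x z).card
          linarith) (by positivity))
      nlinarith
    -- The two sizes depend on `i`, but in their product only the gap of one level, the factor `m ^
    -- (1 / k)`, remains.
    have h₃ : m ^ (((i + 1 : ℕ) : ℝ) / k) = m ^ ((i : ℝ) / k) * m ^ (1 / (k : ℝ)) := by
      rw [← Real.rpow_add hm0]; congr 1; push_cast; ring
    rw [Real.rpow_add hm0, Real.rpow_one]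
    have h₄ : (0 : ℝ) < m ^ (1 / (k : ℝ)) := by positivity
    calc ((T.image g.src).card * (insert x (T'.image g.tgt)).card : ℝ) * L
        ≤ ((T.image g.src).card * (2 * (m ^ (((i + 1 : ℕ) : ℝ) / k) * lg)) : ℝ) * L := by gcongr
      _ = ((T.image g.src).card * (L * m ^ ((i : ℝ) / k))) * (2 * lg * m ^ (1 / (k : ℝ))) := by
        rw [h₃]; ring
      _ ≤ (m * lg) * (2 * lg * m ^ (1 / (k : ℝ))) := by gcongr
      _ = _ := by ring
  refine ⟨T.image g.src, insert x (T'.image g.tgt), η + p, B, η + B - q, fun u => ?_,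
    fun z => ?_, fun h _ w _ => hB h w, by omega, le_rfl, by omega, ?_, ?_, ?_⟩
  · obtain ⟨e, he, he'⟩ := hT u (Finset.mem_univ _)
    exact ⟨g.src e, Finset.mem_image_of_mem _ he, hball.1 he'⟩
  · by_cases hz : η < g.d x z
    · obtain ⟨e, he, he'⟩ := hT' z (by simpa using hz)
      exact ⟨g.tgt e, by simp only [Finset.mem_insert, Finset.mem_image]; exact .inr ⟨e, he, rfl⟩,
        (hS' z hz e he').2⟩
    · exact ⟨x, by simp, by omega⟩
  -- Because of rounding, `q - p` may fall short of `B / k`, but by less than 1; this is the `+ 1`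
  -- in the bound on the radii.
  · have h₁ := Nat.div_mul_le_self (i * B) k
    have h₂ := Nat.lt_div_mul_add (a := (i + 1) * B) (b := k) (by omega)
    rw [← hq] at h₂
    rw [← hp] at h₁
    obtain ⟨t, ht⟩ : ∃ t, t + q = B := ⟨B - q, by omega⟩
    rw [show η + B - q = η + t by omega]
    have : k * t + k * q = k * B := by rw [← ht]; ring
    nlinarith
  · refine le_trans ?_ hcard
    have : (1 : ℝ) ≤ L := by rw [hL]; push_cast; linarith [Nat.cast_nonneg (α := ℝ) (η / y)]
    exact le_mul_of_one_le_right (by positivity) this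
  · rw [mul_right_comm]
    exact mul_le_mul_of_nonneg_right hcard (by positivity)

end cover

end WGraph

/-! ### Certificates for large distances -/

namespace Prog

/-- Registers with constants. -/
def consts : List (Reg × ℕ) :=
  [(20, 0), (21, 1), (22, 2), (23, 3), (24, 4), (25, 5), (26, 6), (27, 7), (28, 8), (31, 0)]

/-- An assignment of values to registers. -/
def vals (l : List ℕ) : Reg → ℕ := fun i =>
  if 20 ≤ i.val ∧ i.val ≤ 28 then i.val - 20 else l.getD i.val 0

theorem vals_le {l : List ℕ} {X : ℕ} (hX : 8 ≤ X) (h : ∀ x ∈ l, x ≤ X) (i : Reg) : vals l i ≤ X := by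
  unfold vals
  split_ifs with hi
  · omega
  · rw [List.getD_eq_getElem?_getD]
    cases hx : l[i.val]? with
    | none => simp
    | some x => exact h x (List.mem_of_getElem? hx)

/-- Rules for multiplication: the fact `(4, x, y, z)` means that `z` is the product of `x` and `y`. -/
def mulRules : List FRule :=
  [⟨[], consts, [(24, 20, 0, 20)], []⟩,
   ⟨[(0, 0, 3), (2, 2, 4)], consts, [(24, 3, 1, 4)], [(24, 0, 1, 2)]⟩,
   ⟨[(0, 0, 3), (3, 21, 5), (2, 2, 4), (4, 1, 6)], consts, [(24, 5, 1, 6)], [(24, 0, 1, 2)]⟩]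

/-- Instances of rules that are correct if the facts satisfying `F` have been established, with all
numbers bounded by `X`. -/
def Fine (rules : List FRule) (F : Rec → Prop) (X : ℕ) (I : List (FRule × (Reg → ℕ))) : Prop :=
  ∀ x ∈ I, x.1 ∈ rules ∧ x.1.Holds x.2 ∧ (∀ i, x.2 i ≤ X) ∧ ∀ f ∈ FRule.reqs x, F f

/-- Doubling along the binary digits of `x`, one instance for each digit and one for zero. The bound
`8 ≤ X` leaves room for the constants in the registers. -/
theorem exists_mul (X y : ℕ) (hX : 8 ≤ X) (hy : y ≤ X) (x : ℕ) : x ≤ X → x * y ≤ X →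
    ∃ I, I.length ≤ x.size + 1 ∧ (∃ i ∈ I, (4, x, y, x * y) ∈ FRule.provs i) ∧
      ∀ F, (∀ i ∈ I, ∀ f ∈ FRule.provs i, F f) → Fine mulRules F X I := by
  induction x using Nat.binaryRec' with
  | zero =>
    intro _ _
    refine ⟨[(⟨[], consts, [(24, 20, 0, 20)], []⟩, vals [y])], by simp,
      ⟨_, List.mem_singleton_self _, by simp [FRule.provs, instRec, vals]⟩, fun F _ i hi => ?_⟩
    obtain rfl := List.mem_singleton.1 hi
    exact ⟨by simp [mulRules], by simp [FRule.Holds, consts, vals],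
      vals_le hX (by simpa using hy), by simp [FRule.reqs]⟩
  | bit b x hb ih =>
    intro hx hxy
    have hne : Nat.bit b x ≠ 0 := by
      cases b
      · simp only [Nat.bit_false]; intro h; exact absurd (hb (by omega)) (by simp)
      · simp
    rw [Nat.size_bit hne]
    have hxb : 2 * x ≤ Nat.bit b x := by
      cases b <;> simp [Nat.bit]
    have hxy2 : 2 * x * y ≤ X := (Nat.mul_le_mul_right y hxb).trans hxy
    have hx1 : x * y ≤ X := by nlinarith
    obtain ⟨I, hI, ⟨i0, hi0, hi0'⟩, hF⟩ := ih (by omega) hx1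
    cases b
    · refine ⟨(⟨[(0, 0, 3), (2, 2, 4)], consts, [(24, 3, 1, 4)], [(24, 0, 1, 2)]⟩,
        vals [x, y, x * y, 2 * x, 2 * (x * y)]) :: I, by simpa using hI,
        ⟨_, List.mem_cons_self, by simp [FRule.provs, instRec, vals, mul_assoc]⟩, fun F h i hi => ?_⟩
      rcases List.mem_cons.1 hi with rfl | hi
      · refine ⟨by simp [mulRules], by simp [FRule.Holds, consts, vals]; omega, vals_le hX ?_, ?_⟩
        · simp only [Nat.bit_false] at hx hxy
          simp only [List.forall_mem_cons, List.not_mem_nil, false_imp_iff, implies_true, and_true]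
          exact ⟨by omega, hy, hx1, hx, by rwa [← mul_assoc]⟩
        · intro f hf
          obtain rfl : f = (4, x, y, x * y) := by simpa [FRule.reqs, instRec, vals] using hf
          exact h i0 (by simp [hi0]) _ hi0'
      · exact hF F (fun i hi => h i (by simp [hi])) i hi
    · refine ⟨(⟨[(0, 0, 3), (3, 21, 5), (2, 2, 4), (4, 1, 6)], consts, [(24, 5, 1, 6)],
        [(24, 0, 1, 2)]⟩, vals [x, y, x * y, 2 * x, 2 * (x * y), 2 * x + 1, (2 * x + 1) * y]) :: I,
        by simpa using hI, ⟨_, List.mem_cons_self, by simp [FRule.provs, instRec, vals]⟩,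
        fun F h i hi => ?_⟩
      rcases List.mem_cons.1 hi with rfl | hi
      · refine ⟨by simp [mulRules], by simp [FRule.Holds, consts, vals]; refine ⟨?_, ?_, ?_⟩ <;> ring,
          vals_le hX ?_, ?_⟩
        · simp only [Nat.bit_true] at hx hxy
          simp only [List.forall_mem_cons, List.not_mem_nil, false_imp_iff, implies_true, and_true]
          exact ⟨by omega, hy, hx1, by omega, by rwa [← mul_assoc], hx, hxy⟩
        · intro f hf
          obtain rfl : f = (4, x, y, x * y) := by simpa [FRule.reqs, instRec, vals] using hf
          exact h i0 (by simp [hi0]) _ hi0'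
      · exact hF F (fun i hi => h i (by simp [hi])) i hi

/-- What the rules for multiplication allow. -/
def MulStep (F : Rec → Prop) (x y z : ℕ) : Prop :=
  x = 0 ∧ z = 0 ∨ ∃ x' z', F (4, x', y, z') ∧
    (x = x' + x' ∧ z = z' + z' ∨ x = x' + x' + 1 ∧ z = z' + z' + y)

/-- Records may support each other circularly, so the induction is on `x + z`, which halving
decreases. The one exception is the doubling of zero, and there the equation holds anyway. -/
theorem eq_mul_of_mulStep {F : Rec → Prop} (hF : ∀ x y z, F (4, x, y, z) → MulStep F x y z)
    {x y z : ℕ} (h : F (4, x, y, z)) : z = x * y := by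
  induction hn : x + z using Nat.strong_induction_on generalizing x z with
  | _ n ih =>
    rcases hF _ _ _ h with ⟨rfl, rfl⟩ | ⟨x', z', h', ⟨rfl, rfl⟩ | ⟨rfl, rfl⟩⟩
    · simp
    · by_cases h0 : x' + z' = 0
      · obtain ⟨rfl, rfl⟩ : x' = 0 ∧ z' = 0 := by omega
        simp
      · have := ih (x' + z') (by omega) h' rfl
        subst this; ring
    · have := ih (x' + z') (by omega) h' rfl
      subst this; ring

theorem mulStep_of_prov {F : Rec → Prop} {i : FRule × (Reg → ℕ)} (hi : i.1 ∈ mulRules)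
    (hh : i.1.Holds i.2) (hr : ∀ f ∈ FRule.reqs i, F f) {f : Rec} (hf : f ∈ FRule.provs i) :
    ∃ x y z, f = (4, x, y, z) ∧ MulStep F x y z := by
  obtain ⟨r, ρ⟩ := i
  simp only [mulRules, List.mem_cons, List.not_mem_nil, or_false] at hi
  rcases hi with rfl | rfl | rfl <;>
    simp [FRule.Holds, consts, FRule.provs, FRule.reqs, instRec] at hh hr hf
  · simp only [hh] at hf
    exact ⟨_, _, _, hf, .inl ⟨rfl, rfl⟩⟩
  · simp only [hh] at hf hr
    exact ⟨_, _, _, hf, .inr ⟨_, _, hr, .inl ⟨hh.1.1.symm, hh.1.2.symm⟩⟩⟩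
  · obtain ⟨⟨h1, h2, h3, h4⟩, h5⟩ := hh
    simp only [h5] at hf hr h2
    exact ⟨_, _, _, hf, .inr ⟨_, _, hr, .inr ⟨by omega, by omega⟩⟩⟩

theorem mem_enumFacts {W : List ℕ} {f : Rec} :
    f ∈ enumFacts W ↔ ∃ j x, f = (3, j, x, 0) ∧ W[j]? = some x := by
  simp only [enumFacts, List.mem_map, Prod.exists, List.mem_zipIdx_iff_getElem?]
  constructor
  · rintro ⟨x, j, h, rfl⟩; exact ⟨j, x, rfl, h⟩
  · rintro ⟨j, x, rfl, h⟩; exact ⟨x, j, h, rfl⟩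

theorem records_eq {n : ℕ} {es : List Rec} {ρ0 : Reg → ℕ} {E : List (Reg → ℕ)}
    (h : n :: es.flatMap quad = ρ0 0 :: E.flatMap fun ρ => [ρ 0, ρ 1, ρ 2, ρ 3]) :
    es = E.map fun ρ => (ρ 0, ρ 1, ρ 2, ρ 3) := by
  replace h := (List.cons.inj h).2
  induction es generalizing E with
  | nil => cases E <;> simp at h ⊢
  | cons e es ih =>
    cases E with
    | nil => simp [quad] at h
    | cons ρ E =>
      simp only [List.flatMap_cons, quad, List.cons_append, List.nil_append, List.cons.injEq] at h
      rw [List.map_cons, ← ih h.2.2.2.2, ← h.1, ← h.2.1, ← h.2.2.1, ← h.2.2.2.1]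

/-- The rule applied to the edges in a certificate for a large distance. -/
def farEdge : FRule :=
  ⟨[(14, 16, 15), (6, 4, 8), (7, 9, 8)], consts, [(20, 0, 20, 20)],
    [(23, 0, 6, 20), (23, 1, 7, 20), (25, 5, 20, 20), (24, 3, 4, 14), (24, 2, 5, 15)]⟩

/-- The initial rule in a certificate for the existence of a distance that is at least `p / q`. -/
def farInit (p q : ℕ) : FRule :=
  ⟨[(3, 6, 4), (15, 16, 14), (17, 21, 5)], consts ++ [(12, q), (13, p)], [(25, 5, 20, 20)],
    [(20, 1, 20, 20), (20, 2, 20, 20), (23, 1, 3, 20), (23, 2, 4, 20), (24, 12, 6, 14),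
      (24, 13, 5, 15)]⟩

/-- In `farEdge`, register 4 is the rounded weight, 5 the scale `N`, 6 and 7 are the labels of
source and target, 14 and 15 the products compared, and 16 and 9 the slacks by which inequalities
are expressed as additions. In `farInit`, register 6 is the difference of two labels, and 17 shows
that `N` is positive. -/
theorem Cert.far {p q n : ℕ} {es : List Rec} {ρ0 : Reg → ℕ} {E : List (Reg → ℕ)}
    {I : List (FRule × (Reg → ℕ))} {W : List ℕ}
    (h : Cert (farInit p q) farEdge mulRules (n :: es.flatMap quad) ρ0 E I W) :
    ∃ (N t : ℕ) (φ : ℕ → ℕ), 1 ≤ N ∧ p * N ≤ q * t ∧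
      (∀ e ∈ es, ∃ w, e.2.2.2 * w ≤ e.2.2.1 * N ∧ φ e.2.1 ≤ φ e.1 + w) ∧
      ∃ e ∈ es, ∃ f ∈ es, φ f.1 = φ e.1 + t := by
  obtain ⟨hI, hE, hR, hinp, hsub⟩ := h
  have hes := records_eq hinp
  set F : Rec → Prop := fun f => f ∈ facts (allInst (farInit p q) farEdge ρ0 E I) W with hF
  have hinit := hsub (farInit p q, ρ0) (mem_allInst.2 (.inl rfl))
  simp [FRule.Holds, farInit, consts, FRule.reqs, instRec] at hI hinit
  obtain ⟨⟨a1, a2, a3⟩, c0⟩ := hI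
  -- The first entry of a record tells which kind of rule provided it; what follows reads off its
  -- meaning.
  have hcases : ∀ f, F f → f = (5, ρ0 5, 0, 0) ∨ (∃ ρ ∈ E, f = (0, ρ 0, 0, 0)) ∨
      (∃ j x, f = (3, j, x, 0) ∧ W[j]? = some x) ∨
      ∃ x y z, f = (4, x, y, z) ∧ MulStep F x y z := by
    intro f hf
    rcases mem_facts.1 hf with ⟨i, hi, hf⟩ | hf
    · rcases mem_allInst.1 hi with rfl | ⟨ρ, hρ, rfl⟩ | hi'
      · simp [farInit, FRule.provs, instRec, c0] at hf
        exact .inl hf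
      · have := hE ρ hρ
        simp [FRule.Holds, farEdge, consts] at this
        simp [farEdge, FRule.provs, instRec, this] at hf
        exact .inr (.inl ⟨ρ, hρ, hf⟩)
      · exact .inr (.inr (.inr (mulStep_of_prov (hR i hi').1 (hR i hi').2 (hsub i hi) hf)))
    · exact .inr (.inr (.inl (mem_enumFacts.1 hf)))
  have hM : ∀ x y z, F (4, x, y, z) → z = x * y := fun x y z => eq_mul_of_mulStep (by
    intro x y z h
    rcases hcases _ h with h | ⟨_, _, h⟩ | ⟨_, _, h, _⟩ | ⟨_, _, _, h, h'⟩ <;> simp at h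
    obtain ⟨rfl, rfl, rfl⟩ := h
    exact h')
  have hP : ∀ j x, F (3, j, x, 0) → W.getD j 0 = x := by
    intro j x h
    rcases hcases _ h with h | ⟨_, _, h⟩ | ⟨_, _, h, h'⟩ | ⟨_, _, _, h, h'⟩ <;> simp at h
    obtain ⟨rfl, rfl⟩ := h
    simp [List.getD_eq_getElem?_getD, h']
  -- Only the initial rule provides such a record, so all edges are forced to use the same scale.
  have hG : ∀ N, F (5, N, 0, 0) → N = ρ0 5 := by
    intro N h
    rcases hcases _ h with h | ⟨_, _, h⟩ | ⟨_, _, h, _⟩ | ⟨_, _, _, h, h'⟩ <;> simp at h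
    exact h
  have hV : ∀ u, F (0, u, 0, 0) → ∃ e ∈ es, e.1 = u := by
    intro u h
    rcases hcases _ h with h | ⟨ρ, hρ, h⟩ | ⟨_, _, h, _⟩ | ⟨_, _, _, h, h'⟩ <;> simp at h
    exact ⟨_, by rw [hes]; exact List.mem_map_of_mem hρ, h.symm⟩
  simp only [c0] at hinit a3
  obtain ⟨r6, r5, r4, r3, r2, r1⟩ := hinit
  refine ⟨ρ0 5, ρ0 6, fun j => W.getD j 0, by omega, ?_, fun e he => ?_, ?_⟩
  · rw [← hM _ _ _ r5, ← hM _ _ _ r6]; omega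
  · rw [hes] at he
    obtain ⟨ρ, hρ, rfl⟩ := List.mem_map.1 he
    have h1 := hE ρ hρ
    have h2 := hsub (farEdge, ρ) (mem_allInst.2 (.inr (.inl ⟨ρ, hρ, rfl⟩)))
    simp [FRule.Holds, farEdge, consts, FRule.reqs, instRec] at h1 h2
    obtain ⟨⟨b1, b2, b3⟩, c⟩ := h1
    simp only [c] at h2
    obtain ⟨s5, s4, s3, s2, s1⟩ := h2
    refine ⟨ρ 4, ?_, ?_⟩
    · rw [← hG _ s3, ← hM _ _ _ s4, ← hM _ _ _ s5]; omega
    · simp only [hP _ _ s1, hP _ _ s2]; omega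
  · obtain ⟨e, he, he'⟩ := hV _ r1
    obtain ⟨f, hf, hf'⟩ := hV _ r2
    refine ⟨e, he, f, hf, ?_⟩
    simp only [he', hf', hP _ _ r3, hP _ _ r4, a1]

/-- A choice of instances that derive a product. -/
noncomputable def mulInst (X x y : ℕ) : List (FRule × (Reg → ℕ)) :=
  if h : 8 ≤ X ∧ y ≤ X ∧ x ≤ X ∧ x * y ≤ X then
    (exists_mul X y h.1 h.2.1 x h.2.2.1 h.2.2.2).choose else []

theorem mulInst_spec {X x y : ℕ} (h : 8 ≤ X ∧ y ≤ X ∧ x ≤ X ∧ x * y ≤ X) :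
    (mulInst X x y).length ≤ x.size + 1 ∧ (∃ i ∈ mulInst X x y, (4, x, y, x * y) ∈ FRule.provs i) ∧
      ∀ F, (∀ i ∈ mulInst X x y, ∀ f ∈ FRule.provs i, F f) → Fine mulRules F X (mulInst X x y) := by
  rw [mulInst, dif_pos h]
  exact (exists_mul X y h.1 h.2.1 x h.2.2.1 h.2.2.2).choose_spec

theorem length_flatMap_le_mul {α β : Type} {l : List α} {f : α → List β} {c : ℕ}
    (h : ∀ a ∈ l, (f a).length ≤ c) : (l.flatMap f).length ≤ l.length * c := by
  induction l with
  | nil => simp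
  | cons a l ih =>
    have := ih fun a ha => h a (by simp [ha])
    have := h a (by simp)
    rw [List.flatMap_cons, List.length_append, List.length_cons, add_mul]
    omega

theorem exists_cert_far {p q n N t : ℕ} {es : List Rec} {W : List ℕ} {w : Rec → ℕ} {X : ℕ}
    (hX : 8 ≤ X) (hX' : n ≤ X ∧ p ≤ X ∧ q ≤ X ∧ q * t ≤ X ∧ p * N ≤ X ∧ t ≤ X)
    (hW : ∀ x ∈ W, x ≤ X) (hN : 1 ≤ N) (ht : p * N ≤ q * t)
    (hes : ∀ e ∈ es, e.1 < W.length ∧ e.2.1 < W.length ∧ e.2.2.2 * w e ≤ e.2.2.1 * N ∧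
      W.getD e.2.1 0 ≤ W.getD e.1 0 + w e ∧ e.1 ≤ X ∧ e.2.1 ≤ X ∧ e.2.2.1 ≤ X ∧ e.2.2.2 ≤ X ∧
      N ≤ X ∧ w e ≤ X ∧ e.2.2.1 * N ≤ X ∧ W.getD e.1 0 + w e ≤ X)
    (hef : ∃ e ∈ es, ∃ f ∈ es, W.getD f.1 0 = W.getD e.1 0 + t) :
    ∃ ρ0 E I, Cert (farInit p q) farEdge mulRules (n :: es.flatMap quad) ρ0 E I W ∧ ρ0 31 = 0 ∧
      (∀ x ∈ allInst (farInit p q) farEdge ρ0 E I, ∀ i, x.2 i ≤ X) ∧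
      E.length = es.length ∧ I.length ≤ (es.length + 1) * (2 * X.size + 2) := by
  obtain ⟨e, he, f, hf, hef⟩ := hef
  set φ : ℕ → ℕ := fun j => W.getD j 0 with hφ
  have hφd : ∀ j, W.getD j 0 = φ j := fun _ => rfl
  simp only [hφd] at hes hef
  have hmem : ∀ j < W.length, (3, j, φ j, 0) ∈ enumFacts W := fun j hj =>
    mem_enumFacts.2 ⟨j, _, rfl, by simp [hφ, hj]⟩
  have hφX : ∀ j, φ j ≤ X := by
    intro j
    simp only [hφ, List.getD_eq_getElem?_getD]
    cases hx : W[j]? with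
    | none => simp
    | some x => exact hW x (List.mem_of_getElem? hx)
  have hNX : N ≤ X := (hes e he).2.2.2.2.2.2.2.2.1
  let reg : Rec → Reg → ℕ := fun e => vals [e.1, e.2.1, e.2.2.1, e.2.2.2, w e, N, φ e.1, φ e.2.1,
    φ e.1 + w e, φ e.1 + w e - φ e.2.1, 0, 0, 0, 0, e.2.2.2 * w e, e.2.2.1 * N,
    e.2.2.1 * N - e.2.2.2 * w e]
  let ρ0 : Reg → ℕ := vals [n, e.1, f.1, φ e.1, φ f.1, N, t, 0, 0, 0, 0, 0, q, p, q * t, p * N,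
    q * t - p * N, N - 1]
  let I : List (FRule × (Reg → ℕ)) := (mulInst X q t ++ mulInst X p N) ++
    es.flatMap fun e => mulInst X e.2.2.2 (w e) ++ mulInst X e.2.2.1 N
  have hm1 := mulInst_spec (X := X) (x := q) (y := t) (by tauto)
  have hm2 := mulInst_spec (X := X) (x := p) (y := N) (by tauto)
  have hm3 := fun e he => mulInst_spec (X := X) (x := e.2.2.2) (y := w e)
    (have h := hes e he; ⟨hX, by tauto, by tauto, h.2.2.1.trans (by tauto)⟩)
  have hm4 := fun e he => mulInst_spec (X := X) (x := e.2.2.1) (y := N)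
    (have h := hes e he; ⟨hX, by tauto, by tauto, by tauto⟩)
  set F : Rec → Prop := fun f => f ∈ facts (allInst (farInit p q) farEdge ρ0 (es.map reg) I) W
    with hF
  have hIF : ∀ i ∈ I, ∀ f ∈ FRule.provs i, F f := fun i hi f hf =>
    mem_facts.2 (.inl ⟨i, mem_allInst.2 (.inr (.inr hi)), hf⟩)
  have hfine : Fine mulRules F X I := by
    intro i hi
    have hi' := hi
    simp only [I, List.mem_append, List.mem_flatMap] at hi
    rcases hi with (hi | hi) | ⟨e, he, hi | hi⟩
    · exact hm1.2.2 F (fun i hi => hIF i (by simp [I, hi])) i hi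
    · exact hm2.2.2 F (fun i hi => hIF i (by simp [I, hi])) i hi
    · exact (hm3 e he).2.2 F (fun i hi => hIF i (by
        simp only [I, List.mem_append, List.mem_flatMap]; exact .inr ⟨e, he, .inl hi⟩)) i hi
    · exact (hm4 e he).2.2 F (fun i hi => hIF i (by
        simp only [I, List.mem_append, List.mem_flatMap]; exact .inr ⟨e, he, .inr hi⟩)) i hi
  have hV : ∀ e ∈ es, F (e.1 |> fun u => (0, u, 0, 0)) := fun e he =>
    mem_facts.2 (.inl ⟨(farEdge, reg e), mem_allInst.2 (.inr (.inl ⟨_, List.mem_map_of_mem he, rfl⟩)),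
      by simp [farEdge, FRule.provs, instRec, reg, vals]⟩)
  have hG : F (5, N, 0, 0) := mem_facts.2 (.inl ⟨(farInit p q, ρ0), mem_allInst.2 (.inl rfl),
      by simp [farInit, FRule.provs, instRec, ρ0, vals]⟩)
  have hP : ∀ j < W.length, F (3, j, φ j, 0) := fun j hj => mem_facts.2 (.inr (hmem j hj))
  refine ⟨ρ0, es.map reg, I, ⟨?_, ?_, fun i hi => ⟨(hfine i hi).1, (hfine i hi).2.1⟩, ?_, ?_⟩,
    by simp [ρ0, vals], ?_, by simp, ?_⟩
  · simp [FRule.Holds, farInit, consts, ρ0, vals]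
    exact ⟨by omega, by omega, by omega⟩
  · intro ρ hρ
    obtain ⟨e, he, rfl⟩ := List.mem_map.1 hρ
    have := hes e he
    simp [FRule.Holds, farEdge, consts, reg, vals]
    exact ⟨by omega, by omega⟩
  · simp [List.flatMap_map, ρ0, reg, vals]
    rfl
  · intro i hi r hr
    rcases mem_allInst.1 hi with rfl | ⟨ρ, hρ, rfl⟩ | hi
    · simp [FRule.reqs, farInit, instRec, ρ0, vals] at hr
      rcases hr with rfl | rfl | rfl | rfl | rfl | rfl
      · obtain ⟨i, hi, hi'⟩ := hm2.2.1
        exact hIF i (by simp [I, hi]) _ hi'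
      · obtain ⟨i, hi, hi'⟩ := hm1.2.1
        exact hIF i (by simp [I, hi]) _ hi'
      · exact hP _ (hes f hf).1
      · exact hP _ (hes e he).1
      · exact hV f hf
      · exact hV e he
    · obtain ⟨e, he, rfl⟩ := List.mem_map.1 hρ
      simp [FRule.reqs, farEdge, instRec, reg, vals] at hr
      rcases hr with rfl | rfl | rfl | rfl | rfl
      · obtain ⟨i, hi, hi'⟩ := (hm4 e he).2.1
        exact hIF i (by simp only [I, List.mem_append, List.mem_flatMap]; exact .inr ⟨e, he, .inr hi⟩)
          _ hi'
      · obtain ⟨i, hi, hi'⟩ := (hm3 e he).2.1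
        exact hIF i (by simp only [I, List.mem_append, List.mem_flatMap]; exact .inr ⟨e, he, .inl hi⟩)
          _ hi'
      · exact hG
      · exact hP _ (hes e he).2.1
      · exact hP _ (hes e he).1
    · exact (hfine i hi).2.2.2 r hr
  · intro i hi
    rcases mem_allInst.1 hi with rfl | ⟨ρ, hρ, rfl⟩ | hi
    · refine vals_le hX ?_
      have := hes e he
      have := hes f hf
      simp only [List.forall_mem_cons, List.not_mem_nil, false_imp_iff, implies_true, and_true]
      have := hφX e.1
      have := hφX f.1
      refine ⟨?_, ?_, ?_, ?_, ?_, ?_, ?_, ?_, ?_, ?_, ?_, ?_, ?_, ?_, ?_, ?_, ?_, ?_⟩ <;> omega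
    · obtain ⟨e, he, rfl⟩ := List.mem_map.1 hρ
      refine vals_le hX ?_
      have := hes e he
      simp only [List.forall_mem_cons, List.not_mem_nil, false_imp_iff, implies_true, and_true]
      have := hφX e.1
      have := hφX e.2.1
      refine ⟨?_, ?_, ?_, ?_, ?_, ?_, ?_, ?_, ?_, ?_, ?_, ?_, ?_, ?_, ?_, ?_, ?_⟩ <;> omega
    · exact (hfine i hi).2.2.1
  · have hs : ∀ {x}, x ≤ X → x.size ≤ X.size := fun h => Nat.size_le_size h
    have h1 : (es.flatMap fun e => mulInst X e.2.2.2 (w e) ++ mulInst X e.2.2.1 N).length ≤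
        es.length * (2 * X.size + 2) := length_flatMap_le_mul fun e he => by
      rw [List.length_append]
      have := (hm3 e he).1
      have := (hm4 e he).1
      have := hs (show e.2.2.2 ≤ X by have := hes e he; tauto)
      have := hs (show e.2.2.1 ≤ X by have := hes e he; tauto)
      omega
    simp only [I, List.length_append (as := _ ++ _)]
    rw [List.length_append, add_mul]
    have := hs hX'.2.1
    have := hs hX'.2.2.1
    have := hm1.1
    have := hm2.1
    omega

end Prog

/-! ### Certificates for small distances -/

namespace Prog

namespace Near

/-! The fact `(0, a, c, w)` means that there is an edge of weight `w` from `a` to `c`, the fact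
`(1, a, b, s)` that there is a path of length `s` from `a` to `b`, the fact `(2, h, j, 0)` that there
are short paths from `h` to the first `j` vertices of the enumerated sequence, the fact
`(7, y, s, 0)` that there is a path of length `s` from `y` to some `h` with `(2, h, J, 0)`, and
`(8, z, s, 0)` that there is one from a vertex of the sequence to `z`. -/

/-- The empty path. -/
def refl : FRule := ⟨[], consts, [(21, 0, 0, 20)], []⟩

/-- Extension of a path. -/
def step : FRule := ⟨[(3, 4, 5)], consts, [(21, 0, 2, 5)], [(20, 0, 1, 4), (21, 1, 2, 3)]⟩

/-- Start of the paths from a vertex. -/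
def hub : FRule := ⟨[], consts, [(22, 0, 20, 20)], []⟩

/-- A further path from a vertex. -/
def hubStep : FRule := ⟨[(3, 4, 7), (1, 21, 8)], consts, [(22, 0, 8, 20)],
  [(22, 0, 1, 20), (23, 1, 2, 20), (21, 0, 2, 3), (25, 5, 6, 7)]⟩

/-- Distance to a vertex from which there are paths. -/
def before : FRule := ⟨[], consts, [(27, 0, 20, 20)], [(22, 0, 9, 20), (26, 8, 9, 20)]⟩

/-- Distance to such a vertex via an edge. -/
def beforeStep : FRule :=
  ⟨[(3, 4, 5)], consts, [(27, 0, 5, 20)], [(20, 0, 1, 4), (27, 1, 3, 20)]⟩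

/-- Distance from a vertex of the sequence. -/
def after : FRule :=
  ⟨[(1, 21, 2), (2, 3, 9)], consts, [(28, 0, 20, 20)], [(23, 1, 0, 20), (26, 8, 9, 20)]⟩

/-- Distance from such a vertex via an edge. -/
def afterStep : FRule :=
  ⟨[(3, 4, 5)], consts, [(28, 0, 5, 20)], [(20, 1, 0, 4), (28, 1, 3, 20)]⟩

/-- The rules. -/
def rules : List FRule :=
  mulRules ++ [refl, step, hub, hubStep, before, beforeStep, after, afterStep]

/-- The rule applied to the edges. -/
def edge : FRule :=
  ⟨[(14, 16, 15), (10, 12, 6), (11, 13, 8)], consts, [(20, 0, 1, 4)],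
    [(25, 5, 6, 7), (26, 8, 9, 20), (24, 2, 5, 14), (24, 3, 4, 15), (27, 0, 10, 20),
      (28, 0, 11, 20)]⟩

/-- The initial rule when all distances are to be at most `p / q`. -/
def init (p q : ℕ) : FRule :=
  ⟨[(6, 7, 10), (10, 8, 11), (14, 16, 15), (17, 21, 5)], consts ++ [(12, q), (13, p)],
    [(25, 5, 6, 7), (26, 8, 9, 20)], [(24, 12, 11, 14), (24, 13, 5, 15)]⟩

/-- How a fact can have been derived. -/
inductive Step (E : List (Reg → ℕ)) (W : List ℕ) (N R1 R2 R3 J : ℕ) (F : Rec → Prop) : Rec → Prop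
  | params : Step E W N R1 R2 R3 J F (5, N, R1, R2)
  | params' : Step E W N R1 R2 R3 J F (6, R3, J, 0)
  | edge (ρ : Reg → ℕ) : ρ ∈ E → Step E W N R1 R2 R3 J F (0, ρ 0, ρ 1, ρ 4)
  | enum (j x : ℕ) : W[j]? = some x → Step E W N R1 R2 R3 J F (3, j, x, 0)
  | mul (x y z : ℕ) : MulStep F x y z → Step E W N R1 R2 R3 J F (4, x, y, z)
  | refl (a : ℕ) : Step E W N R1 R2 R3 J F (1, a, a, 0)
  | step (a c b s w : ℕ) : F (0, a, c, w) → F (1, c, b, s) → Step E W N R1 R2 R3 J F (1, a, b, s + w)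
  | hub (h : ℕ) : Step E W N R1 R2 R3 J F (2, h, 0, 0)
  | hubStep (h j x s N' R1' R2' : ℕ) : F (2, h, j, 0) → F (3, j, x, 0) → F (1, h, x, s) →
      F (5, N', R1', R2') → s ≤ R2' → Step E W N R1 R2 R3 J F (2, h, j + 1, 0)
  | before (h R3' J' : ℕ) : F (2, h, J', 0) → F (6, R3', J', 0) →
      Step E W N R1 R2 R3 J F (7, h, 0, 0)
  | beforeStep (y c s w : ℕ) : F (0, y, c, w) → F (7, c, s, 0) →
      Step E W N R1 R2 R3 J F (7, y, s + w, 0)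
  | after (x j R3' J' : ℕ) : F (3, j, x, 0) → F (6, R3', J', 0) → j < J' →
      Step E W N R1 R2 R3 J F (8, x, 0, 0)
  | afterStep (z c s w : ℕ) : F (0, c, z, w) → F (8, c, s, 0) →
      Step E W N R1 R2 R3 J F (8, z, s + w, 0)

/-- Paths made up of weighted edges. -/
inductive Reach (R : ℕ → ℕ → ℕ → Prop) : ℕ → ℕ → ℕ → Prop
  | refl (a : ℕ) : Reach R a a 0
  | step {a c b w s : ℕ} : R a c w → Reach R c b s → Reach R a b (s + w)

theorem Reach.trans {R : ℕ → ℕ → ℕ → Prop} {a b c s t : ℕ} (h : Reach R a b s)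
    (h' : Reach R b c t) : Reach R a c (s + t) := by
  induction h with
  | refl => simpa using h'
  | @step _ _ _ w s hR _ ih =>
    have := Reach.step hR (ih h')
    rwa [show s + w + t = s + t + w by omega]

theorem step_of_prov {E : List (Reg → ℕ)} {W : List ℕ} {N R1 R2 R3 J : ℕ} {F : Rec → Prop}
    {i : FRule × (Reg → ℕ)} (hi : i.1 ∈ rules)
    (hh : i.1.Holds i.2) (hr : ∀ f ∈ FRule.reqs i, F f) {f : Rec} (hf : f ∈ FRule.provs i) :
    Step E W N R1 R2 R3 J F f := by
  rcases List.mem_append.1 hi with hi | hi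
  · obtain ⟨x, y, z, rfl, h⟩ := mulStep_of_prov hi hh hr hf
    exact .mul x y z h
  obtain ⟨r, ρ⟩ := i
  simp only [List.mem_cons, List.not_mem_nil, or_false] at hi
  rcases hi with rfl | rfl | rfl | rfl | rfl | rfl | rfl | rfl <;>
    simp [refl, step, hub, hubStep, before, beforeStep, after, afterStep, FRule.Holds, consts,
      FRule.provs, FRule.reqs, instRec] at hh hr hf
  · simp only [hh] at hf; subst hf; exact .refl _
  · simp only [hh] at hf hr; subst hf; rw [← hh.1]; exact .step _ _ _ _ _ hr.2 hr.1
  · simp only [hh] at hf; subst hf; exact .hub _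
  · obtain ⟨⟨h₁, h₂⟩, h₃⟩ := hh
    simp only [h₃] at hf hr h₂
    subst hf; rw [← h₂]
    exact .hubStep _ _ _ _ _ _ _ hr.2.2.2 hr.2.2.1 hr.2.1 hr.1 (by omega)
  · simp only [hh] at hf hr; subst hf; exact .before _ _ _ hr.2 hr.1
  · simp only [hh] at hf hr; subst hf; rw [← hh.1]; exact .beforeStep _ _ _ _ hr.2 hr.1
  · obtain ⟨⟨h₁, h₂⟩, h₃⟩ := hh
    simp only [h₃] at hf hr h₁
    subst hf
    exact .after _ _ _ _ hr.2 hr.1 (by omega)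
  · simp only [hh] at hf hr; subst hf; rw [← hh.1]; exact .afterStep _ _ _ _ hr.2 hr.1

/-- Each record of an edge requires that its source has labels of both kinds within `R1` and `R3`.
Unwinding the labels of `y` and `z` gives a path from `y` to some `h`, one from `h` to a vertex of
the sequence, and one from there to `z`. -/
theorem _root_.Prog.Cert.near {p q n : ℕ} {es : List Rec} {ρ0 : Reg → ℕ} {E : List (Reg → ℕ)}
    {I : List (FRule × (Reg → ℕ))} {W : List ℕ} (hpos : ∀ e ∈ es, 1 ≤ e.2.2.1)
    (h : Cert (init p q) edge rules (n :: es.flatMap quad) ρ0 E I W) :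
    ∃ (N t : ℕ) (R : ℕ → ℕ → ℕ → Prop), 1 ≤ N ∧ q * t ≤ p * N ∧
      (∀ a c w, R a c w → ∃ e ∈ es, e.1 = a ∧ e.2.1 = c ∧ e.2.2.1 * N ≤ e.2.2.2 * w) ∧
      ∀ e ∈ es, ∀ f ∈ es, ∃ s ≤ t, Reach R e.1 f.1 s := by
  obtain ⟨hI, hE, hR, hinp, hsub⟩ := h
  have hes := records_eq hinp
  set F : Rec → Prop := fun f => f ∈ facts (allInst (init p q) edge ρ0 E I) W with hF
  have hinit := hsub (init p q, ρ0) (mem_allInst.2 (.inl rfl))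
  simp [FRule.Holds, init, consts, FRule.reqs, instRec] at hI hinit
  obtain ⟨⟨a1, a2, a3, a4⟩, c0⟩ := hI
  have hstep : ∀ f, F f → Step E W (ρ0 5) (ρ0 6) (ρ0 7) (ρ0 8) (ρ0 9) F f := by
    intro f hf
    rcases mem_facts.1 hf with ⟨i, hi, hf⟩ | hf
    · rcases mem_allInst.1 hi with rfl | ⟨ρ, hρ, rfl⟩ | hi'
      · simp [init, FRule.provs, instRec, c0] at hf
        rcases hf with rfl | rfl
        exacts [.params', .params]
      · have := hE ρ hρ
        simp [FRule.Holds, edge, consts] at this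
        simp [edge, FRule.provs, instRec, this] at hf
        rw [hf]
        exact .edge ρ hρ
      · exact step_of_prov (hR i hi').1 (hR i hi').2 (hsub i hi) hf
    · obtain ⟨j, x, rfl, h⟩ := mem_enumFacts.1 hf
      exact .enum j x h
  have hM : ∀ {x y z}, F (4, x, y, z) → z = x * y := eq_mul_of_mulStep fun x y z h => by
    cases hstep _ h with
    | mul _ _ _ h => exact h
  have hedge : ∀ ρ ∈ E, ρ 2 * ρ0 5 ≤ ρ 3 * ρ 4 ∧ (∃ s ≤ ρ0 6, F (7, ρ 0, s, 0)) ∧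
      ∃ s ≤ ρ0 8, F (8, ρ 0, s, 0) := by
    intro ρ hρ
    have h₁ := hE ρ hρ
    have h₂ := hsub (edge, ρ) (mem_allInst.2 (.inr (.inl ⟨ρ, hρ, rfl⟩)))
    simp [FRule.Holds, edge, consts, FRule.reqs, instRec] at h₁ h₂
    obtain ⟨⟨b1, b2, b3⟩, c⟩ := h₁
    simp only [c] at h₂
    obtain ⟨s1, s2, s3, s4, s5, s6⟩ := h₂
    have h₃ := hM s3
    have h4 := hM s4
    have h5 : ρ 5 = ρ0 5 ∧ ρ 6 = ρ0 6 := by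
      generalize ρ 5 = x1, ρ 6 = x2, ρ 7 = x3 at s6 ⊢
      cases hstep _ s6
      exact ⟨rfl, rfl⟩
    have h6 : ρ 8 = ρ0 8 := by
      generalize ρ 8 = x1, ρ 9 = x2 at s5 ⊢
      cases hstep _ s5
      rfl
    rw [← h5.1, ← h5.2, ← h6]
    exact ⟨by omega, ⟨_, by omega, s2⟩, ⟨_, by omega, s1⟩⟩
  set R : ℕ → ℕ → ℕ → Prop := fun a c w => F (0, a, c, w) with hRdef
  have hRe : ∀ a c w, R a c w → ∃ e ∈ es, e.1 = a ∧ e.2.1 = c ∧ e.2.2.1 * ρ0 5 ≤ e.2.2.2 * w := by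
    intro a c w h
    cases hstep _ h with
    | edge ρ hρ =>
      exact ⟨_, by rw [hes]; exact List.mem_map_of_mem hρ, rfl, rfl, (hedge ρ hρ).1⟩
  -- Positive edge weights exclude circular derivations: the records on paths and labels can be
  -- unwound by induction on their lengths.
  have hR1 : ∀ a c w, R a c w → 1 ≤ w := by
    intro a c w h
    obtain ⟨e, he, -, -, h⟩ := hRe a c w h
    have := hpos e he
    by_contra hw
    obtain rfl : w = 0 := by omega
    have : 1 * 1 ≤ e.2.2.1 * ρ0 5 := Nat.mul_le_mul this (by omega)
    omega
  have h1 : ∀ s a b, F (1, a, b, s) → Reach R a b s := by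
    intro s
    induction s using Nat.strong_induction_on with
    | _ s ih =>
      intro a b h
      cases hstep _ h with
      | refl => exact .refl _
      | step _ c _ s w h₁ h₂ =>
        have := hR1 _ _ _ h₁
        exact .step h₁ (ih _ (by omega) _ _ h₂)
  have h3 : ∀ {j x}, F (3, j, x, 0) → W[j]? = some x := by
    intro j x h
    cases hstep _ h with
    | enum _ _ h => exact h
  -- Here the derivations are well-founded because the count `j` decreases. Since an index
  -- determines its vertex, counting up to `j` means reaching each of the first `j` vertices.
  have h2 : ∀ j h, F (2, h, j, 0) → ∀ i < j, ∀ x, W[i]? = some x → ∃ s ≤ ρ0 7, Reach R h x s := by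
    intro j
    induction j with
    | zero => intro h _ i hi; omega
    | succ j ih =>
      intro h hF i hi x hx
      cases hstep _ hF with
      | hubStep _ _ x' s _ _ _ k1 k2 k3 k4 k5 =>
        rcases Nat.lt_succ_iff_lt_or_eq.1 hi with hi | rfl
        · exact ih h k1 i hi x hx
        · obtain rfl : x = x' := Option.some_injective _ (hx.symm.trans (h3 k2))
          cases hstep _ k4
          exact ⟨s, k5, h1 _ _ _ k3⟩
  have h7 : ∀ s y, F (7, y, s, 0) → ∃ h, Reach R y h s ∧ F (2, h, ρ0 9, 0) := by
    intro s
    induction s using Nat.strong_induction_on with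
    | _ s ih =>
      intro y h
      cases hstep _ h with
      | before _ R3' J' h₁ h₂ =>
        cases hstep _ h₂
        exact ⟨y, .refl _, h₁⟩
      | beforeStep _ c s w h₁ h₂ =>
        have := hR1 _ _ _ h₁
        obtain ⟨h, r, hh⟩ := ih _ (by omega) _ h₂
        exact ⟨h, .step h₁ r, hh⟩
  have h8 : ∀ s z, F (8, z, s, 0) → ∃ j < ρ0 9, ∃ x, W[j]? = some x ∧ Reach R x z s := by
    intro s
    induction s using Nat.strong_induction_on with
    | _ s ih =>
      intro z h
      cases hstep _ h with
      | after _ j R3' J' h₁ h₂ h₃ =>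
        cases hstep _ h₂
        exact ⟨j, h₃, z, h3 h₁, .refl _⟩
      | afterStep _ c s w h₁ h₂ =>
        have := hR1 _ _ _ h₁
        obtain ⟨j, hj, x, hx, r⟩ := ih _ (by omega) _ h₂
        have := r.trans (.step h₁ (.refl _))
        rw [zero_add] at this
        exact ⟨j, hj, x, hx, this⟩
  simp only [c0] at hinit a4
  have t1 := hM hinit.1
  have t2 := hM hinit.2
  refine ⟨ρ0 5, ρ0 11, R, by omega, by omega, hRe, fun e he f hf => ?_⟩
  rw [hes] at he hf
  obtain ⟨ρ, hρ, rfl⟩ := List.mem_map.1 he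
  obtain ⟨σ, hσ, rfl⟩ := List.mem_map.1 hf
  obtain ⟨s1, l1, k1⟩ := (hedge ρ hρ).2.1
  obtain ⟨s3, l3, k3⟩ := (hedge σ hσ).2.2
  obtain ⟨h, r1, hh⟩ := h7 _ _ k1
  obtain ⟨j, hj, x, hx, r3⟩ := h8 _ _ k3
  obtain ⟨s2, l2, r2⟩ := h2 _ _ hh j hj x hx
  exact ⟨_, by omega, (r1.trans r2).trans r3⟩

end Near

end Prog

/-! ### Existence of certificates for small distances -/

namespace Prog

namespace Near

variable {X c c' : ℕ} {Base A B : (Rec → Prop) → Prop}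

/-- From facts that satisfy `Base`, at most `c` instances derive facts that satisfy `A`. -/
def Derives (X : ℕ) (Base : (Rec → Prop) → Prop) (c : ℕ) (A : (Rec → Prop) → Prop) : Prop :=
  ∃ I, I.length ≤ c ∧ ∀ F, (∀ i ∈ I, ∀ f ∈ FRule.provs i, F f) →
    A F ∧ (Base F → Fine rules F X I)

/-- The quantification over all `F` that contain what is provided lets partial certificates be
combined by concatenation: requirements are met within the final collection of records, not in any
order of time. -/
theorem Derives.seq (h1 : Derives X Base c A) (h2 : Derives X (fun F => Base F ∧ A F) c' B) :
    Derives X Base (c + c') fun F => A F ∧ B F := by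
  obtain ⟨I, hI, hF⟩ := h1
  obtain ⟨I', hI', hF'⟩ := h2
  refine ⟨I ++ I', by rw [List.length_append]; omega, fun F h => ?_⟩
  obtain ⟨a, a'⟩ := hF F fun i hi => h i (List.mem_append_left _ hi)
  obtain ⟨b, b'⟩ := hF' F fun i hi => h i (List.mem_append_right _ hi)
  refine ⟨⟨a, b⟩, fun hB i hi => ?_⟩
  rcases List.mem_append.1 hi with hi | hi
  exacts [a' hB i hi, b' ⟨hB, a⟩ i hi]

theorem Derives.weaken {Base' A' : (Rec → Prop) → Prop} (h : Derives X Base c A)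
    (hB : ∀ F, Base' F → Base F) (hA : ∀ F, A F → A' F) (hc : c ≤ c') : Derives X Base' c' A' := by
  obtain ⟨I, hI, hF⟩ := h
  exact ⟨I, hI.trans hc, fun F h => ⟨hA F (hF F h).1, fun hb => (hF F h).2 (hB F hb)⟩⟩

theorem Derives.forall {ι : Type} {A : ι → (Rec → Prop) → Prop} {l : List ι}
    (h : ∀ a ∈ l, Derives X Base c (A a)) : Derives X Base (l.length * c) fun F => ∀ a ∈ l, A a F := by
  induction l with
  | nil => exact ⟨[], by simp, by simp [Fine]⟩
  | cons a l ih =>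
    refine ((h a (by simp)).seq ((ih fun b hb => h b (by simp [hb])).weaken (fun F hF => hF.1)
      (fun F hF => hF) le_rfl)).weaken (fun F hF => hF) (fun F hF => ?_) ?_
    · simpa using hF
    · rw [List.length_cons, add_mul]; omega

/-- One instance for each member of a family, where an instance may require other records of the
same family. This fits counting up along a sequence and labels that refer to the labels of
neighbours. -/
theorem derives_map {ι : Type} {l : List ι} {P : ι → Rec} (h : ∀ y ∈ l, ∃ i : FRule × (Reg → ℕ),
    i.1 ∈ rules ∧ i.1.Holds i.2 ∧ (∀ j, i.2 j ≤ X) ∧ P y ∈ FRule.provs i ∧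
      ∀ F, Base F → (∀ y' ∈ l, F (P y')) → ∀ f ∈ FRule.reqs i, F f) :
    Derives X Base l.length fun F => ∀ y ∈ l, F (P y) := by
  have : Nonempty FRule := ⟨refl⟩
  choose! a h1 h2 h3 h4 h5 using h
  refine ⟨l.map a, by simp, fun F hF => ?_⟩
  have hP : ∀ y ∈ l, F (P y) := fun y hy => hF _ (List.mem_map_of_mem hy) _ (h4 y hy)
  refine ⟨hP, fun hB i hi => ?_⟩
  obtain ⟨y, hy, rfl⟩ := List.mem_map.1 hi
  exact ⟨h1 y hy, h2 y hy, h3 y hy, h5 y hy F hB hP⟩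

theorem derives_mul (hX : 8 ≤ X) {x y : ℕ} (hx : x ≤ X) (hy : y ≤ X) (hxy : x * y ≤ X) :
    Derives X Base (X.size + 1) fun F => F (4, x, y, x * y) := by
  obtain ⟨I, hI, ⟨i, hi, hi'⟩, hF⟩ := exists_mul X y hX hy x hx hxy
  have := Nat.size_le_size hx
  refine ⟨I, by omega, fun F h => ⟨h i hi _ hi', fun _ j hj => ?_⟩⟩
  obtain ⟨h1, h2⟩ := hF F h j hj
  exact ⟨List.mem_append_left _ h1, h2⟩

/-- The vertices are the numbers at the beginning of records of edges. -/
def recGraph (w : Rec → ℕ) : WGraph ℕ Rec := ⟨fun e => e.1, fun e => e.2.1, w⟩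

/-- The facts that express the edges. -/
def EdgeFacts (es : List Rec) (w : Rec → ℕ) (F : Rec → Prop) : Prop :=
  ∀ e ∈ es, F (0, e.1, e.2.1, w e)

variable {es : List Rec} {w : Rec → ℕ}

theorem derives_path (hX : 8 ≤ X) (hes : ∀ e ∈ es, e.1 ≤ X ∧ e.2.1 ≤ X) {b : ℕ} (hb : b ≤ X) :
    ∀ {l : List Rec} {a : ℕ}, (recGraph w).Path a l b → (∀ e ∈ l, e ∈ es) →
      (recGraph w).len l ≤ X → Derives X (EdgeFacts es w) (l.length + 1)
        fun F => F (1, a, b, (recGraph w).len l)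
  | [], a, h, _, _ => by
    obtain rfl : a = b := h
    refine (derives_map (l := [()]) (P := fun _ => (1, a, a, 0)) fun _ _ =>
      ⟨(refl, vals [a]), by simp [rules], by simp [FRule.Holds, refl, consts, vals],
        vals_le hX (by simpa using hb), by simp [FRule.provs, instRec, refl, vals],
        by simp [FRule.reqs, refl]⟩).weaken (fun F hF => hF) (fun F hF => hF () (by simp)) le_rfl
  | e :: l, a, h, hl, hX' => by
    obtain ⟨rfl, h⟩ := h
    rw [WGraph.len_cons] at hX'
    have ih := derives_path hX hes hb h (fun e he => hl e (by simp [he])) (by omega)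
    have he := hes e (hl e (by simp))
    have hw : (recGraph w).w e = w e := rfl
    rw [hw] at hX'
    refine (ih.seq (c' := 1) (B := fun F => F (1, e.1, b, (recGraph w).len l + w e))
      ((derives_map (l := [()]) (P := fun _ => (1, e.1, b, (recGraph w).len l + w e)) fun _ _ =>
      ⟨(step, vals [e.1, e.2.1, b, (recGraph w).len l, w e, (recGraph w).len l + w e]),
        by simp [rules], by simp [FRule.Holds, step, consts, vals], vals_le hX ?_,
        by simp [FRule.provs, instRec, step, vals], fun F hF _ f hf => ?_⟩).weaken
        (fun F hF => hF) (fun F hF => hF () (by simp)) le_rfl)).weaken (fun F hF => hF)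
        (fun F hF => ?_) le_rfl
    · simp only [List.forall_mem_cons, List.not_mem_nil, false_imp_iff, implies_true, and_true]
      exact ⟨he.1, he.2, hb, by omega, by omega, by omega⟩
    · simp [FRule.reqs, instRec, step, vals] at hf
      rcases hf with rfl | rfl
      exacts [hF.2, hF.1 e (hl e (by simp))]
    · rw [WGraph.len_cons, Nat.add_comm]; exact hF.2

section data

variable {W : List ℕ} {N R1 R2 R3 P n : ℕ} {H : List ℕ} {α β : ℕ → ℕ}

/-- The facts on the parameters and the enumerated sequence. -/
def ParamFacts (W : List ℕ) (N R1 R2 R3 : ℕ) (F : Rec → Prop) : Prop :=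
  F (5, N, R1, R2) ∧ F (6, R3, W.length, 0) ∧ ∀ j x, W[j]? = some x → F (3, j, x, 0)

/-- For each `h`, there are `W.length` paths with at most `P + 1` instances each, and `W.length + 1`
instances count them. This is the dominant part of a certificate. -/
theorem derives_hubs (hX : 8 ≤ X) (hes : ∀ e ∈ es, e.1 ≤ X ∧ e.2.1 ≤ X)
    (hWX : ∀ x ∈ W, x ≤ X) (hWX' : W.length ≤ X) (hN : N ≤ X) (hR1 : R1 ≤ X) (hR2 : R2 ≤ X)
    (hH : ∀ h ∈ H, h ≤ X ∧ ∀ x ∈ W, ∃ l, (recGraph w).Path h l x ∧ (∀ e ∈ l, e ∈ es) ∧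
      (recGraph w).len l ≤ R2 ∧ l.length ≤ P) :
    Derives X (fun F => EdgeFacts es w F ∧ ParamFacts W N R1 R2 R3 F)
      (H.length * (W.length * (P + 1) + (W.length + 1))) fun F => ∀ h ∈ H, F (2, h, W.length, 0) := by
  refine Derives.forall fun h hh => ?_
  obtain ⟨hhX, hp⟩ := hH h hh
  choose! l hl1 hl2 hl3 hl4 using hp
  refine (Derives.seq (A := fun F => ∀ x ∈ W, F (1, h, x, (recGraph w).len (l x)))
    (B := fun F => ∀ j ∈ List.range (W.length + 1), F (2, h, j, 0)) (c' := W.length + 1)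
    (Derives.forall fun x hx => (derives_path hX hes (hWX x hx) (hl1 x hx) (hl2 x hx)
      ((hl3 x hx).trans hR2)).weaken (fun F hF => hF.1) (fun F hF => hF)
      (Nat.add_le_add_right (hl4 x hx) 1)) ((derives_map fun j hj => ?_).weaken (fun F hF => hF)
      (fun F hF => hF) (by simp))).weaken (fun F hF => hF) (fun F hF => hF.2 _ (by simp)) le_rfl
  rw [List.mem_range] at hj
  cases j with
  | zero =>
    exact ⟨(hub, vals [h]), by simp [rules], by simp [FRule.Holds, hub, consts, vals],
      vals_le hX (by simpa using hhX), by simp [FRule.provs, instRec, hub, vals],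
      by simp [FRule.reqs, hub]⟩
  | succ j =>
    have hjl : j < W.length := by omega
    have hmem : W[j] ∈ W := List.getElem_mem hjl
    have hle := hl3 _ hmem
    refine ⟨(hubStep, vals [h, j, W[j], (recGraph w).len (l W[j]), R2 - (recGraph w).len (l W[j]),
      N, R1, R2, j + 1]), by simp [rules], ?_, vals_le hX ?_,
      by simp [FRule.provs, instRec, hubStep, vals], fun F hF hF' f hf => ?_⟩
    · simp [FRule.Holds, hubStep, consts, vals]; omega
    · have := hWX _ hmem
      simp only [List.forall_mem_cons, List.not_mem_nil, false_imp_iff, implies_true, and_true]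
      refine ⟨hhX, ?_, this, ?_, ?_, hN, hR1, hR2, ?_⟩ <;> omega
    · simp [FRule.reqs, instRec, hubStep, vals] at hf
      rcases hf with rfl | rfl | rfl | rfl
      · exact hF.1.2.1
      · exact hF.2 _ hmem
      · exact hF.1.2.2.2 j _ (by simp [hjl])
      · exact hF' j (by simp; omega)

/-- One instance per vertex suffices, because a label only points to one edge along which it is
attained. -/
theorem derives_before (hX : 8 ≤ X) (hR3 : R3 ≤ X) (hWX : W.length ≤ X) (hnX : n ≤ X)
    (hαX : ∀ y < n, α y ≤ X) (hα : ∀ y < n, α y = 0 ∧ y ∈ H ∨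
      ∃ e ∈ es, e.1 = y ∧ e.2.1 < n ∧ α e.2.1 + w e = α y) :
    Derives X (fun F => (EdgeFacts es w F ∧ ParamFacts W N R1 R2 R3 F) ∧
      ∀ h ∈ H, F (2, h, W.length, 0)) n fun F => ∀ y ∈ List.range n, F (7, y, α y, 0) := by
  refine (derives_map fun y hy => ?_).weaken (fun F hF => hF) (fun F hF => hF) (by simp)
  rw [List.mem_range] at hy
  rcases hα y hy with ⟨h0, hyH⟩ | ⟨e, he, rfl, hn, hw⟩
  · rw [h0]
    refine ⟨(before, vals [y, 0, 0, 0, 0, 0, 0, 0, R3, W.length]), by simp [rules],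
      by simp [FRule.Holds, before, consts, vals], vals_le hX ?_,
      by simp [FRule.provs, instRec, before, vals], fun F hF _ f hf => ?_⟩
    · simp; omega
    · simp [FRule.reqs, instRec, before, vals] at hf
      rcases hf with rfl | rfl
      exacts [hF.1.2.2.1, hF.2 _ hyH]
  · have := hαX _ hy
    refine ⟨(beforeStep, vals [e.1, e.2.1, 0, α e.2.1, w e, α e.1]), by simp [rules],
      by simpa [FRule.Holds, beforeStep, consts, vals] using hw, vals_le hX ?_,
      by simp [FRule.provs, instRec, beforeStep, vals], fun F hF hF' f hf => ?_⟩
    · simp; omega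
    · simp [FRule.reqs, instRec, beforeStep, vals] at hf
      rcases hf with rfl | rfl
      exacts [hF' _ (by simpa using hn), hF.1.1 e he]

theorem derives_after (hX : 8 ≤ X) (hR3 : R3 ≤ X) (hWX : W.length ≤ X) (hnX : n ≤ X)
    (hβX : ∀ y < n, β y ≤ X) (hβ : ∀ z < n, β z = 0 ∧ z ∈ W ∨
      ∃ e ∈ es, e.2.1 = z ∧ e.1 < n ∧ β e.1 + w e = β z) :
    Derives X (fun F => EdgeFacts es w F ∧ ParamFacts W N R1 R2 R3 F) n
      fun F => ∀ y ∈ List.range n, F (8, y, β y, 0) := by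
  refine (derives_map fun y hy => ?_).weaken (fun F hF => hF) (fun F hF => hF) (by simp)
  rw [List.mem_range] at hy
  rcases hβ y hy with ⟨h0, hyW⟩ | ⟨e, he, rfl, hn, hw⟩
  · rw [h0]
    obtain ⟨j, hj, rfl⟩ := List.getElem_of_mem hyW
    refine ⟨(after, vals [W[j], j, j + 1, W.length - (j + 1), 0, 0, 0, 0, R3, W.length]),
      by simp [rules], ?_, vals_le hX ?_,
      by simp [FRule.provs, instRec, after, vals], fun F hF _ f hf => ?_⟩
    · simp [FRule.Holds, after, consts, vals]; omega
    · simp; omega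
    · simp [FRule.reqs, instRec, after, vals] at hf
      rcases hf with rfl | rfl
      exacts [hF.2.2.1, hF.2.2.2 j _ (by simp [hj])]
  · have := hβX _ hy
    refine ⟨(afterStep, vals [e.2.1, e.1, 0, β e.1, w e, β e.2.1]), by simp [rules],
      by simpa [FRule.Holds, afterStep, consts, vals] using hw, vals_le hX ?_,
      by simp [FRule.provs, instRec, afterStep, vals], fun F hF hF' f hf => ?_⟩
    · simp; omega
    · simp [FRule.reqs, instRec, afterStep, vals] at hf
      rcases hf with rfl | rfl
      exacts [hF' _ (by simpa using hn), hF.1 e he]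

theorem exists_cert {p q : ℕ} (hX : 8 ≤ X) (hX' : n ≤ X ∧ p ≤ X ∧ q ≤ X ∧ p * N ≤ X)
    (hN : 1 ≤ N) (ht : q * (R1 + R2 + R3) ≤ p * N) (ht' : R1 + R2 + R3 ≤ X)
    (hes : ∀ e ∈ es, e.1 < n ∧ e.2.1 < n ∧ e.2.2.1 * N ≤ e.2.2.2 * w e ∧ e.2.2.1 ≤ X ∧
      e.2.2.2 ≤ X ∧ N ≤ X ∧ w e ≤ X ∧ e.2.2.2 * w e ≤ X)
    (hne : es ≠ []) (hWn : ∀ x ∈ W, x ≤ X) (hWX : W.length ≤ X)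
    (hH : ∀ h ∈ H, h ≤ X ∧ ∀ x ∈ W, ∃ l, (recGraph w).Path h l x ∧ (∀ e ∈ l, e ∈ es) ∧
      (recGraph w).len l ≤ R2 ∧ l.length ≤ P)
    (hα : ∀ y < n, α y ≤ R1 ∧ (α y = 0 ∧ y ∈ H ∨
      ∃ e ∈ es, e.1 = y ∧ e.2.1 < n ∧ α e.2.1 + w e = α y))
    (hβ : ∀ z < n, β z ≤ R3 ∧ (β z = 0 ∧ z ∈ W ∨
      ∃ e ∈ es, e.2.1 = z ∧ e.1 < n ∧ β e.1 + w e = β z)) :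
    ∃ ρ0 E I, Cert (init p q) edge rules (n :: es.flatMap quad) ρ0 E I W ∧ ρ0 31 = 0 ∧
      (∀ x ∈ allInst (init p q) edge ρ0 E I, ∀ i, x.2 i ≤ X) ∧ E.length = es.length ∧
      I.length ≤ (2 * es.length + 2) * (X.size + 1) +
        H.length * (W.length * (P + 1) + (W.length + 1)) + 2 * n := by
  obtain ⟨e0, he0⟩ := List.exists_mem_of_ne_nil es hne
  have hNX : N ≤ X := by have := hes e0 he0; tauto
  set T := R1 + R2 + R3 with hT
  let reg : Rec → Reg → ℕ := fun e => vals [e.1, e.2.1, e.2.2.1, e.2.2.2, w e, N, R1, R2, R3,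
    W.length, α e.1, β e.1, R1 - α e.1, R3 - β e.1, e.2.2.1 * N, e.2.2.2 * w e,
    e.2.2.2 * w e - e.2.2.1 * N]
  let ρ0 : Reg → ℕ := vals [n, 0, 0, 0, 0, N, R1, R2, R3, W.length, R1 + R2, T, q, p, q * T, p * N,
    p * N - q * T, N - 1]
  have hmul : Derives X (fun F => EdgeFacts es w F ∧ ParamFacts W N R1 R2 R3 F)
      ((2 * es.length + 2) * (X.size + 1)) fun F => (F (4, q, T, q * T) ∧ F (4, p, N, p * N)) ∧
        (∀ e ∈ es, F (4, e.2.2.1, N, e.2.2.1 * N)) ∧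
        ∀ e ∈ es, F (4, e.2.2.2, w e, e.2.2.2 * w e) := by
    refine (((derives_mul hX hX'.2.2.1 ht' (by omega)).seq
      (derives_mul hX hX'.2.1 hNX hX'.2.2.2)).seq ((Derives.forall (c := X.size + 1) fun e he => ?_).seq
      (Derives.forall (c := X.size + 1) fun e he => ?_))).weaken (fun F hF => hF) (fun F hF => hF) (le_of_eq ?_)
    · have := hes e he
      exact derives_mul hX this.2.2.2.1 hNX (by omega)
    · have := hes e he
      exact derives_mul hX this.2.2.2.2.1 this.2.2.2.2.2.2.1 this.2.2.2.2.2.2.2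
    · ring
  have hX1 : R1 ≤ X := by omega
  have hX2 : R2 ≤ X := by omega
  have hX3 : R3 ≤ X := by omega
  have hhub := derives_hubs (R3 := R3) hX (fun e he => by
    have := hes e he; exact ⟨by omega, by omega⟩) hWn hWX hNX hX1 hX2 hH
  have hbef := derives_before (N := N) (R1 := R1) (R2 := R2) hX hX3 hWX hX'.1
    (fun y hy => (hα y hy).1.trans hX1) fun y hy => (hα y hy).2
  have haft := derives_after (N := N) (R1 := R1) (R2 := R2) hX hX3 hWX hX'.1
    (fun y hy => (hβ y hy).1.trans hX3) fun y hy => (hβ y hy).2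
  obtain ⟨I, hI, hF⟩ := (hmul.seq ((hhub.seq hbef).weaken (fun F hF => hF.1) (fun F hF => hF)
    le_rfl)).seq (haft.weaken (fun F hF => hF.1) (fun F hF => hF) le_rfl)
  set F : Rec → Prop := fun f => f ∈ facts (allInst (init p q) edge ρ0 (es.map reg) I) W
    with hFdef
  obtain ⟨⟨⟨⟨m1, m2⟩, m3, m4⟩, -, m5⟩, m6⟩ := (hF F fun i hi f hf =>
    mem_facts.2 (.inl ⟨i, mem_allInst.2 (.inr (.inr hi)), hf⟩)).1
  have hpar : F (5, N, R1, R2) ∧ F (6, R3, W.length, 0) := by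
    constructor <;>
    exact mem_facts.2 (.inl ⟨(init p q, ρ0), mem_allInst.2 (.inl rfl),
      by simp [init, FRule.provs, instRec, ρ0, vals]⟩)
  have hfine := (hF F fun i hi f hf =>
    mem_facts.2 (.inl ⟨i, mem_allInst.2 (.inr (.inr hi)), hf⟩)).2 ⟨fun e he =>
    mem_facts.2 (.inl ⟨(edge, reg e), mem_allInst.2 (.inr (.inl ⟨_, List.mem_map_of_mem he, rfl⟩)),
      by simp [edge, FRule.provs, instRec, reg, vals]⟩), hpar.1, hpar.2, fun j x h =>
      mem_facts.2 (.inr (mem_enumFacts.2 ⟨j, x, rfl, h⟩))⟩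
  refine ⟨ρ0, es.map reg, I, ⟨?_, ?_, fun i hi => ⟨(hfine i hi).1, (hfine i hi).2.1⟩, ?_, ?_⟩,
    by simp [ρ0, vals], ?_, by simp, hI.trans (le_of_eq (by ring))⟩
  · simp [FRule.Holds, init, consts, ρ0, vals]
    exact ⟨hT.symm, by omega, by omega⟩
  · intro ρ hρ
    obtain ⟨e, he, rfl⟩ := List.mem_map.1 hρ
    have h1 := hes e he
    have h2 := (hα e.1 h1.1).1
    have h3 := (hβ e.1 h1.1).1
    simp [FRule.Holds, edge, consts, reg, vals]
    exact ⟨by omega, by omega, by omega⟩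
  · simp [List.flatMap_map, ρ0, reg, vals]
    rfl
  · intro i hi r hr
    rcases mem_allInst.1 hi with rfl | ⟨ρ, hρ, rfl⟩ | hi
    · simp [FRule.reqs, init, instRec, ρ0, vals] at hr
      rcases hr with rfl | rfl
      exacts [m2, m1]
    · obtain ⟨e, he, rfl⟩ := List.mem_map.1 hρ
      have h1 := hes e he
      simp [FRule.reqs, edge, instRec, reg, vals] at hr
      rcases hr with rfl | rfl | rfl | rfl | rfl | rfl
      exacts [m6 _ (by simpa using h1.1), m5 _ (by simpa using h1.1), m4 e he, m3 e he, hpar.2,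
        hpar.1]
    · exact (hfine i hi).2.2.2 r hr
  · intro i hi
    rcases mem_allInst.1 hi with rfl | ⟨ρ, hρ, rfl⟩ | hi
    · refine vals_le hX ?_
      simp only [List.forall_mem_cons, List.not_mem_nil, false_imp_iff, implies_true, and_true]
      refine ⟨?_, ?_, ?_, ?_, ?_, ?_, ?_, ?_, ?_, ?_, ?_, ?_, ?_, ?_, ?_, ?_, ?_, ?_⟩ <;> omega
    · obtain ⟨e, he, rfl⟩ := List.mem_map.1 hρ
      refine vals_le hX ?_
      have h1 := hes e he
      have h2 := (hα e.1 h1.1).1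
      have h3 := (hβ e.1 h1.1).1
      simp only [List.forall_mem_cons, List.not_mem_nil, false_imp_iff, implies_true, and_true]
      refine ⟨?_, ?_, ?_, ?_, ?_, ?_, ?_, ?_, ?_, ?_, ?_, ?_, ?_, ?_, ?_, ?_, ?_⟩ <;> omega
    · exact (hfine i hi).2.2.1

end data

end Near

end Prog

/-! ### Sizes -/

namespace DiameterInput

variable (x : DiameterInput)

/-- The record of an edge. -/
def rcd (e : Fin x.G.m) : Prog.Rec :=
  (x.G.src e, x.G.tgt e, (x.G.wt e).num.natAbs, (x.G.wt e).den)

/-- The records of all edges. -/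
def recs : List Prog.Rec := (List.finRange x.G.m).map x.rcd

/-- The time bound of the theorem, up to logarithms. -/
noncomputable def bound (k : ℕ) : ℝ :=
  (x.G.m : ℝ) ^ (1 + 1 / (k : ℝ)) * (x.G.Wmax / x.G.Wmin)

/-- The logarithm of the magnitude. -/
noncomputable def lg : ℝ := Real.log x.G.magnitude

variable {x}

theorem encode_eq : x.G.encode =
    (x.G.n :: x.recs.flatMap Prog.quad).flatMap encodeNat := by
  simp [WDigraph.encode, recs, List.flatMap_map, List.flatMap_assoc, Prog.quad, rcd]

theorem length_recs : x.recs.length = x.G.m := by simp [recs]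

theorem mem_recs {r : Prog.Rec} : r ∈ x.recs ↔ ∃ e, x.rcd e = r := by simp [recs]

theorem num_pos (e : Fin x.G.m) : 1 ≤ (x.G.wt e).num.natAbs := by
  have := Rat.num_pos.2 (x.wt_pos e); omega

theorem wt_eq (e : Fin x.G.m) :
    (x.G.wt e : ℝ) = ((x.G.wt e).num.natAbs : ℝ) / ((x.G.wt e).den : ℝ) := by
  have h : ((x.G.wt e).num.natAbs : ℤ) = (x.G.wt e).num := by
    have := Rat.num_pos.2 (x.wt_pos e); omega
  rw [Rat.cast_def, ← h]
  simp

theorem add_le_magnitude (e : Fin x.G.m) :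
    x.G.m + ((x.G.wt e).num.natAbs + (x.G.wt e).den) ≤ x.G.magnitude :=
  Nat.add_le_add_left (Finset.le_sup (f := fun e => (x.G.wt e).num.natAbs + (x.G.wt e).den)
    (Finset.mem_univ e)) _

theorem nonempty_edge : Nonempty (Fin x.G.m) := ⟨⟨0, x.edge⟩⟩

theorem three_le_magnitude : 3 ≤ x.G.magnitude := by
  have := add_le_magnitude ⟨0, x.edge⟩
  have := num_pos ⟨0, x.edge⟩
  have := (x.G.wt ⟨0, x.edge⟩).den_pos
  have := x.edge
  omega

theorem m_le_magnitude : x.G.m ≤ x.G.magnitude := by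
  have := add_le_magnitude ⟨0, x.edge⟩; omega

theorem one_le_lg : 1 ≤ x.lg := by
  rw [lg, Real.le_log_iff_exp_le (by have := three_le_magnitude (x := x); positivity)]
  have : (3 : ℝ) ≤ x.G.magnitude := by exact_mod_cast three_le_magnitude
  linarith [Real.exp_one_lt_three]

theorem exists_wt_eq_Wmax : ∃ e, (x.G.wt e : ℝ) = x.G.Wmax :=
  have := nonempty_edge (x := x); exists_eq_ciSup_of_finite

theorem exists_wt_eq_Wmin : ∃ e, (x.G.wt e : ℝ) = x.G.Wmin :=
  have := nonempty_edge (x := x); exists_eq_ciInf_of_finite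

theorem wt_le_Wmax (e : Fin x.G.m) : (x.G.wt e : ℝ) ≤ x.G.Wmax :=
  le_ciSup (f := fun e => (x.G.wt e : ℝ)) (Set.finite_range _).bddAbove e

theorem Wmin_le_wt (e : Fin x.G.m) : x.G.Wmin ≤ (x.G.wt e : ℝ) :=
  ciInf_le (f := fun e => (x.G.wt e : ℝ)) (Set.finite_range _).bddBelow e

theorem Wmin_pos : 0 < x.G.Wmin := by
  obtain ⟨e, he⟩ := exists_wt_eq_Wmin (x := x)
  rw [← he]
  exact_mod_cast x.wt_pos e

theorem Wmin_le_Wmax : x.G.Wmin ≤ x.G.Wmax := (Wmin_le_wt ⟨0, x.edge⟩).trans (wt_le_Wmax _)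

theorem Wmax_le : x.G.Wmax ≤ x.G.magnitude := by
  obtain ⟨e, he⟩ := exists_wt_eq_Wmax (x := x)
  rw [← he, wt_eq]
  have h1 : (1 : ℝ) ≤ (x.G.wt e).den := by exact_mod_cast (x.G.wt e).den_pos
  refine (div_le_self (by positivity) h1).trans ?_
  exact_mod_cast (by have := add_le_magnitude e; omega)

theorem one_le_magnitude_mul_Wmin : 1 ≤ x.G.magnitude * x.G.Wmin := by
  obtain ⟨e, he⟩ := exists_wt_eq_Wmin (x := x)
  rw [← he, wt_eq, ← mul_div_assoc, one_le_div (by exact_mod_cast (x.G.wt e).den_pos)]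
  have h1 : (1 : ℝ) ≤ ((x.G.wt e).num.natAbs : ℝ) := by exact_mod_cast num_pos e
  have h2 : ((x.G.wt e).den : ℝ) ≤ x.G.magnitude := by
    exact_mod_cast (by have := add_le_magnitude e; omega)
  nlinarith

theorem one_le_m : (1 : ℝ) ≤ x.G.m := by exact_mod_cast x.edge

theorem one_le_ratio : 1 ≤ x.G.Wmax / x.G.Wmin := (one_le_div Wmin_pos).2 Wmin_le_Wmax

theorem m_le_bound {k : ℕ} : (x.G.m : ℝ) ≤ x.bound k := by
  have h := one_le_m (x := x)
  have h1 : (x.G.m : ℝ) ≤ (x.G.m : ℝ) ^ (1 + 1 / (k : ℝ)) := by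
    conv_lhs => rw [← Real.rpow_one (x.G.m : ℝ)]
    exact Real.rpow_le_rpow_of_exponent_le h (by simp)
  have := one_le_ratio (x := x)
  unfold bound
  nlinarith

theorem bound_le {k : ℕ} (hk : 1 ≤ k) : x.bound k ≤ (x.G.magnitude : ℝ) ^ 4 := by
  have h := one_le_m (x := x)
  have hM : (x.G.m : ℝ) ≤ x.G.magnitude := by exact_mod_cast m_le_magnitude
  have h1 : (x.G.m : ℝ) ^ (1 + 1 / (k : ℝ)) ≤ (x.G.magnitude : ℝ) ^ 2 := by
    have hk' : (1 : ℝ) / k ≤ 1 := (div_le_one (by exact_mod_cast hk)).2 (by exact_mod_cast hk)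
    calc (x.G.m : ℝ) ^ (1 + 1 / (k : ℝ)) ≤ (x.G.m : ℝ) ^ (2 : ℝ) :=
          Real.rpow_le_rpow_of_exponent_le h (by linarith)
      _ = (x.G.m : ℝ) ^ 2 := by norm_cast
      _ ≤ _ := by gcongr
  have h2 : x.G.Wmax / x.G.Wmin ≤ (x.G.magnitude : ℝ) ^ 2 := by
    rw [div_le_iff₀ Wmin_pos]
    have := Wmax_le (x := x)
    have := one_le_magnitude_mul_Wmin (x := x)
    nlinarith
  unfold bound
  calc _ ≤ (x.G.magnitude : ℝ) ^ 2 * (x.G.magnitude : ℝ) ^ 2 :=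
        mul_le_mul h1 h2 (zero_le_one.trans one_le_ratio) (by positivity)
    _ = _ := by ring

/-- The factors 2 replace 1 / log 2; the constants are absorbed by means of `one_le_lg`. -/
theorem size_le {n a : ℕ} {C : ℝ} (hC : 1 ≤ C) (h : (n : ℝ) ≤ C * (x.G.magnitude : ℝ) ^ a) :
    (n.size : ℝ) ≤ (1 + 2 * Real.log C + 2 * a) * x.lg := by
  have hlg := one_le_lg (x := x)
  have hC' := Real.log_nonneg hC
  have hM : (0 : ℝ) < x.G.magnitude := by
    have := three_le_magnitude (x := x); positivity
  rcases Nat.eq_zero_or_pos n with rfl | hn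
  · simp; positivity
  have h1 : 2 ^ (n.size - 1) ≤ n := by
    have := Nat.size_pos.2 hn
    exact Nat.lt_size.1 (by omega)
  have h2 : ((n.size - 1 : ℕ) : ℝ) * Real.log 2 ≤ Real.log C + a * x.lg := by
    rw [← Real.log_pow, lg, ← Real.log_pow, ← Real.log_mul (by positivity) (by positivity)]
    exact Real.log_le_log (by positivity) (le_trans (by exact_mod_cast h1) h)
  have h3 : (n.size : ℝ) ≤ (n.size - 1 : ℕ) + 1 := by exact_mod_cast (by omega)
  have := Real.log_two_gt_d9
  have h4 : ((n.size - 1 : ℕ) : ℝ) ≤ 2 * (Real.log C + a * x.lg) := by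
    nlinarith [Nat.cast_nonneg (α := ℝ) (n.size - 1)]
  nlinarith

theorem size_le_lg {n : ℕ} (h : n ≤ x.G.magnitude) : (n.size : ℝ) ≤ 3 * x.lg := by
  have := size_le (x := x) (n := n) (a := 1) (C := 1) le_rfl (by simpa using h)
  simp at this
  linarith

/-- By strong connectivity, with the case of a single vertex covered by the existence of an edge. So
`n ≤ m`, and checks made at the sources of edges reach every vertex. -/
theorem exists_src (u : Fin x.G.n) : ∃ e, x.G.src e = u := by
  by_cases h : ∀ v, v = u
  · exact ⟨⟨0, x.edge⟩, h _⟩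
  · push Not at h
    obtain ⟨v, hv⟩ := h
    obtain ⟨L, hL⟩ := x.strong u v
    cases hL with
    | nil => exact absurd rfl hv
    | cons e => exact ⟨e, rfl⟩

theorem n_le_m : x.G.n ≤ x.G.m := by
  simpa using Fintype.card_le_of_surjective x.G.src exists_src

theorem length_encode_le {k : ℕ} : (x.G.encode.length : ℝ) ≤ 35 * x.bound k * x.lg := by
  have hlg := one_le_lg (x := x)
  have h : x.G.encode.length ≤ (x.G.n :: x.recs.flatMap Prog.quad).length *
      (2 * x.G.magnitude.size + 1) := by
    rw [encode_eq]
    refine Prog.length_flatMap_le_mul fun a ha => ?_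
    have hle : a ≤ x.G.magnitude := by
      have hn := n_le_m (x := x)
      have hm := m_le_magnitude (x := x)
      simp only [List.mem_cons, List.mem_flatMap, mem_recs] at ha
      rcases ha with rfl | ⟨_, ⟨e, rfl⟩, ha⟩
      · omega
      · have := add_le_magnitude e
        have := (x.G.src e).isLt
        have := (x.G.tgt e).isLt
        simp only [Prog.quad, rcd, List.mem_cons, List.not_mem_nil, or_false] at ha
        omega
    have := Nat.size_le_size hle
    simp only [encodeNat, List.length_append, List.length_flatMap, List.length_cons,
      List.length_nil, List.map_const', List.sum_replicate, Nat.size_eq_bits_len, smul_eq_mul]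
    omega
  have h2 : (x.G.n :: x.recs.flatMap Prog.quad).length ≤ 5 * x.G.m := by
    have := n_le_m (x := x)
    have := x.edge
    have h3 := Prog.length_flatMap_le_mul (l := x.recs) (f := Prog.quad) (c := 4)
      fun _ _ => by simp [Prog.quad]
    rw [length_recs] at h3
    rw [List.length_cons]
    omega
  have h3 := size_le_lg (x := x) le_rfl
  have h4 := m_le_bound (x := x) (k := k)
  have h5 := one_le_m (x := x)
  calc (x.G.encode.length : ℝ) ≤ (5 * x.G.m : ℕ) * (2 * x.G.magnitude.size + 1 : ℕ) := by
        exact_mod_cast h.trans (Nat.mul_le_mul_right _ h2)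
    _ ≤ (5 * x.G.m) * (7 * x.lg) := by push_cast; gcongr; linarith
    _ ≤ (5 * x.bound k) * (7 * x.lg) := by gcongr
    _ = _ := by ring

/-! ### The exponent of the clock -/

theorem lt_two_pow_length (n : ℕ) : n < 2 ^ n.bits.length := by
  rw [Nat.size_eq_bits_len]; exact Nat.lt_size_self n

theorem two_pow_length_le {n : ℕ} (hn : 1 ≤ n) : 2 ^ n.bits.length ≤ 2 * n := by
  rw [Nat.size_eq_bits_len]
  obtain ⟨s, hs⟩ := Nat.exists_eq_succ_of_ne_zero (Nat.size_pos.2 hn).ne'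
  rw [hs, pow_succ]
  have : 2 ^ s ≤ n := Nat.lt_size.1 (by omega)
  omega

variable {k c1 c2 : ℕ}

/-- Whatever edges are chosen, the quotient of their weights is at most `Wmax / Wmin`, and the
guessed logarithms are never too large. The lengths of `pe` and `qf` overestimate these numbers by a
factor of at most 2 each, whence the 4; the 9 stands for three lengths that are each at most `3 *
x.lg`. -/
theorem two_pow_le_of_isExp (hk : 1 ≤ k) {K : ℕ} (h : Prog.IsExp k c1 c2 x.recs K) :
    ((2 ^ K : ℕ) : ℝ) ≤ 4 * 9 ^ c1 * 2 ^ c2 * x.bound k * x.lg ^ c1 := by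
  obtain ⟨_, he, _, hf, _, hg, μ, l, j, hμ, hl, hj, hK⟩ := h
  obtain ⟨e, rfl⟩ := mem_recs.1 he
  obtain ⟨f, rfl⟩ := mem_recs.1 hf
  obtain ⟨g, rfl⟩ := mem_recs.1 hg
  simp only [rcd] at hl hK
  rw [length_recs] at hμ
  set pe := (x.G.wt e).num.natAbs
  set pf := (x.G.wt f).num.natAbs
  set pg := (x.G.wt g).num.natAbs
  have hqe : 1 ≤ (x.G.wt e).den := (x.G.wt e).den_pos
  have hqf : 1 ≤ (x.G.wt f).den := (x.G.wt f).den_pos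
  set qe := (x.G.wt e).den
  set qf := (x.G.wt f).den
  set qg := (x.G.wt g).den
  have hpe : 1 ≤ pe := num_pos e
  have hpf : 1 ≤ pf := num_pos f
  have hj' : ((2 ^ j : ℕ) : ℝ) ≤ (x.G.m : ℝ) ^ (1 / (k : ℝ)) := by
    rw [one_div, Real.le_rpow_inv_iff_of_pos (by positivity) (by positivity) (by positivity),
      Real.rpow_natCast]
    have : (2 ^ j) ^ k ≤ x.G.m := by
      rw [← pow_mul, mul_comm]
      exact (Nat.pow_le_pow_right (by norm_num) hj).trans hμ
    exact_mod_cast this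
  have hY : ((2 ^ l : ℕ) : ℝ) ≤ 9 * x.lg := by
    have h1 : pg.bits.length ≤ x.G.magnitude.size := by
      rw [Nat.size_eq_bits_len]
      exact Nat.size_le_size (by have := add_le_magnitude g; omega)
    have h2 : qg.bits.length ≤ x.G.magnitude.size := by
      rw [Nat.size_eq_bits_len]
      exact Nat.size_le_size (by have := add_le_magnitude g; omega)
    have h3 : μ < x.G.magnitude.size := Nat.lt_size.2 (hμ.trans m_le_magnitude)
    have h4 := size_le_lg (x := x) le_rfl
    have : ((2 ^ l : ℕ) : ℝ) ≤ (3 * x.G.magnitude.size : ℕ) := by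
      exact_mod_cast hl.trans (by omega)
    push_cast at this ⊢
    linarith
  have key : 2 ^ K * (pf * qe) ≤ (2 * pe) * (2 * qf) * x.G.m * (2 ^ l) ^ c1 * 2 ^ j * 2 ^ c2 := by
    calc 2 ^ K * (pf * qe) ≤ 2 ^ K * (2 ^ pf.bits.length * 2 ^ qe.bits.length) := by
          gcongr <;> exact (lt_two_pow_length _).le
      _ = 2 ^ pe.bits.length * 2 ^ qf.bits.length * 2 ^ μ * (2 ^ l) ^ c1 * 2 ^ j * 2 ^ c2 := by
          rw [← pow_add, ← pow_add, hK, ← pow_mul, mul_comm l]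
          simp only [← pow_add]
      _ ≤ _ := by
          gcongr <;> first | exact two_pow_length_le hpe | exact two_pow_length_le hqf
  have key' : ((2 ^ K : ℕ) : ℝ) * (pf * qe) ≤ (2 * pe) * (2 * qf) * x.G.m * ((2 ^ l : ℕ) : ℝ) ^ c1 *
      ((2 ^ j : ℕ) : ℝ) * 2 ^ c2 := by exact_mod_cast key
  have hratio : ((pe : ℝ) / qe) / ((pf : ℝ) / qf) ≤ x.G.Wmax / x.G.Wmin := by
    rw [← wt_eq, ← wt_eq]
    exact div_le_div₀ (Wmin_pos.le.trans Wmin_le_Wmax) (wt_le_Wmax e) Wmin_pos (Wmin_le_wt f)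
  have hm := one_le_m (x := x)
  have hlg := one_le_lg (x := x)
  have hpf' : (0 : ℝ) < pf := by exact_mod_cast hpf
  have hqe' : (0 : ℝ) < qe := by exact_mod_cast hqe
  have hqf' : (0 : ℝ) < qf := by exact_mod_cast hqf
  calc ((2 ^ K : ℕ) : ℝ) ≤ ((2 * pe) * (2 * qf) * x.G.m * ((2 ^ l : ℕ) : ℝ) ^ c1 *
        ((2 ^ j : ℕ) : ℝ) * 2 ^ c2) / (pf * qe) := (le_div_iff₀ (by positivity)).2 key'
    _ = 4 * (((pe : ℝ) / qe) / ((pf : ℝ) / qf)) * (x.G.m * ((2 ^ j : ℕ) : ℝ)) *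
        ((2 ^ l : ℕ) : ℝ) ^ c1 * 2 ^ c2 := by field_simp; ring
    _ ≤ 4 * (x.G.Wmax / x.G.Wmin) * (x.G.m * (x.G.m : ℝ) ^ (1 / (k : ℝ))) *
        (9 * x.lg) ^ c1 * 2 ^ c2 := by
        have := one_le_ratio (x := x)
        gcongr
    _ = _ := by
        rw [bound, Real.rpow_add (by linarith), Real.rpow_one, mul_pow]; ring

/-- Take a heaviest edge, a lightest edge and one that attains the magnitude, and the largest
possible logarithms. The loss of 16 is 2 for `m`, 2 for `m ^ (1 / k)` and 4 for the lengths of `pf`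
and `qe`; the 8 compares `x.lg` with `2 ^ l`. -/
theorem exists_isExp (hk : 1 ≤ k) (hc : 1 ≤ c2) : ∃ K, Prog.IsExp k c1 c2 x.recs K ∧
    2 ^ c2 * (x.bound k * x.lg ^ c1) ≤ 16 * 8 ^ c1 * ((2 ^ K : ℕ) : ℝ) := by
  obtain ⟨e, he⟩ := exists_wt_eq_Wmax (x := x)
  obtain ⟨f, hf⟩ := exists_wt_eq_Wmin (x := x)
  obtain ⟨g, -, hg⟩ := Finset.exists_mem_eq_sup (Finset.univ : Finset (Fin x.G.m))
    ⟨⟨0, x.edge⟩, Finset.mem_univ _⟩ fun e => (x.G.wt e).num.natAbs + (x.G.wt e).den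
  have hM : x.G.magnitude = x.G.m + ((x.G.wt g).num.natAbs + (x.G.wt g).den) := by
    rw [WDigraph.magnitude, hg]
  have hmem : ∀ e, x.rcd e ∈ x.recs := fun e => mem_recs.2 ⟨e, rfl⟩
  have hqe : 1 ≤ (x.G.wt e).den := (x.G.wt e).den_pos
  have hpe := num_pos e
  have hpf := num_pos f
  have hpg := num_pos g
  have hratio := Wmin_le_Wmax (x := x)
  have hqf : 1 ≤ (x.G.wt f).den := (x.G.wt f).den_pos
  have hwe := wt_eq e
  have hwf := wt_eq f
  rw [← he, ← hf, hwe, hwf, div_le_div_iff₀ (by exact_mod_cast hqf) (by exact_mod_cast hqe)]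
    at hratio
  rw [he] at hwe
  rw [hf] at hwf
  set pe := (x.G.wt e).num.natAbs with hpe'
  set pf := (x.G.wt f).num.natAbs with hpf'
  set pg := (x.G.wt g).num.natAbs with hpg'
  set qe := (x.G.wt e).den with hqe'
  set qf := (x.G.wt f).den with hqf'
  set qg := (x.G.wt g).den with hqg'
  -- Since the weight of `f` is at most that of `e`, the lengths to be subtracted exceed the others
  -- by at most 1. With `1 ≤ c2` the subtraction defining `K` is then not truncated.
  have hle : pf.bits.length + qe.bits.length ≤ pe.bits.length + qf.bits.length + 1 := by
    have h₀ : pf * qe ≤ pe * qf := by exact_mod_cast hratio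
    have h1 := two_pow_length_le hpf
    have h2 := two_pow_length_le hqe
    have h3 := lt_two_pow_length pe
    have h4 := lt_two_pow_length qf
    have : 2 ^ (pf.bits.length + qe.bits.length) < 2 ^ (pe.bits.length + qf.bits.length + 2) := by
      calc 2 ^ (pf.bits.length + qe.bits.length) ≤ (2 * pf) * (2 * qe) := by
            rw [pow_add]; exact Nat.mul_le_mul h1 h2
        _ ≤ 4 * (pe * qf) := by linarith
        _ < 4 * (2 ^ pe.bits.length * 2 ^ qf.bits.length) := by
            have := Nat.mul_lt_mul_of_lt_of_le h3 h4.le (by omega)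
            omega
        _ = _ := by rw [← pow_add, pow_add _ _ 2]; ring
    have := (Nat.pow_lt_pow_iff_right (by norm_num)).1 this
    omega
  set μ := Nat.log 2 x.G.m with hμ
  set Y := pg.bits.length + qg.bits.length + μ with hY
  set l := Nat.log 2 Y with hl
  have hY1 : 1 ≤ Y := by
    have h1 := lt_two_pow_length pg
    by_contra h
    have h2 : pg.bits.length = 0 := by omega
    rw [h2, pow_zero] at h1
    omega
  have hm0 : x.G.m ≠ 0 := x.edge.ne'
  have hz1 := Nat.zero_le (c1 * l)
  have hz2 := Nat.zero_le (μ / k)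
  refine ⟨pe.bits.length + qf.bits.length + μ + c1 * l + μ / k + c2 -
    (pf.bits.length + qe.bits.length), ⟨_, hmem e, _, hmem f, _, hmem g, μ, l, μ / k,
    by rw [length_recs]; exact Nat.pow_log_le_self 2 hm0, Nat.pow_log_le_self 2 (by omega),
    Nat.mul_div_le μ k, by
      simp only [rcd, ← hpe', ← hpf', ← hqe', ← hqf']; omega⟩, ?_⟩
  obtain ⟨K, hK⟩ : ∃ K, K = pe.bits.length + qf.bits.length + μ + c1 * l + μ / k + c2 -
    (pf.bits.length + qe.bits.length) := ⟨_, rfl⟩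
  rw [← hK]
  have hK' : K + (pf.bits.length + qe.bits.length) =
    pe.bits.length + qf.bits.length + μ + c1 * l + μ / k + c2 := by omega
  have hμ' : (x.G.m : ℝ) ≤ 2 * ((2 ^ μ : ℕ) : ℝ) := by
    have := (Nat.lt_pow_succ_log_self (b := 2) (by norm_num) x.G.m).le
    rw [← hμ, pow_succ] at this
    rw [mul_comm]
    exact_mod_cast this
  have hj : (x.G.m : ℝ) ^ (1 / (k : ℝ)) ≤ 2 * ((2 ^ (μ / k) : ℕ) : ℝ) := by
    rw [one_div, Real.rpow_inv_le_iff_of_pos (by positivity) (by positivity) (by positivity),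
      Real.rpow_natCast]
    have h1 : x.G.m ≤ (2 * 2 ^ (μ / k)) ^ k := by
      refine (Nat.lt_pow_succ_log_self (b := 2) (by norm_num) x.G.m).le.trans ?_
      rw [← pow_succ', ← pow_mul]
      refine Nat.pow_le_pow_right (by norm_num) ?_
      have := Nat.lt_mul_div_succ μ (show 0 < k by omega)
      rw [← hμ, mul_comm]
      omega
    exact_mod_cast h1
  have hYlg : x.lg ≤ 8 * ((2 ^ l : ℕ) : ℝ) := by
    have h1 : x.G.magnitude ≤ 2 ^ (Y + 3) := by
      have a1 : pg ≤ 2 ^ (Y + 1) := (lt_two_pow_length pg).le.trans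
        (Nat.pow_le_pow_right (by norm_num) (by omega))
      have a2 : qg ≤ 2 ^ (Y + 1) := (lt_two_pow_length qg).le.trans
        (Nat.pow_le_pow_right (by norm_num) (by omega))
      have a3 : x.G.m ≤ 2 ^ (Y + 1) :=
        (Nat.lt_pow_succ_log_self (b := 2) (by norm_num) x.G.m).le.trans
        (Nat.pow_le_pow_right (by norm_num) (by omega))
      rw [hM, show Y + 3 = Y + 1 + 2 by ring, pow_add _ (Y + 1) 2]
      omega
    have h2 : x.lg ≤ Y + 3 := by
      have h3 : Real.log x.G.magnitude ≤ Real.log ((2 : ℝ) ^ (Y + 3)) :=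
        Real.log_le_log (by have := three_le_magnitude (x := x); positivity) (by exact_mod_cast h1)
      rw [Real.log_pow] at h3
      have := Real.log_two_lt_d9
      have h0 : (0 : ℝ) ≤ Y := Nat.cast_nonneg _
      push_cast at h3
      unfold lg
      nlinarith
    have h3 : (Y : ℝ) ≤ 2 * ((2 ^ l : ℕ) : ℝ) := by
      have := (Nat.lt_pow_succ_log_self (b := 2) (by norm_num) Y).le
      rw [← hl, pow_succ] at this
      rw [mul_comm]
      exact_mod_cast this
    have h4 : (1 : ℝ) ≤ Y := by exact_mod_cast hY1
    linarith
  have key : pe * qf * 2 ^ μ * (2 ^ l) ^ c1 * 2 ^ (μ / k) * 2 ^ c2 ≤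
      2 ^ K * ((2 * pf) * (2 * qe)) := by
    calc _ ≤ 2 ^ pe.bits.length * 2 ^ qf.bits.length * 2 ^ μ * (2 ^ l) ^ c1 * 2 ^ (μ / k) *
          2 ^ c2 := by gcongr <;> exact (lt_two_pow_length _).le
      _ = 2 ^ K * (2 ^ pf.bits.length * 2 ^ qe.bits.length) := by
          rw [← pow_add _ pf.bits.length, ← pow_add _ K, hK', ← pow_mul, mul_comm l]
          simp only [← pow_add]
      _ ≤ _ := by gcongr <;> first | exact two_pow_length_le hpf | exact two_pow_length_le hqe
  have key' : (pe * qf : ℝ) * ((2 ^ μ : ℕ) : ℝ) * ((2 ^ l : ℕ) : ℝ) ^ c1 *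
      ((2 ^ (μ / k) : ℕ) : ℝ) * 2 ^ c2 ≤ ((2 ^ K : ℕ) : ℝ) * (4 * (pf * qe)) := by
    have : (2 * pf) * (2 * qe) = 4 * (pf * qe) := by ring
    rw [this] at key
    exact_mod_cast key
  have hm := one_le_m (x := x)
  have hlg := one_le_lg (x := x)
  have hpf0 : (0 : ℝ) < pf := by exact_mod_cast hpf
  have hqe0 : (0 : ℝ) < qe := by exact_mod_cast hqe
  have hqf0 : (0 : ℝ) < qf := by exact_mod_cast hqf
  calc 2 ^ c2 * (x.bound k * x.lg ^ c1) = 2 ^ c2 * (x.G.m * (x.G.m : ℝ) ^ (1 / (k : ℝ)) *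
        ((pe * qf : ℝ) / (pf * qe)) * x.lg ^ c1) := by
        rw [bound, Real.rpow_add (by linarith), Real.rpow_one, hwe, hwf]
        field_simp
    _ ≤ 2 ^ c2 * ((2 * ((2 ^ μ : ℕ) : ℝ)) * (2 * ((2 ^ (μ / k) : ℕ) : ℝ)) *
        ((pe * qf : ℝ) / (pf * qe)) * (8 * ((2 ^ l : ℕ) : ℝ)) ^ c1) := by
        have : 0 ≤ x.lg := by linarith
        gcongr
    _ = 4 * 8 ^ c1 * (((pe * qf : ℝ) * ((2 ^ μ : ℕ) : ℝ) * ((2 ^ l : ℕ) : ℝ) ^ c1 *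
      ((2 ^ (μ / k) : ℕ) : ℝ) * 2 ^ c2) / (pf * qe)) := by rw [mul_pow]; field_simp; ring
    _ ≤ 4 * 8 ^ c1 * (((2 ^ K : ℕ) : ℝ) * (4 * (pf * qe)) / (pf * qe)) := by gcongr
    _ = _ := by field_simp; ring

end DiameterInput

/-! ### From rules to machines within the time bound of the theorem -/

namespace DiameterInput

/-- Machines that guess and check certificates, with the time bound of the theorem. -/
theorem exists_decider {k : ℕ} (hk : 1 ≤ k) (init edge : Prog.FRule) (rules : List Prog.FRule) (b : Bool)
    {C : ℝ} (hC : 1 ≤ C) (a : ℕ) : ∃ (C' : ℝ) (M : NTM),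
    (∀ x : DiameterInput, M.RunsInTime x.G.encode (C' * x.bound k * x.lg ^ 4)) ∧
    (∀ x : DiameterInput, M.CanOutput x.G.encode b → ∃ ρ0 E I W,
      Prog.Cert init edge rules (x.G.n :: x.recs.flatMap Prog.quad) ρ0 E I W) ∧
    (∀ (x : DiameterInput) ρ0 E I W X,
      Prog.Cert init edge rules (x.G.n :: x.recs.flatMap Prog.quad) ρ0 E I W → ρ0 31 = 0 →
      (∀ y ∈ Prog.allInst init edge ρ0 E I, ∀ i, y.2 i ≤ X) → (∀ w ∈ W, w ≤ X) → W.length ≤ X →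
      8 ≤ X → (X : ℝ) ≤ C * (x.G.magnitude : ℝ) ^ a →
      ((1 + E.length + I.length + W.length : ℕ) : ℝ) ≤ C * (x.bound k * x.lg ^ 2) →
      M.CanOutput x.G.encode b) ∧
    ∀ y, ¬ M.CanOutput y b → M.AlwaysOutputs y !b := by
  obtain ⟨C0, h⟩ := Prog.exists_checker_machine hk init edge rules b
  obtain ⟨a1, ha1⟩ : ∃ a1, a1 = 2 + 2 * Real.log C + 2 * a := ⟨_, rfl⟩
  obtain ⟨a2, ha2⟩ : ∃ a2, a2 = 2 + 2 * Real.log C + 2 * (6 : ℕ) := ⟨_, rfl⟩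
  have hlogC := Real.log_nonneg hC
  -- The clock is lengthened by a constant factor that covers the cost of checking and the loss in
  -- `exists_isExp`.
  obtain ⟨c2, hc2⟩ := pow_unbounded_of_one_lt (16 * 8 ^ 4 * (C0 * a1 * a2 * C))
    (by norm_num : (1 : ℝ) < 2)
  -- The exponent 4 of the logarithm is 2 for the number of instances, 1 for the bit length of the
  -- numbers and 1 for the passes of the radix sort.
  obtain ⟨M, c, hrun, hsound, hcomp, hno⟩ := h 4 (c2 + 1)
  refine ⟨2 * c * (36 + 4 * 9 ^ 4 * 2 ^ (c2 + 1)) + 2, M, fun x => ?_, fun x hx => ?_,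
    fun x ρ0 E I W X hcert h31 hX hW hWX hX8 hXM hN => ?_, hno⟩
  · have hlg := one_le_lg (x := x)
    have hb : 1 ≤ x.bound k := one_le_m.trans m_le_bound
    have hp : 1 ≤ x.bound k * x.lg ^ 4 := one_le_mul_of_one_le_of_one_le hb (one_le_pow₀ hlg)
    have hq : x.bound k * x.lg ≤ x.bound k * x.lg ^ 4 := by
      gcongr
      exact le_self_pow₀ hlg (by norm_num)
    have hrun := hrun x.G.n x.recs ⌊4 * 9 ^ 4 * 2 ^ (c2 + 1) * x.bound k * x.lg ^ 4⌋₊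
      fun K hK => Nat.le_floor (two_pow_le_of_isExp hk hK)
    rw [← encode_eq] at hrun
    intro t cfg ht
    refine (hrun t cfg ht).trans ?_
    have h1 := length_encode_le (x := x) (k := k)
    have h2 := Nat.floor_le
      (show 0 ≤ 4 * 9 ^ 4 * 2 ^ (c2 + 1) * x.bound k * x.lg ^ 4 by positivity)
    push_cast
    have h3 : (x.G.encode.length : ℝ) + ⌊4 * 9 ^ 4 * 2 ^ (c2 + 1) * x.bound k * x.lg ^ 4⌋₊ + 1 ≤
        (36 + 4 * 9 ^ 4 * 2 ^ (c2 + 1)) * (x.bound k * x.lg ^ 4) := by linarith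
    have h4 := mul_le_mul_of_nonneg_left h3 (Nat.cast_nonneg (α := ℝ) c)
    linarith
  · rw [encode_eq] at hx
    exact hsound _ _ hx
  · have hlg := one_le_lg (x := x)
    have hb : 1 ≤ x.bound k := one_le_m.trans m_le_bound
    obtain ⟨K, hK, hK'⟩ := exists_isExp (x := x) (c1 := 4) (c2 := c2 + 1) hk (by omega)
    obtain ⟨N, hN'⟩ : ∃ N, N = 1 + E.length + I.length + W.length := ⟨_, rfl⟩
    rw [← hN'] at hN
    have hsz : ∀ {v}, v ≤ X → v.bits.length ≤ X.size := fun hv => by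
      rw [Nat.size_eq_bits_len]; exact Nat.size_le_size hv
    rw [encode_eq]
    refine hcomp _ _ ρ0 E I W X.size N K hcert h31 (fun y hy i => hsz (hX y hy i))
      (fun w hw => hsz (hW w hw)) (hsz hWX) (Nat.lt_size.2 (by omega)) hN'.ge hK ?_
    have hM : (3 : ℝ) ≤ x.G.magnitude := by exact_mod_cast three_le_magnitude
    have h1 : ((X.size + 1 : ℕ) : ℝ) ≤ a1 * x.lg := by
      have := size_le (x := x) hC hXM
      push_cast; rw [ha1]; linarith
    have h2 : ((N.size + 1 : ℕ) : ℝ) ≤ a2 * x.lg := by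
      have hN6 : (N : ℝ) ≤ C * (x.G.magnitude : ℝ) ^ 6 := by
        have hlgM : x.lg ≤ x.G.magnitude := Real.log_le_self (by positivity)
        calc (N : ℝ) ≤ C * (x.bound k * x.lg ^ 2) := hN
          _ ≤ C * ((x.G.magnitude : ℝ) ^ 4 * (x.G.magnitude : ℝ) ^ 2) := by
            gcongr; exact bound_le hk
          _ = _ := by ring
      have := size_le (x := x) hC hN6
      push_cast at this ⊢; rw [ha2]; push_cast; linarith
    have ha1' : 0 ≤ a1 := by rw [ha1]; positivity
    have ha2' : 0 ≤ a2 := by rw [ha2]; positivity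
    have h3 : ((C0 * (X.size + 1) * (N * (N.size + 1)) : ℕ) : ℝ) ≤ ((2 ^ K : ℕ) : ℝ) := by
      have : ((C0 * (X.size + 1) * (N * (N.size + 1)) : ℕ) : ℝ) =
        C0 * ((X.size + 1 : ℕ) : ℝ) * (N * ((N.size + 1 : ℕ) : ℝ)) := by push_cast; ring
      rw [this]
      have h4 : C0 * ((X.size + 1 : ℕ) : ℝ) * (N * ((N.size + 1 : ℕ) : ℝ)) ≤
          C0 * (a1 * x.lg) * (C * (x.bound k * x.lg ^ 2) * (a2 * x.lg)) := by gcongr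
      have h5 := mul_le_mul_of_nonneg_right hc2.le
        (show 0 ≤ x.bound k * x.lg ^ 4 by positivity)
      have h6 : (0 : ℝ) ≤ 2 ^ c2 * (x.bound k * x.lg ^ 4) := by positivity
      rw [pow_succ] at hK'
      nlinarith
    exact_mod_cast h3

end DiameterInput

/-! ### Distances to and from sets of vertices as labels -/

namespace WGraph

variable {V E : Type} {g : WGraph V E} {R : ℕ}

/-- The label is the distance to the nearest vertex of `H`. It is attained along the first edge of a
shortest path, so each label is explained by one edge or is zero. -/
theorem exists_potential_to (hc : ∀ u v, ∃ l, g.Path u l v) {H : Finset V}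
    (hH : ∀ u, ∃ h ∈ H, g.d u h ≤ R) : ∃ α : V → ℕ, ∀ u, α u ≤ R ∧
      (α u = 0 ∧ u ∈ H ∨ ∃ e, g.src e = u ∧ α (g.tgt e) + g.w e = α u) := by
  have hα : ∀ u, ∃ s, (∃ h ∈ H, g.d u h = s) ∧ ∀ h ∈ H, s ≤ g.d u h := fun u => by
    obtain ⟨h0, h₀H, -⟩ := hH u
    obtain ⟨h, hh, hmin⟩ := H.exists_min_image (g.d u) ⟨h0, h₀H⟩
    exact ⟨_, ⟨h, hh, rfl⟩, hmin⟩
  choose α hα hmin using hα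
  refine ⟨α, fun u => ⟨?_, ?_⟩⟩
  · obtain ⟨h, hh, hR⟩ := hH u
    exact (hmin u h hh).trans hR
  obtain ⟨h, hh, hd⟩ := hα u
  obtain ⟨l, hl, hlen⟩ := exists_path (hc u h)
  cases l with
  | nil => cases hl; exact .inl ⟨by rw [← hd, ← hlen]; rfl, hh⟩
  | cons e l =>
    obtain ⟨rfl, hl⟩ := hl
    obtain ⟨h', hh', hd'⟩ := hα (g.tgt e)
    have h1 := d_edge hc e h'
    have h2 := hmin (g.src e) h' hh'
    have h3 := hmin (g.tgt e) h hh
    have h4 := d_le hl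
    rw [len_cons] at hlen
    exact .inr ⟨e, rfl, by omega⟩

theorem exists_potential_from (hc : ∀ u v, ∃ l, g.Path u l v) {W : Finset V}
    (hW : ∀ z, ∃ y ∈ W, g.d y z ≤ R) : ∃ β : V → ℕ, ∀ z, β z ≤ R ∧
      (β z = 0 ∧ z ∈ W ∨ ∃ e, g.tgt e = z ∧ β (g.src e) + g.w e = β z) := by
  have hβ : ∀ z, ∃ s, (∃ y ∈ W, g.d y z = s) ∧ ∀ y ∈ W, s ≤ g.d y z := fun z => by
    obtain ⟨y0, hy0, -⟩ := hW z
    obtain ⟨y, hy, hmin⟩ := W.exists_min_image (g.d · z) ⟨y0, hy0⟩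
    exact ⟨_, ⟨y, hy, rfl⟩, hmin⟩
  choose β hβ hmin using hβ
  refine ⟨β, fun z => ⟨?_, ?_⟩⟩
  · obtain ⟨y, hy, hR⟩ := hW z
    exact (hmin z y hy).trans hR
  obtain ⟨y, hy, hd⟩ := hβ z
  obtain ⟨l, hl, hlen⟩ := exists_path (hc y z)
  rcases l.eq_nil_or_concat with rfl | ⟨l, e, rfl⟩
  · cases hl; exact .inl ⟨by rw [← hd, ← hlen]; rfl, hy⟩
  · rw [List.concat_eq_append] at hl hlen
    obtain ⟨c, hl', rfl, rfl⟩ := path_append.1 hl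
    obtain ⟨y', hy', hd'⟩ := hβ (g.src e)
    have h1 := d_edge' hc e y'
    have h2 := hmin (g.tgt e) y' hy'
    have h3 := hmin (g.src e) y hy
    have h4 := d_le hl'
    rw [len_append, len_cons] at hlen
    have h5 : g.len ([] : List E) = 0 := rfl
    exact .inr ⟨e, rfl, by omega⟩

end WGraph

/-! ### Distances for the rational weights and for the rounded weights -/

namespace DiameterInput

variable (x : DiameterInput)

/-- The graph with rounded weights. -/
def wgraph (w : Prog.Rec → ℕ) : WGraph (Fin x.G.n) (Fin x.G.m) :=
  ⟨x.G.src, x.G.tgt, fun e => w (x.rcd e)⟩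

variable {x} {w : Prog.Rec → ℕ} {u v : Fin x.G.n} {l : List (Fin x.G.m)} {c r : ℝ}

theorem walkLength_of_path (h : (x.wgraph w).Path u l v) :
    x.G.WalkLength u v (l.map x.G.wt).sum := by
  induction l generalizing u with
  | nil => cases h; exact .nil _
  | cons e l ih => obtain ⟨rfl, h⟩ := h; exact .cons e v _ (ih h)

theorem exists_path_of_walkLength {L : ℚ} (h : x.G.WalkLength u v L) (w : Prog.Rec → ℕ) :
    ∃ l, (x.wgraph w).Path u l v ∧ (l.map x.G.wt).sum = L := by
  induction h with
  | nil u => exact ⟨[], rfl, rfl⟩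
  | cons e v L _ ih =>
    obtain ⟨l, h, rfl⟩ := ih
    exact ⟨e :: l, ⟨rfl, h⟩, rfl⟩

theorem connected (u v : Fin x.G.n) : ∃ l, (x.wgraph w).Path u l v := by
  obtain ⟨L, h⟩ := x.strong u v
  obtain ⟨l, h, -⟩ := exists_path_of_walkLength h w
  exact ⟨l, h⟩

theorem walkLength_nonneg {L : ℚ} (h : x.G.WalkLength u v L) : 0 ≤ L := by
  induction h with
  | nil => rfl
  | cons e v L _ ih => have := x.wt_pos e; linarith

theorem dist_le {L : ℚ} (h : x.G.WalkLength u v L) : x.G.dist u v ≤ L := by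
  refine csInf_le ⟨0, ?_⟩ ⟨L, h, rfl⟩
  rintro _ ⟨L, h, rfl⟩
  exact_mod_cast walkLength_nonneg h

theorem le_dist (h : ∀ L, x.G.WalkLength u v L → r ≤ L) : r ≤ x.G.dist u v := by
  obtain ⟨L, hL⟩ := x.strong u v
  refine le_csInf ⟨_, L, hL, rfl⟩ ?_
  rintro _ ⟨L, hL, rfl⟩
  exact h L hL

theorem nonempty_vertex : Nonempty (Fin x.G.n) := ⟨x.G.src ⟨0, x.edge⟩⟩

theorem dist_le_diam (u v : Fin x.G.n) : x.G.dist u v ≤ x.G.diam :=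
  le_ciSup (f := fun p : Fin x.G.n × Fin x.G.n => x.G.dist p.1 p.2)
    (Set.finite_range _).bddAbove (u, v)

theorem diam_le (h : ∀ u v, x.G.dist u v ≤ r) : x.G.diam ≤ r :=
  have := nonempty_vertex (x := x); ciSup_le fun p => h p.1 p.2

theorem exists_lt_dist (h : r < x.G.diam) : ∃ u v, r < x.G.dist u v := by
  by_contra! h'
  exact absurd (diam_le h') (not_le.2 h)

theorem len_le_mul (h : ∀ e, (w (x.rcd e) : ℝ) ≤ c * x.G.wt e) :
    ((x.wgraph w).len l : ℝ) ≤ c * ((l.map x.G.wt).sum : ℚ) := by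
  induction l with
  | nil => simp [WGraph.len]
  | cons e l ih =>
    have := h e
    rw [WGraph.len_cons]
    simp only [List.map_cons, List.sum_cons]
    push_cast at *
    simp only [wgraph] at *
    linarith

theorem mul_le_len (h : ∀ e, c * x.G.wt e ≤ (w (x.rcd e) : ℝ)) :
    c * ((l.map x.G.wt).sum : ℚ) ≤ ((x.wgraph w).len l : ℝ) := by
  induction l with
  | nil => simp [WGraph.len]
  | cons e l ih =>
    have := h e
    rw [WGraph.len_cons]
    simp only [List.map_cons, List.sum_cons]
    push_cast at *
    simp only [wgraph] at *
    linarith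

theorem length_mul_Wmin_le : (l.length : ℝ) * x.G.Wmin ≤ ((l.map x.G.wt).sum : ℚ) := by
  induction l with
  | nil => simp
  | cons e l ih =>
    have := Wmin_le_wt e
    simp only [List.map_cons, List.sum_cons, List.length_cons]
    push_cast
    push_cast at ih
    linarith

theorem d_le_mul_dist (hc : 0 < c) (h : ∀ e, (w (x.rcd e) : ℝ) ≤ c * x.G.wt e) :
    ((x.wgraph w).d u v : ℝ) ≤ c * x.G.dist u v := by
  rw [← div_le_iff₀' hc]
  refine le_dist fun L hL => ?_
  obtain ⟨l, hl, rfl⟩ := exists_path_of_walkLength hL w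
  rw [div_le_iff₀' hc]
  exact le_trans (by exact_mod_cast WGraph.d_le hl) (len_le_mul h)

theorem mul_dist_le_d (hc : 0 ≤ c) (h : ∀ e, c * x.G.wt e ≤ (w (x.rcd e) : ℝ)) :
    c * x.G.dist u v ≤ ((x.wgraph w).d u v : ℝ) := by
  obtain ⟨l, hl, hlen⟩ := WGraph.exists_path (connected (w := w) u v)
  rw [← hlen]
  exact (mul_le_mul_of_nonneg_left (dist_le (walkLength_of_path hl)) hc).trans (mul_le_len h)

theorem recGraph_path (h : (x.wgraph w).Path u l v) :
    (Prog.Near.recGraph w).Path u (l.map x.rcd) v := by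
  induction l generalizing u with
  | nil => cases h; rfl
  | cons e l ih => obtain ⟨rfl, h⟩ := h; exact ⟨rfl, ih h⟩

theorem recGraph_len : (Prog.Near.recGraph w).len (l.map x.rcd) = (x.wgraph w).len l := by
  simp [WGraph.len, Prog.Near.recGraph, wgraph, Function.comp_def]

theorem num_le_magnitude (e : Fin x.G.m) : (x.G.wt e).num.natAbs ≤ x.G.magnitude := by
  have := add_le_magnitude e; omega

theorem den_le_magnitude (e : Fin x.G.m) : (x.G.wt e).den ≤ x.G.magnitude := by
  have := add_le_magnitude e; omega

theorem n_le_magnitude : x.G.n ≤ x.G.magnitude := n_le_m.trans m_le_magnitude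

/-- With the scale `a * magnitude` every scaled weight is at least `a`, so rounding it to an integer
changes it by a relative error of at most `1 / a`. -/
theorem le_mul_wt {a : ℕ} (e : Fin x.G.m) :
    (a : ℝ) ≤ ((a * x.G.magnitude : ℕ) : ℝ) * x.G.wt e := by
  have h1 := one_le_magnitude_mul_Wmin (x := x)
  have h2 : (x.G.magnitude : ℝ) * x.G.Wmin ≤ x.G.magnitude * x.G.wt e := by
    gcongr; exact Wmin_le_wt e
  push_cast
  nlinarith [Nat.cast_nonneg (α := ℝ) a]

end DiameterInput

/-! ### The machine that certifies a large diameter -/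

namespace DiameterInput

variable {x : DiameterInput}

/-- Summing the inequalities of the edges along a walk, `φ` grows by at most `N` times the length of
the walk. -/
theorem div_le_dist_of_far {N t p q : ℕ} {φ : ℕ → ℕ} (hN : 1 ≤ N) (hq : 1 ≤ q)
    (ht : p * N ≤ q * t)
    (hφ : ∀ e ∈ x.recs, ∃ w, e.2.2.2 * w ≤ e.2.2.1 * N ∧ φ e.2.1 ≤ φ e.1 + w)
    {u v : Fin x.G.n} (huv : φ v = φ u + t) : (p / q : ℝ) ≤ x.G.dist u v := by
  refine le_dist fun L hL => ?_
  have hwalk : (φ v : ℝ) ≤ φ u + N * L := by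
    clear huv
    induction hL with
    | nil => simp
    | cons e v L _ ih =>
      obtain ⟨w, hw, hφe⟩ := hφ _ (mem_recs.2 ⟨e, rfl⟩)
      have h1 : (w : ℝ) ≤ N * x.G.wt e := by
        have hd : (0 : ℝ) < (x.G.wt e).den := by exact_mod_cast (x.G.wt e).den_pos
        rw [wt_eq, mul_div_assoc', le_div_iff₀ hd, mul_comm, mul_comm (N : ℝ)]
        exact_mod_cast hw
      have h2 : (φ (x.G.tgt e) : ℝ) ≤ φ (x.G.src e) + w := by exact_mod_cast hφe
      push_cast
      linarith
  rw [huv] at hwalk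
  push_cast at hwalk
  have hN' : (0 : ℝ) < N := by exact_mod_cast hN
  have hq' : (0 : ℝ) < q := by exact_mod_cast hq
  have ht' : (p : ℝ) * N ≤ q * t := by exact_mod_cast ht
  rw [div_le_iff₀ hq']
  nlinarith

theorem exists_div_btwn {a b : ℝ} (ha : 0 ≤ a) (h : a < b) :
    ∃ p q : ℕ, 1 ≤ q ∧ a < p / q ∧ (p / q : ℝ) < b := by
  obtain ⟨r, h1, h2⟩ := exists_rat_btwn h
  have h3 : (r : ℝ) = (r.num.natAbs : ℕ) / (r.den : ℕ) := by
    have hr : 0 < r := by exact_mod_cast ha.trans_lt h1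
    have h : (r.num.natAbs : ℤ) = r.num := by have := Rat.num_pos.2 hr; omega
    rw [Rat.cast_def, ← h]; simp
  exact ⟨_, _, r.den_pos, h3 ▸ h1, h3 ▸ h2⟩

/-- The distances in a graph of bounded weights. -/
theorem d_le_mul {w : Prog.Rec → ℕ} {y : ℕ} (hw : ∀ e, 1 ≤ w (x.rcd e))
    (hy : ∀ e, w (x.rcd e) ≤ y) (u v : Fin x.G.n) :
    (x.wgraph w).d u v ≤ x.G.magnitude * y := by
  obtain ⟨l, hl, hlen⟩ := WGraph.exists_path (connected (w := w) u v)
  have hnd := WGraph.Short.nodup connected hw ⟨hl, hlen⟩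
  have h1 : l.length ≤ x.G.m := by simpa using hnd.length_le_card
  rw [← hlen]
  exact (WGraph.len_le hy).trans (Nat.mul_le_mul_right _ (h1.trans m_le_magnitude))

set_option maxHeartbeats 400000 in
theorem exists_far_machine {k : ℕ} (hk : 1 ≤ k) {D b : ℝ} (hD : 0 < D) (hDb : D < b) :
    ∃ (C : ℝ) (M : NTM),
      (∀ x : DiameterInput, M.RunsInTime x.G.encode (C * x.bound k * x.lg ^ 4)) ∧
      (∀ x : DiameterInput, b < x.G.diam → M.CanOutput x.G.encode true) ∧
      ∀ x : DiameterInput, x.G.diam ≤ D → M.AlwaysOutputs x.G.encode false := by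
  -- So that `(1 - 1 / a) * b` still exceeds `D`: distances may shrink by the factor `1 - 1 / a`
  -- when weights are rounded down.
  obtain ⟨a, ha⟩ := exists_nat_gt (b / (b - D))
  have hbD : 0 < b - D := sub_pos.2 hDb
  have ha0 : (0 : ℝ) < a := lt_trans (by have := hD.trans hDb; positivity) ha
  have ha1 : 1 ≤ a := by exact_mod_cast ha0
  obtain ⟨p, q, hq1, hDr, hrb⟩ : ∃ p q : ℕ, 1 ≤ q ∧ D < p / q ∧ (p / q : ℝ) < (1 - 1 / a) * b := by
    refine exists_div_btwn hD.le ?_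
    rw [div_lt_iff₀ hbD] at ha
    have : 1 / a * b < b - D := by rw [one_div_mul_eq_div, div_lt_iff₀ ha0]; linarith
    linarith
  obtain ⟨CX, hCX⟩ : ∃ CX, CX = (8 + p + 2 * q) * a := ⟨_, rfl⟩
  have hCX1 : (1 : ℝ) ≤ CX := by
    exact_mod_cast (by rw [hCX]; nlinarith : 1 ≤ CX)
  obtain ⟨S, hS⟩ : ∃ S, S = 1 + 2 * Real.log CX + 2 * (3 : ℕ) := ⟨_, rfl⟩
  have hS0 : 0 ≤ S := by have := Real.log_nonneg hCX1; rw [hS]; positivity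
  obtain ⟨C', M, hrun, hsound, hcomp, hno⟩ := exists_decider hk (Prog.farInit p q) Prog.farEdge
    Prog.mulRules true (C := CX + (7 + 4 * S)) (by linarith) 3
  refine ⟨C', M, hrun, fun x hx => ?_, fun x hx => hno _ fun h => ?_⟩
  · have hM3 := three_le_magnitude (x := x)
    have hnM := n_le_magnitude (x := x)
    have hnum := num_le_magnitude (x := x)
    have hden := den_le_magnitude (x := x)
    have hd := fun w y => d_le_mul (x := x) (w := w) (y := y)
    have hwt := le_mul_wt (x := x) (a := a)
    obtain ⟨μ, hμ⟩ : ∃ μ, μ = x.G.magnitude := ⟨_, rfl⟩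
    simp only [← hμ] at hM3 hnM hnum hden hd hwt
    -- The scale of `le_mul_wt`; it is polynomial in the magnitude, so all numbers keep logarithmic
    -- length.
    obtain ⟨N, hN⟩ : ∃ N, N = a * μ := ⟨_, rfl⟩
    rw [← hN] at hwt
    have hN1 : 1 ≤ N := by rw [hN]; nlinarith
    have hμN : μ ≤ N := by rw [hN]; nlinarith
    -- Rounding down keeps the inequality demanded of each edge: labels computed with `w` prove
    -- lower bounds for the true weights.
    obtain ⟨w, hw⟩ : ∃ w : Prog.Rec → ℕ, ∀ e, w e = e.2.2.1 * N / e.2.2.2 := ⟨_, fun _ => rfl⟩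
    have hw' : ∀ e, w (x.rcd e) = (x.G.wt e).num.natAbs * N / (x.G.wt e).den := fun e => hw _
    have hw1 : ∀ e, 1 ≤ w (x.rcd e) := fun e => by
      rw [hw', Nat.one_le_div_iff (x.G.wt e).den_pos]
      have := hden e
      have := num_pos e
      nlinarith
    have hwle : ∀ e, w (x.rcd e) ≤ μ * N := fun e => by
      rw [hw']
      exact (Nat.div_le_self _ _).trans (Nat.mul_le_mul_right _ (hnum e))
    -- A bound on all distances: a shortest path has at most `μ` edges, each of rounded weight at
    -- most `μ * N`.
    obtain ⟨A, hA⟩ : ∃ A, A = a * μ ^ 3 := ⟨_, rfl⟩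
    have hμμ : μ * (μ * N) = A := by rw [hA, hN]; ring
    have hμNA : μ * N ≤ A := by rw [← hμμ]; exact Nat.le_mul_of_pos_left _ (by omega)
    have hNA : N ≤ A := (Nat.le_mul_of_pos_left N (by omega)).trans hμNA
    have hdA : ∀ u v, (x.wgraph w).d u v ≤ A := fun u v => by rw [← hμμ]; exact hd w _ hw1 hwle u v
    obtain ⟨X, hX⟩ : ∃ X, X = (8 + p + 2 * q) * A := ⟨_, rfl⟩
    have hpA : p * A + q * A + 8 * A ≤ X := by rw [hX]; nlinarith
    have hpN : p * N ≤ p * A := Nat.mul_le_mul_left p hNA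
    have hpA' : p ≤ p * A := Nat.le_mul_of_pos_right p (by omega)
    have hqA' : q ≤ q * A := Nat.le_mul_of_pos_right q (by omega)
    have hlow : ∀ e, ((1 - 1 / a) * N : ℝ) * x.G.wt e ≤ (w (x.rcd e) : ℝ) := fun e => by
      have hdpos : (0 : ℝ) < (x.G.wt e).den := by exact_mod_cast (x.G.wt e).den_pos
      have h1 : (N : ℝ) * x.G.wt e < w (x.rcd e) + 1 := by
        rw [wt_eq, mul_div_assoc', div_lt_iff₀ hdpos]
        have := Nat.lt_mul_div_succ ((x.G.wt e).num.natAbs * N) (x.G.wt e).den_pos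
        rw [← hw' e] at this
        rw [mul_comm (N : ℝ), mul_comm _ ((x.G.wt e).den : ℝ)]
        exact_mod_cast this
      have h2 : 1 ≤ 1 / a * ((N : ℝ) * x.G.wt e) := by
        rw [one_div_mul_eq_div, one_le_div ha0]; exact hwt e
      nlinarith
    obtain ⟨u, v, huv⟩ := exists_lt_dist hx
    obtain ⟨t, ht⟩ : ∃ t, t = (x.wgraph w).d u v := ⟨_, rfl⟩
    have htA : t ≤ A := ht ▸ hdA u v
    have hqt : q * t ≤ q * A := Nat.mul_le_mul_left q htA
    have ha1' : (1 : ℝ) / a ≤ 1 := (div_le_one ha0).2 (by exact_mod_cast ha1)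
    have hpqt : p * N ≤ q * t := by
      have hN0 : (0 : ℝ) < N := by exact_mod_cast hN1
      have hq0 : (0 : ℝ) < q := by exact_mod_cast hq1
      have h1 := mul_dist_le_d (x := x) (u := u) (v := v)
        (mul_nonneg (sub_nonneg.2 ha1') hN0.le) hlow
      rw [← ht] at h1
      have h2 : (p / q : ℝ) * N ≤ t := by
        refine le_trans ?_ h1
        rw [mul_comm (1 - 1 / (a : ℝ)), mul_assoc, mul_comm]
        refine mul_le_mul_of_nonneg_left (hrb.le.trans ?_) hN0.le
        exact mul_le_mul_of_nonneg_left huv.le (sub_nonneg.2 ha1')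
      rw [div_mul_eq_mul_div, div_le_iff₀ hq0, mul_comm (t : ℝ)] at h2
      exact_mod_cast h2
    -- The enumerated sequence holds the labels, here the distances from one end of a large
    -- distance.
    obtain ⟨W, hW⟩ : ∃ W : List ℕ, W = List.ofFn fun z => (x.wgraph w).d u z := ⟨_, rfl⟩
    have hWlen : W.length = x.G.n := by simp [hW]
    have hWget : ∀ z : Fin x.G.n, W.getD z 0 = (x.wgraph w).d u z := fun z => by simp [hW]
    have hWA : ∀ y ∈ W, y ≤ A := by
      intro y hy
      rw [hW, List.mem_ofFn] at hy
      obtain ⟨z, rfl⟩ := hy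
      exact hdA u z
    obtain ⟨ρ0, E, I, hcert, h31, hval, hE, hI⟩ := Prog.exists_cert_far (p := p) (q := q)
      (n := x.G.n) (N := N) (t := t) (es := x.recs) (W := W) (w := w) (X := X) (by omega)
      ⟨by omega, by omega, by omega, by omega, by omega, by omega⟩
      (fun y hy => (hWA y hy).trans (by omega)) hN1 hpqt
      (by
        intro r hr
        obtain ⟨e, rfl⟩ := mem_recs.1 hr
        have h1 := (x.G.src e).2
        have h2 := (x.G.tgt e).2
        have h3 := hnum e
        have h4 := hden e
        have h5 := hwle e
        have h6 := hdA u (x.G.src e)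
        have h7 := Nat.mul_le_mul_right N h3
        have h8 : W.getD (x.G.tgt e) 0 ≤ W.getD (x.G.src e) 0 + w (x.rcd e) := by
          rw [hWget, hWget]
          exact WGraph.d_edge' (g := x.wgraph w) connected e u
        have h9 : (x.G.wt e).den * w (x.rcd e) ≤ (x.G.wt e).num.natAbs * N := by
          rw [hw']; exact Nat.mul_div_le _ _
        have h10 := hWget (x.G.src e)
        refine ⟨?_, ?_, h9, h8, ?_, ?_, ?_, ?_, ?_, ?_, ?_, ?_⟩ <;> simp only [rcd] at * <;> omega)
      (by
        obtain ⟨e, rfl⟩ := exists_src u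
        obtain ⟨f, rfl⟩ := exists_src v
        refine ⟨_, mem_recs.2 ⟨e, rfl⟩, _, mem_recs.2 ⟨f, rfl⟩, ?_⟩
        simp only [rcd]
        rw [hWget, hWget, WGraph.d_self, ht, zero_add])
    have hXM : (X : ℝ) ≤ CX * (x.G.magnitude : ℝ) ^ 3 := by
      rw [← hμ]
      exact_mod_cast (by rw [hX, hA, hCX]; linarith : X ≤ CX * μ ^ 3)
    refine hcomp x ρ0 E I W X hcert h31 hval (fun y hy => (hWA y hy).trans (by omega)) (by omega)
      (by omega) (hXM.trans ?_) ?_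
    · gcongr; linarith
    · clear * - hE hI hXM hCX1 hS0 hS hWlen
      have hXS := size_le hCX1 hXM
      rw [← hS] at hXS
      have hlg := one_le_lg (x := x)
      have hm := one_le_m (x := x)
      have hmb := m_le_bound (x := x) (k := k)
      rw [length_recs] at hE hI
      have h1 : 1 + E.length + I.length + W.length ≤ x.G.m * (7 + 4 * X.size) := by
        have h2 := n_le_m (x := x)
        have h3 := x.edge
        have h4 := Nat.mul_le_mul_right (2 * X.size + 2) (show x.G.m + 1 ≤ 2 * x.G.m by omega)
        rw [hE, hWlen]
        linarith
      have h2 : (7 + 4 * X.size : ℝ) ≤ (7 + 4 * S) * x.lg ^ 2 := by nlinarith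
      calc ((1 + E.length + I.length + W.length : ℕ) : ℝ) ≤ x.G.m * (7 + 4 * X.size) := by
            exact_mod_cast h1
        _ ≤ x.bound k * ((7 + 4 * S) * x.lg ^ 2) :=
            mul_le_mul hmb h2 (by positivity) (by linarith)
        _ ≤ x.bound k * ((CX + (7 + 4 * S)) * x.lg ^ 2) := by
            have : 0 ≤ x.bound k := by linarith
            refine mul_le_mul_of_nonneg_left (mul_le_mul_of_nonneg_right ?_ (by positivity)) this
            linarith
        _ = _ := by ring
  · obtain ⟨ρ0, E, I, W, hcert⟩ := hsound x h
    obtain ⟨N, t, φ, hN, ht, hφ, _, he, _, hf, hef⟩ := hcert.far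
    obtain ⟨e, rfl⟩ := mem_recs.1 he
    obtain ⟨f, rfl⟩ := mem_recs.1 hf
    have := div_le_dist_of_far hN hq1 ht hφ hef
    have := dist_le_diam (x.G.src e) (x.G.src f)
    linarith

end DiameterInput

/-! ### Covers of graphs of small diameter -/

namespace DiameterInput

variable {x : DiameterInput}

theorem dist_le_div_of_near {N t p q : ℕ} {R : ℕ → ℕ → ℕ → Prop} (hN : 1 ≤ N) (hq : 1 ≤ q)
    (ht : q * t ≤ p * N) (hR : ∀ a c w, R a c w → ∃ e ∈ x.recs, e.1 = a ∧ e.2.1 = c ∧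
      e.2.2.1 * N ≤ e.2.2.2 * w) {u v : Fin x.G.n} {s : ℕ} (hs : s ≤ t)
    (h : Prog.Near.Reach R u v s) : x.G.dist u v ≤ p / q := by
  have hwalk : ∀ {a b s}, Prog.Near.Reach R a b s → ∀ u v : Fin x.G.n, (u : ℕ) = a → (v : ℕ) = b →
      ∃ L, x.G.WalkLength u v L ∧ N * (L : ℝ) ≤ s := by
    intro a b s h
    induction h with
    | refl a =>
      rintro u v hu hv
      obtain rfl : u = v := Fin.ext (hu.trans hv.symm)
      exact ⟨0, .nil u, by simp⟩
    | @step a c b w s hac _ ih =>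
      intro u v hu hv
      obtain ⟨_, he, h1, h2, h3⟩ := hR _ _ _ hac
      obtain ⟨e, rfl⟩ := mem_recs.1 he
      obtain ⟨L, hL, hLs⟩ := ih (x.G.tgt e) v h2 hv
      obtain rfl : x.G.src e = u := Fin.ext (h1.trans hu.symm)
      have h4 : (N : ℝ) * x.G.wt e ≤ w := by
        have hd : (0 : ℝ) < (x.G.wt e).den := by exact_mod_cast (x.G.wt e).den_pos
        rw [wt_eq, mul_div_assoc', div_le_iff₀ hd, mul_comm, mul_comm (w : ℝ)]
        exact_mod_cast h3
      refine ⟨_, .cons e v L hL, ?_⟩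
      push_cast
      linarith
  obtain ⟨L, hL, hLs⟩ := hwalk h u v rfl rfl
  have hN' : (0 : ℝ) < N := by exact_mod_cast hN
  have hq' : (0 : ℝ) < q := by exact_mod_cast hq
  have ht' : (q : ℝ) * s ≤ p * N := by
    exact_mod_cast (Nat.mul_le_mul_left q hs).trans ht
  refine (dist_le hL).trans ?_
  rw [le_div_iff₀ hq']
  nlinarith

/-- Few short paths that prove an upper bound on all distances. -/
theorem exists_near_cover {k : ℕ} (hk : 1 ≤ k) {δ b : ℝ} (hδ : 0 < δ) (hδ1 : δ ≤ 1) (hb : 0 < b)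
    {N : ℕ} (hN : 1 ≤ N) {w : Prog.Rec → ℕ} (hw : ∀ e, N * (x.G.wt e : ℝ) ≤ w (x.rcd e))
    (hw' : ∀ e, (w (x.rcd e) : ℝ) ≤ (1 + δ) * N * x.G.wt e) (hbN : 1 ≤ δ * b * N)
    (hx : x.G.diam ≤ b) :
    ∃ (H W : Finset (Fin x.G.n)) (R1 R2 R3 P : ℕ), (∀ u, ∃ h ∈ H, (x.wgraph w).d u h ≤ R1) ∧
      (∀ z, ∃ y ∈ W, (x.wgraph w).d y z ≤ R3) ∧
      (∀ h ∈ H, ∀ y ∈ W, ∃ l, (x.wgraph w).Path h l y ∧ (x.wgraph w).len l ≤ R2 ∧ l.length ≤ P) ∧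
      ((R1 + R2 + R3 : ℕ) : ℝ) ≤ (2 - 1 / k + 5 * δ) * b * N ∧
      ((H.card * W.card * (P + 1) : ℕ) : ℝ) ≤ 40 / δ * (x.bound k * x.lg ^ 2) := by
  have hN0 : (0 : ℝ) < N := by exact_mod_cast hN
  have hk1 : (1 : ℝ) ≤ k := by exact_mod_cast hk
  have hwmax := wt_le_Wmax (x := x)
  have hmin0 := Wmin_pos (x := x)
  have hmax0 := hmin0.trans_le (Wmin_le_Wmax (x := x))
  have hw1 : ∀ e, 1 ≤ w (x.rcd e) := fun e => by
    have h1 : (0 : ℝ) < x.G.wt e := by exact_mod_cast x.wt_pos e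
    exact_mod_cast (mul_pos hN0 h1).trans_le (hw e)
  -- On the scale `N` with rounded weights, `B` bounds the distances, `η` is the tolerated loss, a
  -- fraction `δ` of the diameter, and `y` bounds the edge weights.
  obtain ⟨B, hB⟩ : ∃ B, B = ⌊(1 + δ) * N * b⌋₊ := ⟨_, rfl⟩
  obtain ⟨η, hη⟩ : ∃ η, η = ⌊δ * b * N⌋₊ := ⟨_, rfl⟩
  obtain ⟨y, hy⟩ : ∃ y, y = ⌊(1 + δ) * N * x.G.Wmax⌋₊ := ⟨_, rfl⟩
  have hB' : (B : ℝ) ≤ (1 + δ) * N * b := hB ▸ Nat.floor_le (by positivity)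
  have hη' : (η : ℝ) ≤ δ * b * N := hη ▸ Nat.floor_le (by positivity)
  have hη'' : δ * b * N < η + 1 := hη ▸ Nat.lt_floor_add_one _
  have hy' : (y : ℝ) ≤ (1 + δ) * N * x.G.Wmax := hy ▸ Nat.floor_le (by positivity)
  have hwy : ∀ e, w (x.rcd e) ≤ y := fun e => by
    rw [hy]
    refine Nat.le_floor ((hw' e).trans ?_)
    gcongr
    exact hwmax e
  have hdB : ∀ u v, (x.wgraph w).d u v ≤ B := fun u v => by
    rw [hB]
    refine Nat.le_floor ((d_le_mul_dist (by positivity) hw').trans ?_)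
    gcongr
    exact (dist_le_diam u v).trans hx
  have hy0 : 0 < y := (hw1 ⟨0, x.edge⟩).trans (hwy _)
  have := nonempty_vertex (x := x)
  obtain ⟨H, W, R1, R2, R3, hH, hW, hHW, -, -, -, hR, hc1, hc2⟩ := WGraph.exists_cover (η := η)
    connected (g := x.wgraph w) hw1 hwy hk (by rw [Fintype.card_fin]; exact x.edge) hdB
  -- A path of length at most `R2` has at most this many edges. Here `Wmin` enters.
  obtain ⟨P, hP⟩ : ∃ P, P = ⌊R2 / (N * x.G.Wmin)⌋₊ := ⟨_, rfl⟩
  have hP' : P * (N * x.G.Wmin) ≤ R2 := by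
    rw [← le_div_iff₀ (by positivity), hP]
    exact Nat.floor_le (by positivity)
  refine ⟨H, W, R1, R2, R3, P, hH, hW, fun h hh y hy => ?_, ?_, ?_⟩
  · obtain ⟨l, hl, hlen⟩ := WGraph.exists_path (connected (w := w) h y)
    refine ⟨l, hl, hlen.trans_le (hHW h hh y hy), ?_⟩
    rw [hP]
    refine Nat.le_floor ((le_div_iff₀ (by positivity)).2 ?_)
    have h1 := mul_le_len (l := l) hw
    have h2 := mul_le_mul_of_nonneg_left (length_mul_Wmin_le (l := l)) hN0.le
    have h3 : ((x.wgraph w).len l : ℝ) ≤ R2 := by exact_mod_cast hlen.trans_le (hHW h hh y hy)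
    linarith
  -- The error of `5 * δ` consists of at most 2 for the rounding contained in `B`, 2 for `2 * η`,
  -- and 1 for the additional 1, which is at most `δ * b * N`.
  · have hR' : (k : ℝ) * (R1 + R2 + R3) + B ≤ k * (2 * B + 2 * η + 1) := by exact_mod_cast hR
    have h1 : ((R1 + R2 + R3 : ℕ) : ℝ) ≤ (2 - 1 / k) * B + 2 * η + 1 := by
      have hk0 : (0 : ℝ) < k := by linarith
      refine le_of_mul_le_mul_left (a := (k : ℝ)) ?_ hk0
      have : (k : ℝ) * ((2 - 1 / k) * B + 2 * η + 1) = k * (2 * B + 2 * η + 1) - B := by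
        field_simp; ring
      rw [this]
      push_cast
      linarith
    have h2 : 0 ≤ 1 / (k : ℝ) := by positivity
    have h3 : 1 / (k : ℝ) ≤ 1 := (div_le_one (by linarith)).2 hk1
    have h4 : (2 - 1 / (k : ℝ)) * B ≤ (2 - 1 / k) * ((1 + δ) * N * b) :=
      mul_le_mul_of_nonneg_left hB' (by linarith)
    have h5 : 0 ≤ 1 / (k : ℝ) * (δ * b * N) := by positivity
    nlinarith
  · obtain ⟨K, hK⟩ : ∃ K : ℝ, K = H.card * W.card := ⟨_, rfl⟩
    obtain ⟨m', hm'⟩ : ∃ m' : ℝ, m' = (x.G.m : ℝ) ^ (1 + 1 / (k : ℝ)) := ⟨_, rfl⟩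
    obtain ⟨Q, hQ⟩ : ∃ Q : ℕ, Q = η / y + 1 := ⟨_, rfl⟩
    have hK0 : 0 ≤ K := by rw [hK]; positivity
    have hm0 : 0 ≤ m' := by rw [hm']; positivity
    have hlg := one_le_lg (x := x)
    have hlog : (1 + Real.log x.G.n) ^ 2 ≤ 4 * x.lg ^ 2 := by
      have h1 : Real.log x.G.n ≤ x.lg := by
        have hn : 0 < x.G.n := Fin.pos_iff_nonempty.2 nonempty_vertex
        exact Real.log_le_log (by exact_mod_cast hn) (by exact_mod_cast n_le_magnitude)
      have h2 := Real.log_natCast_nonneg x.G.n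
      nlinarith
    simp only [Fintype.card_fin, ← hm', ← hK, ← hQ] at hc1 hc2
    have hc1' : K ≤ 8 * m' * x.lg ^ 2 := by
      have := mul_le_mul_of_nonneg_left hlog (show 0 ≤ 2 * m' by positivity)
      linarith
    have hc2' : K * R2 * Q ≤ 8 * m' * x.lg ^ 2 * ((1 + δ) * N * b) := by
      refine hc2.trans ?_
      have h1 := mul_le_mul_of_nonneg_left hlog (show 0 ≤ 2 * m' by positivity)
      exact mul_le_mul (by linarith) hB' (Nat.cast_nonneg _) (by positivity)
    -- `Q` is at least of the order of `b / Wmax`, and the bound on the number of pairs times `R2`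
    -- gains this factor. The scale `N` cancels.
    have hQ' : δ * b ≤ (1 + δ) * x.G.Wmax * Q := by
      have h1 := Nat.lt_mul_div_succ η hy0
      rw [← hQ] at h1
      have h2 : (η : ℝ) + 1 ≤ y * Q := by exact_mod_cast h1
      have h3 : (y : ℝ) * Q ≤ (1 + δ) * N * x.G.Wmax * Q := by gcongr
      refine le_of_mul_le_mul_right (a := (N : ℝ)) ?_ hN0
      linarith
    have hKR : K * R2 * δ ≤ 32 * m' * x.lg ^ 2 * N * x.G.Wmax := by
      refine le_of_mul_le_mul_right (a := b) ?_ hb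
      calc K * R2 * δ * b = K * R2 * (δ * b) := by ring
        _ ≤ K * R2 * ((1 + δ) * x.G.Wmax * Q) := by gcongr
        _ = (1 + δ) * x.G.Wmax * (K * R2 * Q) := by ring
        _ ≤ (1 + δ) * x.G.Wmax * (8 * m' * x.lg ^ 2 * ((1 + δ) * N * b)) := by gcongr
        _ = (1 + δ) ^ 2 * (8 * m' * x.lg ^ 2 * N * x.G.Wmax * b) := by ring
        _ ≤ 4 * (8 * m' * x.lg ^ 2 * N * x.G.Wmax * b) := by gcongr; nlinarith
        _ = _ := by ring
    -- Dividing `R2` by `N * Wmin` completes the quotient `Wmax / Wmin`; together with the 8 of the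
    -- next estimate this gives 40.
    have hKP : K * P * δ ≤ 32 * (x.bound k * x.lg ^ 2) := by
      refine le_of_mul_le_mul_right (a := N * x.G.Wmin) ?_ (by positivity)
      calc K * P * δ * (N * x.G.Wmin) = K * δ * (P * (N * x.G.Wmin)) := by ring
        _ ≤ K * δ * R2 := by gcongr
        _ = K * R2 * δ := by ring
        _ ≤ _ := hKR
        _ = _ := by rw [bound, ← hm']; field_simp
    have hK8 : K * δ ≤ 8 * (x.bound k * x.lg ^ 2) := by
      have h1 : m' ≤ x.bound k := by
        rw [bound, ← hm']; exact le_mul_of_one_le_right hm0 one_le_ratio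
      calc K * δ ≤ K * 1 := by gcongr
        _ ≤ 8 * m' * x.lg ^ 2 := by linarith
        _ ≤ 8 * x.bound k * x.lg ^ 2 := by gcongr
        _ = _ := by ring
    rw [div_mul_eq_mul_div, le_div_iff₀ hδ]
    push_cast
    rw [← hK]
    linarith

end DiameterInput

/-! ### The machine that certifies a small diameter -/

namespace DiameterInput

variable {x : DiameterInput}

set_option maxHeartbeats 400000 in
theorem exists_near_machine {k : ℕ} (hk : 1 ≤ k) {b s : ℝ} (hb : 0 < b)
    (hbs : (2 - 1 / (k : ℝ)) * b < s) :
    ∃ (C : ℝ) (M : NTM),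
      (∀ x : DiameterInput, M.RunsInTime x.G.encode (C * x.bound k * x.lg ^ 4)) ∧
      (∀ x : DiameterInput, x.G.diam ≤ b → M.CanOutput x.G.encode false) ∧
      ∀ x : DiameterInput, s ≤ x.G.diam → M.AlwaysOutputs x.G.encode true := by
  -- The division by `6 * b` makes the error `5 * δ * b` of `exists_near_cover` smaller than the
  -- gap.
  obtain ⟨δ, hδ, hδ1, hδs⟩ : ∃ δ : ℝ, 0 < δ ∧ δ ≤ 1 ∧ (2 - 1 / (k : ℝ) + 5 * δ) * b < s := by
    have hgap : 0 < (s - (2 - 1 / (k : ℝ)) * b) / (6 * b) :=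
      div_pos (by linarith) (by positivity)
    refine ⟨min 1 ((s - (2 - 1 / (k : ℝ)) * b) / (6 * b)), lt_min one_pos hgap, min_le_left _ _, ?_⟩
    have h1 := min_le_right 1 ((s - (2 - 1 / (k : ℝ)) * b) / (6 * b))
    rw [le_div_iff₀ (by positivity)] at h1
    linarith
  -- The first summand keeps the relative error of rounding below `δ`; the second makes `δ * b * N`
  -- at least 1.
  obtain ⟨a, ha⟩ := exists_nat_gt (1 / δ + 1 / (δ * b))
  have haδ : 1 ≤ δ * a := by
    have : 1 / δ < a := lt_of_le_of_lt (le_add_of_nonneg_right (by positivity)) ha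
    rw [div_lt_iff₀ hδ] at this
    linarith
  have haδb : 1 ≤ δ * b * a := by
    have : 1 / (δ * b) < a := lt_of_le_of_lt (le_add_of_nonneg_left (by positivity)) ha
    rw [div_lt_iff₀ (by positivity)] at this
    linarith
  have ha0 : (0 : ℝ) < a := lt_trans (by positivity) ha
  have ha1 : 1 ≤ a := by exact_mod_cast ha0
  obtain ⟨p, q, hq1, hbr, hrs⟩ := exists_div_btwn (mul_nonneg (by
    have : 1 / (k : ℝ) ≤ 1 := (div_le_one (by exact_mod_cast hk)).2 (by exact_mod_cast hk)
    linarith) hb.le) hδs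
  obtain ⟨CX, hCX⟩ : ∃ CX, CX = (8 + p + q) * a := ⟨_, rfl⟩
  have hCX1 : (1 : ℝ) ≤ CX := by
    exact_mod_cast (by rw [hCX]; nlinarith : 1 ≤ CX)
  obtain ⟨S, hS⟩ : ∃ S, S = 1 + 2 * Real.log CX + 2 * (2 : ℕ) := ⟨_, rfl⟩
  have hS0 : 0 ≤ S := by have := Real.log_nonneg hCX1; rw [hS]; positivity
  have hδ' : 0 < 120 / δ := by positivity
  obtain ⟨C', M, hrun, hsound, hcomp, hno⟩ := exists_decider hk (Prog.Near.init p q) Prog.Near.edge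
    Prog.Near.rules false (C := CX + (9 + 4 * S + 120 / δ)) (by linarith) 2
  refine ⟨C', M, hrun, fun x hx => ?_, fun x hx => hno _ fun h => ?_⟩
  · have hM3 := three_le_magnitude (x := x)
    have hnM := n_le_magnitude (x := x)
    have hnum := num_le_magnitude (x := x)
    have hden := den_le_magnitude (x := x)
    have hwt := le_mul_wt (x := x) (a := a)
    obtain ⟨μ, hμ⟩ : ∃ μ, μ = x.G.magnitude := ⟨_, rfl⟩
    simp only [← hμ] at hM3 hnM hnum hden hwt
    obtain ⟨N, hN⟩ : ∃ N, N = a * μ := ⟨_, rfl⟩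
    rw [← hN] at hwt
    have hN1 : 1 ≤ N := by rw [hN]; nlinarith
    have hN0 : (0 : ℝ) < N := by exact_mod_cast hN1
    -- Upper bounds on distances need weights that are rounded up; the additional 1 also makes them
    -- positive.
    obtain ⟨w, hw⟩ : ∃ w : Prog.Rec → ℕ, ∀ e, w e = e.2.2.1 * N / e.2.2.2 + 1 :=
      ⟨_, fun _ => rfl⟩
    have hw' : ∀ e, w (x.rcd e) = (x.G.wt e).num.natAbs * N / (x.G.wt e).den + 1 := fun e => hw _
    have hwdiv : ∀ e, (N : ℝ) * x.G.wt e =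
        (((x.G.wt e).num.natAbs * N : ℕ) : ℝ) / (x.G.wt e).den := fun e => by
      rw [wt_eq, mul_div_assoc', mul_comm]; push_cast; rfl
    have hlow : ∀ e, N * (x.G.wt e : ℝ) ≤ w (x.rcd e) := fun e => by
      have hd : (0 : ℝ) < (x.G.wt e).den := by exact_mod_cast (x.G.wt e).den_pos
      rw [hwdiv, div_le_iff₀ hd, hw']
      have := (Nat.lt_mul_div_succ ((x.G.wt e).num.natAbs * N) (x.G.wt e).den_pos).le
      rw [Nat.mul_comm (x.G.wt e).den] at this
      exact_mod_cast this
    have hupp : ∀ e, (w (x.rcd e) : ℝ) ≤ (1 + δ) * N * x.G.wt e := fun e => by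
      have h1 : (((x.G.wt e).num.natAbs * N / (x.G.wt e).den : ℕ) : ℝ) ≤ N * x.G.wt e := by
        rw [hwdiv]; exact Nat.cast_div_le
      have h2 := mul_le_mul_of_nonneg_left (hwt e) hδ.le
      rw [hw']
      push_cast
      linarith
    have hδbN : 1 ≤ δ * b * N := by
      refine haδb.trans (mul_le_mul_of_nonneg_left ?_ (by positivity))
      exact_mod_cast (by rw [hN]; exact Nat.le_mul_of_pos_right a (by omega) : a ≤ N)
    obtain ⟨H, W, R1, R2, R3, P, hH, hW, hHW, hR, hcard⟩ :=
      exists_near_cover hk hδ hδ1 hb hN1 hlow hupp hδbN hx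
    obtain ⟨α, hα⟩ := WGraph.exists_potential_to connected hH
    obtain ⟨β, hβ⟩ := WGraph.exists_potential_from connected hW
    obtain ⟨T, hT⟩ : ∃ T, T = R1 + R2 + R3 := ⟨_, rfl⟩
    have hqT : q * T ≤ p * N := by
      have hq0 : (0 : ℝ) < q := by exact_mod_cast hq1
      have h1 : (T : ℝ) ≤ p / q * N := by
        rw [hT]
        exact hR.trans (mul_le_mul_of_nonneg_right hbr.le hN0.le)
      rw [div_mul_eq_mul_div, le_div_iff₀ hq0, mul_comm (T : ℝ)] at h1
      exact_mod_cast h1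
    have hTle : T ≤ q * T := Nat.le_mul_of_pos_left T (by omega)
    obtain ⟨A, hA⟩ : ∃ A, A = μ * N := ⟨_, rfl⟩
    have hNA : N ≤ A := hA ▸ Nat.le_mul_of_pos_left N (by omega)
    have hμA : μ ≤ A := hA ▸ Nat.le_mul_of_pos_right μ (by omega)
    obtain ⟨X, hX⟩ : ∃ X, X = (8 + p + q) * A := ⟨_, rfl⟩
    have hpA : p * A + q * A + 8 * A = X := by rw [hX]; ring
    have hpN : p * N ≤ p * A := Nat.mul_le_mul_left p hNA
    have hpA' : p ≤ p * A := Nat.le_mul_of_pos_right p (by omega)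
    have hqA' : q ≤ q * A := Nat.le_mul_of_pos_right q (by omega)
    have hWcard : W.card ≤ x.G.n := by simpa using Finset.card_le_univ W
    have hmem : ∀ {F : Finset (Fin x.G.n)} {y : ℕ}, y ∈ F.toList.map Fin.val ↔
      ∃ z ∈ F, (z : ℕ) = y := by simp
    obtain ⟨ρ0, E, I, hcert, h31, hval, hE, hI⟩ := Prog.Near.exists_cert (p := p) (q := q)
      (n := x.G.n) (N := N) (es := x.recs) (W := W.toList.map Fin.val) (H := H.toList.map Fin.val)
      (R1 := R1) (R2 := R2) (R3 := R3) (P := P) (w := w) (X := X)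
      (α := fun y => if h : y < x.G.n then α ⟨y, h⟩ else 0)
      (β := fun y => if h : y < x.G.n then β ⟨y, h⟩ else 0) (by omega)
      ⟨by omega, by omega, by omega, by omega⟩ hN1 (by rwa [← hT]) (by omega)
      (by
        intro r hr
        obtain ⟨e, rfl⟩ := mem_recs.1 hr
        have h1 := (x.G.src e).2
        have h2 := (x.G.tgt e).2
        have h3 := hnum e
        have h4 := hden e
        have h5 := Nat.mul_le_mul_right N h3
        have h6 := Nat.mul_div_le ((x.G.wt e).num.natAbs * N) (x.G.wt e).den
        have h7 := Nat.lt_mul_div_succ ((x.G.wt e).num.natAbs * N) (x.G.wt e).den_pos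
        have h8 := Nat.div_le_self ((x.G.wt e).num.natAbs * N) (x.G.wt e).den
        rw [← hw' e] at h7
        have h9 : (x.G.wt e).den * w (x.rcd e) =
            (x.G.wt e).den * ((x.G.wt e).num.natAbs * N / (x.G.wt e).den) +
              (x.G.wt e).den := by rw [hw']; ring
        have h10 := hw' e
        exact ⟨h1, h2, h7.le, by simp only [rcd]; omega, by simp only [rcd]; omega, by omega,
          by omega, by simp only [rcd] at *; omega⟩)
      (fun h => absurd (congrArg List.length h) (by rw [length_recs]; exact x.edge.ne'))
      (fun y hy => by obtain ⟨z, -, rfl⟩ := hmem.1 hy; have := z.2; omega)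
      (by simp; omega)
      (by
        intro h hh
        obtain ⟨h, hh', rfl⟩ := hmem.1 hh
        refine ⟨by have := h.2; omega, fun y hy => ?_⟩
        obtain ⟨y, hy', rfl⟩ := hmem.1 hy
        obtain ⟨l, hl, hlen, hlP⟩ := hHW h hh' y hy'
        exact ⟨_, recGraph_path hl, fun e he => (by
          obtain ⟨e, -, rfl⟩ := List.mem_map.1 he
          exact mem_recs.2 ⟨e, rfl⟩), by rwa [recGraph_len], by simpa using hlP⟩)
      (by
        intro y hy
        obtain ⟨h1, h2⟩ := hα ⟨y, hy⟩
        simp only [hy, dif_pos]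
        refine ⟨h1, h2.imp (fun h => ⟨h.1, hmem.2 ⟨_, h.2, rfl⟩⟩) ?_⟩
        rintro ⟨e, he, hαe⟩
        refine ⟨_, mem_recs.2 ⟨e, rfl⟩, congrArg Fin.val he, (x.G.tgt e).2, ?_⟩
        rw [dif_pos (show (x.rcd e).2.1 < x.G.n from (x.G.tgt e).2)]
        exact hαe)
      (by
        intro y hy
        obtain ⟨h1, h2⟩ := hβ ⟨y, hy⟩
        simp only [hy, dif_pos]
        refine ⟨h1, h2.imp (fun h => ⟨h.1, hmem.2 ⟨_, h.2, rfl⟩⟩) ?_⟩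
        rintro ⟨e, he, hβe⟩
        refine ⟨_, mem_recs.2 ⟨e, rfl⟩, congrArg Fin.val he, (x.G.src e).2, ?_⟩
        rw [dif_pos (show (x.rcd e).1 < x.G.n from (x.G.src e).2)]
        exact hβe)
    have hXM : (X : ℝ) ≤ CX * (x.G.magnitude : ℝ) ^ 2 := by
      rw [← hμ]
      exact_mod_cast (by rw [hX, hA, hN, hCX]; linarith : X ≤ CX * μ ^ 2)
    refine hcomp x ρ0 E I _ X hcert h31 hval
      (fun y hy => by obtain ⟨z, -, rfl⟩ := hmem.1 hy; have := z.2; omega) (by simp; omega)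
      (by omega) (hXM.trans ?_) ?_
    · gcongr; linarith
    -- As `W` is nonempty, the summand `W.card + 1` for counting is absorbed by the number of
    -- records on paths.
    · have hW0 : 1 ≤ W.card := by
        obtain ⟨y, hy, -⟩ := hW (x.G.src ⟨0, x.edge⟩)
        exact Finset.card_pos.2 ⟨y, hy⟩
      clear * - hE hI hXM hCX1 hS0 hS hWcard hcard hW0 hδ
      have hXS := size_le hCX1 hXM
      rw [← hS] at hXS
      have hlg := one_le_lg (x := x)
      have hm := one_le_m (x := x)
      have hmb := m_le_bound (x := x) (k := k)
      simp only [length_recs, List.length_map, Finset.length_toList] at hE hI ⊢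
      have h1 : 1 + E.length + I.length + W.card ≤
          x.G.m * (9 + 4 * X.size) + 3 * (H.card * W.card * (P + 1)) := by
        have h2 := n_le_m (x := x)
        have h3 := x.edge
        have h4 := Nat.mul_le_mul_right (X.size + 1) (show 2 * x.G.m + 2 ≤ 4 * x.G.m by omega)
        have h5 : H.card * (W.card * (P + 1) + (W.card + 1)) ≤
            3 * (H.card * W.card * (P + 1)) := by
          have h6 : W.card ≤ W.card * (P + 1) := Nat.le_mul_of_pos_right _ (by omega)
          calc H.card * (W.card * (P + 1) + (W.card + 1)) ≤
                H.card * (3 * (W.card * (P + 1))) := Nat.mul_le_mul_left _ (by omega)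
            _ = _ := by ring
        rw [hE]
        linarith
      have h2 : (9 + 4 * X.size : ℝ) ≤ (9 + 4 * S) * x.lg ^ 2 := by nlinarith
      have hb0 : 0 ≤ x.bound k := by linarith
      calc ((1 + E.length + I.length + W.card : ℕ) : ℝ) ≤
            x.G.m * (9 + 4 * X.size) + 3 * ((H.card * W.card * (P + 1) : ℕ) : ℝ) := by
            exact_mod_cast h1
        _ ≤ x.bound k * ((9 + 4 * S) * x.lg ^ 2) + 3 * (40 / δ * (x.bound k * x.lg ^ 2)) :=
            add_le_add (mul_le_mul hmb h2 (by positivity) hb0) (by linarith)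
        _ = (9 + 4 * S + 120 / δ) * (x.bound k * x.lg ^ 2) := by ring
        _ ≤ _ := by
            refine mul_le_mul_of_nonneg_right ?_ (by positivity)
            linarith
  · obtain ⟨ρ0, E, I, W, hcert⟩ := hsound x h
    have hpos : ∀ e ∈ x.recs, 1 ≤ e.2.2.1 := fun _ he => by
      obtain ⟨e, rfl⟩ := mem_recs.1 he
      exact num_pos e
    obtain ⟨N, t, R, hN, ht, hR, hreach⟩ := hcert.near hpos
    have : x.G.diam ≤ p / q := diam_le fun u v => by
      obtain ⟨e, rfl⟩ := exists_src u
      obtain ⟨f, rfl⟩ := exists_src v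
      obtain ⟨s, hs, h⟩ := hreach _ (mem_recs.2 ⟨e, rfl⟩) _ (mem_recs.2 ⟨f, rfl⟩)
      exact dist_le_div_of_near hN hq1 ht hR hs h
    linarith

end DiameterInput

/-! ### The main theorem -/

theorem mainTheorem4 (k : ℕ) (hk : 1 ≤ k) (ε : ℝ) (hε : 0 < ε) (D : ℝ) (hD : 0 < D) :
    InNcoNPlusTilde (fun x : DiameterInput => x.G.encode) (fun x => x.G.magnitude)
      (gapDiameter ((2 - 1 / (k : ℝ) + ε) * D) D (gap_lt hk hε hD))
      (fun x => (x.G.m : ℝ) ^ (1 + 1 / (k : ℝ)) * (x.G.Wmax / x.G.Wmin)) := by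
  obtain ⟨b, hDb, hbD, hbD'⟩ : ∃ b, D < b ∧ (2 - 1 / (k : ℝ)) * b < (2 - 1 / (k : ℝ) + ε) * D ∧
      b < (2 - 1 / (k : ℝ) + ε) * D := by
    have hk0 : 0 ≤ 1 / (k : ℝ) := by positivity
    have hk1 : 1 / (k : ℝ) ≤ 1 := (div_le_one (by exact_mod_cast hk)).2 (by exact_mod_cast hk)
    have hεD := mul_pos hε hD
    have h2 : 0 ≤ 1 / (k : ℝ) * (ε * D) := by positivity
    have h3 : 1 / (k : ℝ) * D ≤ 1 * D := by gcongr
    -- As `2 - 1 / k` is less than 2, it enlarges the excess `ε / 4` to less than `ε / 2`.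
    refine ⟨(1 + ε / 4) * D, by nlinarith, by nlinarith, by nlinarith⟩
  obtain ⟨C1, M1, hrun₁, hyes₁, hno₁⟩ := DiameterInput.exists_far_machine hk hD hDb
  obtain ⟨C2, M2, hrun₂, hno₂, hyes₂⟩ :=
    DiameterInput.exists_near_machine hk (hD.trans hDb) hbD
  have hle : ∀ (x : DiameterInput) {C : ℝ}, C ≤ max C1 C2 → C * x.bound k * x.lg ^ 4 ≤
      max C1 C2 * ((x.G.m : ℝ) ^ (1 + 1 / (k : ℝ)) * (x.G.Wmax / x.G.Wmin)) *
        Real.log x.G.magnitude ^ 4 := fun x C hC => by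
    have h1 : 1 ≤ x.bound k := DiameterInput.one_le_m.trans DiameterInput.m_le_bound
    have h2 := DiameterInput.one_le_lg (x := x)
    exact mul_le_mul_of_nonneg_right (mul_le_mul_of_nonneg_right hC (by linarith)) (by positivity)
  refine ⟨max C1 C2, 4, M1, M2, fun x t c h => (hrun₁ x t c h).trans (hle x (le_max_left _ _)),
    fun x t c h => (hrun₂ x t c h).trans (hle x (le_max_right _ _)),
    ⟨fun x hx => hyes₁ x (hbD'.trans_le hx), hno₁⟩,
    ⟨fun x hx => hno₂ x (hx.trans hDb.le), hyes₂⟩, fun x _ => ?_⟩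
  -- Both machines are complete up to the same threshold `b`, so no input escapes them.
  rcases lt_or_ge b x.G.diam with h | h
  · exact .inl (hyes₁ x h)
  · exact .inr (hno₂ x h)
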